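/- **Theorem 4.3.** Let $s\ge 0$, $d=s+1$, $m>0$, $0<\alpha\le 1/2$. Write $x=(x^0,\vec x)\in\mathbb R\times\mathbb R^s$, $k\cdot x=k^0x^0+\vec k\cdot\vec x$, $k^2=(k^0)^2-|\vec k|^2$, $\bar V_0^{\pm}=\{k: k^2\ge 0,\ \pm k^0\ge 0\}$, and let $\mathcal S_n$ be the space of complex Schwartz functions on $\mathbb R^{dn}$. Let $\nu$ be an infinitely divisible probability law on $\mathbb R$ with moments of all orders (the law of the white noise $\eta$ on a unit cell, in the Euclidean random field $\varphi$ solving $(-\Delta+m^2)^\alpha\varphi=\eta$) and let $c_n$ ($n\ge1$) be its cumulants. Put $$\mu^{\pm}_\alpha(k)=(2\pi)^{-d/2}\sin(\pi\alpha)\,\frac{1_{\{k^2>m^2,\ \pm k^0>0\}}(k)}{(k^2-m^2)^{\alpha}},\qquad \mu_\alpha(k)=(2\pi)^{-d/2}\,\frac{\cos(\pi\alpha)1_{\{k^2>m^2\}}(k)+1_{\{k^2<m^2\}}(k)}{|k^2-m^2|^{\alpha}},$$ $$\hat W_n^T(k_1,\dots,k_n)=c_n2^{n-1}(2\pi)^{d}\Big\{\sum_{j=1}^n\prod_{l<j}\mu^-_\alpha(k_l)\,\mu_\alpha(k_j)\prod_{l>j}\mu^+_\alpha(k_l)\Big\}\,\delta\Big(\sum_{l=1}^n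 k_l\Big)\qquad(n\ge1),$$ except that $\hat W_2^T(k_1,k_2)=2\pi c_2\,1_{\{k_1^0<0\}}\,\delta(k_1^2-m^2)\,\delta(k_1+k_2)$ if $\alpha=1/2$. Let $\hat W_n=\sum_I\prod_{\{j_1<\dots<j_l\}\in I}\hat W_l^T(k_{j_1},\dots,k_{j_l})$, the sum over all partitions $I$ of $\{1,\dots,n\}$ ($\hat W_0=1$), and let the Wightman functions be $$W_n(f)=\int \hat W_n(k_1,\dots,k_n)\Big[(2\pi)^{-dn/2}\int e^{i\sum_l k_l\cdot x_l}f(x_1,\dots,x_n)\,dx_1\cdots dx_n\Big]dk_1\cdots dk_n .$$ These integrals (for each partition separately) converge absolutely for $f\in\mathcal S_n$, the $W_n$ are tempered distributions, and the following hold. 1. There are continuous Hilbert seminorms $p_n$ on $\mathcal S_n$ (seminorms given by positive semidefinite sesquilinear forms), $n\ge 0$, such that $|W_{j+l}(f\otimes g)|\le p_j(f)\,p_l(g)$ for all $j,l\ge 0$, $f\in\mathcal S_j$, $g\in\mathcal S_l$, and which are translation invariant: $p_n(f_a)=p_n(f)$ for $a\in\mathbb R^{d}$, where $f_a(x_1,\dots,x_n)=f(x_1-a,\dots,x_n-a)$.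 2. There is a quantum field theory in indefinite metric with Wightman functions $W_n$, that is: - a complex Hilbert space $(\mathcal H,(\cdot,\cdot))$, a self-adjoint metric operator $T$ with $T^2=1$ defining $\langle\Phi,\Psi\rangle=(\Phi,T\Psi)$, a dense subspace $\mathcal D$ and a vacuum $\Omega\in\mathcal D$; - a field $\phi$ assigning linearly to each $f\in\mathcal S_1$ an operator $\phi(f):\mathcal D\to\mathcal D$, with $f\mapsto\phi(f)\Psi$ continuous into $\mathcal H$ for $\Psi\in\mathcal D$, with $\mathcal D$ spanned by the vectors $\phi(f_1)\cdots\phi(f_n)\Omega$ ($n\ge0$), $T$-symmetric ($\langle\Phi,\phi(f)\Psi\rangle=\langle\phi(\bar f)\Phi,\Psi\rangle$ on $\mathcal D$), local ($\phi(f)\phi(g)=\phi(g)\phi(f)$ on $\mathcal D$ if the supports of $f,g$ are space-like separated), and with $W_n(f_1\otimes\cdots\otimes f_n)=\langle\Omega,\phi(f_1)\cdots\phi(f_n)\Omega\rangle$; - a representation $\mathcal U$ of the proper orthochronous Poincaré group by linear operators on $\mathcal D$ that is $T$-unitary ($\langle\mathcal U\Phi,\mathcal U\Psi\rangle=\langle\Phi,\Psi\rangle$),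 leaves $\Omega$ invariant, satisfies $\mathcal U(a,\Lambda)\phi(f)\mathcal U(a,\Lambda)^{-1}=\phi(f_{a,\Lambda})$ with $f_{a,\Lambda}(x)=f(\Lambda^{-1}(x-a))$, and fulfills the spectral condition $\int\langle\Phi,\mathcal U(a,1)\Psi\rangle\big[\int e^{iq\cdot a}h(q)\,dq\big]da=0$ for $\Phi,\Psi\in\mathcal D$ and all $h\in\mathcal S_1$ with $\operatorname{supp}h\cap\bar V_0^-=\emptyset$; and it can be chosen such that the translations $\mathcal U(a,1)$ extend to a strongly continuous unitary representation of $\mathbb R^d$ on $\mathcal H$, which commutes with $T$. Its generator $P=(P_0,\dots,P_s)$, $P_\mu\Psi=-i\frac{d}{dt}\mathcal U(te_\mu,1)\Psi|_{t=0}$ on all $\Psi$ for which the derivative exists, consists of self-adjoint operators with a joint spectral measure $E$ ($P_\mu=\int\lambda_\mu\,dE(\lambda)$), and $$\operatorname{spec}(P)=\operatorname{supp}(E)\subseteq\bar V_0^+ .$$ -/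

import Mathlib

open MeasureTheory Topology
open scoped SchwartzMap InnerProductSpace ComplexConjugate

noncomputable section

namespace IndefQFT

/-! ### Minkowski space -/

/-- Space-time `ℝ × ℝ^s` (and momentum space); coordinate `0` is the time (energy). The norm and
the inner product of this type are the Euclidean ones; Lebesgue measure is its `volume`. -/
abbrev Spacetime (s : ℕ) : Type := EuclideanSpace ℝ (Fin (s + 1))

/-- The Minkowski square `k² = (k⁰)² - |k⃗|²`. -/
def minkSq {s : ℕ} (k : Spacetime s) : ℝ := k 0 ^ 2 - ∑ i : Fin s, k i.succ ^ 2

/-- The closed forward light cone. -/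
def forwardCone (s : ℕ) : Set (Spacetime s) := {k | 0 ≤ minkSq k ∧ 0 ≤ k 0}

/-- The closed backward light cone. -/
def backwardCone (s : ℕ) : Set (Spacetime s) := {k | 0 ≤ minkSq k ∧ k 0 ≤ 0}

/-- The proper orthochronous Lorentz group: linear maps that preserve the Minkowski square, have
determinant one and preserve the direction of time. -/
def lorentzGroup (s : ℕ) : Subgroup (Spacetime s ≃ₗ[ℝ] Spacetime s) where
  carrier := {Λ | (∀ x, minkSq (Λ x) = minkSq x) ∧ LinearEquiv.det Λ = 1 ∧
    ∀ x, Λ x ∈ forwardCone s ↔ x ∈ forwardCone s}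
  one_mem' := ⟨fun _ => rfl, map_one _, fun _ => Iff.rfl⟩
  mul_mem' := by
    rintro A B ⟨hA, hA', hA''⟩ ⟨hB, hB', hB''⟩
    refine ⟨fun x => ?_, by rw [map_mul, hA', hB', mul_one], fun x => ?_⟩
    · rw [LinearEquiv.mul_apply, hA, hB]
    · rw [LinearEquiv.mul_apply, hA'', hB'']
  inv_mem' := by
    rintro A ⟨hA, hA', hA''⟩
    have key : ∀ x, A (A⁻¹ x) = x := fun x => A.apply_symm_apply x
    refine ⟨fun x => ?_, by rw [map_inv, hA', inv_one], fun x => ?_⟩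
    · rw [← hA, key]
    · rw [← hA'', key]

/-- The proper orthochronous Poincaré group, as the group of affine transformations
`x ↦ Λ x + a` of space-time. -/
def poincareGroup (s : ℕ) : Subgroup (Spacetime s ≃ᵃ[ℝ] Spacetime s) :=
  (lorentzGroup s).comap AffineEquiv.linearHom

/-- The translation `(a, 1)` as an element of the Poincaré group. -/
def transl {s : ℕ} (a : Spacetime s) : poincareGroup s :=
  ⟨AffineEquiv.constVAdd ℝ (Spacetime s) a, (lorentzGroup s).one_mem⟩

/-! ### Test functions -/

/-- The space `𝓢ₙ` of complex Schwartz functions of `n` space-time variables. -/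
abbrev TestFn (s n : ℕ) : Type := 𝓢(Fin n → Spacetime s, ℂ)

/-- Simultaneous translation of all the arguments: `f (x₁ - a, …, xₙ - a)`. -/
def translate {s n : ℕ} (a : Spacetime s) (f : TestFn s n) : TestFn s n :=
  SchwartzMap.compSubConstCLM ℂ (fun _ : Fin n => a) f

/-- The action of `g = (a, Λ)` on a test function of one variable: `x ↦ f (Λ⁻¹ (x - a))`. -/
def poincareAct {s : ℕ} (g : poincareGroup s) (f : 𝓢(Spacetime s, ℂ)) : 𝓢(Spacetime s, ℂ) :=
  SchwartzMap.compSubConstCLM ℂ (g.1 0)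
    (SchwartzMap.compCLMOfContinuousLinearEquiv ℂ
      (AffineEquiv.linear g.1).symm.toContinuousLinearEquiv f)

/-- The complex conjugate of a test function. -/
def conjFn {s : ℕ} (f : 𝓢(Spacetime s, ℂ)) : 𝓢(Spacetime s, ℂ) :=
  SchwartzMap.postcompCLM (𝕜 := ℝ) (Complex.conjCLE : ℂ →L[ℝ] ℂ) f

/-- The tensor product `f (x₁, …, x_j) g (x_{j+1}, …, x_{j+l})`. -/
def tensor {s j l : ℕ} (f : TestFn s j) (g : TestFn s l) : (Fin (j + l) → Spacetime s) → ℂ :=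
  fun x => f (fun i => x (Fin.castAdd l i)) * g (fun i => x (Fin.natAdd j i))

/-- `(2π)^{-(s+1)n/2} ∫ e^{i ∑ k_l · x_l} f(x₁, …, xₙ) dx₁ ⋯ dxₙ`. -/
def planeWaveTransform {s n : ℕ} (f : (Fin n → Spacetime s) → ℂ) (k : Fin n → Spacetime s) : ℂ :=
  (((2 * Real.pi) ^ (-((s + 1 : ℝ) * n / 2)) : ℝ) : ℂ) *
    ∫ x : Fin n → Spacetime s, Complex.exp (Complex.I * ((∑ l, ⟪k l, x l⟫_ℝ : ℝ) : ℂ)) * f x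

/-! ### The law of the noise -/

/-- `ν` is infinitely divisible: for each `n ≥ 1` it is the law of a sum of `n` independent
identically distributed random variables. -/
def InfinitelyDivisible (ν : Measure ℝ) : Prop :=
  ∀ n : ℕ, 1 ≤ n → ∃ ρ : Measure ℝ, IsProbabilityMeasure ρ ∧
    Measure.map (fun x : Fin n → ℝ => ∑ i, x i) (Measure.pi fun _ => ρ) = ν

/-- The cumulants of `ν`, through the moment-cumulant recursion
`m_{n+1} = c_{n+1} + ∑_{k<n} (n choose k) c_{k+1} m_{n-k}`. -/
def cumulant (ν : Measure ℝ) : ℕ → ℝ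
  | 0 => 0
  | n + 1 => (∫ t, t ^ (n + 1) ∂ν) -
      ∑ k : Fin n, (n.choose k : ℝ) * cumulant ν (k + 1) * ∫ t, t ^ (n - (k : ℕ)) ∂ν

/-! ### The Wightman functions in momentum space -/

/-- `μ⁺_α`. -/
def muPlus {s : ℕ} (m α : ℝ) (k : Spacetime s) : ℝ :=
  open Classical in
  (2 * Real.pi) ^ (-((s + 1 : ℝ) / 2)) * Real.sin (Real.pi * α) *
    (if m ^ 2 < minkSq k ∧ 0 < k 0 then 1 else 0) * (1 / (minkSq k - m ^ 2) ^ α)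

/-- `μ⁻_α`. -/
def muMinus {s : ℕ} (m α : ℝ) (k : Spacetime s) : ℝ :=
  open Classical in
  (2 * Real.pi) ^ (-((s + 1 : ℝ) / 2)) * Real.sin (Real.pi * α) *
    (if m ^ 2 < minkSq k ∧ k 0 < 0 then 1 else 0) * (1 / (minkSq k - m ^ 2) ^ α)

/-- `μ_α`. -/
def muMid {s : ℕ} (m α : ℝ) (k : Spacetime s) : ℝ :=
  open Classical in
  (2 * Real.pi) ^ (-((s + 1 : ℝ) / 2)) *
    (Real.cos (Real.pi * α) * (if m ^ 2 < minkSq k then 1 else 0) +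
      (if minkSq k < m ^ 2 then 1 else 0)) * (1 / |minkSq k - m ^ 2| ^ α)

/-- The density `∑_j ∏_{l<j} μ⁻_α(k_l) · μ_α(k_j) · ∏_{l>j} μ⁺_α(k_l)`. -/
def truncDensity {s n : ℕ} (m α : ℝ) (k : Fin n → Spacetime s) : ℝ :=
  ∑ j : Fin n, ∏ l : Fin n,
    if l < j then muMinus m α (k l) else if l = j then muMid m α (k l) else muPlus m α (k l)

/-- The measure `δ(k₁ + ⋯ + kₙ) dk₁ ⋯ dkₙ`, `n ≥ 1` (zero for `n = 0`, which is never used). -/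
def deltaSum (s : ℕ) : (n : ℕ) → Measure (Fin n → Spacetime s)
  | 0 => 0
  | n + 1 => Measure.map
      (fun k : Fin n → Spacetime s => (Fin.snoc k (-∑ i, k i) : Fin (n + 1) → Spacetime s)) volume

/-- The point `(-√(|p|² + m²), p)` on the negative energy mass shell. -/
def negShell {s : ℕ} (m : ℝ) (p : EuclideanSpace ℝ (Fin s)) : Spacetime s :=
  WithLp.toLp 2 (Fin.cons (-Real.sqrt (‖p‖ ^ 2 + m ^ 2)) (fun i => p i))

/-- The measure `1_{k₁⁰ < 0} δ(k₁² - m²) δ(k₁ + k₂) dk₁ dk₂`; the energy integral over `δ(k₁² - m²)`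
leaves the density `1 / (2 √(|p|² + m²))` with respect to the spatial momentum `p`. -/
def massShell (s : ℕ) (m : ℝ) : Measure (Fin 2 → Spacetime s) :=
  Measure.map (fun p : EuclideanSpace ℝ (Fin s) => ![negShell m p, -negShell m p])
    (volume.withDensity fun p => ENNReal.ofReal (1 / (2 * Real.sqrt (‖p‖ ^ 2 + m ^ 2))))

/-- The regular form of the truncated `n`-point measure (without the factor `c_n`). -/
def truncRegular (s : ℕ) (m α : ℝ) (n : ℕ) : Measure (Fin n → Spacetime s) :=
  ENNReal.ofReal (2 ^ (n - 1) * (2 * Real.pi) ^ (s + 1)) •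
    (deltaSum s n).withDensity fun k => ENNReal.ofReal (truncDensity m α k)

/-- The truncated `n`-point function in momentum space is `c_n` times this measure. -/
def truncMeasure (s : ℕ) (m α : ℝ) : (n : ℕ) → Measure (Fin n → Spacetime s)
  | 2 => open Classical in
      if α = 1 / 2 then ENNReal.ofReal (2 * Real.pi) • massShell s m else truncRegular s m α 2
  | n => truncRegular s m α n

/-- Assembles momenta that are given block by block; inside a block they come in increasing order of
the labels. -/
def glue {s n : ℕ} (P : Finpartition (Finset.univ : Finset (Fin n)))
    (q : (B : P.parts) → Fin B.1.card → Spacetime s) : Fin n → Spacetime s :=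
  fun i => q ⟨P.part i, P.part_mem.2 (Finset.mem_univ i)⟩
    (((P.part i).orderIsoOfFin rfl).symm ⟨i, P.mem_part (Finset.mem_univ i)⟩)

/-- The product of the truncated measures over the blocks of a partition of `{1, …, n}`. -/
def partitionMeasure (s : ℕ) (m α : ℝ) {n : ℕ} (P : Finpartition (Finset.univ : Finset (Fin n))) :
    Measure (Fin n → Spacetime s) :=
  Measure.map (glue P) (Measure.pi fun B : P.parts => truncMeasure s m α B.1.card)

/-- The Wightman function `Wₙ` with constants `c`, applied to a function `f`:
`Wₙ(f) = ∑_P ∏_{B ∈ P} Ŵ^T_{|B|}`, integrated against the Fourier transform of `f`. -/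
def wightman (s : ℕ) (m α : ℝ) (c : ℕ → ℝ) (n : ℕ) (f : (Fin n → Spacetime s) → ℂ) : ℂ :=
  ∑ P : Finpartition (Finset.univ : Finset (Fin n)),
    (((∏ B ∈ P.parts, c B.card : ℝ)) : ℂ) * ∫ k, planeWaveTransform f k ∂(partitionMeasure s m α P)

/-! ### Hilbert seminorms -/

/-- The seminorm comes from a positive semidefinite sesquilinear form and is continuous. -/
def IsHilbertSeminorm {s n : ℕ} (p : Seminorm ℂ (TestFn s n)) : Prop :=
  Continuous p ∧ ∃ B : TestFn s n →ₗ⋆[ℂ] TestFn s n →ₗ[ℂ] ℂ, ∀ f, B f f = ((p f ^ 2 : ℝ) : ℂ)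

/-- The Hilbert space structure condition for the family of seminorms `p`. -/
def HilbertStructureCondition {s : ℕ} (W : (n : ℕ) → ((Fin n → Spacetime s) → ℂ) → ℂ)
    (p : (n : ℕ) → Seminorm ℂ (TestFn s n)) : Prop :=
  (∀ n, IsHilbertSeminorm (p n)) ∧
    ∀ (j l : ℕ) (f : TestFn s j) (g : TestFn s l), ‖W (j + l) (tensor f g)‖ ≤ p j f * p l g

/-! ### Quantum field theory in indefinite metric -/

section QFT

variable (H : Type*) [NormedAddCommGroup H] [InnerProductSpace ℂ H]

/-- A quantum field theory in indefinite metric on the Hilbert space `H` with Wightman functions `W`.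
Linear operators that may be unbounded are given on their common invariant dense domain `D`. The
indefinite inner product is `⟨Φ, Ψ⟩ = (Φ, T Ψ)`. -/
structure IndefiniteMetricQFT [CompleteSpace H] (s : ℕ)
    (W : (n : ℕ) → ((Fin n → Spacetime s) → ℂ) → ℂ) where
  /-- the metric operator -/
  T : H →L[ℂ] H
  T_selfAdjoint : IsSelfAdjoint T
  T_sq : T * T = 1
  /-- the domain -/
  D : Submodule ℂ H
  dense_D : Dense (D : Set H)
  /-- the vacuum -/
  Ω : D
  /-- the field -/
  φ : 𝓢(Spacetime s, ℂ) →ₗ[ℂ] D →ₗ[ℂ] D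
  φ_continuous : ∀ Ψ : D, Continuous fun f => (φ f Ψ : H)
  /-- `D` is generated from the vacuum by the field -/
  cyclic : Submodule.span ℂ
    (Set.range fun fs : List 𝓢(Spacetime s, ℂ) => fs.foldr (fun f Ψ => φ f Ψ) Ω) = ⊤
  /-- `T`-symmetry, `φ(x)* = T φ(x) T` -/
  φ_symm : ∀ (f : 𝓢(Spacetime s, ℂ)) (Φ Ψ : D),
    ⟪(Φ : H), T (φ f Ψ)⟫_ℂ = ⟪(φ (conjFn f) Φ : H), T Ψ⟫_ℂ
  locality : ∀ f g : 𝓢(Spacetime s, ℂ),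
    (∀ x ∈ tsupport f, ∀ y ∈ tsupport g, minkSq (x - y) < 0) →
    ∀ Ψ : D, φ f (φ g Ψ) = φ g (φ f Ψ)
  /-- the vacuum expectation values `⟨Ω, φ(x₁) ⋯ φ(xₙ) Ω⟩` are the Wightman functions -/
  vev : ∀ (n : ℕ) (f : Fin n → 𝓢(Spacetime s, ℂ)),
    W n (fun x => ∏ i, f i (x i)) =
      ⟪(Ω : H), T ((List.ofFn f).foldr (fun f Ψ => φ f Ψ) Ω : D)⟫_ℂ
  /-- the representation of the Poincaré group -/
  U : poincareGroup s →* Module.End ℂ D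
  /-- `T`-unitarity, `T U(g)* T = U(g)⁻¹` -/
  U_unitary : ∀ (g : poincareGroup s) (Φ Ψ : D),
    ⟪(U g Φ : H), T (U g Ψ)⟫_ℂ = ⟪(Φ : H), T Ψ⟫_ℂ
  U_vacuum : ∀ g : poincareGroup s, U g Ω = Ω
  covariance : ∀ (g : poincareGroup s) (f : 𝓢(Spacetime s, ℂ)) (Ψ : D),
    U g (φ f (U g⁻¹ Ψ)) = φ (poincareAct g f) Ψ
  /-- the spectral condition, `∫ ⟨Φ, U(a, 1) Ψ⟩ e^{iqa} da = 0` off the backward cone, as an identity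
  of distributions in `q` -/
  spectral : ∀ (Φ Ψ : D) (h : 𝓢(Spacetime s, ℂ)), Disjoint (tsupport h) (backwardCone s) →
    ∫ a : Spacetime s, ⟪(Φ : H), T (U (transl a) Ψ)⟫_ℂ *
      ∫ q : Spacetime s, Complex.exp (Complex.I * ((⟪q, a⟫_ℝ : ℝ) : ℂ)) * h q = 0

/-- `V` is a strongly continuous unitary representation of the translations on all of `H` that
agrees with `U(a, 1)` on the domain of the field theory. -/
structure IsUnitaryTranslations {H : Type*} [NormedAddCommGroup H] [InnerProductSpace ℂ H]
    [CompleteSpace H] {s : ℕ} {W : (n : ℕ) → ((Fin n → Spacetime s) → ℂ) → ℂ}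
    (Q : IndefiniteMetricQFT H s W) (V : Spacetime s → H ≃ₗᵢ[ℂ] H) : Prop where
  map_add : ∀ (a b : Spacetime s) (Ψ : H), V (a + b) Ψ = V a (V b Ψ)
  continuous : ∀ Ψ : H, Continuous fun a => V a Ψ
  extends_U : ∀ (a : Spacetime s) (Ψ : Q.D), V a (Ψ : H) = (Q.U (transl a) Ψ : H)

variable {H}

/-! ### Generators and spectral measures -/

/-- The generator of `t ↦ V (t a)`: the operator `Ψ ↦ -i d/dt V (t a) Ψ |_{t = 0}` on all vectors
for which the derivative exists, so that formally `V (t a) = e^{itP}`. -/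
def generator {s : ℕ} (V : Spacetime s → H ≃ₗᵢ[ℂ] H) (a : Spacetime s) : H →ₗ.[ℂ] H where
  domain :=
    { carrier := {Ψ | DifferentiableAt ℝ (fun t : ℝ => V (t • a) Ψ) 0}
      add_mem' := by
        intro Φ Ψ hΦ hΨ
        simp only [Set.mem_ofPred_eq, map_add] at *
        exact hΦ.add hΨ
      zero_mem' := by simp
      smul_mem' := by
        intro c Ψ hΨ
        simp only [Set.mem_ofPred_eq, map_smul] at *
        exact hΨ.const_smul c }
  toFun :=
    { toFun := fun Ψ => (-Complex.I) • deriv (fun t : ℝ => V (t • a) (Ψ : H)) 0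
      map_add' := by
        intro Φ Ψ
        have h := deriv_fun_add (𝕜 := ℝ) Φ.2 Ψ.2
        simp only [Submodule.coe_add, map_add, h, smul_add]
      map_smul' := by
        intro c Ψ
        have h := deriv_fun_const_smul (𝕜 := ℝ) c Ψ.2
        simp only [Submodule.coe_smul, map_smul, h, RingHom.id_apply]
        rw [smul_comm] }

/-- The energy-momentum operator: the components `P_μ` with `V a = e^{i ∑ a_μ P_μ}`. -/
def energyMomentum {s : ℕ} (V : Spacetime s → H ≃ₗᵢ[ℂ] H) (i : Fin (s + 1)) : H →ₗ.[ℂ] H :=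
  generator V (EuclideanSpace.single i 1)

end QFT

/-- A projection-valued measure on `X` (only its values on measurable sets matter). -/
structure ProjectionValuedMeasure (H : Type*) [NormedAddCommGroup H] [InnerProductSpace ℂ H]
    [CompleteSpace H] (X : Type*) [MeasurableSpace X] where
  proj : Set X → H →L[ℂ] H
  isStarProjection : ∀ A, MeasurableSet A → IsStarProjection (proj A)
  proj_univ : proj Set.univ = 1
  proj_inter : ∀ A B, MeasurableSet A → MeasurableSet B → proj (A ∩ B) = proj A * proj B
  hasSum_iUnion : ∀ A : ℕ → Set X, (∀ i, MeasurableSet (A i)) →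
    Pairwise (Function.onFun Disjoint A) → ∀ Ψ : H,
      HasSum (fun i => proj (A i) Ψ) (proj (⋃ i, A i) Ψ)

namespace ProjectionValuedMeasure

variable {H : Type*} [NormedAddCommGroup H] [InnerProductSpace ℂ H] [CompleteSpace H]
  {X : Type*} [MeasurableSpace X] (E : ProjectionValuedMeasure H X)

theorem proj_empty_apply (Ψ : H) : E.proj ∅ Ψ = 0 := by
  have h := E.hasSum_iUnion (fun _ => ∅) (fun _ => MeasurableSet.empty)
    (fun _ _ _ => disjoint_bot_left) Ψ
  exact tendsto_nhds_unique tendsto_const_nhds h.summable.tendsto_atTop_zero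

theorem re_inner_proj (A : Set X) (hA : MeasurableSet A) (Ψ : H) :
    RCLike.re ⟪Ψ, E.proj A Ψ⟫_ℂ = ‖E.proj A Ψ‖ ^ 2 := by
  have h := E.isStarProjection A hA
  have h1 : E.proj A (E.proj A Ψ) = E.proj A Ψ :=
    congrArg (fun S : H →L[ℂ] H => S Ψ) h.isIdempotentElem
  have h2 : ContinuousLinearMap.adjoint (E.proj A) = E.proj A := h.isSelfAdjoint
  rw [← h1, ← ContinuousLinearMap.adjoint_inner_left, h2, inner_self_eq_norm_sq, h1]

/-- The scalar measure `A ↦ (Ψ, E(A) Ψ) = ‖E(A) Ψ‖²`. -/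
def scalar (Ψ : H) : Measure X :=
  Measure.ofMeasurable (fun A _ => ENNReal.ofReal (‖E.proj A Ψ‖ ^ 2))
    (by simp [E.proj_empty_apply])
    (by
      intro A hA hd
      have h := (E.hasSum_iUnion A hA hd Ψ).mapL
        ((RCLike.reCLM (K := ℂ)).comp ((innerSL ℂ Ψ).restrictScalars ℝ))
      have h' : HasSum (fun i => ‖E.proj (A i) Ψ‖ ^ 2) (‖E.proj (⋃ i, A i) Ψ‖ ^ 2) := by
        rw [← E.re_inner_proj _ (MeasurableSet.iUnion hA)]
        simp_rw [← fun i => E.re_inner_proj (A i) (hA i) Ψ]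
        exact h
      rw [← h'.tsum_eq]
      exact ENNReal.ofReal_tsum_of_nonneg (fun _ => sq_nonneg _) h'.summable)

/-- The support of `E`: the points all of whose open neighbourhoods `O` have `E(O) ≠ 0`. -/
def support [TopologicalSpace X] : Set X := {x | ∀ O, IsOpen O → x ∈ O → E.proj O ≠ 0}

end ProjectionValuedMeasure

/-- `E` is the joint spectral measure of the operators `P_μ`, that is `P_μ = ∫ λ_μ dE(λ)`: the domain
of `P_μ` is `{Ψ | ∫ λ_μ² d(Ψ, E(λ) Ψ) < ∞}`, and there `(Ψ, P_μ Ψ) = ∫ λ_μ d(Ψ, E(λ) Ψ)`. Then `E` is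
determined by the `P_μ`, and the (joint) spectrum of `P` is the support of `E`. -/
structure IsJointSpectralMeasure {H : Type*} [NormedAddCommGroup H] [InnerProductSpace ℂ H]
    [CompleteSpace H] {s : ℕ} (P : Fin (s + 1) → H →ₗ.[ℂ] H)
    (E : ProjectionValuedMeasure H (Spacetime s)) : Prop where
  mem_domain_iff : ∀ i (Ψ : H),
    Ψ ∈ (P i).domain ↔ Integrable (fun k : Spacetime s => k i ^ 2) (E.scalar Ψ)
  inner_apply : ∀ i (Ψ : (P i).domain),
    ⟪(Ψ : H), P i Ψ⟫_ℂ = ((∫ k : Spacetime s, k i ∂(E.scalar (Ψ : H)) : ℝ) : ℂ)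

end IndefQFT

end

noncomputable section

namespace IndefQFT

/-! ### Splitting space-time into time and space -/

/-- The point with time component `t` and space component `p`. -/
def join {s : ℕ} (t : ℝ) (p : EuclideanSpace ℝ (Fin s)) : Spacetime s :=
  WithLp.toLp 2 (Fin.cons t (fun i => p i))

/-- The space component of a point. -/
def space {s : ℕ} (k : Spacetime s) : EuclideanSpace ℝ (Fin s) :=
  WithLp.toLp 2 (fun i => k i.succ)

variable {s : ℕ}

@[simp] theorem join_zero (t : ℝ) (p : EuclideanSpace ℝ (Fin s)) : join t p 0 = t := rfl

@[simp] theorem join_succ (t : ℝ) (p : EuclideanSpace ℝ (Fin s)) (i : Fin s) :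
    join t p i.succ = p i := rfl

@[simp] theorem space_apply (k : Spacetime s) (i : Fin s) : space k i = k i.succ := rfl

@[simp] theorem space_join (t : ℝ) (p : EuclideanSpace ℝ (Fin s)) : space (join t p) = p := rfl

@[simp] theorem join_space (k : Spacetime s) : join (k 0) (space k) = k := by
  ext i
  refine Fin.cases ?_ (fun i => ?_) i <;> simp

theorem minkSq_eq (k : Spacetime s) : minkSq k = k 0 ^ 2 - ‖space k‖ ^ 2 := by
  simp [minkSq, EuclideanSpace.norm_sq_eq]

@[simp] theorem minkSq_join (t : ℝ) (p : EuclideanSpace ℝ (Fin s)) :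
    minkSq (join t p) = t ^ 2 - ‖p‖ ^ 2 := by
  rw [minkSq_eq, space_join, join_zero]

theorem norm_sq_eq (k : Spacetime s) : ‖k‖ ^ 2 = k 0 ^ 2 + ‖space k‖ ^ 2 := by
  simp [EuclideanSpace.norm_sq_eq, Fin.sum_univ_succ]

theorem inner_eq (k x : Spacetime s) : ⟪k, x⟫_ℝ = k 0 * x 0 + ⟪space k, space x⟫_ℝ := by
  simp [PiLp.inner_apply, Fin.sum_univ_succ, mul_comm]

theorem negShell_eq (m : ℝ) (p : EuclideanSpace ℝ (Fin s)) :
    negShell m p = join (-Real.sqrt (‖p‖ ^ 2 + m ^ 2)) p := rfl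

@[fun_prop] theorem continuous_coord (i : Fin (s + 1)) : Continuous fun k : Spacetime s => k i :=
  (EuclideanSpace.proj (𝕜 := ℝ) i).continuous

@[fun_prop] theorem continuous_minkSq : Continuous (minkSq : Spacetime s → ℝ) := by
  unfold minkSq; fun_prop

@[fun_prop] theorem continuous_space : Continuous (space : Spacetime s → _) := by
  unfold space; fun_prop

theorem continuous_join : Continuous fun q : ℝ × EuclideanSpace ℝ (Fin s) => join q.1 q.2 := by
  unfold join
  refine (PiLp.continuous_toLp 2 _).comp (continuous_pi fun i => ?_)
  refine Fin.cases ?_ (fun i => ?_) i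
  · exact continuous_fst
  · simp only [Fin.cons_succ]; fun_prop

/-- Space-time as a product. -/
def splitEquiv (s : ℕ) : ℝ × EuclideanSpace ℝ (Fin s) ≃ᵐ Spacetime s where
  toFun q := join q.1 q.2
  invFun k := (k 0, space k)
  left_inv q := by simp
  right_inv k := by simp
  measurable_toFun := continuous_join.measurable
  measurable_invFun := by
    exact ((continuous_coord 0).prodMk continuous_space).measurable

@[simp] theorem splitEquiv_apply (q : ℝ × EuclideanSpace ℝ (Fin s)) :
    splitEquiv s q = join q.1 q.2 := rfl

theorem measurePreserving_split : MeasurePreserving (splitEquiv s) := by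
  have h1 : MeasurePreserving (Prod.map id (WithLp.ofLp) :
      ℝ × EuclideanSpace ℝ (Fin s) → ℝ × (Fin s → ℝ)) :=
    (MeasurePreserving.id volume).prod (PiLp.volume_preserving_ofLp (Fin s))
  have h2 := (volume_preserving_piFinSuccAbove (fun _ : Fin (s + 1) => ℝ) 0).symm
  have h3 := PiLp.volume_preserving_toLp (Fin (s + 1))
  convert! h3.comp (h2.comp h1) using 1
  funext q
  ext i
  refine Fin.cases ?_ (fun i => ?_) i <;>
    simp [MeasurableEquiv.piFinSuccAbove_symm_apply, Fin.insertNthEquiv]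

theorem integral_split {E : Type*} [NormedAddCommGroup E] [NormedSpace ℝ E] (F : Spacetime s → E) :
    ∫ k, F k = ∫ q : ℝ × EuclideanSpace ℝ (Fin s), F (join q.1 q.2) :=
  (measurePreserving_split.integral_comp' F).symm

theorem integrable_split {E : Type*} [NormedAddCommGroup E] (F : Spacetime s → E) :
    Integrable F ↔ Integrable fun q : ℝ × EuclideanSpace ℝ (Fin s) => F (join q.1 q.2) :=
  (measurePreserving_split.integrable_comp_emb (splitEquiv s).measurableEmbedding).symm

/-! ### The weight and the singular integral -/

/-- A polynomial weight whose inverse is integrable. -/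
def wt (k : Spacetime s) : ℝ := (1 + ‖k‖ ^ 2) ^ (s + 2)

theorem one_le_wt (k : Spacetime s) : 1 ≤ wt k :=
  one_le_pow₀ (by nlinarith [sq_nonneg ‖k‖])

theorem wt_pos (k : Spacetime s) : 0 < wt k := zero_lt_one.trans_le (one_le_wt k)

@[simp] theorem wt_neg (k : Spacetime s) : wt (-k) = wt k := by simp [wt]

@[fun_prop] theorem continuous_wt : Continuous (wt : Spacetime s → ℝ) := by unfold wt; fun_prop

theorem integrable_inv_space :
    Integrable fun p : EuclideanSpace ℝ (Fin s) => ((1 + ‖p‖ ^ 2) ^ (s + 1))⁻¹ := by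
  have h := integrable_rpow_neg_one_add_norm_sq (E := EuclideanSpace ℝ (Fin s)) (μ := volume)
    (r := 2 * (s + 1)) (by simp; linarith)
  refine h.congr (Filter.Eventually.of_forall fun p => ?_)
  have h0 : 0 ≤ 1 + ‖p‖ ^ 2 := by positivity
  have h2 : -(2 * ((s : ℝ) + 1)) / 2 = -((s + 1 : ℕ) : ℝ) := by push_cast; ring
  simp only [h2, Real.rpow_neg h0, Real.rpow_natCast]

theorem inv_wt_join_le (t : ℝ) (p : EuclideanSpace ℝ (Fin s)) :
    (wt (join t p))⁻¹ ≤ (1 + t ^ 2)⁻¹ * ((1 + ‖p‖ ^ 2) ^ (s + 1))⁻¹ := by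
  rw [← mul_inv]
  refine inv_anti₀ (by positivity) ?_
  rw [wt, norm_sq_eq, join_zero, space_join, pow_succ' _ (s + 1)]
  gcongr <;> nlinarith [sq_nonneg t, sq_nonneg ‖p‖]

theorem integrable_inv_abs_rpow_near {β : ℝ} (hβ : β < 1) :
    Integrable fun u : ℝ => (Set.Ioo (-1 : ℝ) 1).indicator (fun u => (|u| ^ β)⁻¹) u := by
  rw [integrable_indicator_iff measurableSet_Ioo]
  have h1 : IntegrableOn (fun u : ℝ => (|u| ^ β)⁻¹) (Set.Ioc 0 1) := by
    have := (intervalIntegral.intervalIntegrable_rpow' (a := 0) (b := 1) (r := -β)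
      (by linarith)).1
    refine this.congr_fun (fun u hu => ?_) measurableSet_Ioc
    simp only [abs_of_pos hu.1, Real.rpow_neg hu.1.le]
  have h2 : IntegrableOn (fun u : ℝ => (|u| ^ β)⁻¹) (Set.Ico (-1) 0) := by
    have := h1.comp_neg
    simpa using this
  refine (h2.union ((integrableOn_Icc_iff_integrableOn_Ioc (by simp)).2 h1)).mono_set fun u hu => ?_
  rcases lt_or_ge u 0 with h | h
  · exact Or.inl ⟨hu.1.le, h⟩
  · exact Or.inr ⟨h, hu.2.le⟩

/-- The energy integral of `|t² - ω²|^{-β}` is bounded uniformly in `ω`. -/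
theorem exists_lintegral_energy_le {m β : ℝ} (hm : 0 < m) (hβ0 : 0 ≤ β) (hβ : β < 1) :
    ∃ C : ENNReal, C ≠ ⊤ ∧ ∀ ω, m ≤ ω →
      ∫⁻ t : ℝ, ENNReal.ofReal ((1 + t ^ 2)⁻¹ * (|t ^ 2 - ω ^ 2| ^ β)⁻¹) ≤ C := by
  set N : ℝ → ℝ := fun u => (Set.Ioo (-1 : ℝ) 1).indicator (fun u => (|u| ^ β)⁻¹) u with hN
  have hNi : Integrable N := integrable_inv_abs_rpow_near hβ
  set J : ℝ → ℝ := fun t => (1 + t ^ 2)⁻¹ with hJ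
  have hJi : Integrable J := integrable_inv_one_add_sq
  set g : ℝ → ℝ → ℝ := fun ω t => (m ^ β)⁻¹ * (N (t - ω) + N (t + ω) + 2 * J t) with hg
  have hN0 : ∀ u, 0 ≤ N u := fun u => Set.indicator_nonneg (fun _ _ => by positivity) u
  have hJ0 : ∀ u, 0 ≤ J u := fun u => by positivity
  have hle : ∀ t a : ℝ, J t * (|a| ^ β)⁻¹ ≤ N a + J t := by
    intro t a
    by_cases ha : a ∈ Set.Ioo (-1 : ℝ) 1
    · have : N a = (|a| ^ β)⁻¹ := Set.indicator_of_mem ha _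
      rw [this]
      have h1 : J t ≤ 1 := inv_le_one_of_one_le₀ (by nlinarith [sq_nonneg t])
      have h2 : 0 ≤ (|a| ^ β)⁻¹ := by positivity
      nlinarith [hJ0 t]
    · have h1 : 1 ≤ |a| := by
        by_contra h
        push Not at h
        exact ha (abs_lt.1 h)
      have h2 : (|a| ^ β)⁻¹ ≤ 1 := inv_le_one_of_one_le₀ (Real.one_le_rpow h1 hβ0)
      nlinarith [hJ0 t, hN0 a]
  have key : ∀ ω, m ≤ ω → ∀ t, (1 + t ^ 2)⁻¹ * (|t ^ 2 - ω ^ 2| ^ β)⁻¹ ≤ g ω t := by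
    intro ω hω t
    have h1 : (|t ^ 2 - ω ^ 2| ^ β)⁻¹ = (|t - ω| ^ β)⁻¹ * (|t + ω| ^ β)⁻¹ := by
      rw [← mul_inv, ← Real.mul_rpow (abs_nonneg _) (abs_nonneg _), ← abs_mul]
      ring_nf
    have hmβ : 0 < m ^ β := Real.rpow_pos_of_pos hm β
    have aux : ∀ a b : ℝ, m ≤ |b| → J t * ((|a| ^ β)⁻¹ * (|b| ^ β)⁻¹) ≤
        (m ^ β)⁻¹ * (N a + J t) := by
      intro a b hb
      have h2 : (|b| ^ β)⁻¹ ≤ (m ^ β)⁻¹ := inv_anti₀ hmβ (Real.rpow_le_rpow hm.le hb hβ0)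
      calc J t * ((|a| ^ β)⁻¹ * (|b| ^ β)⁻¹) = (|b| ^ β)⁻¹ * (J t * (|a| ^ β)⁻¹) := by ring
        _ ≤ (m ^ β)⁻¹ * (N a + J t) :=
          mul_le_mul h2 (hle t a) (mul_nonneg (hJ0 t) (by positivity)) (by positivity)
    have hpos : 0 ≤ (m ^ β)⁻¹ := by positivity
    rw [h1]
    change J t * _ ≤ (m ^ β)⁻¹ * (N (t - ω) + N (t + ω) + 2 * J t)
    rcases le_total 0 t with ht | ht
    · have := aux (t - ω) (t + ω) (by rw [abs_of_nonneg (by linarith)]; linarith)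
      nlinarith [mul_nonneg hpos (hN0 (t + ω)), mul_nonneg hpos (hJ0 t)]
    · have := aux (t + ω) (t - ω) (by rw [abs_of_nonpos (by linarith)]; linarith)
      rw [mul_comm (|t - ω| ^ β)⁻¹]
      nlinarith [mul_nonneg hpos (hN0 (t - ω)), mul_nonneg hpos (hJ0 t)]
  have hgi : ∀ ω, Integrable (g ω) := fun ω =>
    (((hNi.comp_sub_right ω).add (hNi.comp_add_right ω)).add (hJi.const_mul 2)).const_mul _
  refine ⟨ENNReal.ofReal ((m ^ β)⁻¹ * ((∫ u, N u) + (∫ u, N u) + 2 * ∫ u, J u)),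
    ENNReal.ofReal_ne_top, fun ω hω => ?_⟩
  calc ∫⁻ t : ℝ, ENNReal.ofReal ((1 + t ^ 2)⁻¹ * (|t ^ 2 - ω ^ 2| ^ β)⁻¹)
      ≤ ∫⁻ t, ENNReal.ofReal (g ω t) :=
        lintegral_mono fun t => ENNReal.ofReal_le_ofReal (key ω hω t)
    _ = ENNReal.ofReal (∫ t, g ω t) := by
        rw [ofReal_integral_eq_lintegral_ofReal (hgi ω)]
        refine Filter.Eventually.of_forall fun t => mul_nonneg (by positivity) ?_
        have h1 := hN0 (t - ω)
        have h2 := hN0 (t + ω)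
        have h3 := hJ0 t
        linarith
    _ = _ := by
        congr 1
        rw [integral_const_mul, integral_add _ (hJi.const_mul 2), integral_add
          (hNi.comp_sub_right ω) (hNi.comp_add_right ω), integral_const_mul,
          integral_sub_right_eq_self N, integral_add_right_eq_self N]
        exact (hNi.comp_sub_right ω).add (hNi.comp_add_right ω)

/-- The singularity of `|k² - m²|^{-β}` on the mass shell is integrable for `β < 1`. -/
theorem integrable_inv_wt_mul_inv_rpow {m β : ℝ} (hm : 0 < m) (hβ0 : 0 ≤ β) (hβ : β < 1) :
    Integrable fun k : Spacetime s => (wt k)⁻¹ * (|minkSq k - m ^ 2| ^ β)⁻¹ := by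
  obtain ⟨C, hC, hCle⟩ := exists_lintegral_energy_le hm hβ0 hβ
  have hmeas : Measurable fun k : Spacetime s => (wt k)⁻¹ * (|minkSq k - m ^ 2| ^ β)⁻¹ := by
    have h1 : Measurable (wt : Spacetime s → ℝ) := continuous_wt.measurable
    have h2 : Measurable (minkSq : Spacetime s → ℝ) := continuous_minkSq.measurable
    fun_prop
  rw [integrable_split]
  have hmeas' := hmeas.comp (splitEquiv s).measurable
  refine ⟨hmeas'.aestronglyMeasurable, ?_⟩
  rw [hasFiniteIntegral_iff_norm]
  set Q : EuclideanSpace ℝ (Fin s) → ℝ := fun p => ((1 + ‖p‖ ^ 2) ^ (s + 1))⁻¹ with hQ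
  calc ∫⁻ q : ℝ × EuclideanSpace ℝ (Fin s), ENNReal.ofReal
        ‖(wt (join q.1 q.2))⁻¹ * (|minkSq (join q.1 q.2) - m ^ 2| ^ β)⁻¹‖
      ≤ ∫⁻ q : ℝ × EuclideanSpace ℝ (Fin s), ENNReal.ofReal (Q q.2) * ENNReal.ofReal
        ((1 + q.1 ^ 2)⁻¹ * (|q.1 ^ 2 - (Real.sqrt (‖q.2‖ ^ 2 + m ^ 2)) ^ 2| ^ β)⁻¹) := by
        refine lintegral_mono fun q => ?_
        rw [← ENNReal.ofReal_mul (by positivity)]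
        refine ENNReal.ofReal_le_ofReal ?_
        rw [Real.norm_of_nonneg (mul_nonneg (inv_nonneg.2 (wt_pos _).le) (by positivity)),
          Real.sq_sqrt (by positivity), minkSq_join, ← sub_sub, ← mul_assoc]
        refine mul_le_mul_of_nonneg_right ?_ (by positivity)
        rw [mul_comm]
        exact inv_wt_join_le _ _
    _ = ∫⁻ p : EuclideanSpace ℝ (Fin s), ENNReal.ofReal (Q p) * ∫⁻ t : ℝ, ENNReal.ofReal
        ((1 + t ^ 2)⁻¹ * (|t ^ 2 - (Real.sqrt (‖p‖ ^ 2 + m ^ 2)) ^ 2| ^ β)⁻¹) := by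
        rw [Measure.volume_eq_prod, lintegral_prod_symm _ (by fun_prop)]
        refine lintegral_congr fun p => ?_
        dsimp only
        rw [lintegral_const_mul]
        fun_prop
    _ ≤ ∫⁻ p : EuclideanSpace ℝ (Fin s), ENNReal.ofReal (Q p) * C := by
        refine lintegral_mono fun p => mul_le_mul_right (hCle _ ?_) _
        exact Real.le_sqrt_of_sq_le (by nlinarith [sq_nonneg ‖p‖])
    _ < ⊤ := by
        rw [lintegral_mul_const _ (by fun_prop)]
        refine ENNReal.mul_lt_top ?_ hC.lt_top
        rw [← ofReal_integral_eq_lintegral_ofReal integrable_inv_space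
          (Filter.Eventually.of_forall fun p => by positivity)]
        exact ENNReal.ofReal_lt_top

theorem integrable_inv_wt : Integrable fun k : Spacetime s => (wt k)⁻¹ := by
  simpa using integrable_inv_wt_mul_inv_rpow (s := s) one_pos le_rfl one_pos

/-! ### The measure `δ(k₁ + ⋯ + kₙ) dk` -/

/-- A linear involution preserves Lebesgue measure. -/
theorem measurePreserving_of_involution {E : Type*} [NormedAddCommGroup E] [NormedSpace ℝ E]
    [MeasurableSpace E] [BorelSpace E] [FiniteDimensional ℝ E] (μ : Measure E) [μ.IsAddHaarMeasure]
    (L : E →ₗ[ℝ] E) (hL : ∀ x, L (L x) = x) : MeasurePreserving L μ μ := by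
  have h1 : LinearMap.det L * LinearMap.det L = 1 := by
    rw [← LinearMap.det_comp, show L ∘ₗ L = LinearMap.id from LinearMap.ext hL, LinearMap.det_id]
  have h2 : |(LinearMap.det L)⁻¹| = 1 := by
    rcases mul_self_eq_one_iff.1 h1 with h | h <;> simp [h]
  refine ⟨L.continuous_of_finiteDimensional.measurable, ?_⟩
  rw [Measure.map_linearMap_addHaar_eq_smul_addHaar μ (left_ne_zero_of_mul_eq_one h1), h2]
  simp

variable {s : ℕ}

/-- Appends minus the sum. -/
def snocNeg (n : ℕ) : (Fin n → Spacetime s) →ₗ[ℝ] (Fin (n + 1) → Spacetime s) where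
  toFun k := Fin.snoc k (-∑ i, k i)
  map_add' k k' := by
    funext i
    refine Fin.lastCases ?_ (fun i => ?_) i
    · simp only [Fin.snoc_last, Pi.add_apply, Finset.sum_add_distrib]; abel
    · simp
  map_smul' c k := by
    funext i
    refine Fin.lastCases ?_ (fun i => ?_) i
    · simp [Finset.smul_sum]
    · simp

theorem snocNeg_apply {n : ℕ} (k : Fin n → Spacetime s) :
    snocNeg n k = (Fin.snoc k (-∑ i, k i) : Fin (n + 1) → Spacetime s) := rfl

@[simp] theorem snocNeg_last {n : ℕ} (k : Fin n → Spacetime s) :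
    snocNeg n k (Fin.last n) = -∑ i, k i := by simp [snocNeg_apply]

@[simp] theorem snocNeg_castSucc {n : ℕ} (k : Fin n → Spacetime s) (i : Fin n) :
    snocNeg n k i.castSucc = k i := by simp [snocNeg_apply]

theorem deltaSum_succ (n : ℕ) :
    deltaSum s (n + 1) = Measure.map (snocNeg n) volume := rfl

theorem measurable_snocNeg (n : ℕ) : Measurable (snocNeg (s := s) n) :=
  (snocNeg n).continuous_of_finiteDimensional.measurable

theorem sum_snocNeg {n : ℕ} (k : Fin n → Spacetime s) : ∑ i, snocNeg n k i = 0 := by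
  simp [Fin.sum_univ_castSucc]

theorem snocNeg_init {n : ℕ} (w : Fin (n + 1) → Spacetime s) (hw : ∑ i, w i = 0) :
    snocNeg n (fun i => w i.castSucc) = w := by
  funext i
  refine Fin.lastCases ?_ (fun i => ?_) i
  · rw [Fin.sum_univ_castSucc] at hw
    rw [snocNeg_last, neg_eq_of_add_eq_zero_right hw]
  · simp

theorem snocNeg_injective (n : ℕ) : Function.Injective (snocNeg (s := s) n) := fun k k' h => by
  funext i
  have := congrFun h i.castSucc
  simpa using this

theorem ae_deltaSum_sum_eq_zero (n : ℕ) : ∀ᵐ k ∂deltaSum s n, ∑ i, k i = 0 := by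
  rcases n with _ | n
  · simp [deltaSum]
  · rw [deltaSum_succ, ae_map_iff (measurable_snocNeg n).aemeasurable]
    · exact Filter.Eventually.of_forall fun k => sum_snocNeg k
    · exact measurableSet_eq_fun (by fun_prop) measurable_const

instance sigmaFinite_deltaSum (n : ℕ) : SigmaFinite (deltaSum s n) := by
  rcases n with _ | n
  · change SigmaFinite (0 : Measure (Fin 0 → Spacetime s)); infer_instance
  · rw [deltaSum_succ]
    exact ((measurable_snocNeg n).measurableEmbedding (snocNeg_injective n)).sigmaFinite_map

/-- `δ(k₁ + ⋯ + kₙ) dk` is symmetric. -/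
theorem measurePreserving_deltaSum_perm {n : ℕ} (σ : Equiv.Perm (Fin n)) :
    MeasurePreserving (fun k : Fin n → Spacetime s => k ∘ σ) (deltaSum s n) (deltaSum s n) := by
  have hmeas : ∀ σ : Equiv.Perm (Fin n), Measurable fun k : Fin n → Spacetime s => k ∘ σ :=
    fun σ => by fun_prop
  refine Equiv.Perm.swap_induction_on σ ?_ fun f x y hxy hf => ?_
  · exact MeasurePreserving.id _
  · have key : MeasurePreserving (fun k : Fin n → Spacetime s => k ∘ Equiv.swap x y)
        (deltaSum s n) (deltaSum s n) := by
      rcases n with _ | n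
      · exact x.elim0
      · have hsum : ∀ k : Fin n → Spacetime s,
            ∑ i, (snocNeg n k ∘ Equiv.swap x y) i = 0 := fun k => by
          simp only [Function.comp_apply]
          rw [Equiv.sum_comp (Equiv.swap x y) (fun i => snocNeg n k i), sum_snocNeg]
        let L : (Fin n → Spacetime s) →ₗ[ℝ] (Fin n → Spacetime s) :=
          LinearMap.pi fun i =>
            LinearMap.proj (Equiv.swap x y i.castSucc) ∘ₗ snocNeg n
        have hL : ∀ k, snocNeg n (L k) = snocNeg n k ∘ Equiv.swap x y := fun k =>
          snocNeg_init _ (hsum k)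
        have hinv : ∀ k, L (L k) = k := fun k => by
          apply snocNeg_injective
          rw [hL, hL, Function.comp_assoc]
          funext i
          simp
        have hmp := measurePreserving_of_involution (volume : Measure (Fin n → Spacetime s)) L hinv
        refine ⟨hmeas _, ?_⟩
        rw [deltaSum_succ, Measure.map_map (hmeas _) (measurable_snocNeg n)]
        conv_rhs => rw [← hmp.map_eq, Measure.map_map (measurable_snocNeg n) hmp.measurable]
        congr 1
        funext k
        exact (hL k).symm
    exact hf.comp key

theorem integral_deltaSum_perm {n : ℕ} {E : Type*} [NormedAddCommGroup E] [NormedSpace ℝ E]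
    (σ : Equiv.Perm (Fin n)) (F : (Fin n → Spacetime s) → E) :
    ∫ k, F (k ∘ σ) ∂deltaSum s n = ∫ k, F k ∂deltaSum s n :=
  (measurePreserving_deltaSum_perm σ).integral_comp
    ((measurePreserving_deltaSum_perm (s := s) σ).measurable.measurableEmbedding
      fun _ _ h => σ.surjective.injective_comp_right h) F

theorem integrable_deltaSum_perm {n : ℕ} {E : Type*} [NormedAddCommGroup E]
    (σ : Equiv.Perm (Fin n)) (F : (Fin n → Spacetime s) → E) :
    Integrable (fun k => F (k ∘ σ)) (deltaSum s n) ↔ Integrable F (deltaSum s n) :=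
  (measurePreserving_deltaSum_perm σ).integrable_comp_emb
    ((measurePreserving_deltaSum_perm (s := s) σ).measurable.measurableEmbedding
      fun _ _ h => σ.surjective.injective_comp_right h)

theorem integral_deltaSum_succ {n : ℕ} {E : Type*} [NormedAddCommGroup E] [NormedSpace ℝ E]
    (F : (Fin (n + 1) → Spacetime s) → E) :
    ∫ k, F k ∂deltaSum s (n + 1) = ∫ k, F (snocNeg n k) := by
  rw [deltaSum_succ]
  exact ((measurable_snocNeg n).measurableEmbedding (snocNeg_injective n)).integral_map F

theorem integrable_deltaSum_succ {n : ℕ} {E : Type*} [NormedAddCommGroup E]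
    (F : (Fin (n + 1) → Spacetime s) → E) :
    Integrable F (deltaSum s (n + 1)) ↔ Integrable (fun k => F (snocNeg n k)) := by
  rw [deltaSum_succ]
  exact ((measurable_snocNeg n).measurableEmbedding (snocNeg_injective n)).integrable_map_iff

/-! ### Integrability of products on `δ(k₁ + ⋯ + kₙ) dk` -/

theorem integrable_deltaSum_prod_erase {n : ℕ} (i : Fin (n + 1)) {g : Spacetime s → ℝ}
    (hg : Integrable g) :
    Integrable (fun k => ∏ l ∈ Finset.univ.erase i, g (k l)) (deltaSum s (n + 1)) := by
  have h1 : Integrable (fun k : Fin (n + 1) → Spacetime s => ∏ l : Fin n, g (k l.castSucc))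
      (deltaSum s (n + 1)) := by
    rw [integrable_deltaSum_succ]
    simp only [snocNeg_castSucc]
    exact Integrable.fintype_prod (μ := fun _ => volume) fun _ => hg
  have h2 := (measurePreserving_deltaSum_perm (s := s) (Equiv.swap i (Fin.last n))).integrable_comp_of_integrable h1
  refine h2.congr (Filter.Eventually.of_forall fun k => ?_)
  change (∏ l : Fin n, g ((k ∘ Equiv.swap i (Fin.last n)) l.castSucc)) = _
  have h3 : (Finset.univ.erase i : Finset (Fin (n + 1))) =
      (Finset.univ.erase (Fin.last n)).map (Equiv.swap i (Fin.last n)).toEmbedding := by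
    ext l
    simp only [Finset.mem_erase, Finset.mem_univ, and_true, Finset.mem_map_equiv,
      Equiv.symm_swap, ne_eq]
    rw [not_iff_not, Equiv.swap_apply_eq_iff, Equiv.swap_apply_right]
  have h4 : (Finset.univ.erase (Fin.last n) : Finset (Fin (n + 1))) =
      Finset.univ.map Fin.castSuccEmb := by
    ext l
    refine Fin.lastCases ?_ (fun l => ?_) l <;> simp [Fin.castSucc_ne_last]
  dsimp only
  rw [h3, h4, Finset.prod_map, Finset.prod_map]
  rfl

theorem prod_le_sum_prod_erase_rpow {n : ℕ} (x : Fin (n + 2) → ℝ) (hx : ∀ i, 0 ≤ x i) :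
    ∏ i, x i ≤ ∑ i, ∏ l ∈ Finset.univ.erase i, x l ^ (((n : ℝ) + 2) / (n + 1)) := by
  obtain ⟨i, -, hi⟩ := Finset.exists_min_image Finset.univ x ⟨0, Finset.mem_univ _⟩
  have hcard : (Finset.univ.erase i : Finset (Fin (n + 2))).card = n + 1 := by
    rw [Finset.card_erase_of_mem (Finset.mem_univ i)]; simp
  have hP0 : 0 ≤ ∏ l ∈ Finset.univ.erase i, x l := Finset.prod_nonneg fun l _ => hx l
  have hpow : x i ^ (n + 1) ≤ ∏ l ∈ Finset.univ.erase i, x l := by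
    rw [← hcard, ← Finset.prod_const]
    exact Finset.prod_le_prod (fun _ _ => hx i) fun l _ => hi l (Finset.mem_univ l)
  have h1 : x i ≤ (∏ l ∈ Finset.univ.erase i, x l) ^ ((1 : ℝ) / (n + 1)) := by
    have := Real.rpow_le_rpow (pow_nonneg (hx i) _) hpow
      (show (0 : ℝ) ≤ 1 / (n + 1) by positivity)
    rwa [← Real.rpow_natCast, ← Real.rpow_mul (hx i), show ((n + 1 : ℕ) : ℝ) * (1 / (n + 1)) = 1 by
      push_cast; field_simp, Real.rpow_one] at this
  calc ∏ i, x i = x i * ∏ l ∈ Finset.univ.erase i, x l :=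
        (Finset.mul_prod_erase _ _ (Finset.mem_univ i)).symm
    _ ≤ (∏ l ∈ Finset.univ.erase i, x l) ^ ((1 : ℝ) / (n + 1)) * ∏ l ∈ Finset.univ.erase i, x l :=
        mul_le_mul_of_nonneg_right h1 hP0
    _ = ∏ l ∈ Finset.univ.erase i, x l ^ (((n : ℝ) + 2) / (n + 1)) := by
        rw [Real.finsetProd_rpow _ _ fun l _ => hx l]
        rw [show ((n : ℝ) + 2) / (n + 1) = 1 / (n + 1) + 1 by field_simp; ring,
          Real.rpow_add_one' hP0 (by positivity)]
    _ ≤ _ := Finset.single_le_sum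
        (f := fun i => ∏ l ∈ Finset.univ.erase i, x l ^ (((n : ℝ) + 2) / (n + 1)))
        (fun j _ => Finset.prod_nonneg fun l _ => Real.rpow_nonneg (hx l) _) (Finset.mem_univ i)

/-- The singular factor of the truncated functions with a weight that makes it integrable. -/
def sing (m α : ℝ) (k : Spacetime s) : ℝ := (wt k)⁻¹ * (|minkSq k - m ^ 2| ^ α)⁻¹

theorem sing_nonneg (m α : ℝ) (k : Spacetime s) : 0 ≤ sing m α k :=
  mul_nonneg (inv_nonneg.2 (wt_pos k).le) (by positivity)

@[fun_prop] theorem measurable_minkSq : Measurable (minkSq : Spacetime s → ℝ) :=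
  continuous_minkSq.measurable

@[fun_prop] theorem measurable_wt : Measurable (wt : Spacetime s → ℝ) :=
  continuous_wt.measurable

@[fun_prop] theorem measurable_coord (i : Fin (s + 1)) : Measurable fun k : Spacetime s => k i :=
  (continuous_coord i).measurable

@[fun_prop] theorem measurable_sing (m α : ℝ) : Measurable (sing m α : Spacetime s → ℝ) := by
  unfold sing; fun_prop

theorem integrable_deltaSum_prod_sing {n : ℕ} {m α : ℝ} (hm : 0 < m) (hα0 : 0 < α)
    (hα : α * (((n : ℝ) + 2) / (n + 1)) < 1) :
    Integrable (fun k => ∏ l, sing m α (k l)) (deltaSum s (n + 2)) := by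
  set p : ℝ := ((n : ℝ) + 2) / (n + 1) with hp
  have hp1 : 1 ≤ p := by rw [hp, le_div_iff₀ (by positivity)]; linarith
  have hg : Integrable fun k : Spacetime s => sing m α k ^ p := by
    refine (integrable_inv_wt_mul_inv_rpow (s := s) hm (by positivity : 0 ≤ α * p) hα).mono'
      ((measurable_sing m α).pow_const p).aestronglyMeasurable (Filter.Eventually.of_forall fun k => ?_)
    rw [Real.norm_of_nonneg (Real.rpow_nonneg (sing_nonneg _ _ _) _), sing,
      Real.mul_rpow (inv_nonneg.2 (wt_pos k).le) (by positivity),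
      Real.inv_rpow (Real.rpow_nonneg (abs_nonneg _) α), ← Real.rpow_mul (abs_nonneg _)]
    refine mul_le_mul_of_nonneg_right ?_ (by positivity)
    have h1 : (wt k)⁻¹ ≤ 1 := inv_le_one_of_one_le₀ (one_le_wt k)
    simpa using Real.rpow_le_rpow_of_exponent_ge' (inv_nonneg.2 (wt_pos k).le) h1
      zero_le_one hp1
  refine (integrable_finsetSum Finset.univ fun i _ =>
    integrable_deltaSum_prod_erase (n := n + 1) i hg).mono'
    (Finset.measurable_prod _ fun i _ =>
      (measurable_sing m α).comp (measurable_pi_apply i)).aestronglyMeasurable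
    (Filter.Eventually.of_forall fun k => ?_)
  rw [Real.norm_of_nonneg (Finset.prod_nonneg fun l _ => sing_nonneg _ _ _)]
  exact prod_le_sum_prod_erase_rpow _ fun l => sing_nonneg _ _ _

/-! ### The truncated measures -/

variable {s : ℕ}

theorem measurableSet_mass (m : ℝ) : MeasurableSet {k : Spacetime s | m ^ 2 < minkSq k} :=
  measurableSet_lt measurable_const measurable_minkSq

@[fun_prop] theorem measurable_muPlus (m α : ℝ) : Measurable (muPlus m α : Spacetime s → ℝ) := by
  have h : MeasurableSet {k : Spacetime s | m ^ 2 < minkSq k ∧ 0 < k 0} :=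
    (measurableSet_mass m).inter (measurableSet_lt measurable_const (measurable_coord 0))
  unfold muPlus
  refine (measurable_const.mul (Measurable.ite h measurable_const measurable_const)).mul ?_
  fun_prop

@[fun_prop] theorem measurable_muMinus (m α : ℝ) : Measurable (muMinus m α : Spacetime s → ℝ) := by
  have h : MeasurableSet {k : Spacetime s | m ^ 2 < minkSq k ∧ k 0 < 0} :=
    (measurableSet_mass m).inter (measurableSet_lt (measurable_coord 0) measurable_const)
  unfold muMinus
  refine (measurable_const.mul (Measurable.ite h measurable_const measurable_const)).mul ?_
  fun_prop

@[fun_prop] theorem measurable_muMid (m α : ℝ) : Measurable (muMid m α : Spacetime s → ℝ) := by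
  have h : MeasurableSet {k : Spacetime s | minkSq k < m ^ 2} :=
    measurableSet_lt measurable_minkSq measurable_const
  unfold muMid
  refine (measurable_const.mul ((measurable_const.mul (Measurable.ite (measurableSet_mass m)
    measurable_const measurable_const)).add
      (Measurable.ite h measurable_const measurable_const))).mul ?_
  fun_prop

@[fun_prop] theorem measurable_truncDensity {n : ℕ} (m α : ℝ) :
    Measurable (truncDensity m α : (Fin n → Spacetime s) → ℝ) := by
  unfold truncDensity
  refine Finset.measurable_sum _ fun j _ => Finset.measurable_prod _ fun l _ => ?_
  split_ifs <;> fun_prop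

/-- The normalization constant of the densities. -/
def muConst (s : ℕ) : ℝ := (2 * Real.pi) ^ (-((s + 1 : ℝ) / 2))

theorem muConst_pos (s : ℕ) : 0 < muConst s := Real.rpow_pos_of_pos (by positivity) _

section bounds

variable {m α : ℝ}

theorem sin_nonneg_of_le_half (hα0 : 0 < α) (hα : α ≤ 1 / 2) : 0 ≤ Real.sin (Real.pi * α) :=
  Real.sin_nonneg_of_nonneg_of_le_pi (by positivity) (by nlinarith [Real.pi_pos])

theorem cos_nonneg_of_le_half (hα0 : 0 < α) (hα : α ≤ 1 / 2) : 0 ≤ Real.cos (Real.pi * α) :=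
  Real.cos_nonneg_of_mem_Icc ⟨by nlinarith [Real.pi_pos], by nlinarith [Real.pi_pos]⟩

theorem muPlus_nonneg (hα0 : 0 < α) (hα : α ≤ 1 / 2) (k : Spacetime s) : 0 ≤ muPlus m α k := by
  have h1 := (muConst_pos s).le
  have h2 := sin_nonneg_of_le_half hα0 hα
  unfold muPlus
  change 0 ≤ muConst s * _ * _ * _
  split_ifs with h
  · exact mul_nonneg (by positivity) (one_div_nonneg.2 (Real.rpow_nonneg (by linarith [h.1]) _))
  · simp

theorem muMinus_nonneg (hα0 : 0 < α) (hα : α ≤ 1 / 2) (k : Spacetime s) :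
    0 ≤ muMinus m α k := by
  have h1 := (muConst_pos s).le
  have h2 := sin_nonneg_of_le_half hα0 hα
  unfold muMinus
  change 0 ≤ muConst s * _ * _ * _
  split_ifs with h
  · exact mul_nonneg (by positivity) (one_div_nonneg.2 (Real.rpow_nonneg (by linarith [h.1]) _))
  · simp

theorem muMid_nonneg (hα0 : 0 < α) (hα : α ≤ 1 / 2) (k : Spacetime s) : 0 ≤ muMid m α k := by
  have h1 := (muConst_pos s).le
  have h2 := cos_nonneg_of_le_half hα0 hα
  unfold muMid
  change 0 ≤ muConst s * _ * _
  refine mul_nonneg (mul_nonneg h1 ?_) (by positivity)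
  split_ifs <;> linarith

theorem muPlus_le (hα0 : 0 < α) (hα : α ≤ 1 / 2) (k : Spacetime s) :
    muPlus m α k ≤ muConst s * (|minkSq k - m ^ 2| ^ α)⁻¹ := by
  have h1 := (muConst_pos s).le
  have h2 := sin_nonneg_of_le_half hα0 hα
  have h3 := Real.sin_le_one (Real.pi * α)
  unfold muPlus
  change muConst s * _ * _ * _ ≤ _
  split_ifs with h
  · rw [mul_one, abs_of_pos (by linarith [h.1]), one_div]
    refine mul_le_mul_of_nonneg_right (mul_le_of_le_one_right h1 h3)
      (inv_nonneg.2 (Real.rpow_nonneg (by linarith [h.1]) _))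
  · simp only [mul_zero, zero_mul]; positivity

theorem muMinus_le (hα0 : 0 < α) (hα : α ≤ 1 / 2) (k : Spacetime s) :
    muMinus m α k ≤ muConst s * (|minkSq k - m ^ 2| ^ α)⁻¹ := by
  have h1 := (muConst_pos s).le
  have h2 := sin_nonneg_of_le_half hα0 hα
  have h3 := Real.sin_le_one (Real.pi * α)
  unfold muMinus
  change muConst s * _ * _ * _ ≤ _
  split_ifs with h
  · rw [mul_one, abs_of_pos (by linarith [h.1]), one_div]
    refine mul_le_mul_of_nonneg_right (mul_le_of_le_one_right h1 h3)
      (inv_nonneg.2 (Real.rpow_nonneg (by linarith [h.1]) _))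
  · simp only [mul_zero, zero_mul]; positivity

theorem muMid_le (k : Spacetime s) :
    muMid m α k ≤ muConst s * (|minkSq k - m ^ 2| ^ α)⁻¹ := by
  have h1 := (muConst_pos s).le
  have h3 := Real.cos_le_one (Real.pi * α)
  unfold muMid
  change muConst s * _ * _ ≤ _
  rw [one_div]
  refine mul_le_mul_of_nonneg_right (mul_le_of_le_one_right h1 ?_) (by positivity)
  split_ifs with h h' <;> linarith

theorem truncDensity_nonneg (hα0 : 0 < α) (hα : α ≤ 1 / 2) {n : ℕ} (k : Fin n → Spacetime s) :
    0 ≤ truncDensity m α k := by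
  refine Finset.sum_nonneg fun j _ => Finset.prod_nonneg fun l _ => ?_
  split_ifs
  exacts [muMinus_nonneg hα0 hα _, muMid_nonneg hα0 hα _, muPlus_nonneg hα0 hα _]

theorem truncDensity_le (hα0 : 0 < α) (hα : α ≤ 1 / 2) {n : ℕ} (k : Fin n → Spacetime s) :
    truncDensity m α k ≤ n * muConst s ^ n * ∏ l, (|minkSq (k l) - m ^ 2| ^ α)⁻¹ := by
  have h : ∀ j ∈ (Finset.univ : Finset (Fin n)), (∏ l : Fin n, if l < j then muMinus m α (k l) else
      if l = j then muMid m α (k l) else muPlus m α (k l)) ≤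
      muConst s ^ n * ∏ l, (|minkSq (k l) - m ^ 2| ^ α)⁻¹ := by
    intro j _
    have h1 : muConst s ^ n = ∏ _l : Fin n, muConst s := by simp
    rw [h1, ← Finset.prod_mul_distrib]
    refine Finset.prod_le_prod (fun l _ => ?_) fun l _ => ?_
    · split_ifs
      exacts [muMinus_nonneg hα0 hα _, muMid_nonneg hα0 hα _, muPlus_nonneg hα0 hα _]
    · split_ifs
      exacts [muMinus_le hα0 hα _, muMid_le _, muPlus_le hα0 hα _]
  refine (Finset.sum_le_sum h).trans (le_of_eq ?_)
  simp [mul_assoc]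

end bounds

/-- The inverse of the product of the weights. -/
def invWt {n : ℕ} (k : Fin n → Spacetime s) : ℝ := ∏ l, (wt (k l))⁻¹

@[fun_prop] theorem measurable_invWt {n : ℕ} : Measurable (invWt : (Fin n → Spacetime s) → ℝ) :=
  Finset.measurable_prod _ fun l _ => (measurable_wt.comp (measurable_pi_apply l)).inv

theorem invWt_pos {n : ℕ} (k : Fin n → Spacetime s) : 0 < invWt k :=
  Finset.prod_pos fun _ _ => inv_pos.2 (wt_pos _)

theorem integrable_truncRegular_iff {E : Type*} [NormedAddCommGroup E] [NormedSpace ℝ E]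
    {m α : ℝ} (hα0 : 0 < α) (hα : α ≤ 1 / 2) {n : ℕ} (F : (Fin n → Spacetime s) → E) :
    Integrable F (truncRegular s m α n) ↔
      Integrable (fun k => truncDensity m α k • F k) (deltaSum s n) := by
  rw [truncRegular, integrable_smul_measure (by simp; positivity) ENNReal.ofReal_ne_top]
  have h := integrable_withDensity_iff_integrable_smul₀ (μ := deltaSum s n)
    (f := fun k => Real.toNNReal (truncDensity m α k)) (g := F)
    (measurable_truncDensity m α).real_toNNReal.aemeasurable
  refine h.trans (integrable_congr (Filter.Eventually.of_forall fun k => ?_))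
  change ((Real.toNNReal (truncDensity m α k) : ℝ)) • F k = _
  rw [Real.coe_toNNReal _ (truncDensity_nonneg hα0 hα k)]

theorem integral_truncRegular {E : Type*} [NormedAddCommGroup E] [NormedSpace ℝ E]
    {m α : ℝ} (hα0 : 0 < α) (hα : α ≤ 1 / 2) {n : ℕ} (F : (Fin n → Spacetime s) → E) :
    ∫ k, F k ∂truncRegular s m α n = ((2 : ℝ) ^ (n - 1) * (2 * Real.pi) ^ (s + 1)) •
      ∫ k, truncDensity m α k • F k ∂deltaSum s n := by
  rw [truncRegular, integral_smul_measure, ENNReal.toReal_ofReal (by positivity)]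
  congr 1
  have h := integral_withDensity_eq_integral_smul₀ (μ := deltaSum s n)
    (f := fun k => Real.toNNReal (truncDensity m α k)) 
    (measurable_truncDensity m α).real_toNNReal.aemeasurable F
  refine h.trans (integral_congr_ae (Filter.Eventually.of_forall fun k => ?_))
  change ((Real.toNNReal (truncDensity m α k) : ℝ)) • F k = _
  rw [Real.coe_toNNReal _ (truncDensity_nonneg hα0 hα k)]

/-- The sum over the truncated measure splits according to the two forms of the two-point
function. -/
theorem truncMeasure_cases (s : ℕ) (m α : ℝ) (n : ℕ) :
    (truncMeasure s m α n = truncRegular s m α n ∧ ¬ (n = 2 ∧ α = 1 / 2)) ∨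
      ∃ h : n = 2, α = 1 / 2 ∧
        truncMeasure s m α n = h ▸ (ENNReal.ofReal (2 * Real.pi) • massShell s m) := by
  by_cases hn : n = 2
  · subst hn
    by_cases hα : α = 1 / 2
    · exact Or.inr ⟨rfl, hα, if_pos hα⟩
    · exact Or.inl ⟨if_neg hα, fun h => hα h.2⟩
  · refine Or.inl ⟨?_, fun h => hn h.1⟩
    rcases n with _ | _ | _ | n
    · rfl
    · rfl
    · exact absurd rfl hn
    · rfl

theorem measurable_negShell (m : ℝ) : Measurable (negShell (s := s) m) := by
  have : Continuous fun p : EuclideanSpace ℝ (Fin s) => negShell m p :=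
    continuous_join.comp (by fun_prop : Continuous fun p : EuclideanSpace ℝ (Fin s) =>
      (-Real.sqrt (‖p‖ ^ 2 + m ^ 2), p))
  exact this.measurable

/-- The pair of opposite momenta on the mass shell. -/
def shellPair (m : ℝ) (p : EuclideanSpace ℝ (Fin s)) : Fin 2 → Spacetime s :=
  ![negShell m p, -negShell m p]

theorem measurable_shellPair (m : ℝ) : Measurable (shellPair (s := s) m) := by
  refine measurable_pi_lambda _ fun i => ?_
  fin_cases i
  · exact measurable_negShell m
  · exact (measurable_negShell m).neg

theorem measurableEmbedding_shellPair (m : ℝ) : MeasurableEmbedding (shellPair (s := s) m) :=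
  (measurable_shellPair m).measurableEmbedding fun p p' h => by
    have h0 : negShell m p = negShell m p' := congrFun h 0
    simpa [negShell_eq] using congrArg space h0

/-- The energy on the mass shell. -/
def energy (m : ℝ) (p : EuclideanSpace ℝ (Fin s)) : ℝ := Real.sqrt (‖p‖ ^ 2 + m ^ 2)

@[fun_prop] theorem continuous_energy (m : ℝ) : Continuous (energy (s := s) m) := by
  unfold energy; fun_prop

theorem le_energy {m : ℝ} (p : EuclideanSpace ℝ (Fin s)) : m ≤ energy m p :=
  Real.le_sqrt_of_sq_le (by nlinarith [sq_nonneg ‖p‖])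

theorem energy_sq (m : ℝ) (p : EuclideanSpace ℝ (Fin s)) : energy m p ^ 2 = ‖p‖ ^ 2 + m ^ 2 :=
  Real.sq_sqrt (by positivity)

theorem massShell_eq (m : ℝ) : massShell s m = Measure.map (shellPair m)
    (volume.withDensity fun p => ENNReal.ofReal (1 / (2 * energy m p))) := rfl

theorem measurable_shellDensity (m : ℝ) :
    Measurable fun p : EuclideanSpace ℝ (Fin s) => 1 / (2 * energy m p) := by
  have := (continuous_energy (s := s) m).measurable
  fun_prop

theorem integrable_massShell_iff {E : Type*} [NormedAddCommGroup E] [NormedSpace ℝ E]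
    {m : ℝ} (F : (Fin 2 → Spacetime s) → E) :
    Integrable F (massShell s m) ↔
      Integrable fun p => (1 / (2 * energy m p)) • F (shellPair m p) := by
  rw [massShell_eq, (measurableEmbedding_shellPair m).integrable_map_iff]
  have h := integrable_withDensity_iff_integrable_smul₀
    (μ := (volume : Measure (EuclideanSpace ℝ (Fin s))))
    (f := fun p => Real.toNNReal (1 / (2 * energy m p))) (g := F ∘ shellPair m)
    (measurable_shellDensity m).real_toNNReal.aemeasurable
  refine h.trans (integrable_congr (Filter.Eventually.of_forall fun p => ?_))
  change ((Real.toNNReal (1 / (2 * energy m p)) : ℝ)) • F (shellPair m p) = _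
  rw [Real.coe_toNNReal _ (by unfold energy; positivity)]

theorem integral_massShell {E : Type*} [NormedAddCommGroup E] [NormedSpace ℝ E]
    {m : ℝ} (F : (Fin 2 → Spacetime s) → E) :
    ∫ k, F k ∂massShell s m = ∫ p, (1 / (2 * energy m p)) • F (shellPair m p) := by
  rw [massShell_eq, (measurableEmbedding_shellPair m).integral_map]
  have h := integral_withDensity_eq_integral_smul₀
    (μ := (volume : Measure (EuclideanSpace ℝ (Fin s))))
    (f := fun p => Real.toNNReal (1 / (2 * energy m p)))
    (measurable_shellDensity m).real_toNNReal.aemeasurable (fun p => F (shellPair m p))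
  refine h.trans (integral_congr_ae (Filter.Eventually.of_forall fun p => ?_))
  change ((Real.toNNReal (1 / (2 * energy m p)) : ℝ)) • F (shellPair m p) = _
  rw [Real.coe_toNNReal _ (by unfold energy; positivity)]

theorem sigmaFinite_ofReal_smul {X : Type*} [MeasurableSpace X] (c : ℝ) (μ : Measure X)
    [SigmaFinite μ] : SigmaFinite (ENNReal.ofReal c • μ) :=
  SMul.sigmaFinite (μ := μ) c.toNNReal

instance sigmaFinite_truncMeasure (m α : ℝ) (n : ℕ) : SigmaFinite (truncMeasure s m α n) := by
  rcases truncMeasure_cases s m α n with ⟨h, -⟩ | ⟨rfl, -, h⟩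
  · rw [h, truncRegular]
    have : SigmaFinite ((deltaSum s n).withDensity fun k => ENNReal.ofReal (truncDensity m α k)) :=
      SigmaFinite.withDensity_ofReal (truncDensity m α)
    exact sigmaFinite_ofReal_smul _ _
  · rw [h, massShell_eq]
    have : SigmaFinite ((volume : Measure (EuclideanSpace ℝ (Fin s))).withDensity
        fun p => ENNReal.ofReal (1 / (2 * energy m p))) :=
      SigmaFinite.withDensity_ofReal _
    have := (measurableEmbedding_shellPair (s := s) m).sigmaFinite_map
      (μ := volume.withDensity fun p => ENNReal.ofReal (1 / (2 * energy m p)))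
    exact sigmaFinite_ofReal_smul _ _

theorem integrable_density_invWt {m α : ℝ} (hm : 0 < m) (hα0 : 0 < α) (hα : α ≤ 1 / 2) {n : ℕ}
    (hn : ¬ (n = 2 ∧ α = 1 / 2)) :
    Integrable (fun k => truncDensity m α k * invWt k) (deltaSum s n) := by
  rcases n with _ | _ | n
  · change Integrable _ (0 : Measure (Fin 0 → Spacetime s)); exact integrable_zero_measure
  · rw [integrable_deltaSum_succ]
    have : IsFiniteMeasure (volume : Measure (Fin 0 → Spacetime s)) := by
      rw [volume_pi, Measure.pi_of_empty (x := Fin.elim0)]; infer_instance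
    refine (integrable_const (truncDensity m α (snocNeg 0 (Fin.elim0 : Fin 0 → Spacetime s)) *
      invWt (snocNeg 0 (Fin.elim0 : Fin 0 → Spacetime s)))).congr
      (Filter.Eventually.of_forall fun k => ?_)
    rw [Subsingleton.elim k Fin.elim0]
  · have h : α * (((n : ℝ) + 2) / (n + 1)) < 1 := by
      rw [mul_div_assoc', div_lt_one (by positivity)]
      rcases Nat.eq_zero_or_pos n with rfl | hn'
      · have : α ≠ 1 / 2 := fun h => hn ⟨rfl, h⟩
        have : α < 1 / 2 := lt_of_le_of_ne hα this
        norm_num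
        linarith
      · have : (1 : ℝ) ≤ n := by exact_mod_cast hn'
        nlinarith
    have h1 := (integrable_deltaSum_prod_sing (s := s) hm hα0 h).const_mul
      (((n + 2 : ℕ) : ℝ) * muConst s ^ (n + 2))
    refine h1.mono' (by fun_prop) (Filter.Eventually.of_forall fun k => ?_)
    rw [Real.norm_of_nonneg (mul_nonneg (truncDensity_nonneg hα0 hα k) (invWt_pos k).le)]
    refine (mul_le_mul_of_nonneg_right (truncDensity_le hα0 hα k) (invWt_pos k).le).trans
      (le_of_eq ?_)
    rw [mul_assoc, invWt, ← Finset.prod_mul_distrib]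
    congr 1
    exact Finset.prod_congr rfl fun l _ => mul_comm _ _

theorem integrable_invWt_truncMeasure {m α : ℝ} (hm : 0 < m) (hα0 : 0 < α) (hα : α ≤ 1 / 2)
    (n : ℕ) : Integrable invWt (truncMeasure s m α n) := by
  rcases truncMeasure_cases s m α n with ⟨h, hn⟩ | ⟨rfl, -, h⟩
  · rw [h, integrable_truncRegular_iff hα0 hα]
    exact integrable_density_invWt hm hα0 hα hn
  · rw [h]
    refine Integrable.smul_measure ?_ ENNReal.ofReal_ne_top
    rw [integrable_massShell_iff]
    refine (integrable_inv_space (s := s)).const_mul (1 / (2 * m)) |>.mono' ?_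
      (Filter.Eventually.of_forall fun p => ?_)
    · exact ((measurable_shellDensity m).mul
        (measurable_invWt.comp (measurable_shellPair m))).aestronglyMeasurable
    · have h1 := le_energy (m := m) p
      rw [smul_eq_mul, Real.norm_of_nonneg (mul_nonneg
        (one_div_nonneg.2 (by linarith)) (invWt_pos _).le)]
      refine mul_le_mul (one_div_le_one_div_of_le (by linarith) (by linarith)) ?_
        (invWt_pos _).le (by positivity)
      have h2 : (wt (negShell m p))⁻¹ ≤ ((1 + ‖p‖ ^ 2) ^ (s + 1))⁻¹ := by
        rw [negShell_eq]
        refine (inv_wt_join_le _ _).trans (mul_le_of_le_one_left (by positivity)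
          (inv_le_one_of_one_le₀ ?_))
        nlinarith [sq_nonneg (-Real.sqrt (‖p‖ ^ 2 + m ^ 2))]
      have h3 : (wt (negShell m p))⁻¹ ≤ 1 := inv_le_one_of_one_le₀ (one_le_wt _)
      have h4 : 0 ≤ (wt (negShell m p))⁻¹ := inv_nonneg.2 (wt_pos _).le
      simp only [invWt, shellPair, Fin.prod_univ_two, Matrix.cons_val_zero, Matrix.cons_val_one,
        wt_neg]
      nlinarith

/-! ### The support of the truncated measures -/

theorem mem_forwardCone_iff (k : Spacetime s) : k ∈ forwardCone s ↔ ‖space k‖ ≤ k 0 := by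
  simp only [forwardCone, Set.mem_ofPred_eq, minkSq_eq, sub_nonneg]
  constructor
  · rintro ⟨h, h0⟩
    exact abs_le_of_sq_le_sq' h h0 |>.2
  · intro h
    exact ⟨by gcongr, (norm_nonneg _).trans h⟩

theorem neg_mem_forwardCone_iff (k : Spacetime s) : -k ∈ forwardCone s ↔ k ∈ backwardCone s := by
  simp [forwardCone, backwardCone, minkSq]

theorem zero_mem_forwardCone : (0 : Spacetime s) ∈ forwardCone s := by
  simp [forwardCone, minkSq]

@[simp] theorem space_add (k k' : Spacetime s) : space (k + k') = space k + space k' := rfl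
@[simp] theorem space_neg (k : Spacetime s) : space (-k) = -space k := rfl
@[simp] theorem space_smul (c : ℝ) (k : Spacetime s) : space (c • k) = c • space k := rfl
@[simp] theorem minkSq_neg (k : Spacetime s) : minkSq (-k) = minkSq k := by simp [minkSq]

theorem add_mem_forwardCone {k k' : Spacetime s} (h : k ∈ forwardCone s)
    (h' : k' ∈ forwardCone s) : k + k' ∈ forwardCone s := by
  rw [mem_forwardCone_iff] at *
  rw [space_add, PiLp.add_apply]
  exact (norm_add_le _ _).trans (add_le_add h h')

theorem sum_mem_forwardCone {ι : Type*} (S : Finset ι) (f : ι → Spacetime s)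
    (h : ∀ i ∈ S, f i ∈ forwardCone s) : ∑ i ∈ S, f i ∈ forwardCone s :=
  Finset.sum_induction f (· ∈ forwardCone s) (fun _ _ => add_mem_forwardCone)
    zero_mem_forwardCone h

theorem isClosed_forwardCone : IsClosed (forwardCone s) := by
  have : forwardCone s = {k | 0 ≤ minkSq k} ∩ {k | 0 ≤ k 0} := rfl
  rw [this]
  exact (isClosed_le continuous_const continuous_minkSq).inter
    (isClosed_le continuous_const (continuous_coord 0))

/-- The support property of the momenta of one truncated function. -/
def SpectralTuple {n : ℕ} (k : Fin n → Spacetime s) : Prop :=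
  (∑ l, k l = 0) ∧ ∀ U : Finset (Fin n), IsUpperSet (U : Set (Fin n)) → ∑ l ∈ U, k l ∈ forwardCone s

theorem spectralTuple_of_exists {n : ℕ} {k : Fin n → Spacetime s} (hk : ∑ l, k l = 0) (j : Fin n)
    (h1 : ∀ l < j, -k l ∈ forwardCone s) (h2 : ∀ l, j < l → k l ∈ forwardCone s) :
    SpectralTuple k := by
  refine ⟨hk, fun U hU => ?_⟩
  by_cases hj : j ∈ U
  · have h3 : ∑ l ∈ U, k l = ∑ l ∈ Uᶜ, -k l := by
      rw [Finset.sum_neg_distrib, eq_neg_iff_add_eq_zero, Finset.sum_add_sum_compl, hk]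
    rw [h3]
    refine sum_mem_forwardCone _ _ fun l hl => h1 l ?_
    by_contra h
    exact Finset.mem_compl.1 hl (hU (not_lt.1 h) hj)
  · refine sum_mem_forwardCone _ _ fun l hl => h2 l ?_
    by_contra h
    exact hj (hU (not_lt.1 h) hl)

theorem measurableSet_spectralTuple {n : ℕ} :
    MeasurableSet {k : Fin n → Spacetime s | SpectralTuple k} := by
  have hm : ∀ U : Finset (Fin n), Measurable fun k : Fin n → Spacetime s => ∑ l ∈ U, k l :=
    fun U => Finset.measurable_sum _ fun l _ => measurable_pi_apply l
  have h1 : MeasurableSet {k : Fin n → Spacetime s | ∑ l, k l = 0} :=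
    measurableSet_eq_fun (hm _) measurable_const
  have h2 : MeasurableSet {k : Fin n → Spacetime s | ∀ U : Finset (Fin n),
      IsUpperSet (U : Set (Fin n)) → ∑ l ∈ U, k l ∈ forwardCone s} := by
    have : {k : Fin n → Spacetime s | ∀ U : Finset (Fin n),
      IsUpperSet (U : Set (Fin n)) → ∑ l ∈ U, k l ∈ forwardCone s} =
      ⋂ U : Finset (Fin n), ⋂ _ : IsUpperSet (U : Set (Fin n)),
        (fun k => ∑ l ∈ U, k l) ⁻¹' forwardCone s := by ext; simp
    rw [this]
    exact MeasurableSet.iInter fun U => MeasurableSet.iInter fun _ =>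
      hm U isClosed_forwardCone.measurableSet
  exact h1.inter h2

theorem mem_forwardCone_of_muPlus {m α : ℝ} {k : Spacetime s} (h : muPlus m α k ≠ 0) :
    k ∈ forwardCone s := by
  by_contra hk
  refine h ?_
  unfold muPlus
  rw [if_neg]
  · simp
  · exact fun h => hk ⟨(sq_nonneg m).trans h.1.le, h.2.le⟩

theorem neg_mem_forwardCone_of_muMinus {m α : ℝ} {k : Spacetime s} (h : muMinus m α k ≠ 0) :
    -k ∈ forwardCone s := by
  by_contra hk
  refine h ?_
  unfold muMinus
  rw [if_neg]
  · simp
  · intro h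
    exact hk ⟨by rw [minkSq_neg]; exact (sq_nonneg m).trans h.1.le, by simpa using h.2.le⟩

theorem spectralTuple_of_truncDensity {m α : ℝ} {n : ℕ} {k : Fin n → Spacetime s}
    (hk : ∑ l, k l = 0) (h : truncDensity m α k ≠ 0) : SpectralTuple k := by
  obtain ⟨j, -, hj⟩ := Finset.exists_ne_zero_of_sum_ne_zero h
  rw [Finset.prod_ne_zero_iff] at hj
  refine spectralTuple_of_exists hk j (fun l hl => ?_) fun l hl => ?_
  · have := hj l (Finset.mem_univ l)
    rw [if_pos hl] at this
    exact neg_mem_forwardCone_of_muMinus this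
  · have := hj l (Finset.mem_univ l)
    rw [if_neg hl.not_gt, if_neg hl.ne'] at this
    exact mem_forwardCone_of_muPlus this

theorem neg_negShell_mem (m : ℝ) (p : EuclideanSpace ℝ (Fin s)) :
    -negShell m p ∈ forwardCone s := by
  rw [mem_forwardCone_iff, negShell_eq, space_neg, space_join, norm_neg, PiLp.neg_apply, join_zero,
    neg_neg]
  exact Real.le_sqrt_of_sq_le (by nlinarith [sq_nonneg m])

theorem ae_spectralTuple (m α : ℝ) (n : ℕ) :
    ∀ᵐ k ∂truncMeasure s m α n, SpectralTuple k := by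
  rcases truncMeasure_cases s m α n with ⟨h, -⟩ | ⟨rfl, -, h⟩
  · rw [h, truncRegular]
    refine Measure.ae_smul_measure ?_ _
    rw [ae_withDensity_iff (by fun_prop)]
    filter_upwards [ae_deltaSum_sum_eq_zero (s := s) n] with k hk h0
    exact spectralTuple_of_truncDensity hk fun h' => h0 (by rw [h', ENNReal.ofReal_zero])
  · rw [h, massShell_eq]
    refine Measure.ae_smul_measure ?_ _
    rw [ae_map_iff (measurable_shellPair m).aemeasurable measurableSet_spectralTuple]
    refine Filter.Eventually.of_forall fun p => spectralTuple_of_exists ?_ 1 ?_ ?_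
    · simp [shellPair]
    · intro l hl
      have : l = 0 := by omega
      subst this
      exact neg_negShell_mem m p
    · intro l hl
      omega

/-! ### Products over the blocks of a partition -/

/-- The increasing enumeration of a block. -/
def emb {n : ℕ} (B : Finset (Fin n)) : Fin B.card ↪o Fin n := B.orderEmbOfFin rfl

theorem map_emb {n : ℕ} (B : Finset (Fin n)) : Finset.univ.map (emb B).toEmbedding = B :=
  B.map_orderEmbOfFin_univ rfl

theorem emb_mem {n : ℕ} (B : Finset (Fin n)) (l : Fin B.card) : emb B l ∈ B :=
  B.orderEmbOfFin_mem rfl l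

/-- An operation over all labels, block by block. -/
@[to_additive]
theorem prod_eq_prod_parts {M : Type*} [CommMonoid M] {n : ℕ}
    (P : Finpartition (Finset.univ : Finset (Fin n))) (g : Fin n → M) :
    ∏ i, g i = ∏ B : P.parts, ∏ l, g (emb B.1 l) := by
  have h1 : ∀ B : Finset (Fin n), ∏ l, g (emb B l) = ∏ i ∈ B, g i := fun B => by
    conv_rhs => rw [← map_emb B, Finset.prod_map]
    rfl
  simp_rw [h1]
  rw [Finset.prod_coe_sort P.parts (fun B => ∏ i ∈ B, g i)]
  conv_lhs => rw [← P.biUnion_parts]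
  exact Finset.prod_biUnion P.disjoint

variable {s : ℕ}

theorem glue_emb {n : ℕ} (P : Finpartition (Finset.univ : Finset (Fin n)))
    (q : (B : P.parts) → Fin B.1.card → Spacetime s) (B : P.parts) (l : Fin B.1.card) :
    glue P q (emb B.1 l) = q B l := by
  obtain ⟨B, hB⟩ := B
  have hpart : P.part (emb B l) = B := P.part_eq_of_mem hB (emb_mem B l)
  have key : ∀ (C : Finset (Fin n)) (hC : C ∈ P.parts) (hl : emb B l ∈ C), C = B →
      q ⟨C, hC⟩ ((C.orderIsoOfFin rfl).symm ⟨emb B l, hl⟩) = q ⟨B, hB⟩ l := by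
    rintro C hC hl rfl
    congr 1
    rw [OrderIso.symm_apply_eq]
    rfl
  exact key _ _ _ hpart

theorem measurable_glue {n : ℕ} (P : Finpartition (Finset.univ : Finset (Fin n))) :
    Measurable (glue (s := s) P) := by
  unfold glue
  fun_prop

theorem prod_glue {n : ℕ} {M : Type*} [CommMonoid M]
    (P : Finpartition (Finset.univ : Finset (Fin n)))
    (q : (B : P.parts) → Fin B.1.card → Spacetime s) (g : Fin n → Spacetime s → M) :
    ∏ i, g i (glue P q i) = ∏ B : P.parts, ∏ l, g (emb B.1 l) (q B l) := by
  rw [prod_eq_prod_parts P]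
  simp_rw [glue_emb]

theorem integrable_invWt_partitionMeasure {m α : ℝ} (hm : 0 < m) (hα0 : 0 < α) (hα : α ≤ 1 / 2)
    {n : ℕ} (P : Finpartition (Finset.univ : Finset (Fin n))) :
    Integrable invWt (partitionMeasure s m α P) := by
  rw [partitionMeasure, integrable_map_measure measurable_invWt.aestronglyMeasurable
    (measurable_glue P).aemeasurable]
  have h : (invWt ∘ glue P : ((B : P.parts) → Fin B.1.card → Spacetime s) → ℝ) =
      fun q => ∏ B : P.parts, invWt (q B) := by
    funext q
    exact prod_glue P q fun _ k => (wt k)⁻¹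
  rw [h]
  exact Integrable.fintype_prod_dep fun B => integrable_invWt_truncMeasure hm hα0 hα _

theorem integral_prod_partitionMeasure (m α : ℝ) {n : ℕ}
    (P : Finpartition (Finset.univ : Finset (Fin n))) (F : Fin n → Spacetime s → ℂ)
    (hF : ∀ i, Measurable (F i)) :
    ∫ k, ∏ i, F i (k i) ∂partitionMeasure s m α P =
      ∏ B ∈ P.parts, ∫ k, ∏ l, F (emb B l) (k l) ∂truncMeasure s m α B.card := by
  have hmeas : Measurable fun k : Fin n → Spacetime s => ∏ i, F i (k i) :=
    Finset.measurable_prod _ fun i _ => (hF i).comp (measurable_pi_apply i)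
  rw [partitionMeasure, integral_map (measurable_glue P).aemeasurable hmeas.aestronglyMeasurable]
  simp_rw [prod_glue P _ F]
  rw [integral_fintype_prod_eq_prod (fun (B : P.parts) (k : Fin B.1.card → Spacetime s) =>
    ∏ l, F (emb B.1 l) (k l))]
  exact Finset.prod_coe_sort P.parts
    (fun B => ∫ k, ∏ l, F (emb B l) (k l) ∂truncMeasure s m α B.card)

theorem ae_spectralTuple_partitionMeasure (m α : ℝ) {n : ℕ}
    (P : Finpartition (Finset.univ : Finset (Fin n))) :
    ∀ᵐ k ∂partitionMeasure s m α P, SpectralTuple k := by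
  rw [partitionMeasure, ae_map_iff (measurable_glue P).aemeasurable measurableSet_spectralTuple]
  have h : ∀ᵐ q ∂Measure.pi fun B : P.parts => truncMeasure s m α B.1.card,
      ∀ B, SpectralTuple (q B) :=
    Filter.eventually_all.2 fun B => Measure.tendsto_eval_ae_ae.eventually (ae_spectralTuple m α _)
  filter_upwards [h] with q hq
  have hsum : ∀ U : Finset (Fin n), ∑ i ∈ U, glue P q i =
      ∑ B : P.parts, ∑ l ∈ Finset.univ.filter (fun l => emb B.1 l ∈ U), q B l := by
    intro U
    rw [← Finset.univ_inter U, ← Finset.sum_ite_mem, sum_eq_sum_parts P]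
    refine Finset.sum_congr rfl fun B _ => ?_
    rw [Finset.sum_filter]
    simp only [glue_emb]
    rw [Finset.univ_inter]
  refine ⟨?_, fun U hU => ?_⟩
  · rw [hsum]
    refine Finset.sum_eq_zero fun B _ => ?_
    simpa using (hq B).1
  · rw [hsum]
    refine sum_mem_forwardCone _ _ fun B _ => (hq B).2 _ ?_
    intro l l' hl h
    simp only [Finset.coe_filter, Finset.mem_univ, true_and, Set.mem_ofPred_eq] at h ⊢
    exact hU ((emb B.1).monotone hl) h

theorem wt_le_pow {n : ℕ} (k : Fin n → Spacetime s) (i : Fin n) :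
    wt (k i) ≤ (1 + ‖k‖) ^ (2 * (s + 2)) := by
  rw [wt, pow_mul]
  have : ‖k i‖ ≤ ‖k‖ := norm_le_pi_norm k i
  gcongr
  nlinarith [norm_nonneg (k i), norm_nonneg k]

theorem hasTemperateGrowth_of_invWt {n : ℕ} {μ : Measure (Fin n → Spacetime s)}
    (h : Integrable invWt μ) : μ.HasTemperateGrowth := by
  refine ⟨⟨2 * (s + 2) * n, h.mono' ?_ (Filter.Eventually.of_forall fun k => ?_)⟩⟩
  · exact (by fun_prop : Measurable fun k : Fin n → Spacetime s =>
      (1 + ‖k‖) ^ (-((2 * (s + 2) * n : ℕ) : ℝ))).aestronglyMeasurable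
  · have h0 : 0 ≤ 1 + ‖k‖ := by positivity
    rw [Real.norm_of_nonneg (Real.rpow_nonneg h0 _), Real.rpow_neg h0, Real.rpow_natCast, invWt,
      pow_mul, ← inv_pow]
    calc ((1 + ‖k‖) ^ (2 * (s + 2)))⁻¹ ^ n = ∏ _i : Fin n, ((1 + ‖k‖) ^ (2 * (s + 2)))⁻¹ := by simp
      _ ≤ _ := Finset.prod_le_prod (fun _ _ => by positivity) fun i _ =>
        inv_anti₀ (wt_pos _) (wt_le_pow k i)

theorem hasTemperateGrowth_partitionMeasure {m α : ℝ} (hm : 0 < m) (hα0 : 0 < α)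
    (hα : α ≤ 1 / 2) {n : ℕ} (P : Finpartition (Finset.univ : Finset (Fin n))) :
    (partitionMeasure s m α P).HasTemperateGrowth :=
  hasTemperateGrowth_of_invWt (integrable_invWt_partitionMeasure hm hα0 hα P)

/-! ### Relabelling partitions -/

/-- The action of a permutation on finite sets, as an order isomorphism. -/
def finsetIso {n : ℕ} (e : Equiv.Perm (Fin n)) : Finset (Fin n) ≃o Finset (Fin n) where
  toEquiv := e.finsetCongr
  map_rel_iff' := by
    intro A B
    exact Finset.map_subset_map

theorem sum_finpartition_perm {M : Type*} [CommSemiring M] {n : ℕ} (e : Equiv.Perm (Fin n))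
    (φ : Finset (Fin n) → M) :
    ∑ P : Finpartition (Finset.univ : Finset (Fin n)), ∏ B ∈ P.parts, φ (B.map e.toEmbedding) =
      ∑ P : Finpartition (Finset.univ : Finset (Fin n)), ∏ B ∈ P.parts, φ B := by
  have hu : ∀ e : Equiv.Perm (Fin n), finsetIso e Finset.univ = Finset.univ := fun e =>
    Finset.map_univ_equiv e
  let f : Equiv.Perm (Fin n) → Finpartition (Finset.univ : Finset (Fin n)) →
      Finpartition (Finset.univ : Finset (Fin n)) := fun e P => (P.map (finsetIso e)).copy (hu e)
  have hf : ∀ e P, (f e P).parts = P.parts.map (finsetIso e).toEquiv.toEmbedding := fun e P => rfl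
  have hinv : ∀ e P, f e.symm (f e P) = P := fun e P => by
    ext B
    rw [hf, hf]
    simp only [Finset.mem_map, exists_exists_and_eq_and]
    constructor
    · rintro ⟨C, hC, rfl⟩
      have : (finsetIso e.symm).toEquiv ((finsetIso e).toEquiv C) = C := by
        change (C.map e.toEmbedding).map e.symm.toEmbedding = C
        rw [Finset.map_map]
        simp
      rw [← this] at hC
      exact hC
    · intro hB
      refine ⟨B, hB, ?_⟩
      change (B.map e.toEmbedding).map e.symm.toEmbedding = B
      rw [Finset.map_map]
      simp
  refine Fintype.sum_equiv ⟨f e, f e.symm, hinv e, hinv e.symm⟩ _ _ fun P => ?_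
  change _ = ∏ B ∈ (f e P).parts, φ B
  rw [hf, Finset.prod_map]
  rfl

/-! ### The Fourier transform in the convention `∫ e^{ikx} f(x) dx` -/

section wave

variable {V : Type*} [NormedAddCommGroup V] [InnerProductSpace ℝ V]

/-- The plane wave `e^{i⟨k, x⟩}`. -/
def wave (k x : V) : ℂ := Complex.exp (Complex.I * ((⟪k, x⟫_ℝ : ℝ) : ℂ))

theorem norm_wave (k x : V) : ‖wave k x‖ = 1 := by
  rw [wave, mul_comm]; exact Complex.norm_exp_ofReal_mul_I _

theorem wave_comm (k x : V) : wave k x = wave x k := by simp only [wave, real_inner_comm]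

theorem wave_add_right (k x y : V) : wave k (x + y) = wave k x * wave k y := by
  simp only [wave, inner_add_right, ← Complex.exp_add]; push_cast; ring_nf

theorem wave_sum_left {ι : Type*} (S : Finset ι) (k : ι → V) (x : V) :
    wave (∑ l ∈ S, k l) x = ∏ l ∈ S, wave (k l) x := by
  simp only [wave, ← Complex.exp_sum, sum_inner]
  push_cast
  rw [Finset.mul_sum]

theorem wave_neg_left (k x : V) : wave (-k) x = conj (wave k x) := by
  simp [wave, ← Complex.exp_conj]

theorem wave_zero_left (x : V) : wave 0 x = 1 := by simp [wave]
theorem wave_zero_right (x : V) : wave x 0 = 1 := by simp [wave]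

@[fun_prop] theorem continuous_wave_right (k : V) : Continuous fun x => wave k x := by
  unfold wave; fun_prop

@[fun_prop] theorem continuous_wave_left (x : V) : Continuous fun k => wave k x := by
  unfold wave; fun_prop

theorem continuous_wave : Continuous fun p : V × V => wave p.1 p.2 := by
  unfold wave; fun_prop

end wave

section osc

variable {V : Type*} [NormedAddCommGroup V] [InnerProductSpace ℝ V] [FiniteDimensional ℝ V]
  [MeasurableSpace V] [BorelSpace V]

/-- Scaling by `-1 / (2π)`. -/
def oscScale : V ≃L[ℝ] V :=
  ContinuousLinearEquiv.smulLeft (Units.mk0 (-(2 * Real.pi)⁻¹) (by simp [Real.pi_ne_zero]))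

/-- The oscillatory integral `k ↦ ∫ e^{i⟨k, x⟩} f(x) dx` on Schwartz functions. -/
def osc : 𝓢(V, ℂ) →L[ℂ] 𝓢(V, ℂ) :=
  (SchwartzMap.compCLMOfContinuousLinearEquiv ℂ (oscScale (V := V))).comp
    (SchwartzMap.fourierTransformCLM ℂ)

theorem osc_apply (f : 𝓢(V, ℂ)) (k : V) : osc f k = ∫ x, wave k x * f x := by
  have h : osc f k = FourierTransform.fourier (f : V → ℂ) ((-(2 * Real.pi)⁻¹ : ℝ) • k) := rfl
  rw [h, Real.fourier_eq']
  refine integral_congr_ae (Filter.Eventually.of_forall fun x => ?_)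
  simp only [smul_eq_mul, wave, inner_smul_right]
  congr 2
  rw [real_inner_comm]
  push_cast
  have : (Real.pi : ℂ) ≠ 0 := by exact_mod_cast Real.pi_ne_zero
  field_simp

theorem osc_surjective : Function.Surjective (osc (V := V)) := by
  intro h
  refine ⟨FourierTransformInv.fourierInv
    (SchwartzMap.compCLMOfContinuousLinearEquiv ℂ (oscScale (V := V)).symm h), ?_⟩
  have h1 : ∀ g : 𝓢(V, ℂ), osc g =
    SchwartzMap.compCLMOfContinuousLinearEquiv ℂ (oscScale (V := V))
      (FourierTransform.fourier g) := fun g => rfl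
  rw [h1, FourierTransform.fourier_fourierInv_eq]
  ext x
  simp

theorem integrable_wave_mul {f : V → ℂ} (hf : Integrable f) (k : V) :
    Integrable fun x => wave k x * f x :=
  hf.bdd_mul (c := 1) (continuous_wave_right k).aestronglyMeasurable
    (Filter.Eventually.of_forall fun x => (norm_wave k x).le)

/-- Fubini's theorem for the Fourier transform. -/
theorem integral_integral_wave {g h : V → ℂ} (hg : Integrable g) (hh : Integrable h) :
    ∫ k, g k * ∫ x, wave k x * h x = ∫ x, h x * ∫ k, wave x k * g k := by
  simp_rw [← integral_const_mul]
  rw [integral_integral_swap]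
  · refine integral_congr_ae (Filter.Eventually.of_forall fun x => integral_congr_ae
      (Filter.Eventually.of_forall fun k => ?_))
    simp only [wave_comm k x]; ring
  · have h1 := (hg.mul_prod hh).bdd_mul (c := 1) (f := fun p : V × V => wave p.1 p.2)
      continuous_wave.aestronglyMeasurable
      (Filter.Eventually.of_forall fun x => (norm_wave _ _).le)
    refine h1.congr (Filter.Eventually.of_forall fun p => ?_)
    simp only [Function.uncurry]; ring

/-- The Fourier transform is injective on integrable functions. -/
theorem ae_eq_zero_of_integral_wave {g : V → ℂ} (hg : Integrable g)
    (h : ∀ x, ∫ k, wave x k * g k = 0) : g =ᵐ[volume] 0 := by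
  have key : ∀ f : 𝓢(V, ℂ), ∫ k, g k * f k = 0 := by
    intro f
    obtain ⟨f, rfl⟩ := osc_surjective f
    simp_rw [osc_apply]
    rw [integral_integral_wave hg f.integrable]
    simp [h]
  refine ae_eq_zero_of_integral_contDiff_smul_eq_zero hg.locallyIntegrable fun φ hφ hc => ?_
  have hs : HasCompactSupport fun x => (φ x : ℂ) := hc.comp_left (g := fun r : ℝ => (r : ℂ)) (by simp)
  have hd : ContDiff ℝ ((⊤ : ℕ∞) : WithTop ℕ∞) fun x => (φ x : ℂ) := Complex.ofRealCLM.contDiff.comp hφ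
  have := key (hs.toSchwartzMap hd)
  rw [← this]
  refine integral_congr_ae (Filter.Eventually.of_forall fun x => ?_)
  simp [mul_comm]

/-- Fourier inversion. -/
theorem integral_wave_mul_osc (h : 𝓢(V, ℂ)) (k : V) :
    ∫ x, wave k x * osc h x = ((2 * Real.pi) ^ Module.finrank ℝ V : ℝ) * h (-k) := by
  have h1 : FourierTransformInv.fourierInv (FourierTransform.fourier (h : V → ℂ)) (-k) = h (-k) :=
    congrFun (h.continuous.fourierInv_fourier_eq h.integrable
      (FourierTransform.fourier h : 𝓢(V, ℂ)).integrable) (-k)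
  rw [← h1, Real.fourierInv_eq']
  have h2 := Measure.integral_comp_smul (volume : Measure V) (fun x => Complex.exp
    (↑(2 * Real.pi * ⟪x, -k⟫_ℝ) * Complex.I) • FourierTransform.fourier (h : V → ℂ) x)
      (-(2 * Real.pi)⁻¹)
  have h3 : |((-(2 * Real.pi)⁻¹) ^ Module.finrank ℝ V)⁻¹| = (2 * Real.pi) ^ Module.finrank ℝ V := by
    rw [abs_inv, abs_pow, abs_neg, abs_inv, abs_of_pos (by positivity : 0 < 2 * Real.pi), inv_pow,
      inv_inv]
  rw [h3] at h2
  rw [← Complex.real_smul, ← h2]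
  refine integral_congr_ae (Filter.Eventually.of_forall fun x => ?_)
  have h4 : osc h x = FourierTransform.fourier (h : V → ℂ) ((-(2 * Real.pi)⁻¹ : ℝ) • x) := rfl
  simp only [h4, smul_eq_mul, wave, inner_smul_left, inner_neg_right]
  congr 2
  rw [real_inner_comm]
  have : (Real.pi : ℂ) ≠ 0 := by exact_mod_cast Real.pi_ne_zero
  simp
  field_simp

end osc

variable {s : ℕ}

/-! ### Transforms of test functions -/

/-- The transform of a test function of one variable. -/
def pw (f : 𝓢(Spacetime s, ℂ)) : 𝓢(Spacetime s, ℂ) := (muConst s : ℂ) • osc f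

theorem pw_apply (f : 𝓢(Spacetime s, ℂ)) (k : Spacetime s) :
    pw f k = muConst s * ∫ x, wave k x * f x := by
  rw [pw, smul_apply, osc_apply, smul_eq_mul]

theorem pw_add (f g : 𝓢(Spacetime s, ℂ)) : pw (f + g) = pw f + pw g := by simp [pw]
theorem pw_smul (c : ℂ) (f : 𝓢(Spacetime s, ℂ)) : pw (c • f) = c • pw f := by
  simp only [pw, map_smul, smul_comm c]

theorem muConst_ne_zero : (muConst s : ℂ) ≠ 0 := by exact_mod_cast (muConst_pos s).ne'

theorem pw_surjective : Function.Surjective (pw (s := s)) := fun h => by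
  obtain ⟨f, rfl⟩ := osc_surjective h
  exact ⟨(muConst s : ℂ)⁻¹ • f, by
    rw [pw, map_smul, smul_smul, mul_inv_cancel₀ muConst_ne_zero, one_smul]⟩

theorem planeWaveTransform_eq {n : ℕ} (f : (Fin n → Spacetime s) → ℂ) (k : Fin n → Spacetime s) :
    planeWaveTransform f k = (muConst s : ℂ) ^ n * ∫ x, (∏ l, wave (k l) (x l)) * f x := by
  have h1 : (((2 * Real.pi) ^ (-((s + 1 : ℝ) * n / 2)) : ℝ) : ℂ) = (muConst s : ℂ) ^ n := by
    rw [muConst, ← Complex.ofReal_pow, ← Real.rpow_natCast, ← Real.rpow_mul (by positivity)]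
    ring_nf
  rw [planeWaveTransform, h1]
  congr 1
  refine integral_congr_ae (Filter.Eventually.of_forall fun x => ?_)
  simp only [wave, ← Complex.exp_sum]
  push_cast
  rw [Finset.mul_sum]

theorem planeWaveTransform_prod {n : ℕ} (f : Fin n → 𝓢(Spacetime s, ℂ)) (k : Fin n → Spacetime s) :
    planeWaveTransform (fun x => ∏ i, f i (x i)) k = ∏ i, pw (f i) (k i) := by
  rw [planeWaveTransform_eq]
  simp_rw [← Finset.prod_mul_distrib]
  rw [integral_fintype_prod_volume_eq_prod (fun i x => wave (k i) x * f i x)]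
  simp [pw_apply, Finset.prod_mul_distrib]

theorem planeWaveTransform_tensor {j l : ℕ} (f : TestFn s j) (g : TestFn s l)
    (k : Fin (j + l) → Spacetime s) :
    planeWaveTransform (tensor f g) k = planeWaveTransform f (fun i => k (Fin.castAdd l i)) *
      planeWaveTransform g (fun i => k (Fin.natAdd j i)) := by
  simp only [planeWaveTransform_eq]
  have e1 := (volume_measurePreserving_piCongrLeft (fun _ : Fin (j + l) => Spacetime s)
    (finSumFinEquiv (m := j) (n := l)))
  have e2 := (volume_measurePreserving_sumPiEquivProdPi_symm
    (fun _ : Fin j ⊕ Fin l => Spacetime s))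
  have h := (e1.comp e2).integral_comp ((MeasurableEquiv.measurableEmbedding _).comp
    (MeasurableEquiv.measurableEmbedding _))
    (fun x : Fin (j + l) → Spacetime s => (∏ l, wave (k l) (x l)) * tensor f g x)
  rw [← h, mul_mul_mul_comm, ← pow_add, ← integral_prod_mul, ← Measure.volume_eq_prod]
  congr 1
  refine integral_congr_ae (Filter.Eventually.of_forall fun x => ?_)
  have hx1 : ∀ i, MeasurableEquiv.piCongrLeft (fun _ : Fin (j + l) => Spacetime s)
      finSumFinEquiv ((MeasurableEquiv.sumPiEquivProdPi fun _ => Spacetime s).symm x)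
        (Fin.castAdd l i) = x.1 i := fun i => by
    have := Equiv.piCongrLeft_apply_apply (fun _ : Fin (j + l) => Spacetime s) finSumFinEquiv
      ((MeasurableEquiv.sumPiEquivProdPi fun _ => Spacetime s).symm x) (Sum.inl i)
    exact this
  have hx2 : ∀ i, MeasurableEquiv.piCongrLeft (fun _ : Fin (j + l) => Spacetime s)
      finSumFinEquiv ((MeasurableEquiv.sumPiEquivProdPi fun _ => Spacetime s).symm x)
        (Fin.natAdd j i) = x.2 i := fun i => by
    have := Equiv.piCongrLeft_apply_apply (fun _ : Fin (j + l) => Spacetime s) finSumFinEquiv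
      ((MeasurableEquiv.sumPiEquivProdPi fun _ => Spacetime s).symm x) (Sum.inr i)
    exact this
  simp only [Function.comp_apply, tensor, Fin.prod_univ_add, hx1, hx2]
  ring

theorem planeWaveTransform_translate {n : ℕ} (a : Spacetime s) (f : TestFn s n)
    (k : Fin n → Spacetime s) :
    planeWaveTransform (translate a f) k = wave (∑ l, k l) a * planeWaveTransform f k := by
  simp only [planeWaveTransform_eq]
  have h1 := integral_add_right_eq_self (μ := (volume : Measure (Fin n → Spacetime s)))
    (fun x => (∏ l, wave (k l) (x l)) * translate a f x) (fun _ => a)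
  rw [← h1, mul_left_comm]
  congr 1
  rw [← integral_const_mul]
  refine integral_congr_ae (Filter.Eventually.of_forall fun x => ?_)
  simp only [translate, SchwartzMap.compSubConstCLM_apply, Pi.add_apply, wave_add_right,
    Finset.prod_mul_distrib, wave_sum_left, add_sub_cancel_right]
  ring

theorem pw_conjFn (f : 𝓢(Spacetime s, ℂ)) (k : Spacetime s) :
    pw (conjFn f) k = conj (pw f (-k)) := by
  rw [pw_apply, pw_apply, map_mul, Complex.conj_ofReal, ← integral_conj]
  congr 1
  refine integral_congr_ae (Filter.Eventually.of_forall fun x => ?_)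
  simp [wave_neg_left, conjFn]

/-- The transform on the euclidean space of `n` variables. -/
def piEquiv (s n : ℕ) : (PiLp 2 fun _ : Fin n => Spacetime s) ≃L[ℝ] (Fin n → Spacetime s) :=
  PiLp.continuousLinearEquiv 2 ℝ _

theorem exists_planeWaveTransform_clm (n : ℕ) :
    ∃ L : TestFn s n →L[ℂ] TestFn s n, ∀ f, (L f : (Fin n → Spacetime s) → ℂ) =
      planeWaveTransform f := by
  let V := PiLp 2 fun _ : Fin n => Spacetime s
  let _ : MeasurableSpace V := borel V
  have : BorelSpace V := ⟨rfl⟩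
  let e := piEquiv s n
  let μ : Measure (Fin n → Spacetime s) := Measure.map e (volume : Measure V)
  have : μ.IsAddHaarMeasure :=
    e.toAddEquiv.isAddHaarMeasure_map (volume : Measure V) e.continuous e.symm.continuous
  obtain ⟨c, hc⟩ : ∃ c : NNReal, (volume : Measure (Fin n → Spacetime s)) = c • μ :=
    ⟨_, Measure.isAddLeftInvariant_eq_smul _ _⟩
  refine ⟨((muConst s : ℂ) ^ n * (c : ℝ)) • (SchwartzMap.compCLMOfContinuousLinearEquiv ℂ e.symm).comp
    (osc.comp (SchwartzMap.compCLMOfContinuousLinearEquiv ℂ e)), fun f => ?_⟩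
  funext k
  have h1 : ((((muConst s : ℂ) ^ n * (c : ℝ)) •
      (SchwartzMap.compCLMOfContinuousLinearEquiv ℂ e.symm).comp
      (osc.comp (SchwartzMap.compCLMOfContinuousLinearEquiv ℂ e))) f) k =
      ((muConst s : ℂ) ^ n * (c : ℝ)) *
        osc (SchwartzMap.compCLMOfContinuousLinearEquiv ℂ e f) (e.symm k) := rfl
  rw [h1, osc_apply, planeWaveTransform_eq, mul_assoc, hc, integral_smul_nnreal_measure]
  congr 1
  have hmap : ∫ x, (∏ l, wave (k l) (x l)) * f x ∂μ =
      ∫ x : V, (∏ l, wave (k l) (e x l)) * f (e x) :=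
    e.toHomeomorph.measurableEmbedding.integral_map _
  rw [hmap, NNReal.smul_def, Complex.real_smul]
  congr 1
  refine integral_congr_ae (Filter.Eventually.of_forall fun x => ?_)
  have h2 : wave (e.symm k) x = ∏ l, wave (k l) (e x l) := by
    simp only [wave, ← Complex.exp_sum, PiLp.inner_apply]
    push_cast
    rw [Finset.mul_sum]
    rfl
  simp only [h2]
  rfl

/-- The transform of a test function of `n` variables. -/
def pwn (n : ℕ) : TestFn s n →L[ℂ] TestFn s n := (exists_planeWaveTransform_clm n).choose

theorem pwn_coe {n : ℕ} (f : TestFn s n) :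
    (pwn n f : (Fin n → Spacetime s) → ℂ) = planeWaveTransform f :=
  (exists_planeWaveTransform_clm n).choose_spec f

/-! ### Laplace transforms and supports in a half space -/

open ProbabilityTheory in
theorem integral_cpow_mul_exp_neg_mul_of_re_pos {β : ℝ} (hβ : 0 < β) {r : ℂ} (hr : 0 < r.re) :
    ∫ t in Set.Ioi (0 : ℝ), ((t ^ (β - 1) : ℝ) : ℂ) * Complex.exp (-(r * t)) =
      (1 / r) ^ (β : ℂ) * Complex.Gamma β := by
  set μ : Measure ℝ := (volume.restrict (Set.Ioi 0)).withDensity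
    fun t => ENNReal.ofReal (t ^ (β - 1)) with hμ
  have hpos : ∀ᵐ t ∂(volume.restrict (Set.Ioi (0 : ℝ))), 0 ≤ t ^ (β - 1) := by
    filter_upwards [ae_restrict_mem measurableSet_Ioi] with t ht
    exact Real.rpow_nonneg (le_of_lt ht) _
  have hint : ∀ u < 0, Integrable (fun t => Real.exp (u * id t)) μ := by
    intro u hu
    rw [hμ, integrable_withDensity_iff_integrable_smul₀' (by fun_prop) (by simp)]
    have h1 := integrableOn_rpow_mul_exp_neg_mul_rpow (s := β - 1) (p := 1) (b := -u)
      (by linarith) one_pos (by linarith)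
    refine h1.congr ?_
    filter_upwards [hpos] with t ht
    simp [ENNReal.toReal_ofReal ht]
  have hset : Set.Iio 0 ⊆ integrableExpSet id μ := fun u hu => hint u hu
  have hmem : ∀ z : ℂ, z.re < 0 → z.re ∈ interior (integrableExpSet id μ) := fun z hz =>
    interior_maximal hset isOpen_Iio hz
  have hval : ∀ z : ℂ, complexMGF id μ z =
      ∫ t in Set.Ioi (0 : ℝ), ((t ^ (β - 1) : ℝ) : ℂ) * Complex.exp (z * t) := by
    intro z
    rw [complexMGF, hμ, integral_withDensity_eq_integral_toReal_smul₀ (by fun_prop) (by simp)]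
    refine integral_congr_ae ?_
    filter_upwards [hpos] with t ht
    simp [ENNReal.toReal_ofReal ht]
  have hopen : IsPreconnected {z : ℂ | z.re < 0} :=
    (convex_halfSpace_re_lt 0).isPreconnected
  have hf : AnalyticOnNhd ℂ (complexMGF id μ) {z : ℂ | z.re < 0} := fun z hz =>
    analyticAt_complexMGF (hmem z hz)
  have hslit : ∀ z : ℂ, z.re < 0 → 1 / (-z) ∈ Complex.slitPlane := by
    intro z hz
    left
    have h0 : z ≠ 0 := by rintro rfl; simp at hz
    rw [one_div, Complex.inv_re]
    exact div_pos (by simpa using hz) (Complex.normSq_pos.2 (neg_ne_zero.2 h0))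
  have hg : AnalyticOnNhd ℂ (fun z : ℂ => (1 / (-z)) ^ (β : ℂ) * Complex.Gamma β)
      {z : ℂ | z.re < 0} := by
    intro z hz
    have h0 : z ≠ 0 := by rintro rfl; simp at hz
    exact ((analyticAt_const.div analyticAt_id.neg (neg_ne_zero.2 h0)).cpow analyticAt_const
      (hslit z hz)).mul analyticAt_const
  have hreal : ∀ u : ℝ, 0 < u → complexMGF id μ ((-u : ℝ) : ℂ) =
      (1 / (-((-u : ℝ) : ℂ))) ^ (β : ℂ) * Complex.Gamma β := by
    intro u hu
    have h1 := Complex.integral_cpow_mul_exp_neg_mul_Ioi (a := (β : ℂ)) (by simpa using hβ) hu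
    rw [hval]
    push_cast
    rw [neg_neg, ← h1]
    refine setIntegral_congr_fun measurableSet_Ioi fun t ht => ?_
    have ht0 : (0 : ℝ) ≤ t := le_of_lt ht
    rw [Complex.ofReal_cpow ht0]
    push_cast
    ring_nf
  have hfreq : ∃ᶠ z in 𝓝[≠] (-1 : ℂ), complexMGF id μ z =
      (1 / (-z)) ^ (β : ℂ) * Complex.Gamma β := by
    have ht : Filter.Tendsto (fun u : ℝ => ((-u : ℝ) : ℂ)) (𝓝[≠] 1) (𝓝[≠] (-1)) := by
      refine tendsto_nhdsWithin_iff.2 ⟨?_, ?_⟩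
      · have : Continuous fun u : ℝ => ((-u : ℝ) : ℂ) := by fun_prop
        simpa using (this.tendsto 1).mono_left nhdsWithin_le_nhds
      · filter_upwards [self_mem_nhdsWithin] with u hu h
        apply hu
        simp only [Set.mem_singleton_iff] at h ⊢
        push_cast at h
        exact_mod_cast neg_injective h
    refine ht.frequently (Filter.Eventually.frequently ?_)
    filter_upwards [mem_nhdsWithin_of_mem_nhds (lt_mem_nhds (zero_lt_one' ℝ))] with u hu
    exact hreal u hu
  have := hf.eqOn_of_preconnected_of_frequently_eq hg hopen (z₀ := -1) (by simp) hfreq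
    (show (-r).re < 0 by simpa using hr)
  rw [hval] at this
  simpa using this

/-- If the oscillatory integrals of `G` vanish at all positive times, so do the integrals
against complex powers, which are superpositions of these. -/
theorem integral_mul_cpow_eq_zero {X : Type*} [MeasurableSpace X] {μ : Measure X} [SFinite μ]
    {G : X → ℂ} (hG : Integrable G μ) {a : X → ℝ} (ha : Measurable a)
    (h : ∀ t : ℝ, 0 < t → ∫ x, G x * Complex.exp (Complex.I * ((t * a x : ℝ) : ℂ)) ∂μ = 0)
    {ε β : ℝ} (hε : 0 < ε) (hβ : 0 < β) :
    ∫ x, G x * (1 / ((ε : ℂ) - Complex.I * a x)) ^ (β : ℂ) ∂μ = 0 := by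
  have hΓ : Complex.Gamma β ≠ 0 := Complex.Gamma_ne_zero_of_re_pos (by simpa using hβ)
  have key : ∀ x, (1 / ((ε : ℂ) - Complex.I * a x)) ^ (β : ℂ) * Complex.Gamma β =
      ∫ t in Set.Ioi (0 : ℝ), (((t ^ (β - 1) : ℝ) : ℂ) * Complex.exp (-(ε * t : ℝ))) *
        Complex.exp (Complex.I * ((t * a x : ℝ) : ℂ)) := by
    intro x
    rw [← integral_cpow_mul_exp_neg_mul_of_re_pos hβ
      (by simpa using hε : 0 < ((ε : ℂ) - Complex.I * a x).re)]
    refine integral_congr_ae (Filter.Eventually.of_forall fun t => ?_)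
    simp only [mul_assoc, ← Complex.exp_add]
    congr 2
    push_cast
    ring
  have hE : IntegrableOn (fun t : ℝ => ((t ^ (β - 1) : ℝ) : ℂ) * Complex.exp (-(ε * t : ℝ)))
      (Set.Ioi 0) := by
    have h1 := integrableOn_rpow_mul_exp_neg_mul_rpow (s := β - 1) (p := 1) (b := ε)
      (by linarith) one_pos hε
    refine (Integrable.ofReal (𝕜 := ℂ) h1).congr (Filter.Eventually.of_forall fun t => ?_)
    simp
  rw [← mul_eq_zero_iff_right hΓ, ← integral_mul_const]
  simp_rw [mul_assoc, key, ← integral_const_mul]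
  rw [integral_integral_swap]
  · rw [← integral_zero (α := ℝ) (G := ℂ) (μ := volume.restrict (Set.Ioi 0))]
    refine setIntegral_congr_fun measurableSet_Ioi fun t ht => ?_
    have := h t ht
    calc ∫ x, G x * (((t ^ (β - 1) : ℝ) : ℂ) * Complex.exp (-(ε * t : ℝ)) *
          Complex.exp (Complex.I * ((t * a x : ℝ) : ℂ))) ∂μ
        = ∫ x, (((t ^ (β - 1) : ℝ) : ℂ) * Complex.exp (-(ε * t : ℝ))) *
          (G x * Complex.exp (Complex.I * ((t * a x : ℝ) : ℂ))) ∂μ := by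
          refine integral_congr_ae (Filter.Eventually.of_forall fun x => ?_)
          simp only; ring
      _ = 0 := by rw [integral_const_mul, this, mul_zero]
  · have h1 := (hG.mul_prod hE).bdd_mul (c := 1)
      (f := fun p : X × ℝ => Complex.exp (Complex.I * ((p.2 * a p.1 : ℝ) : ℂ)))
      (by fun_prop) (Filter.Eventually.of_forall fun p => by
        rw [mul_comm]; exact (Complex.norm_exp_ofReal_mul_I _).le)
    refine h1.congr (Filter.Eventually.of_forall fun p => ?_)
    simp only [Function.uncurry]
    ring

variable {s : ℕ}

/-- Slices of a function at negative times vanish if the function does. -/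
theorem integral_slice_eq_zero {g : 𝓢(Spacetime s, ℂ)} (hg : ∀ x, x 0 < 0 → g x = 0) {τ : ℝ}
    (hτ : 0 < τ) {ψ : EuclideanSpace ℝ (Fin s) → ℂ} (hψ : Measurable ψ) {C : ℝ}
    (hψC : ∀ p, ‖ψ p‖ ≤ C) :
    ∫ k, osc g k * (Complex.exp (Complex.I * ((τ * k 0 : ℝ) : ℂ)) * ψ (space k)) = 0 := by
  set F : ℝ × EuclideanSpace ℝ (Fin s) → ℂ := fun q =>
    osc g (join q.1 q.2) * Complex.exp (Complex.I * ((τ * q.1 : ℝ) : ℂ)) with hF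
  have hFi : Integrable F := by
    have h1 := ((integrable_split _).1 (osc g).integrable).bdd_mul (c := 1)
      (f := fun q : ℝ × EuclideanSpace ℝ (Fin s) => Complex.exp (Complex.I * ((τ * q.1 : ℝ) : ℂ)))
      (by fun_prop) (Filter.Eventually.of_forall fun p => by
        rw [mul_comm]; exact (Complex.norm_exp_ofReal_mul_I _).le)
    exact h1.congr (Filter.Eventually.of_forall fun p => mul_comm _ _)
  set G : EuclideanSpace ℝ (Fin s) → ℂ := fun p => ∫ t, F (t, p) with hGdef
  have hGi : Integrable G := hFi.integral_prod_right
  have hG0 : G =ᵐ[volume] 0 := by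
    refine ae_eq_zero_of_integral_wave hGi fun y => ?_
    simp_rw [hGdef, ← integral_const_mul]
    have h2 : Integrable fun q : ℝ × EuclideanSpace ℝ (Fin s) => wave y q.2 * F q :=
      hFi.bdd_mul (c := 1) ((continuous_wave_right y).comp continuous_snd).aestronglyMeasurable
        (Filter.Eventually.of_forall fun _ => (norm_wave _ _).le)
    rw [← integral_prod_symm _ h2, ← Measure.volume_eq_prod]
    have h3 := integral_wave_mul_osc g (join τ y)
    rw [hg (-join τ y) (by simpa using hτ), mul_zero, integral_split] at h3
    rw [← h3]
    refine integral_congr_ae (Filter.Eventually.of_forall fun q => ?_)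
    have h4 : wave (join τ y) (join q.1 q.2) =
        Complex.exp (Complex.I * ((τ * q.1 : ℝ) : ℂ)) * wave y q.2 := by
      simp only [wave, inner_eq, join_zero, space_join, ← Complex.exp_add]
      push_cast
      ring_nf
    simp only [hF, h4]
    ring
  rw [integral_split]
  have h5 : Integrable fun q : ℝ × EuclideanSpace ℝ (Fin s) => F q * ψ q.2 :=
    hFi.mul_bdd (c := C) (hψ.comp measurable_snd).aestronglyMeasurable
      (Filter.Eventually.of_forall fun _ => hψC _)
  calc ∫ q : ℝ × EuclideanSpace ℝ (Fin s), osc g (join q.1 q.2) *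
        (Complex.exp (Complex.I * ((τ * join q.1 q.2 0 : ℝ) : ℂ)) * ψ (space (join q.1 q.2)))
      = ∫ q : ℝ × EuclideanSpace ℝ (Fin s), F q * ψ q.2 := by
        refine integral_congr_ae (Filter.Eventually.of_forall fun q => ?_)
        simp only [hF, join_zero, space_join]
        ring
    _ = ∫ p, G p * ψ p := by
        rw [Measure.volume_eq_prod, integral_prod_symm _ h5]
        simp_rw [integral_mul_const, hGdef]
    _ = 0 := by
        rw [integral_congr_ae (g := fun _ => (0 : ℂ)), integral_zero]
        filter_upwards [hG0] with p hp
        rw [hp, Pi.zero_apply, zero_mul]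

/-- The two factors of the regularized retarded propagator. -/
def factor (ε β x : ℝ) : ℂ := (1 / ((ε : ℂ) - Complex.I * x)) ^ (β : ℂ)

theorem norm_factor_le {ε β x : ℝ} (hβ : 0 < β) (hx : x ≠ 0) :
    ‖factor ε β x‖ ≤ (|x| ^ β)⁻¹ := by
  have h1 : |x| ≤ ‖(ε : ℂ) - Complex.I * x‖ := by
    simpa using Complex.abs_im_le_norm ((ε : ℂ) - Complex.I * x)
  have h0 : 0 < |x| := abs_pos.2 hx
  rw [factor, Complex.norm_cpow_real, norm_div, norm_one, one_div,
    Real.inv_rpow (norm_nonneg _)]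
  exact inv_anti₀ (Real.rpow_pos_of_pos h0 _) (Real.rpow_le_rpow h0.le h1 hβ.le)

theorem measurable_factor (ε β : ℝ) : Measurable (factor ε β) := by
  unfold factor; fun_prop

theorem tendsto_factor {β x : ℝ} (hx : x ≠ 0) :
    Filter.Tendsto (fun ε => factor ε β x) (𝓝 0) (𝓝 (factor 0 β x)) := by
  have h0 : ((0 : ℝ) : ℂ) - Complex.I * x ≠ 0 := by
    simpa using hx
  have h1 : 1 / (((0 : ℝ) : ℂ) - Complex.I * x) ∈ Complex.slitPlane := by
    refine Or.inr ?_
    have : 1 / (((0 : ℝ) : ℂ) - Complex.I * x) = Complex.I * ((x⁻¹ : ℝ) : ℂ) := by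
      have hx' : (x : ℂ) ≠ 0 := by exact_mod_cast hx
      push_cast
      rw [zero_sub, one_div, ← neg_mul, mul_inv, ← Complex.inv_I, inv_inv]
    rw [this]
    simpa using hx
  have h2 : ContinuousAt (fun ε : ℝ => factor ε β x) 0 := by
    unfold factor
    refine ContinuousAt.cpow ?_ continuousAt_const h1
    exact continuousAt_const.div (by fun_prop) h0
  exact h2

theorem factor_zero_eq {β x : ℝ} (hx : x ≠ 0) :
    factor 0 β x = ((|x| ^ β)⁻¹ : ℝ) *
      Complex.exp ((if 0 < x then 1 else -1) * (Complex.I * (Real.pi * β / 2 : ℝ))) := by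
  have h0 : 0 < |x| := abs_pos.2 hx
  have hx' : (x : ℂ) ≠ 0 := by exact_mod_cast hx
  have h1 : 1 / (((0 : ℝ) : ℂ) - Complex.I * x) =
      ((|x|⁻¹ : ℝ) : ℂ) * Complex.exp ((if 0 < x then 1 else -1) * (Real.pi / 2 * Complex.I)) := by
    rw [div_eq_iff (by simpa using hx)]
    split_ifs with h
    · rw [one_mul, Complex.exp_pi_div_two_mul_I, abs_of_pos h]
      push_cast
      field_simp
      linear_combination (x : ℂ) * Complex.I_mul_I
    · rw [neg_one_mul, Complex.exp_neg, Complex.exp_pi_div_two_mul_I, Complex.inv_I,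
        abs_of_neg (lt_of_le_of_ne (not_lt.1 h) hx)]
      push_cast
      field_simp
      linear_combination (x : ℂ) * Complex.I_mul_I
  have h2 : (Real.log |x|⁻¹ : ℂ) + (if 0 < x then 1 else -1) * (Real.pi / 2 * Complex.I) =
      ((Real.log |x|⁻¹ : ℝ) : ℂ) +
        (((if 0 < x then 1 else -1) * (Real.pi / 2) : ℝ) : ℂ) * Complex.I := by
    split_ifs <;> push_cast <;> ring
  have h3 : Complex.log (1 / (((0 : ℝ) : ℂ) - Complex.I * x)) =
      (Real.log |x|⁻¹ : ℂ) + (if 0 < x then 1 else -1) * (Real.pi / 2 * Complex.I) := by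
    rw [h1, ← Real.exp_log (inv_pos.2 h0), Complex.ofReal_exp, ← Complex.exp_add,
      Real.log_exp, Complex.log_exp]
    all_goals rw [h2]; simp only [Complex.add_im, Complex.ofReal_im, Complex.mul_I_im,
      Complex.ofReal_re, zero_add]; split_ifs <;> linarith [Real.pi_pos]
  have hne : 1 / (((0 : ℝ) : ℂ) - Complex.I * x) ≠ 0 := by
    rw [h1]
    exact mul_ne_zero (by exact_mod_cast (inv_pos.2 h0).ne') (Complex.exp_ne_zero _)
  rw [factor, Complex.cpow_def_of_ne_zero hne, h3, add_mul, Complex.exp_add]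
  congr 1
  · rw [← Real.inv_rpow h0.le, Real.rpow_def_of_pos (inv_pos.2 h0)]
    push_cast
    rfl
  · congr 1
    push_cast
    ring

/-! ### Retarded propagators -/

section

variable {s : ℕ}

/-- The boundary value of `(m² - k²)^{-β}` from the forward tube, up to a constant phase. -/
def retard (m β : ℝ) (k : Spacetime s) : ℂ :=
  open Classical in
  ((|minkSq k - m ^ 2| ^ β)⁻¹ : ℝ) * (if m ^ 2 < minkSq k then
    Complex.exp ((if 0 < k 0 then 1 else -1) * (Complex.I * (Real.pi * β : ℝ))) else 1)

theorem norm_retard (m β : ℝ) (k : Spacetime s) :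
    ‖retard m β k‖ = (|minkSq k - m ^ 2| ^ β)⁻¹ := by
  have h1 : ‖((|minkSq k - m ^ 2| ^ β)⁻¹ : ℝ)‖ = (|minkSq k - m ^ 2| ^ β)⁻¹ :=
    Real.norm_of_nonneg (by positivity)
  rw [retard, norm_mul, Complex.norm_real, h1]
  have : ∀ x : ℝ, ‖Complex.exp (Complex.I * x)‖ = 1 := fun x => by
    rw [mul_comm]; exact Complex.norm_exp_ofReal_mul_I x
  split_ifs with h h'
  · rw [one_mul, this, mul_one]
  · rw [neg_one_mul, Complex.exp_neg, norm_inv, this, inv_one, mul_one]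
  · rw [norm_one, mul_one]

@[fun_prop]
theorem measurable_retard (m β : ℝ) : Measurable (retard m β : Spacetime s → ℂ) := by
  unfold retard
  refine Measurable.mul (by fun_prop) (Measurable.ite ?_ (Measurable.cexp (Measurable.mul_const
    (Measurable.ite ?_ measurable_const measurable_const) _)) measurable_const)
  · exact measurableSet_lt measurable_const (by fun_prop)
  · exact measurableSet_lt measurable_const (by fun_prop)

theorem retard_eq_factor (m : ℝ) {β : ℝ} (hβ : 0 < β) (k : Spacetime s) :
    retard m β k = factor 0 β (k 0 - energy m (space k)) * factor 0 β (k 0 + energy m (space k)) := by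
  set ω := energy m (space k) with hω
  have h1 : minkSq k - m ^ 2 = (k 0 - ω) * (k 0 + ω) := by
    have := energy_sq m (space k)
    rw [minkSq_eq]
    nlinarith
  have hω0 : 0 ≤ ω := Real.sqrt_nonneg _
  have h2 : factor 0 β 0 = 0 := by
    simp [factor, Complex.zero_cpow (show (β : ℂ) ≠ 0 by exact_mod_cast hβ.ne')]
  rw [retard, h1, abs_mul, Real.mul_rpow (abs_nonneg _) (abs_nonneg _)]
  by_cases ha : k 0 - ω = 0
  · rw [ha, h2]; simp [Real.zero_rpow hβ.ne']
  by_cases hb : k 0 + ω = 0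
  · rw [hb, h2]; simp [Real.zero_rpow hβ.ne']
  rw [factor_zero_eq ha, factor_zero_eq hb]
  have h3 : m ^ 2 < minkSq k ↔ 0 < (k 0 - ω) * (k 0 + ω) := by rw [← h1, sub_pos]
  have e1 : ∀ a b c d : ℂ, a * c * (b * d) = a * b * (c * d) := fun a b c d => by ring
  rw [e1, ← Complex.exp_add, ← add_mul, mul_inv]
  push_cast
  congr 1
  rcases lt_or_gt_of_ne ha with ha | ha <;> rcases lt_or_gt_of_ne hb with hb | hb
  · rw [if_pos (h3.2 (mul_pos_of_neg_of_neg ha hb)), if_neg (by linarith), if_neg (by linarith),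
      if_neg (by linarith)]
    congr 1; ring
  · rw [if_neg (by rw [h3]; nlinarith), if_neg (by linarith), if_pos hb]
    simp
  · linarith
  · rw [if_pos (h3.2 (mul_pos ha hb)), if_pos (by linarith), if_pos ha, if_pos hb]
    congr 1; ring

theorem retard_neg {m : ℝ} (β : ℝ) (k : Spacetime s) :
    retard m β (-k) = conj (retard m β k) := by
  rw [retard, retard, minkSq_neg, map_mul, Complex.conj_ofReal]
  congr 1
  by_cases h : m ^ 2 < minkSq k
  · have h0 : k 0 ≠ 0 := by
      intro h0
      have : minkSq k ≤ 0 := by rw [minkSq_eq, h0]; nlinarith [sq_nonneg ‖space k‖]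
      nlinarith [sq_nonneg m]
    rw [if_pos h, if_pos h, ← Complex.exp_conj]
    rcases lt_or_gt_of_ne h0 with h0 | h0
    · rw [if_pos (by simpa using h0), if_neg (by linarith)]
      simp
    · rw [if_neg (by simpa using h0.le), if_pos h0]
      simp
  · rw [if_neg h, if_neg h, map_one]

/-- Schwartz functions are bounded by the inverse of the weight. -/
theorem exists_norm_le_inv_wt (F : 𝓢(Spacetime s, ℂ)) : ∃ C, 0 ≤ C ∧ ∀ k, ‖F k‖ ≤ C * (wt k)⁻¹ := by
  obtain ⟨C, hC⟩ : ∃ C, ∀ k, (1 + ‖k‖) ^ (2 * (s + 2)) * ‖iteratedFDeriv ℝ 0 F k‖ ≤ C :=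
    ⟨_, fun k => SchwartzMap.one_add_le_sup_seminorm_apply (𝕜 := ℂ) (m := (2 * (s + 2), 0)) le_rfl
      le_rfl F k⟩
  refine ⟨max C 0, le_max_right _ _, fun k => ?_⟩
  rw [← div_eq_mul_inv, le_div_iff₀ (wt_pos k), mul_comm]
  refine le_trans ?_ (le_max_left _ _)
  refine le_trans ?_ (hC k)
  rw [norm_iteratedFDeriv_zero, pow_mul]
  refine mul_le_mul_of_nonneg_right ?_ (norm_nonneg _)
  rw [wt]
  refine pow_le_pow_left₀ (by positivity) ?_ _
  nlinarith [norm_nonneg k]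

theorem integrable_retard_mul {m β : ℝ} (hm : 0 < m) (hβ0 : 0 ≤ β) (hβ : β < 1) {F : Spacetime s → ℂ}
    (hF : Measurable F) {C : ℝ} (hC : ∀ k, ‖F k‖ ≤ C * (wt k)⁻¹) :
    Integrable fun k => retard m β k * F k := by
  refine ((integrable_inv_wt_mul_inv_rpow hm hβ0 hβ).const_mul C).mono' (by fun_prop)
    (Filter.Eventually.of_forall fun k => ?_)
  rw [norm_mul, norm_retard]
  calc _ ≤ (|minkSq k - m ^ 2| ^ β)⁻¹ * (C * (wt k)⁻¹) :=
        mul_le_mul_of_nonneg_left (hC k) (by positivity)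
    _ = _ := by ring

theorem ae_minkSq_ne (c : ℝ) : ∀ᵐ k : Spacetime s, minkSq k ≠ c := by
  have hs : MeasurableSet {k : Spacetime s | minkSq k = c} :=
    measurableSet_eq_fun (by fun_prop) measurable_const
  rw [ae_iff]
  simp only [not_not]
  rw [← measurePreserving_split.measure_preimage hs.nullMeasurableSet, Measure.volume_eq_prod,
    Measure.prod_apply_symm (measurePreserving_split.measurable hs)]
  rw [lintegral_eq_zero_iff' (by
    exact (measurable_measure_prodMk_right (measurePreserving_split.measurable hs)).aemeasurable)]
  refine Filter.Eventually.of_forall fun p => ?_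
  refine Set.Finite.measure_zero (Set.Finite.subset
    (Set.toFinite {Real.sqrt (c + ‖p‖ ^ 2), -Real.sqrt (c + ‖p‖ ^ 2)}) fun t ht => ?_) _
  have h1 : t ^ 2 - ‖p‖ ^ 2 = c := by
    have := ht
    simp only [Set.mem_preimage, Set.mem_ofPred_eq] at this
    rw [← this]
    exact (minkSq_join _ _).symm
  have h2 : t ^ 2 = c + ‖p‖ ^ 2 := by linarith
  have h3 : Real.sqrt (c + ‖p‖ ^ 2) = |t| := by rw [← h2, Real.sqrt_sq_eq_abs]
  rw [h3]
  rcases abs_choice t with h | h <;> rw [h] <;> simp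

theorem norm_factor_le' {ε β : ℝ} (hε : 0 < ε) (hβ : 0 < β) (x : ℝ) :
    ‖factor ε β x‖ ≤ (ε ^ β)⁻¹ := by
  have h1 : ε ≤ ‖(ε : ℂ) - Complex.I * x‖ := by
    refine (le_abs_self ε).trans ?_
    simpa using Complex.abs_re_le_norm ((ε : ℂ) - Complex.I * x)
  rw [factor, Complex.norm_cpow_real, norm_div, norm_one, one_div,
    Real.inv_rpow (norm_nonneg _)]
  exact inv_anti₀ (Real.rpow_pos_of_pos hε _) (Real.rpow_le_rpow hε.le h1 hβ.le)

theorem integral_retard_osc_of_time {m β : ℝ} (hm : 0 < m) (hβ0 : 0 < β) (hβ : β < 1)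
    {g : 𝓢(Spacetime s, ℂ)} (hg : ∀ x, x 0 < 0 → g x = 0) :
    ∫ k, retard m β k * osc g k = 0 := by
  have hω : Measurable fun k : Spacetime s => energy m (space k) :=
    ((continuous_energy m).comp continuous_space).measurable
  have hf1 : ∀ ε, Measurable fun k : Spacetime s => factor ε β (k 0 - energy m (space k)) :=
    fun ε => (measurable_factor ε β).comp (by fun_prop)
  have hf2 : ∀ ε, Measurable fun k : Spacetime s => factor ε β (k 0 + energy m (space k)) :=
    fun ε => (measurable_factor ε β).comp (by fun_prop)
  have hexp : ∀ x : ℝ, ‖Complex.exp (Complex.I * x)‖ = 1 := fun x => by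
    rw [mul_comm]; exact Complex.norm_exp_ofReal_mul_I x
  have hreg : ∀ ε : ℝ, 0 < ε → ∫ k, (osc g k * factor ε β (k 0 + energy m (space k))) *
      factor ε β (k 0 - energy m (space k)) = 0 := by
    intro ε hε
    refine integral_mul_cpow_eq_zero ?_ (by fun_prop) (fun t ht => ?_) hε hβ0
    · exact (osc g).integrable.mul_bdd (hf2 ε).aestronglyMeasurable
        (Filter.Eventually.of_forall fun _ => norm_factor_le' hε hβ0 _)
    have := integral_mul_cpow_eq_zero (μ := volume)
      (G := fun k : Spacetime s => osc g k *
        Complex.exp (Complex.I * ((t * (k 0 - energy m (space k)) : ℝ) : ℂ)))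
      (a := fun k => k 0 + energy m (space k)) ?_ (by fun_prop) (fun t' ht' => ?_) hε hβ0
    · rw [← this]
      refine integral_congr_ae (Filter.Eventually.of_forall fun k => ?_)
      simp only [factor]
      push_cast
      ring
    · exact (osc g).integrable.mul_bdd (by fun_prop)
        (Filter.Eventually.of_forall fun _ => (hexp _).le)
    · have h3 := integral_slice_eq_zero hg (τ := t + t') (by positivity)
        (ψ := fun p => Complex.exp (Complex.I * (((t' - t) * energy m p : ℝ) : ℂ)))
        (by have := (continuous_energy (s := s) m).measurable; fun_prop)
        (C := 1) (fun p => (hexp _).le)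
      rw [← h3]
      refine integral_congr_ae (Filter.Eventually.of_forall fun k => ?_)
      simp only [mul_assoc, ← Complex.exp_add]
      congr 2
      push_cast
      ring
  obtain ⟨C, hC0, hC⟩ := exists_norm_le_inv_wt (osc g)
  have hlim : Filter.Tendsto (fun ε : ℝ => ∫ k, (osc g k * factor ε β (k 0 + energy m (space k))) *
      factor ε β (k 0 - energy m (space k))) (𝓝[>] 0) (𝓝 (∫ k, retard m β k * osc g k)) := by
    refine tendsto_integral_filter_of_dominated_convergence
      (fun k => C * ((wt k)⁻¹ * (|minkSq k - m ^ 2| ^ β)⁻¹))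
      (Filter.Eventually.of_forall fun ε => ?_) (Filter.Eventually.of_forall fun ε => ?_)
      ((integrable_inv_wt_mul_inv_rpow hm hβ0.le hβ).const_mul C) ?_
    · exact (((osc g).continuous.measurable.mul (hf2 ε)).mul (hf1 ε)).aestronglyMeasurable
    all_goals
      filter_upwards [ae_minkSq_ne (s := s) (m ^ 2)] with k hk
      have h1 : minkSq k - m ^ 2 =
          (k 0 - energy m (space k)) * (k 0 + energy m (space k)) := by
        have := energy_sq m (space k)
        rw [minkSq_eq]
        nlinarith
      have h2 : (k 0 - energy m (space k)) * (k 0 + energy m (space k)) ≠ 0 := by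
        rw [← h1]; exact sub_ne_zero.2 hk
    · rw [h1, abs_mul, Real.mul_rpow (abs_nonneg _) (abs_nonneg _), norm_mul, norm_mul, mul_inv]
      have h3 := norm_factor_le (ε := ε) hβ0 (left_ne_zero_of_mul h2)
      have h4 := norm_factor_le (ε := ε) hβ0 (right_ne_zero_of_mul h2)
      calc _ ≤ (C * (wt k)⁻¹) * (|k 0 + energy m (space k)| ^ β)⁻¹ *
            (|k 0 - energy m (space k)| ^ β)⁻¹ := by
            have := inv_nonneg.2 (wt_pos k).le
            gcongr
            exact hC k
        _ = _ := by ring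
    · rw [retard_eq_factor m hβ0]
      have h5 := (tendsto_factor (β := β) (left_ne_zero_of_mul h2)).mono_left
        (nhdsWithin_le_nhds (s := Set.Ioi 0))
      have h6 := (tendsto_factor (β := β) (right_ne_zero_of_mul h2)).mono_left
        (nhdsWithin_le_nhds (s := Set.Ioi 0))
      convert! (h6.const_mul (osc g k)).mul h5 using 2
      ring
  refine tendsto_nhds_unique hlim (tendsto_const_nhds.congr' ?_)
  filter_upwards [self_mem_nhdsWithin] with ε hε
  exact (hreg ε hε).symm

end

/-! ### Lorentz transformations -/

section

variable {s : ℕ}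

/-- The Minkowski inner product. -/
def mink (k x : Spacetime s) : ℝ := k 0 * x 0 - ⟪space k, space x⟫_ℝ

/-- Spatial reflection. -/
def parity (s : ℕ) : Spacetime s →ₗ[ℝ] Spacetime s where
  toFun k := join (k 0) (-space k)
  map_add' k x := by
    ext i
    refine Fin.cases ?_ (fun i => ?_) i
    · simp
    · simp [add_comm]
  map_smul' c x := by
    ext i
    refine Fin.cases ?_ (fun i => ?_) i
    · simp
    · simp

theorem parity_apply (k : Spacetime s) : parity s k = join (k 0) (-space k) := rfl

theorem parity_parity (k : Spacetime s) : parity s (parity s k) = k := by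
  simp [parity_apply]

theorem minkSq_eq_mink (k : Spacetime s) : minkSq k = mink k k := by
  rw [minkSq_eq, mink, real_inner_self_eq_norm_sq]; ring

theorem mink_comm (k x : Spacetime s) : mink k x = mink x k := by
  rw [mink, mink, real_inner_comm]; ring

theorem mink_add_left (k k' x : Spacetime s) : mink (k + k') x = mink k x + mink k' x := by
  simp only [mink, space_add, inner_add_left, PiLp.add_apply]; ring

theorem mink_smul_left (c : ℝ) (k x : Spacetime s) : mink (c • k) x = c * mink k x := by
  simp only [mink, space_smul, real_inner_smul_left, PiLp.smul_apply, smul_eq_mul]; ring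

theorem mink_add_right (k x x' : Spacetime s) : mink k (x + x') = mink k x + mink k x' := by
  rw [mink_comm, mink_add_left, mink_comm x, mink_comm x']

theorem mink_smul_right (c : ℝ) (k x : Spacetime s) : mink k (c • x) = c * mink k x := by
  rw [mink_comm, mink_smul_left, mink_comm]

theorem inner_eq_mink (k x : Spacetime s) : ⟪k, x⟫_ℝ = mink (parity s k) x := by
  rw [inner_eq, mink, parity_apply, join_zero, space_join, inner_neg_left]; ring

theorem minkSq_add (k x : Spacetime s) : minkSq (k + x) = minkSq k + 2 * mink k x + minkSq x := by
  simp only [minkSq_eq_mink, mink_add_left, mink_add_right, mink_comm x k]; ring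

/-- Invertible linear maps that preserve the Minkowski square, the direction of time and
Lebesgue measure (the last property being automatic). -/
structure IsLorentz (L : Spacetime s ≃ₗ[ℝ] Spacetime s) : Prop where
  minkSq : ∀ x, minkSq (L x) = minkSq x
  cone : ∀ x ∈ forwardCone s, L x ∈ forwardCone s
  cone_symm : ∀ x ∈ forwardCone s, L.symm x ∈ forwardCone s
  measurePreserving : MeasurePreserving L volume volume

namespace IsLorentz

variable {L : Spacetime s ≃ₗ[ℝ] Spacetime s}

theorem symm (h : IsLorentz L) : IsLorentz L.symm where
  minkSq x := by rw [← h.minkSq, L.apply_symm_apply]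
  cone := h.cone_symm
  cone_symm := h.cone
  measurePreserving :=
    MeasurePreserving.symm L.toContinuousLinearEquiv.toHomeomorph.toMeasurableEquiv
      h.measurePreserving

theorem mul {M : Spacetime s ≃ₗ[ℝ] Spacetime s} (h : IsLorentz L) (hM : IsLorentz M) :
    IsLorentz (L.trans M) where
  minkSq x := by rw [LinearEquiv.trans_apply, hM.minkSq, h.minkSq]
  cone x hx := hM.cone _ (h.cone _ hx)
  cone_symm x hx := h.cone_symm _ (hM.cone_symm _ hx)
  measurePreserving := hM.measurePreserving.comp h.measurePreserving

theorem mink (h : IsLorentz L) (k x : Spacetime s) : mink (L k) (L x) = IndefQFT.mink k x := by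
  have h1 := h.minkSq (k + x)
  rw [map_add, minkSq_add, minkSq_add, h.minkSq, h.minkSq] at h1
  linarith

theorem measurableEmbedding (_ : IsLorentz L) : MeasurableEmbedding L :=
  L.toContinuousLinearEquiv.toHomeomorph.measurableEmbedding

theorem of_involution (L : Spacetime s ≃ₗ[ℝ] Spacetime s) (hL : ∀ x, L (L x) = x)
    (h1 : ∀ x, IndefQFT.minkSq (L x) = IndefQFT.minkSq x)
    (h2 : ∀ x ∈ forwardCone s, L x ∈ forwardCone s) : IsLorentz L where
  minkSq := h1
  cone := h2
  cone_symm x hx := by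
    have : L.symm x = L x := by rw [LinearEquiv.symm_apply_eq, hL]
    rw [this]; exact h2 x hx
  measurePreserving := measurePreserving_of_involution volume L.toLinearMap hL

theorem zero_lt_iff (h : IsLorentz L) {k : Spacetime s} (hk : 0 < IndefQFT.minkSq k) :
    0 < L k 0 ↔ 0 < k 0 := by
  have key : ∀ {M : Spacetime s ≃ₗ[ℝ] Spacetime s} (_ : IsLorentz M) {k : Spacetime s},
      0 < IndefQFT.minkSq k → 0 < k 0 → 0 < M k 0 := by
    intro M hM k hk h0
    have h1 := hM.cone k ⟨hk.le, h0.le⟩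
    refine lt_of_le_of_ne h1.2 fun h2 => ?_
    have h3 := hM.minkSq k
    rw [minkSq_eq, ← h2] at h3
    nlinarith [sq_nonneg ‖space (M k)‖]
  refine ⟨fun h0 => ?_, key h hk⟩
  have := key h.symm (k := L k) (by rwa [h.minkSq]) h0
  rwa [L.symm_apply_apply] at this

theorem retard (h : IsLorentz L) (m β : ℝ) (k : Spacetime s) :
    retard m β (L k) = IndefQFT.retard m β k := by
  rw [IndefQFT.retard, IndefQFT.retard, h.minkSq]
  by_cases hk : m ^ 2 < IndefQFT.minkSq k
  · simp only [h.zero_lt_iff (lt_of_le_of_lt (sq_nonneg m) hk)]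
  · simp only [hk, if_false]

end IsLorentz

theorem isLorentz_parity (s : ℕ) :
    IsLorentz (LinearEquiv.ofInvolutive (parity s) parity_parity) := by
  refine IsLorentz.of_involution _ parity_parity (fun x => ?_) (fun x hx => ?_)
  · change minkSq (parity s x) = _
    simp [parity_apply, minkSq_eq]
  · change parity s x ∈ _
    rw [mem_forwardCone_iff] at hx ⊢
    simpa [parity_apply] using hx

/-- The contragredient transformation. -/
def dual (L : Spacetime s ≃ₗ[ℝ] Spacetime s) : Spacetime s ≃ₗ[ℝ] Spacetime s :=
  ((LinearEquiv.ofInvolutive (parity s) parity_parity).trans L.symm).trans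
    (LinearEquiv.ofInvolutive (parity s) parity_parity)

theorem IsLorentz.dual {L : Spacetime s ≃ₗ[ℝ] Spacetime s} (h : IsLorentz L) :
    IsLorentz (dual L) := ((isLorentz_parity s).mul h.symm).mul (isLorentz_parity s)

theorem IsLorentz.inner_apply {L : Spacetime s ≃ₗ[ℝ] Spacetime s} (h : IsLorentz L)
    (k x : Spacetime s) : ⟪k, L x⟫_ℝ = ⟪IndefQFT.dual L k, x⟫_ℝ := by
  have h1 : IndefQFT.dual L k = parity s (L.symm (parity s k)) := rfl
  rw [inner_eq_mink, inner_eq_mink, h1, parity_parity, ← h.mink (L.symm _),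
    L.apply_symm_apply]

theorem IsLorentz.wave_apply {L : Spacetime s ≃ₗ[ℝ] Spacetime s} (h : IsLorentz L)
    (k x : Spacetime s) : wave k (L x) = wave (IndefQFT.dual L k) x := by
  rw [wave, wave, h.inner_apply]

theorem mink_nonneg {k x : Spacetime s} (hk : k ∈ forwardCone s) (hx : x ∈ forwardCone s) :
    0 ≤ mink k x := by
  rw [mem_forwardCone_iff] at hk hx
  have := real_inner_le_norm (space k) (space x)
  rw [mink, sub_nonneg]
  exact this.trans (mul_le_mul hk hx (norm_nonneg _) ((norm_nonneg _).trans hk))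

/-- The Minkowski reflection along `w`. -/
def reflection (w : Spacetime s) : Spacetime s →ₗ[ℝ] Spacetime s where
  toFun k := k - (2 * mink k w / minkSq w) • w
  map_add' k x := by
    rw [mink_add_left, mul_add, add_div, add_smul]; abel
  map_smul' c x := by
    rw [mink_smul_left, RingHom.id_apply, smul_sub, smul_smul]
    congr 2; ring

theorem reflection_apply (w k : Spacetime s) :
    reflection w k = k + (-(2 * mink k w / minkSq w)) • w := by
  rw [neg_smul, ← sub_eq_add_neg]; rfl

theorem mink_reflection {w : Spacetime s} (hw : minkSq w ≠ 0) (k : Spacetime s) :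
    mink (reflection w k) w = -mink k w := by
  rw [reflection_apply, mink_add_left, mink_smul_left, ← minkSq_eq_mink]
  field_simp
  ring

theorem reflection_reflection {w : Spacetime s} (hw : minkSq w ≠ 0) (k : Spacetime s) :
    reflection w (reflection w k) = k := by
  rw [reflection_apply w (reflection w k), mink_reflection hw, reflection_apply, add_assoc,
    ← add_smul]
  have : -(2 * mink k w / minkSq w) + -(2 * -mink k w / minkSq w) = 0 := by ring
  rw [this, zero_smul, add_zero]

theorem reflection_self {w : Spacetime s} (hw : minkSq w ≠ 0) : reflection w w = -w := by
  rw [reflection_apply, ← minkSq_eq_mink, mul_div_assoc, div_self hw, mul_one, neg_smul, two_smul]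
  abel

/-- Reflections along space-like vectors. -/
theorem isLorentz_reflection {w : Spacetime s} (hw : minkSq w < 0) :
    IsLorentz (LinearEquiv.ofInvolutive (reflection w) (reflection_reflection hw.ne)) := by
  have h1 : ∀ x, minkSq (reflection w x) = minkSq x := by
    intro x
    rw [reflection_apply, minkSq_add, mink_smul_right, minkSq_eq_mink (_ • w), mink_smul_left,
      mink_smul_right, ← minkSq_eq_mink]
    have := hw.ne
    field_simp
    ring
  refine IsLorentz.of_involution _ (reflection_reflection hw.ne) h1 fun x hx => ?_
  change reflection w x ∈ forwardCone s
  refine ⟨by rw [h1]; exact hx.1, ?_⟩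
  by_contra hneg
  rw [not_le] at hneg
  have h2 : -reflection w x ∈ forwardCone s := by
    refine ⟨by rw [minkSq_neg, h1]; exact hx.1, ?_⟩
    simpa using hneg.le
  have h3 := mink_nonneg hx h2
  have h4 : mink x (-reflection w x) = -(minkSq x - 2 * mink x w ^ 2 / minkSq w) := by
    rw [← neg_one_smul ℝ, mink_smul_right, reflection_apply, mink_add_right, mink_smul_right,
      ← minkSq_eq_mink]
    ring
  have h5 : mink x w ^ 2 / minkSq w ≤ 0 := div_nonpos_of_nonneg_of_nonpos (sq_nonneg _) hw.le
  have h6 : mink x w ^ 2 / minkSq w = 0 := by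
    refine le_antisymm h5 ?_
    rw [h4] at h3
    have h8 := hx.1
    rw [mul_div_assoc] at h3
    linarith
  have h7 : mink x w = 0 := by
    rcases div_eq_zero_iff.1 h6 with h | h
    · exact pow_eq_zero_iff two_ne_zero |>.1 h
    · exact absurd h hw.ne
  rw [reflection_apply, h7] at hneg
  simp only [mul_zero, zero_div, neg_zero, zero_smul, add_zero] at hneg
  exact absurd hx.2 (not_le.2 hneg)

theorem isLorentz_of_mem {L : Spacetime s ≃ₗ[ℝ] Spacetime s} (hL : L ∈ lorentzGroup s) :
    IsLorentz L where
  minkSq := hL.1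
  cone x hx := (hL.2.2 x).2 hx
  cone_symm x hx := by rw [← hL.2.2, L.apply_symm_apply]; exact hx
  measurePreserving := by
    have hd : LinearMap.det (L : Spacetime s →ₗ[ℝ] Spacetime s) = 1 := by
      rw [← LinearEquiv.coe_det, hL.2.1, Units.val_one]
    refine ⟨L.toContinuousLinearEquiv.continuous.measurable, ?_⟩
    have := Measure.map_linearMap_addHaar_eq_smul_addHaar
      (volume : Measure (Spacetime s)) (f := (L : Spacetime s →ₗ[ℝ] Spacetime s))
      (by rw [hd]; exact one_ne_zero)
    rw [hd] at this
    simpa using this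

end

/-! ### Supports of the Fourier transforms of retarded and advanced propagators -/

section

variable {s : ℕ} {m β : ℝ}

/-- Translation of a test function of one variable. -/
def shift (y : Spacetime s) (f : 𝓢(Spacetime s, ℂ)) : 𝓢(Spacetime s, ℂ) :=
  SchwartzMap.compSubConstCLM ℂ y f

theorem shift_apply (y : Spacetime s) (f : 𝓢(Spacetime s, ℂ)) (x : Spacetime s) :
    shift y f x = f (x - y) := rfl

theorem osc_shift (y : Spacetime s) (f : 𝓢(Spacetime s, ℂ)) (k : Spacetime s) :
    osc (shift y f) k = wave k y * osc f k := by
  rw [osc_apply, osc_apply, ← integral_const_mul,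
    ← integral_add_right_eq_self (fun x => wave k x * shift y f x) y]
  refine integral_congr_ae (Filter.Eventually.of_forall fun x => ?_)
  simp only [shift_apply, add_sub_cancel_right, wave_add_right]
  ring

/-- The image of a test function under a linear transformation. -/
def transform (L : Spacetime s ≃ₗ[ℝ] Spacetime s) (f : 𝓢(Spacetime s, ℂ)) : 𝓢(Spacetime s, ℂ) :=
  SchwartzMap.compCLMOfContinuousLinearEquiv ℂ L.symm.toContinuousLinearEquiv f

theorem transform_apply (L : Spacetime s ≃ₗ[ℝ] Spacetime s) (f : 𝓢(Spacetime s, ℂ))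
    (x : Spacetime s) : transform L f x = f (L.symm x) := rfl

theorem osc_transform {L : Spacetime s ≃ₗ[ℝ] Spacetime s} (h : IsLorentz L)
    (f : 𝓢(Spacetime s, ℂ)) (k : Spacetime s) : osc (transform L f) k = osc f (dual L k) := by
  rw [osc_apply, osc_apply, ← h.measurePreserving.integral_comp h.measurableEmbedding]
  refine integral_congr_ae (Filter.Eventually.of_forall fun x => ?_)
  simp only [transform_apply, h.wave_apply, L.symm_apply_apply]

theorem integral_retard_osc_of_lorentz (hm : 0 < m) (hβ0 : 0 < β) (hβ : β < 1)
    {L : Spacetime s ≃ₗ[ℝ] Spacetime s} (h : IsLorentz L) {g : 𝓢(Spacetime s, ℂ)}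
    (hg : ∀ x, L x 0 < 0 → g x = 0) : ∫ k, retard m β k * osc g k = 0 := by
  have h1 := integral_retard_osc_of_time hm hβ0 hβ (g := transform L g)
    (fun x hx => hg (L.symm x) (by rwa [L.apply_symm_apply]))
  rw [← h1, ← h.dual.measurePreserving.integral_comp h.dual.measurableEmbedding]
  refine integral_congr_ae (Filter.Eventually.of_forall fun k => ?_)
  simp only [osc_transform h, h.dual.retard]

theorem integral_retard_wave_osc (hm : 0 < m) (hβ0 : 0 < β) (hβ : β < 1) {χ : 𝓢(Spacetime s, ℂ)}
    (hχ : ∀ x, x ∉ forwardCone s → χ x = 0) {y : Spacetime s} (hy : y ∉ backwardCone s) :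
    ∫ k, retard m β k * (wave k y * osc χ k) = 0 := by
  simp_rw [← osc_shift]
  rcases le_or_gt 0 (y 0) with h0 | h0
  · refine integral_retard_osc_of_time hm hβ0 hβ fun x hx => ?_
    rw [shift_apply]
    refine hχ _ fun h => ?_
    have := h.2
    simp only [PiLp.sub_apply] at this
    linarith
  · have hy2 : minkSq y < 0 := by
      by_contra h
      exact hy ⟨not_lt.1 h, h0.le⟩
    have hL := isLorentz_reflection hy2
    refine integral_retard_osc_of_lorentz hm hβ0 hβ hL fun x hx => ?_
    rw [shift_apply]
    refine hχ _ fun h => ?_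
    have h1 := (hL.cone _ h).2
    rw [map_sub] at h1
    have h2 : LinearEquiv.ofInvolutive (reflection y) (reflection_reflection hy2.ne) y = -y :=
      reflection_self hy2.ne
    rw [h2] at h1
    simp only [PiLp.sub_apply, PiLp.neg_apply] at h1
    linarith

/-- Smooth approximations of the point mass at the origin, supported in the forward cone. -/
theorem exists_mollifier (s : ℕ) (r : ℝ) (hr : 0 < r) : ∃ χ : 𝓢(Spacetime s, ℂ),
    (∀ x, x ∉ forwardCone s → χ x = 0) ∧ ∀ k, ‖osc χ k‖ ≤ 1 ∧ ‖osc χ k - 1‖ ≤ ‖k‖ * (3 * r) := by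
  set c : Spacetime s := EuclideanSpace.single 0 (2 * r) with hc
  let φ : ContDiffBump c := ⟨r / 2, r, by positivity, by linarith⟩
  have hφ : Continuous (φ.normed volume) := φ.continuous_normed
  have hφC : HasCompactSupport fun x => ((φ.normed volume x : ℝ) : ℂ) :=
    φ.hasCompactSupport_normed.comp_left (g := fun t : ℝ => (t : ℂ)) Complex.ofReal_zero
  have hsm : ContDiff ℝ (⊤ : ℕ∞) fun x => ((φ.normed volume x : ℝ) : ℂ) :=
    Complex.ofRealCLM.contDiff.comp (φ.contDiff_normed (μ := volume))
  let χ : 𝓢(Spacetime s, ℂ) := hφC.toSchwartzMap hsm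
  have hχ : ∀ x, χ x = ((φ.normed volume x : ℝ) : ℂ) := fun x => rfl
  have hball : ∀ x, φ.normed volume x ≠ 0 → ‖x - c‖ < r := fun x hx => by
    have : x ∈ Function.support (φ.normed volume) := hx
    rw [φ.support_normed_eq, mem_ball_iff_norm] at this
    exact this
  have hi : Integrable fun x => ((φ.normed volume x : ℝ) : ℂ) :=
    φ.integrable_normed.ofReal
  have hosc : ∀ k, osc χ k = ∫ x, wave k x * ((φ.normed volume x : ℝ) : ℂ) := fun k => osc_apply _ _
  have hn : ∀ x, ‖((φ.normed volume x : ℝ) : ℂ)‖ = φ.normed volume x := fun x => by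
    rw [Complex.norm_real, Real.norm_of_nonneg (φ.nonneg_normed x)]
  refine ⟨χ, fun x hx => ?_, fun k => ⟨?_, ?_⟩⟩
  · rw [hχ, Complex.ofReal_eq_zero]
    by_contra hne
    refine hx ?_
    have h1 := hball x hne
    have h2 : ‖space (x - c)‖ ≤ r ∧ |(x - c) 0| ≤ r := by
      have := norm_sq_eq (x - c)
      constructor
      · nlinarith [norm_nonneg (space (x - c)), norm_nonneg (x - c), sq_nonneg ((x - c) 0)]
      · refine abs_le_of_sq_le_sq ?_ hr.le
        nlinarith [norm_nonneg (space (x - c)), norm_nonneg (x - c), sq_nonneg ‖space (x - c)‖]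
    have h3 : space c = 0 := by ext i; simp [hc]
    have h4 : space (x - c) = space x := by
      rw [sub_eq_add_neg, space_add, space_neg, h3, neg_zero, add_zero]
    rw [h4] at h2
    rw [mem_forwardCone_iff]
    have h5 : (x - c) 0 = x 0 - 2 * r := by simp [hc]
    rw [h5] at h2
    have := (abs_le.1 h2.2).1
    linarith [h2.1]
  · rw [hosc]
    refine (norm_integral_le_integral_norm _).trans ?_
    simp_rw [norm_mul, norm_wave, one_mul, hn]
    rw [φ.integral_normed]
  · have h1 : (1 : ℂ) = ∫ x, ((φ.normed volume x : ℝ) : ℂ) := by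
      rw [integral_complex_ofReal, φ.integral_normed, Complex.ofReal_one]
    rw [hosc, h1, ← integral_sub (integrable_wave_mul hi k) hi]
    have h2 : ∀ x, ‖wave k x * ((φ.normed volume x : ℝ) : ℂ) - ((φ.normed volume x : ℝ) : ℂ)‖ ≤
        ‖k‖ * (3 * r) * φ.normed volume x := by
      intro x
      rw [← sub_one_mul, norm_mul, hn]
      by_cases hx : φ.normed volume x = 0
      · rw [hx, mul_zero, mul_zero]
      refine mul_le_mul_of_nonneg_right ?_ (φ.nonneg_normed x)
      have h3 : ‖x‖ ≤ 3 * r := by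
        have h4 : ‖c‖ = 2 * r := by
          rw [hc, PiLp.norm_single, Real.norm_of_nonneg (by positivity)]
        have h5 := hball x hx
        have h6 := norm_add_le (x - c) c
        rw [sub_add_cancel] at h6
        linarith
      have h7 : ‖wave k x - 1‖ ≤ |⟪k, x⟫_ℝ| := by
        rw [wave]
        exact Real.norm_exp_I_mul_ofReal_sub_one_le
      refine h7.trans ((abs_real_inner_le_norm k x).trans ?_)
      exact mul_le_mul_of_nonneg_left h3 (norm_nonneg _)
    refine (norm_integral_le_of_norm_le (φ.integrable_normed.const_mul _)
      (Filter.Eventually.of_forall h2)).trans ?_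
    rw [integral_const_mul, φ.integral_normed, mul_one]

/-- The Fourier transform of the retarded propagator is supported in the backward cone. -/
theorem integral_retard_osc (hm : 0 < m) (hβ0 : 0 < β) (hβ : β < 1) {f : 𝓢(Spacetime s, ℂ)}
    (hf : ∀ x ∈ backwardCone s, f x = 0) : ∫ k, retard m β k * osc f k = 0 := by
  choose χ hχ hχk using fun n : ℕ => exists_mollifier s (1 / (n + 1)) Nat.one_div_pos_of_nat
  obtain ⟨C, hC0, hC⟩ := exists_norm_le_inv_wt (osc f)
  have hb : Integrable fun k => retard m β k * osc f k :=
    integrable_retard_mul hm hβ0.le hβ (osc f).continuous.measurable hC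
  have hzero : ∀ n, ∫ k, retard m β k * osc f k * osc (χ n) k = 0 := by
    intro n
    obtain ⟨C', hC0', hC'⟩ := exists_norm_le_inv_wt (osc (χ n))
    have h1 : Integrable fun k => retard m β k * osc (χ n) k :=
      integrable_retard_mul hm hβ0.le hβ (osc (χ n)).continuous.measurable hC'
    have h2 := integral_integral_wave (g := fun k => retard m β k * osc (χ n) k) (h := f)
      h1 f.integrable
    calc ∫ k, retard m β k * osc f k * osc (χ n) k
        = ∫ k, retard m β k * osc (χ n) k * ∫ x, wave k x * f x := by
          refine integral_congr_ae (Filter.Eventually.of_forall fun k => ?_)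
          simp only [osc_apply f]
          ring
      _ = ∫ x, f x * ∫ k, wave x k * (retard m β k * osc (χ n) k) := h2
      _ = ∫ x : Spacetime s, (0 : ℂ) := by
          refine integral_congr_ae (Filter.Eventually.of_forall fun x => ?_)
          by_cases hx : x ∈ backwardCone s
          · simp only [hf x hx, zero_mul]
          · have h3 := integral_retard_wave_osc hm hβ0 hβ (hχ n) hx
            simp only
            rw [← mul_zero (f x), ← h3]
            congr 1
            refine integral_congr_ae (Filter.Eventually.of_forall fun k => ?_)
            simp only [wave_comm x k]
            ring
      _ = 0 := integral_zero _ _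
  have hlim : Filter.Tendsto (fun n => ∫ k, retard m β k * osc f k * osc (χ n) k) Filter.atTop
      (𝓝 (∫ k, retard m β k * osc f k)) := by
    refine tendsto_integral_of_dominated_convergence (fun k => ‖retard m β k * osc f k‖)
      (fun n => (hb.aestronglyMeasurable.mul (osc (χ n)).continuous.aestronglyMeasurable)) hb.norm
      (fun n => Filter.Eventually.of_forall fun k => ?_) (Filter.Eventually.of_forall fun k => ?_)
    · rw [norm_mul _ (osc (χ n) k)]
      exact mul_le_of_le_one_right (norm_nonneg _) (hχk n k).1
    · have h1 : Filter.Tendsto (fun n => osc (χ n) k) Filter.atTop (𝓝 1) := by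
        rw [tendsto_iff_norm_sub_tendsto_zero]
        have h2 : Filter.Tendsto (fun n : ℕ => ‖k‖ * (3 * (1 / ((n : ℝ) + 1)))) Filter.atTop
            (𝓝 (‖k‖ * (3 * 0))) :=
          (tendsto_one_div_add_atTop_nhds_zero_nat.const_mul 3).const_mul _
        rw [mul_zero, mul_zero] at h2
        exact squeeze_zero (fun _ => norm_nonneg _) (fun n => (hχk n k).2) h2
      simpa using h1.const_mul (retard m β k * osc f k)
  exact tendsto_nhds_unique hlim (by simp_rw [hzero]; exact tendsto_const_nhds)

theorem integral_conj_retard_osc (hm : 0 < m) (hβ0 : 0 < β) (hβ : β < 1) {f : 𝓢(Spacetime s, ℂ)}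
    (hf : ∀ x ∈ forwardCone s, f x = 0) : ∫ k, conj (retard m β k) * osc f k = 0 := by
  set N : Spacetime s ≃ₗ[ℝ] Spacetime s := LinearEquiv.neg ℝ
  have h1 := integral_retard_osc hm hβ0 hβ (f := transform N f)
    (fun x hx => hf _ (by
      change -x ∈ forwardCone s
      exact (neg_mem_forwardCone_iff _).2 hx))
  rw [← h1, ← integral_neg_eq_self]
  refine integral_congr_ae (Filter.Eventually.of_forall fun k => ?_)
  simp only [retard_neg, Complex.conj_conj]
  congr 1
  rw [osc_apply, osc_apply, ← integral_neg_eq_self]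
  refine integral_congr_ae (Filter.Eventually.of_forall fun x => ?_)
  have h2 : transform N f x = f (-x) := rfl
  simp only [h2]
  simp only [wave, inner_neg_neg]

theorem integral_wave_retard_osc (hm : 0 < m) (hβ0 : 0 < β) (hβ : β < 1) {f : 𝓢(Spacetime s, ℂ)}
    {y : Spacetime s} (hf : ∀ x, f x ≠ 0 → x + y ∉ backwardCone s) :
    ∫ k, wave y k * (retard m β k * osc f k) = 0 := by
  have h1 := integral_retard_osc hm hβ0 hβ (f := shift y f) (fun x hx => by
    rw [shift_apply]
    by_contra h
    exact hf _ h (by rwa [sub_add_cancel]))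
  rw [← h1]
  refine integral_congr_ae (Filter.Eventually.of_forall fun k => ?_)
  simp only [osc_shift, wave_comm y k]
  ring

theorem integral_wave_conj_retard_osc (hm : 0 < m) (hβ0 : 0 < β) (hβ : β < 1)
    {f : 𝓢(Spacetime s, ℂ)} {y : Spacetime s} (hf : ∀ x, f x ≠ 0 → x + y ∉ forwardCone s) :
    ∫ k, wave y k * (conj (retard m β k) * osc f k) = 0 := by
  have h1 := integral_conj_retard_osc hm hβ0 hβ (f := shift y f) (fun x hx => by
    rw [shift_apply]
    by_contra h
    exact hf _ h (by rwa [sub_add_cancel]))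
  rw [← h1]
  refine integral_congr_ae (Filter.Eventually.of_forall fun k => ?_)
  simp only [osc_shift, wave_comm y k]
  ring

/-- The three densities combine to the retarded propagator. -/
theorem muMid_add_eq_retard (hβ0 : 0 < β) (k : Spacetime s) :
    (muMid m β k : ℂ) + Complex.I * (muPlus m β k - muMinus m β k : ℝ) =
      muConst s * retard m β k := by
  rw [retard, muMid, muPlus, muMinus]
  change ((muConst s * _ * _ : ℝ) : ℂ) + Complex.I * ((muConst s * _ * _ * _ -
    muConst s * _ * _ * _ : ℝ) : ℂ) = _
  rcases lt_trichotomy (m ^ 2) (minkSq k) with h | h | h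
  · have h0 : k 0 ≠ 0 := by
      intro h0
      have : minkSq k ≤ 0 := by rw [minkSq_eq, h0]; nlinarith [sq_nonneg ‖space k‖]
      nlinarith [sq_nonneg m]
    have he : ∀ t : ℝ, Complex.exp (Complex.I * t) =
        (Real.cos t : ℂ) + Complex.I * (Real.sin t : ℂ) := fun t => by
      rw [mul_comm, Complex.exp_mul_I]; push_cast; ring
    have hn : ∀ t : ℝ, Complex.exp (-1 * (Complex.I * t)) =
        (Real.cos t : ℂ) - Complex.I * (Real.sin t : ℂ) := fun t => by
      have := he (-t)
      rw [Real.cos_neg, Real.sin_neg] at this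
      push_cast at this ⊢
      rw [neg_one_mul, ← mul_neg, this]; ring
    rw [abs_of_pos (sub_pos.2 h)]
    simp only [h, true_and, if_true, not_lt.2 h.le, if_false, add_zero, mul_one, one_div]
    rcases lt_or_gt_of_ne h0 with h0 | h0
    · simp only [h0, not_lt.2 h0.le, if_true, if_false, hn]
      push_cast
      ring
    · simp only [h0, not_lt.2 h0.le, if_true, if_false, one_mul, he]
      push_cast
      ring
  · simp [h, Real.zero_rpow hβ0.ne']
  · simp [h, not_lt.2 h.le]

end

/-! ### Convolutions of functions with disjoint Fourier supports -/

section

variable {s : ℕ}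

theorem integrable_convolution_integrand {u v : Spacetime s → ℂ} (hu : Integrable u)
    (hv : Integrable v) : Integrable fun p : Spacetime s × Spacetime s => u p.2 * v (p.1 - p.2) := by
  have := hu.convolution_integrand (ContinuousLinearMap.mul ℝ ℂ) hv
  exact this

theorem ae_convolution_eq_zero {u v : Spacetime s → ℂ} (hu : Integrable u) (hv : Integrable v)
    (h : ∀ y, (∫ k, wave y k * u k) * ∫ k, wave y k * v k = 0) :
    ∀ᵐ q, ∫ k, u k * v (q - k) = 0 := by
  have hi := integrable_convolution_integrand hu hv
  refine ae_eq_zero_of_integral_wave (g := fun q => ∫ k, u k * v (q - k)) hi.integral_prod_left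
    fun y => ?_
  rw [← h y]
  have hi' : Integrable fun p : Spacetime s × Spacetime s => wave y p.1 * (u p.2 * v (p.1 - p.2)) :=
    hi.bdd_mul (c := 1) (by fun_prop) (Filter.Eventually.of_forall fun _ => (norm_wave _ _).le)
  have hL : ∫ q, wave y q * ∫ k, u k * v (q - k) = ∫ q, ∫ k, wave y q * (u k * v (q - k)) := by
    simp_rw [← integral_const_mul]
  rw [hL, integral_integral_swap hi', ← integral_mul_const (∫ k, wave y k * v k)]
  refine integral_congr_ae (Filter.Eventually.of_forall fun k => ?_)
  simp only
  rw [← integral_add_right_eq_self _ k, ← integral_const_mul (wave y k * u k)]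
  refine integral_congr_ae (Filter.Eventually.of_forall fun q => ?_)
  simp only [add_sub_cancel_right, wave_add_right]
  ring

theorem ae_neg_sum {n : ℕ} {p : Spacetime s → Prop} (hp : ∀ᵐ q, p q) :
    ∀ᵐ k : Fin (n + 1) → Spacetime s, p (-∑ i, k i) := by
  let L : (Fin (n + 1) → Spacetime s) →ₗ[ℝ] Spacetime s :=
    -∑ i, LinearMap.proj (R := ℝ) (φ := fun _ => Spacetime s) i
  have hL : ∀ k, L k = -∑ i, k i := fun k => by simp [L]
  have hs : Function.Surjective L := fun q => ⟨Fin.cons (-q) 0, by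
    rw [hL, Fin.sum_univ_succ]; simp⟩
  obtain ⟨c, -, hc⟩ := LinearMap.exists_map_addHaar_eq_smul_addHaar (L := L)
    (volume : Measure (Fin (n + 1) → Spacetime s)) (volume : Measure (Spacetime s)) hs
  have h1 : ∀ᵐ q ∂Measure.map L volume, p q := by
    rw [hc]; exact Measure.ae_smul_measure hp c
  have h2 := ae_of_ae_map L.continuous_of_finiteDimensional.measurable.aemeasurable h1
  filter_upwards [h2] with k hk
  rwa [← hL]

theorem piFinSuccAbove_symm_apply {n : ℕ} (p : Spacetime s × (Fin n → Spacetime s)) :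
    (MeasurableEquiv.piFinSuccAbove (fun _ : Fin (n + 1) => Spacetime s) 0).symm p =
      (Fin.cons p.1 p.2 : Fin (n + 1) → Spacetime s) := by
  simp [MeasurableEquiv.piFinSuccAbove]
  rfl

theorem integral_cons {n : ℕ} (F : (Fin (n + 1) → Spacetime s) → ℂ) :
    ∫ k, F k = ∫ p : Spacetime s × (Fin n → Spacetime s), F (Fin.cons p.1 p.2) := by
  have hmp := (volume_preserving_piFinSuccAbove (fun _ : Fin (n + 1) => Spacetime s) 0).symm
  rw [← hmp.integral_comp (MeasurableEquiv.measurableEmbedding _)]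
  simp_rw [piFinSuccAbove_symm_apply]

theorem integrable_cons {n : ℕ} (F : (Fin (n + 1) → Spacetime s) → ℂ) :
    Integrable F ↔
      Integrable fun p : Spacetime s × (Fin n → Spacetime s) => F (Fin.cons p.1 p.2) := by
  have hmp := (volume_preserving_piFinSuccAbove (fun _ : Fin (n + 1) => Spacetime s) 0).symm
  rw [← hmp.integrable_comp_emb (MeasurableEquiv.measurableEmbedding _)]
  simp_rw [Function.comp_def, piFinSuccAbove_symm_apply]

/-- The integral over the hyperplane of vanishing total momentum vanishes if two of the factors
have Fourier transforms with disjoint supports. -/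
theorem integral_deltaSum_prod_eq_zero_of_ends {n : ℕ} {W : Fin (n + 3) → Spacetime s → ℂ}
    (hW : Integrable (fun k => ∏ l, W l (k l)) (deltaSum s (n + 3)))
    (h0 : Integrable (W 0)) (h1 : Integrable (W (Fin.last _)))
    (h : ∀ y, (∫ k, wave y k * W 0 k) * ∫ k, wave y k * W (Fin.last _) k = 0) :
    ∫ k, ∏ l, W l (k l) ∂deltaSum s (n + 3) = 0 := by
  have e : ∀ p : Spacetime s × (Fin (n + 1) → Spacetime s),
      ∏ l, W l (snocNeg (n + 2) (Fin.cons p.1 p.2 : Fin (n + 2) → Spacetime s) l) =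
      (∏ l : Fin (n + 1), W l.succ.castSucc (p.2 l)) *
        (W 0 p.1 * W (Fin.last _) (-(∑ i, p.2 i) - p.1)) := by
    rintro ⟨q, k⟩
    have e2 : snocNeg (n + 2) (Fin.cons q k : Fin (n + 2) → Spacetime s) (Fin.last _) =
        -(∑ i, k i) - q := by
      rw [snocNeg_last, Fin.sum_univ_succ, Fin.cons_zero]
      simp only [Fin.cons_succ]
      abel
    have e3 : snocNeg (n + 2) (Fin.cons q k : Fin (n + 2) → Spacetime s) (Fin.castSucc 0) = q :=
      snocNeg_castSucc _ _
    have e4 : ∀ l : Fin (n + 1), snocNeg (n + 2) (Fin.cons q k : Fin (n + 2) → Spacetime s)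
        l.succ.castSucc = k l := fun l => snocNeg_castSucc _ _
    rw [Fin.prod_univ_castSucc, Fin.prod_univ_succ, e2, e3]
    simp only [e4]
    rw [Fin.castSucc_zero]
    ring
  rw [integrable_deltaSum_succ, integrable_cons] at hW
  rw [integral_deltaSum_succ, integral_cons]
  simp_rw [e] at hW ⊢
  rw [Measure.volume_eq_prod] at hW ⊢
  rw [integral_prod_symm _ hW]
  refine (integral_congr_ae (g := fun _ => (0 : ℂ)) ?_).trans (integral_zero _ _)
  filter_upwards [ae_neg_sum (n := n) (ae_convolution_eq_zero h0 h1 h)] with k hk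
  rw [integral_const_mul, hk, mul_zero]

theorem integral_deltaSum_prod_eq_zero {n : ℕ} (hn : 3 ≤ n) {W : Fin n → Spacetime s → ℂ}
    (hW : Integrable (fun k => ∏ l, W l (k l)) (deltaSum s n)) {i j : Fin n} (hij : i ≠ j)
    (hi : Integrable (W i)) (hj : Integrable (W j))
    (h : ∀ y, (∫ k, wave y k * W i k) * ∫ k, wave y k * W j k = 0) :
    ∫ k, ∏ l, W l (k l) ∂deltaSum s n = 0 := by
  obtain ⟨n, rfl⟩ : ∃ r, n = r + 3 := ⟨n - 3, by omega⟩
  set τ : Equiv.Perm (Fin (n + 3)) := Equiv.swap (Fin.last _) j with hτ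
  set σ : Equiv.Perm (Fin (n + 3)) := τ * Equiv.swap 0 (τ i) with hσ
  have hτi : τ i ≠ Fin.last _ := fun h => hij (by
    have h2 : τ j = Fin.last _ := Equiv.swap_apply_right _ _
    exact τ.injective (h.trans h2.symm))
  have h0 : σ 0 = i := by
    rw [hσ, Equiv.Perm.mul_apply, Equiv.swap_apply_left, hτ, Equiv.swap_apply_self]
  have h1 : σ (Fin.last _) = j := by
    rw [hσ, Equiv.Perm.mul_apply, Equiv.swap_apply_of_ne_of_ne (Fin.last_pos.ne') hτi.symm, hτ,
      Equiv.swap_apply_left]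
  have e : ∀ k : Fin (n + 3) → Spacetime s, ∏ l, W l ((k ∘ σ.symm) l) = ∏ l, W (σ l) (k l) := by
    intro k
    rw [← Equiv.prod_comp σ]
    simp
  rw [← integral_deltaSum_perm σ.symm]
  rw [← integrable_deltaSum_perm σ.symm] at hW
  simp_rw [e] at hW ⊢
  exact integral_deltaSum_prod_eq_zero_of_ends hW (by rwa [h0]) (by rwa [h1]) (by simpa [h0, h1] using h)

/-- The effect of an adjacent transposition on sums of the form of the truncated densities. -/
theorem sum_prod_swap {n : ℕ} {i j : Fin n} (hij : (i : ℕ) + 1 = j) (a b c : Fin n → ℝ) :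
    (∑ r, ∏ l, if l < r then a (Equiv.swap i j l) else if l = r then b (Equiv.swap i j l)
        else c (Equiv.swap i j l)) -
      ∑ r, ∏ l, (if l < r then a l else if l = r then b l else c l) =
    (∏ l ∈ (Finset.univ.erase j).erase i, if l < i then a l else c l) *
      (b i * (a j - c j) - (a i - c i) * b j) := by
  have hne : i ≠ j := fun h => by rw [h] at hij; omega
  have hlt : i < j := by rw [Fin.lt_def]; omega
  have hsplit : ∀ w : Fin n → ℝ, ∏ l, w l =
      (∏ l ∈ (Finset.univ.erase j).erase i, w l) * w i * w j := by
    intro w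
    rw [Finset.prod_erase_mul _ _ (Finset.mem_erase.2 ⟨hne, Finset.mem_univ i⟩),
      Finset.prod_erase_mul _ _ (Finset.mem_univ j)]
  have hrest : ∀ (r : Fin n), ∏ l ∈ (Finset.univ.erase j).erase i,
      (if l < r then a (Equiv.swap i j l) else if l = r then b (Equiv.swap i j l)
        else c (Equiv.swap i j l)) =
      ∏ l ∈ (Finset.univ.erase j).erase i, (if l < r then a l else if l = r then b l else c l) := by
    intro r
    refine Finset.prod_congr rfl fun l hl => ?_
    simp only [Finset.mem_erase] at hl
    rw [Equiv.swap_apply_of_ne_of_ne hl.1 hl.2.1]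
  rw [← Finset.sum_sub_distrib, Fintype.sum_eq_add i j hne]
  · rw [hsplit, hsplit, hsplit (fun l => if l < j then _ else _), hsplit (fun l => if l < j then _ else _),
      hrest, hrest]
    have hi : ∏ l ∈ (Finset.univ.erase j).erase i, (if l < i then a l else if l = i then b l else c l)
        = ∏ l ∈ (Finset.univ.erase j).erase i, if l < i then a l else c l := by
      refine Finset.prod_congr rfl fun l hl => ?_
      simp only [Finset.mem_erase] at hl
      simp [hl.1]
    have hj : ∏ l ∈ (Finset.univ.erase j).erase i, (if l < j then a l else if l = j then b l else c l)
        = ∏ l ∈ (Finset.univ.erase j).erase i, if l < i then a l else c l := by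
      refine Finset.prod_congr rfl fun l hl => ?_
      simp only [Finset.mem_erase, ne_eq, Fin.ext_iff] at hl
      have h3 : l < j ↔ l < i := by rw [Fin.lt_def, Fin.lt_def]; omega
      have h4 : l ≠ j := fun h => hl.2.1 (by rw [h])
      simp only [h3, h4, if_false]
    rw [hi, hj]
    simp [hlt, hne.symm, not_lt.2 hlt.le]
    ring
  · intro r hr
    rw [hsplit, hsplit, hrest, Equiv.swap_apply_left, Equiv.swap_apply_right, sub_eq_zero,
      mul_assoc, mul_assoc]
    congr 1
    have h1 : i ≠ r := hr.1.symm
    have h2 : j ≠ r := hr.2.symm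
    have h3 : j < r ↔ i < r := by
      rw [Fin.lt_def, Fin.lt_def]; rw [ne_eq, Fin.ext_iff] at h1 h2; omega
    simp only [h1, h2, h3, if_false]
    split_ifs <;> ring

end

/-! ### Locality of the regular truncated functions -/

section

variable {s : ℕ} {m α β : ℝ}

/-- The supports of the two functions are space-like separated. -/
def Separated (f g : 𝓢(Spacetime s, ℂ)) : Prop :=
  ∀ x y, f x ≠ 0 → g y ≠ 0 → minkSq (x - y) < 0

theorem Separated.symm {f g : 𝓢(Spacetime s, ℂ)} (h : Separated f g) : Separated g f :=
  fun x y hx hy => by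
    have := h y x hy hx
    rwa [← minkSq_neg, neg_sub] at this

theorem Separated.smul {f g : 𝓢(Spacetime s, ℂ)} (h : Separated f g) (c : ℂ) :
    Separated (c • f) (c • g) := fun x y hx hy => by
  refine h x y (fun h0 => hx ?_) fun h0 => hy ?_
  · rw [smul_apply, h0, smul_zero]
  · rw [smul_apply, h0, smul_zero]

theorem osc_neg (g : 𝓢(Spacetime s, ℂ)) (q : Spacetime s) :
    osc g (-q) = ∫ x, wave q x * g (-x) := by
  rw [osc_apply, ← integral_neg_eq_self]
  simp only [wave, inner_neg_neg]

theorem integral_mul_osc_mul_osc_neg {G : Spacetime s → ℂ} {f g : 𝓢(Spacetime s, ℂ)}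
    (hG : Integrable fun k => G k * osc f k)
    (h : ∀ x, g (-x) ≠ 0 → ∫ k, wave x k * (G k * osc f k) = 0) :
    ∫ k, G k * (osc f k * osc g (-k)) = 0 := by
  have h1 := integral_integral_wave hG (h := fun x => g (-x)) (g.integrable.comp_neg)
  calc ∫ k, G k * (osc f k * osc g (-k))
      = ∫ k, G k * osc f k * ∫ x, wave k x * g (-x) := by
        simp only [osc_neg, mul_assoc]
    _ = ∫ x, g (-x) * ∫ k, wave x k * (G k * osc f k) := h1
    _ = ∫ _ : Spacetime s, (0 : ℂ) := by
        refine integral_congr_ae (Filter.Eventually.of_forall fun x => ?_)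
        by_cases hx : g (-x) = 0
        · simp only [hx, zero_mul]
        · simp only [h x hx, mul_zero]
    _ = 0 := integral_zero _ _

theorem integrable_retard_mul_osc (hm : 0 < m) (hβ0 : 0 < β) (hβ : β < 1) (f : 𝓢(Spacetime s, ℂ)) :
    Integrable fun k => retard m β k * osc f k := by
  obtain ⟨C, -, hC⟩ := exists_norm_le_inv_wt (osc f)
  exact integrable_retard_mul hm hβ0.le hβ (osc f).continuous.measurable hC

theorem integrable_conj_retard_mul_osc (hm : 0 < m) (hβ0 : 0 < β) (hβ : β < 1)
    (f : 𝓢(Spacetime s, ℂ)) : Integrable fun k => conj (retard m β k) * osc f k := by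
  refine (integrable_retard_mul_osc hm hβ0 hβ f).mono
    ((Complex.continuous_conj.measurable.comp (measurable_retard m β)).mul
      (osc f).continuous.measurable).aestronglyMeasurable (Filter.Eventually.of_forall fun k => ?_)
  rw [norm_mul, norm_mul, RCLike.norm_conj]

theorem integral_retard_osc_osc_neg (hm : 0 < m) (hβ0 : 0 < β) (hβ : β < 1)
    {f g : 𝓢(Spacetime s, ℂ)} (h : Separated f g) :
    ∫ k, retard m β k * (osc f k * osc g (-k)) = 0 := by
  refine integral_mul_osc_mul_osc_neg (integrable_retard_mul_osc hm hβ0 hβ f) fun x hx => ?_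
  refine integral_wave_retard_osc hm hβ0 hβ fun z hz hzx => ?_
  have := h z (-x) hz hx
  rw [sub_neg_eq_add] at this
  exact absurd hzx.1 (not_le.2 this)

theorem integral_conj_retard_osc_osc_neg (hm : 0 < m) (hβ0 : 0 < β) (hβ : β < 1)
    {f g : 𝓢(Spacetime s, ℂ)} (h : Separated f g) :
    ∫ k, conj (retard m β k) * (osc f k * osc g (-k)) = 0 := by
  refine integral_mul_osc_mul_osc_neg (integrable_conj_retard_mul_osc hm hβ0 hβ f) fun x hx => ?_
  refine integral_wave_conj_retard_osc hm hβ0 hβ fun z hz hzx => ?_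
  have := h z (-x) hz hx
  rw [sub_neg_eq_add] at this
  exact absurd hzx.1 (not_le.2 this)

theorem retard_sq (k : Spacetime s) : retard m β k ^ 2 = retard m (2 * β) k := by
  rw [retard, retard, mul_pow]
  congr 1
  · rw [← Complex.ofReal_pow, inv_pow, ← Real.rpow_natCast, ← Real.rpow_mul (abs_nonneg _)]
    push_cast
    rw [mul_comm β 2]
  · by_cases h : m ^ 2 < minkSq k
    · rw [if_pos h, if_pos h, ← Complex.exp_nat_mul]
      congr 1
      push_cast
      ring
    · rw [if_neg h, if_neg h, one_pow]

/-- Products of a retarded and an advanced propagator do not contribute at space-like distances. -/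
theorem integral_deltaSum_retard_conj_retard (hm : 0 < m) (hα0 : 0 < α) (hα : α ≤ 1 / 2) {n : ℕ}
    (hn : 2 ≤ n) (hnα : n = 2 → α ≠ 1 / 2) {i j : Fin n} (hij : i ≠ j) {f g : 𝓢(Spacetime s, ℂ)}
    (h : Separated f g) {W : Fin n → Spacetime s → ℂ}
    (hi : W i = fun k => retard m α k * osc f k) (hj : W j = fun k => conj (retard m α k) * osc g k)
    (hW : Integrable (fun k => ∏ l, W l (k l)) (deltaSum s n)) :
    ∫ k, ∏ l, W l (k l) ∂deltaSum s n = 0 := by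
  rcases hn.lt_or_eq with hn | rfl
  · refine integral_deltaSum_prod_eq_zero hn hW hij ?_ ?_ fun y => ?_
    · rw [hi]; exact integrable_retard_mul_osc hm hα0 (by linarith) f
    · rw [hj]; exact integrable_conj_retard_mul_osc hm hα0 (by linarith) g
    rw [hi, hj, mul_eq_zero]
    by_contra! hne
    have h1 : ∃ x, f x ≠ 0 ∧ x + y ∈ backwardCone s := by
      by_contra! h1
      exact hne.1 (integral_wave_retard_osc hm hα0 (by linarith) h1)
    have h2 : ∃ x, g x ≠ 0 ∧ x + y ∈ forwardCone s := by
      by_contra! h2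
      exact hne.2 (integral_wave_conj_retard_osc hm hα0 (by linarith) h2)
    obtain ⟨x, hx, hx'⟩ := h1
    obtain ⟨z, hz, hz'⟩ := h2
    have h3 := add_mem_forwardCone hz' ((neg_mem_forwardCone_iff _).2 hx')
    have h4 : z + y + -(x + y) = z - x := by abel
    rw [h4] at h3
    exact absurd h3.1 (not_le.2 (h.symm z x hz hx))
  · have hα2 : 2 * α < 1 := by
      have := lt_of_le_of_ne hα (hnα rfl)
      linarith
    rw [integral_deltaSum_succ]
    have hu : ∀ F : Spacetime s → ℂ, ∫ q : Fin 1 → Spacetime s, F (q 0) = ∫ q, F q := fun F =>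
      (volume_preserving_funUnique (Fin 1) (Spacetime s)).integral_comp
        (MeasurableEquiv.measurableEmbedding _) F
    have hk : ∀ q : Fin 1 → Spacetime s, ∏ l, W l (snocNeg 1 q l) = W 0 (q 0) * W 1 (-q 0) := by
      intro q
      have e0 : snocNeg 1 q 0 = q 0 := snocNeg_castSucc q 0
      have e1 : snocNeg 1 q 1 = -q 0 := by
        have := snocNeg_last q
        simpa using this
      rw [Fin.prod_univ_two, e0, e1]
    simp_rw [hk]
    rw [hu fun q => W 0 q * W 1 (-q)]
    have hij' : (i = 0 ∧ j = 1) ∨ (i = 1 ∧ j = 0) := by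
      fin_cases i <;> fin_cases j <;> simp_all
    rcases hij' with ⟨rfl, rfl⟩ | ⟨rfl, rfl⟩
    · rw [hi, hj, ← integral_retard_osc_osc_neg hm (by positivity) hα2 h]
      refine integral_congr_ae (Filter.Eventually.of_forall fun q => ?_)
      simp only [retard_neg, Complex.conj_conj, ← retard_sq]
      ring
    · rw [hi, hj, ← integral_conj_retard_osc_osc_neg hm (by positivity) hα2 h.symm]
      refine integral_congr_ae (Filter.Eventually.of_forall fun q => ?_)
      simp only [retard_neg, ← retard_sq, map_pow]
      ring

theorem integrable_deltaSum_prod_of_le (hm : 0 < m) (hα0 : 0 < α) (hα : α ≤ 1 / 2) {n : ℕ}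
    (hn : 2 ≤ n) (hnα : n = 2 → α ≠ 1 / 2) {W : Fin n → Spacetime s → ℂ}
    (hW : ∀ l, Measurable (W l)) {C : Fin n → ℝ} (hC : ∀ l k, ‖W l k‖ ≤ C l * sing m α k) :
    Integrable (fun k => ∏ l, W l (k l)) (deltaSum s n) := by
  obtain ⟨r, rfl⟩ : ∃ r, n = r + 2 := ⟨n - 2, by omega⟩
  have h1 : α * (((r : ℝ) + 2) / (r + 1)) < 1 := by
    rw [← mul_div_assoc, div_lt_one (by positivity)]
    rcases Nat.eq_zero_or_pos r with rfl | hr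
    · have := lt_of_le_of_ne hα (hnα rfl)
      simp only [Nat.cast_zero]; linarith
    · have : (1 : ℝ) ≤ r := by exact_mod_cast hr
      nlinarith
  refine ((integrable_deltaSum_prod_sing (s := s) hm hα0 h1).const_mul (∏ l, C l)).mono'
    (Finset.measurable_prod _ fun l _ => (hW l).comp (measurable_pi_apply l)).aestronglyMeasurable
    (Filter.Eventually.of_forall fun k => ?_)
  rw [norm_prod, ← Finset.prod_mul_distrib]
  exact Finset.prod_le_prod (fun l _ => norm_nonneg _) fun l _ => hC l _

theorem truncDensity_comp_swap_sub (hα0 : 0 < α) {n : ℕ} {i j : Fin n} (hij : (i : ℕ) + 1 = j)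
    (k : Fin n → Spacetime s) (F : Fin n → Spacetime s → ℂ) :
    2 * Complex.I * ((truncDensity m α (k ∘ Equiv.swap i j) - truncDensity m α k : ℝ) *
        ∏ l, F l (k l)) =
      (muConst s : ℂ) ^ 2 * ((∏ l, if l = i then retard m α (k l) * F l (k l) else
        if l = j then conj (retard m α (k l)) * F l (k l) else
        ((if l < i then muMinus m α (k l) else muPlus m α (k l) : ℝ) : ℂ) * F l (k l)) -
      ∏ l, if l = j then retard m α (k l) * F l (k l) else
        if l = i then conj (retard m α (k l)) * F l (k l) else
        ((if l < i then muMinus m α (k l) else muPlus m α (k l) : ℝ) : ℂ) * F l (k l)) := by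
  have hne : i ≠ j := fun h => by rw [h] at hij; omega
  have hsplit : ∀ w : Fin n → ℂ, ∏ l, w l =
      (∏ l ∈ (Finset.univ.erase j).erase i, w l) * w i * w j := by
    intro w
    rw [Finset.prod_erase_mul _ _ (Finset.mem_erase.2 ⟨hne, Finset.mem_univ i⟩),
      Finset.prod_erase_mul _ _ (Finset.mem_univ j)]
  have hD : truncDensity m α (k ∘ Equiv.swap i j) - truncDensity m α k = _ :=
    sum_prod_swap hij (fun l => muMinus m α (k l)) (fun l => muMid m α (k l))
      (fun l => muPlus m α (k l))
  rw [hD, hsplit (fun l => F l (k l)), hsplit, hsplit]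
  have hr1 : ∏ l ∈ (Finset.univ.erase j).erase i, (if l = i then retard m α (k l) * F l (k l) else
        if l = j then conj (retard m α (k l)) * F l (k l) else
        ((if l < i then muMinus m α (k l) else muPlus m α (k l) : ℝ) : ℂ) * F l (k l)) =
      ((∏ l ∈ (Finset.univ.erase j).erase i,
        if l < i then muMinus m α (k l) else muPlus m α (k l) : ℝ) : ℂ) *
      ∏ l ∈ (Finset.univ.erase j).erase i, F l (k l) := by
    rw [Complex.ofReal_prod, ← Finset.prod_mul_distrib]
    refine Finset.prod_congr rfl fun l hl => ?_
    simp only [Finset.mem_erase] at hl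
    rw [if_neg hl.1, if_neg hl.2.1]
  have hr2 : ∏ l ∈ (Finset.univ.erase j).erase i, (if l = j then retard m α (k l) * F l (k l) else
        if l = i then conj (retard m α (k l)) * F l (k l) else
        ((if l < i then muMinus m α (k l) else muPlus m α (k l) : ℝ) : ℂ) * F l (k l)) =
      ((∏ l ∈ (Finset.univ.erase j).erase i,
        if l < i then muMinus m α (k l) else muPlus m α (k l) : ℝ) : ℂ) *
      ∏ l ∈ (Finset.univ.erase j).erase i, F l (k l) := by
    rw [Complex.ofReal_prod, ← Finset.prod_mul_distrib]
    refine Finset.prod_congr rfl fun l hl => ?_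
    simp only [Finset.mem_erase] at hl
    rw [if_neg hl.2.1, if_neg hl.1]
  rw [hr1, hr2, if_pos rfl, if_pos rfl, if_neg hne, if_neg hne.symm, if_pos rfl, if_pos rfl]
  have hRi := muMid_add_eq_retard (m := m) hα0 (k i)
  have hRj := muMid_add_eq_retard (m := m) hα0 (k j)
  have hAi := congrArg conj hRi
  have hAj := congrArg conj hRj
  simp only [map_add, map_mul, Complex.conj_ofReal, Complex.conj_I] at hAi hAj
  have e : ∀ p ri aj fi fj rj ai : ℂ, (muConst s : ℂ) ^ 2 * (p * (ri * fi) * (aj * fj) -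
      p * (ai * fi) * (rj * fj)) = p * fi * fj * ((muConst s * ri) * (muConst s * aj) -
        (muConst s * ai) * (muConst s * rj)) := by intros; ring
  rw [e, ← hRi, ← hRj, ← hAi, ← hAj]
  push_cast
  ring

theorem integral_truncRegular_swap (hm : 0 < m) (hα0 : 0 < α) (hα : α ≤ 1 / 2) {n : ℕ}
    (hnα : n = 2 → α ≠ 1 / 2) {i j : Fin n} (hij : (i : ℕ) + 1 = j)
    (f : Fin n → 𝓢(Spacetime s, ℂ)) (hf : Separated (f i) (f j)) :
    ∫ k, ∏ l, osc (f (Equiv.swap i j l)) (k l) ∂truncRegular s m α n =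
      ∫ k, ∏ l, osc (f l) (k l) ∂truncRegular s m α n := by
  have hn : 2 ≤ n := by have := j.2; omega
  have hne : i ≠ j := fun h => by rw [h] at hij; omega
  choose C hC0 hC using fun l => exists_norm_le_inv_wt (osc (f l))
  rw [integral_truncRegular hα0 hα, integral_truncRegular hα0 hα]
  congr 1
  have hsing : ∀ l k (z : ℂ) (c : ℝ), ‖z‖ ≤ c * (|minkSq k - m ^ 2| ^ α)⁻¹ →
      ‖z * osc (f l) k‖ ≤ c * C l * sing m α k := by
    intro l k z c hz
    rw [norm_mul]
    refine (mul_le_mul hz (hC l k) (norm_nonneg _) ((norm_nonneg _).trans hz)).trans (le_of_eq ?_)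
    rw [sing]; ring
  have hmuc : ∀ (l : Fin n) (k : Spacetime s), ‖(((if l < i then muMinus m α k else muPlus m α k : ℝ)) : ℂ)‖ ≤
      muConst s * (|minkSq k - m ^ 2| ^ α)⁻¹ := by
    intro l k
    rw [Complex.norm_real]
    split_ifs
    · rw [Real.norm_of_nonneg (muMinus_nonneg hα0 hα k)]; exact muMinus_le hα0 hα k
    · rw [Real.norm_of_nonneg (muPlus_nonneg hα0 hα k)]; exact muPlus_le hα0 hα k
  have hmm : ∀ l : Fin n, Measurable fun k : Spacetime s =>
      (((if l < i then muMinus m α k else muPlus m α k : ℝ)) : ℂ) := by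
    intro l
    refine Complex.measurable_ofReal.comp ?_
    split_ifs
    · exact measurable_muMinus m α
    · exact measurable_muPlus m α
  have hcr : Measurable fun k : Spacetime s => conj (retard m α k) :=
    Complex.continuous_conj.measurable.comp (measurable_retard m α)
  have hosc : ∀ l, Measurable (osc (f l)) := fun l => (osc (f l)).continuous.measurable
  have hint : ∀ a b : Fin n, Integrable (fun k => ∏ l, if l = a then retard m α (k l) * osc (f l) (k l)
      else if l = b then conj (retard m α (k l)) * osc (f l) (k l) else
      ((if l < i then muMinus m α (k l) else muPlus m α (k l) : ℝ) : ℂ) * osc (f l) (k l))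
      (deltaSum s n) := by
    intro a b
    refine integrable_deltaSum_prod_of_le (W := fun l k => if l = a then retard m α k * osc (f l) k
      else if l = b then conj (retard m α k) * osc (f l) k else
      ((if l < i then muMinus m α k else muPlus m α k : ℝ) : ℂ) * osc (f l) k) hm hα0 hα hn hnα
      (C := fun l => (if l = a then 1 else if l = b then 1 else muConst s) * C l)
      (fun l => ?_) fun l k => ?_
    · simp only
      split_ifs
      · exact (measurable_retard m α).mul (hosc l)
      · exact hcr.mul (hosc l)
      · rename_i h; have := (hmm l).mul (hosc l); simp only [h, if_true] at this; exact this
      · rename_i h; have := (hmm l).mul (hosc l); simp only [h, if_false] at this; exact this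
    · simp only
      by_cases h1 : l = a
      · rw [if_pos h1, if_pos h1]
        exact hsing l k _ _ (by rw [norm_retard, one_mul])
      rw [if_neg h1, if_neg h1]
      by_cases h2 : l = b
      · rw [if_pos h2, if_pos h2]
        exact hsing l k _ _ (by rw [RCLike.norm_conj, norm_retard, one_mul])
      rw [if_neg h2, if_neg h2]
      exact hsing l k _ _ (hmuc l k)
  have hzero : ∀ a b : Fin n, a ≠ b → Separated (f a) (f b) →
      ∫ k, (∏ l, if l = a then retard m α (k l) * osc (f l) (k l)
      else if l = b then conj (retard m α (k l)) * osc (f l) (k l) else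
      ((if l < i then muMinus m α (k l) else muPlus m α (k l) : ℝ) : ℂ) * osc (f l) (k l))
      ∂(deltaSum s n) = 0 := by
    intro a b hab hs
    refine integral_deltaSum_retard_conj_retard (W := fun l k => if l = a then
      retard m α k * osc (f l) k else if l = b then conj (retard m α k) * osc (f l) k else
      ((if l < i then muMinus m α k else muPlus m α k : ℝ) : ℂ) * osc (f l) k) hm hα0 hα hn hnα
      hab hs ?_ ?_ (hint a b)
    · simp
    · simp [hab.symm]
  have hdint : ∀ σ : Equiv.Perm (Fin n), Integrable (fun k => truncDensity m α (k ∘ σ) •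
      ∏ l, osc (f l) (k l)) (deltaSum s n) := by
    intro σ
    have h1 := integrable_deltaSum_prod_of_le (s := s) (W := fun l k =>
      (((|minkSq k - m ^ 2| ^ α)⁻¹ : ℝ) : ℂ) * osc (f l) k) (C := fun l => 1 * C l) hm hα0 hα hn hnα
      (fun l => by have := hosc l; fun_prop) (fun l k => hsing l k _ _ (by
        rw [Complex.norm_real, Real.norm_of_nonneg (by positivity), one_mul]))
    refine (h1.norm.const_mul (n * muConst s ^ n)).mono'
      (((measurable_truncDensity m α).comp (by fun_prop)).smul (Finset.measurable_prod _ fun l _ =>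
        (hosc l).comp (measurable_pi_apply l))).aestronglyMeasurable
      (Filter.Eventually.of_forall fun k => ?_)
    rw [norm_smul, Real.norm_of_nonneg (truncDensity_nonneg hα0 hα _)]
    refine (mul_le_mul_of_nonneg_right (truncDensity_le hα0 hα _) (norm_nonneg _)).trans
      (le_of_eq ?_)
    have e : ∏ l, (|minkSq ((k ∘ σ) l) - m ^ 2| ^ α)⁻¹ = ∏ l, (|minkSq (k l) - m ^ 2| ^ α)⁻¹ :=
      Equiv.prod_comp σ fun l => (|minkSq (k l) - m ^ 2| ^ α)⁻¹
    rw [e, Finset.prod_mul_distrib, norm_mul, mul_assoc, ← Complex.ofReal_prod, Complex.norm_real,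
      Real.norm_of_nonneg (Finset.prod_nonneg fun _ _ => by positivity)]
  have hperm : ∫ k, truncDensity m α k • ∏ l, osc (f (Equiv.swap i j l)) (k l) ∂deltaSum s n =
      ∫ k, truncDensity m α (k ∘ Equiv.swap i j) • ∏ l, osc (f l) (k l) ∂deltaSum s n := by
    rw [← integral_deltaSum_perm (Equiv.swap i j)]
    refine integral_congr_ae (Filter.Eventually.of_forall fun k => ?_)
    simp only
    rw [← Equiv.prod_comp (Equiv.swap i j) fun l => osc (f l) (k l)]
    rfl
  have hdint' : Integrable (fun k => truncDensity m α k • ∏ l, osc (f l) (k l)) (deltaSum s n) :=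
    hdint (Equiv.refl _)
  rw [hperm, ← sub_eq_zero, ← integral_sub (hdint _) hdint']
  have hkey : ∀ k : Fin n → Spacetime s, truncDensity m α (k ∘ Equiv.swap i j) • ∏ l, osc (f l) (k l) -
      truncDensity m α k • ∏ l, osc (f l) (k l) = (2 * Complex.I)⁻¹ * (2 * Complex.I *
        ((truncDensity m α (k ∘ Equiv.swap i j) - truncDensity m α k : ℝ) *
        ∏ l, osc (f l) (k l))) := by
    intro k
    rw [← mul_assoc, inv_mul_cancel₀ (by simp), one_mul, Complex.real_smul, Complex.real_smul]
    push_cast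
    ring
  simp_rw [hkey, truncDensity_comp_swap_sub hα0 hij _ fun l => ⇑(osc (f l))]
  rw [integral_const_mul, integral_const_mul, integral_sub (hint _ _) (hint _ _),
    hzero i j hne hf, hzero j i hne.symm hf.symm]
  simp

end

/-! ### The mass shell as a limit of thin shells -/

section

variable {s : ℕ} {m : ℝ}

/-- The part of momentum space with squared mass in `(m², m² + δ]` and positive energy. -/
def thinShell (s : ℕ) (m δ : ℝ) : Set (Spacetime s) :=
  {k | m ^ 2 < minkSq k ∧ minkSq k ≤ m ^ 2 + δ ∧ 0 < k 0}

theorem measurableSet_thinShell (m δ : ℝ) : MeasurableSet (thinShell s m δ) := by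
  unfold thinShell
  exact (measurableSet_lt measurable_const measurable_minkSq).inter
    ((measurableSet_le measurable_minkSq measurable_const).inter
      (measurableSet_lt measurable_const (measurable_coord 0)))

theorem join_mem_thinShell {δ : ℝ} (hδ : 0 ≤ δ) (t : ℝ) (p : EuclideanSpace ℝ (Fin s)) :
    join t p ∈ thinShell s m δ ↔
      t ∈ Set.Ioc (energy m p) (Real.sqrt (energy m p ^ 2 + δ)) := by
  have h1 := energy_sq m p
  have h0 : 0 ≤ energy m p := Real.sqrt_nonneg _
  simp only [thinShell, Set.mem_ofPred_eq, minkSq_join, join_zero, Set.mem_Ioc]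
  constructor
  · rintro ⟨h2, h3, h4⟩
    exact ⟨lt_of_pow_lt_pow_left₀ 2 h4.le (by linarith), Real.le_sqrt_of_sq_le (by linarith)⟩
  · rintro ⟨h2, h3⟩
    have h4 : 0 < t := h0.trans_lt h2
    have h5 := (Real.le_sqrt h4.le (by positivity)).1 h3
    exact ⟨by nlinarith, by linarith, h4⟩

theorem inv_wt_join_le_pow (t : ℝ) (p : EuclideanSpace ℝ (Fin s)) :
    (wt (join t p))⁻¹ ≤ ((1 + ‖p‖ ^ 2) ^ (s + 1))⁻¹ := by
  refine inv_anti₀ (by positivity) ?_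
  rw [wt, norm_sq_eq, join_zero, space_join]
  calc (1 + ‖p‖ ^ 2) ^ (s + 1) ≤ (1 + ‖p‖ ^ 2) ^ (s + 2) :=
        pow_le_pow_right₀ (by nlinarith [sq_nonneg ‖p‖]) (by omega)
    _ ≤ _ := pow_le_pow_left₀ (by positivity) (by nlinarith [sq_nonneg t]) _

/-- The averages over thin shells converge to the integral over the mass shell. -/
theorem tendsto_thinShell (hm : 0 < m) {H : Spacetime s → ℂ} (hH : Continuous H) {C : ℝ}
    (hC : ∀ k, ‖H k‖ ≤ C * (wt k)⁻¹) :
    Filter.Tendsto (fun δ : ℝ => δ⁻¹ • ∫ k in thinShell s m δ, H k) (𝓝[>] 0)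
      (𝓝 (∫ p : EuclideanSpace ℝ (Fin s), (1 / (2 * energy m p)) • H (join (energy m p) p))) := by
  have hE : ∀ p : EuclideanSpace ℝ (Fin s), 0 < energy m p := fun p => hm.trans_le (le_energy p)
  have hHi : Integrable H := (integrable_inv_wt.const_mul C).mono' hH.aestronglyMeasurable
    (Filter.Eventually.of_forall hC)
  have hC0 : 0 ≤ C := by
    have := (norm_nonneg _).trans (hC 0)
    exact nonneg_of_mul_nonneg_left this (inv_pos.2 (wt_pos 0))
  have hsplit : ∀ δ : ℝ, 0 < δ → δ⁻¹ • ∫ k in thinShell s m δ, H k =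
      ∫ p : EuclideanSpace ℝ (Fin s),
        δ⁻¹ • ∫ t in (energy m p)..(Real.sqrt (energy m p ^ 2 + δ)), H (join t p) := by
    intro δ hδ
    rw [integral_smul, ← integral_indicator (measurableSet_thinShell m δ), integral_split]
    have hi := (integrable_split _).1 (hHi.indicator (measurableSet_thinShell m δ))
    rw [Measure.volume_eq_prod] at hi ⊢
    rw [integral_prod_symm _ hi]
    congr 1
    refine integral_congr_ae (Filter.Eventually.of_forall fun p => ?_)
    have hle : energy m p ≤ Real.sqrt (energy m p ^ 2 + δ) :=
      Real.le_sqrt_of_sq_le (by linarith)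
    simp only
    rw [intervalIntegral.integral_of_le hle, ← integral_indicator measurableSet_Ioc]
    refine integral_congr_ae (Filter.Eventually.of_forall fun t => ?_)
    simp only [Set.indicator, join_mem_thinShell hδ.le]
  have hev : ∀ᶠ δ : ℝ in 𝓝[>] 0, 0 < δ := self_mem_nhdsWithin
  refine Filter.Tendsto.congr' (hev.mono fun δ hδ => (hsplit δ hδ).symm) ?_
  have hslice : ∀ p : EuclideanSpace ℝ (Fin s), Continuous fun t : ℝ => H (join t p) := fun p =>
    hH.comp (continuous_join.comp (Continuous.prodMk_left p))
  refine tendsto_integral_filter_of_dominated_convergence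
    (fun p => C * (1 / (2 * m)) * ((1 + ‖p‖ ^ 2) ^ (s + 1))⁻¹) (hev.mono fun δ hδ => ?_)
    (hev.mono fun δ hδ => Filter.Eventually.of_forall fun p => ?_)
    (integrable_inv_space.const_mul _) (Filter.Eventually.of_forall fun p => ?_)
  · have hi := (integrable_split _).1 (hHi.indicator (measurableSet_thinShell m δ))
    rw [Measure.volume_eq_prod] at hi
    have h1 := (hi.integral_prod_right.const_mul ((δ⁻¹ : ℝ) : ℂ)).aestronglyMeasurable
    refine h1.congr (Filter.Eventually.of_forall fun p => ?_)
    have hle : energy m p ≤ Real.sqrt (energy m p ^ 2 + δ) :=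
      Real.le_sqrt_of_sq_le (by linarith)
    simp only
    rw [← Complex.real_smul, intervalIntegral.integral_of_le hle,
      ← integral_indicator measurableSet_Ioc]
    congr 1
    refine integral_congr_ae (Filter.Eventually.of_forall fun t => ?_)
    simp only [Set.indicator, join_mem_thinShell hδ.le]
  · have hle : energy m p ≤ Real.sqrt (energy m p ^ 2 + δ) :=
      Real.le_sqrt_of_sq_le (by linarith)
    have h1 : ‖∫ t in (energy m p)..(Real.sqrt (energy m p ^ 2 + δ)), H (join t p)‖ ≤
        C * ((1 + ‖p‖ ^ 2) ^ (s + 1))⁻¹ * |Real.sqrt (energy m p ^ 2 + δ) - energy m p| :=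
      intervalIntegral.norm_integral_le_of_norm_le_const fun t _ =>
        (hC _).trans (mul_le_mul_of_nonneg_left (inv_wt_join_le_pow t p) hC0)
    have h2 : Real.sqrt (energy m p ^ 2 + δ) - energy m p ≤ δ * (1 / (2 * m)) := by
      have h3 := Real.sq_sqrt (show 0 ≤ energy m p ^ 2 + δ by positivity)
      have h4 := le_energy (m := m) p
      have h5 : (Real.sqrt (energy m p ^ 2 + δ) - energy m p) * (2 * m) ≤ δ := by nlinarith
      rw [mul_one_div, le_div_iff₀ (by positivity)]
      exact h5
    rw [norm_smul, Real.norm_of_nonneg (inv_nonneg.2 hδ.le)]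
    rw [abs_of_nonneg (sub_nonneg.2 hle)] at h1
    calc _ ≤ δ⁻¹ * (C * ((1 + ‖p‖ ^ 2) ^ (s + 1))⁻¹ * (δ * (1 / (2 * m)))) := by
          gcongr
          exact h1.trans (mul_le_mul_of_nonneg_left h2 (by positivity))
      _ = _ := by field_simp
  · have h1 : HasDerivAt (fun δ : ℝ => Real.sqrt (energy m p ^ 2 + δ)) (1 / (2 * energy m p)) 0 := by
      have h2 : HasDerivAt (fun δ : ℝ => energy m p ^ 2 + δ) 1 0 := (hasDerivAt_id 0).const_add _
      have h3 := h2.sqrt (by have := hE p; positivity)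
      rwa [add_zero, Real.sqrt_sq (hE p).le] at h3
    have h4 : HasDerivAt (fun u : ℝ => ∫ t in (energy m p)..u, H (join t p))
        (H (join (energy m p) p)) (Real.sqrt (energy m p ^ 2 + 0)) := by
      rw [add_zero, Real.sqrt_sq (hE p).le]
      exact intervalIntegral.integral_hasDerivAt_right ((hslice p).intervalIntegrable _ _)
        ((hslice p).stronglyMeasurableAtFilter _ _) (hslice p).continuousAt
    have h5 := h4.scomp (0 : ℝ) h1
    have h6 := h5.tendsto_slope_zero_right
    refine h6.congr fun δ => ?_
    simp [Real.sqrt_sq (hE p).le]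

theorem massShell_eq_of_thinShell_eq (hm : 0 < m) {H K : Spacetime s → ℂ} (hH : Continuous H)
    (hK : Continuous K) {C D : ℝ} (hC : ∀ k, ‖H k‖ ≤ C * (wt k)⁻¹) (hD : ∀ k, ‖K k‖ ≤ D * (wt k)⁻¹)
    (h : ∀ δ > 0, ∫ k in thinShell s m δ, H k = ∫ k in thinShell s m δ, K k) :
    ∫ p : EuclideanSpace ℝ (Fin s), (1 / (2 * energy m p)) • H (join (energy m p) p) =
      ∫ p : EuclideanSpace ℝ (Fin s), (1 / (2 * energy m p)) • K (join (energy m p) p) := by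
  refine tendsto_nhds_unique (tendsto_thinShell hm hH hC) ((tendsto_thinShell hm hK hD).congr' ?_)
  filter_upwards [self_mem_nhdsWithin] with δ hδ
  rw [h δ hδ]

theorem integral_massShell_prod (F : Fin 2 → Spacetime s → ℂ) :
    ∫ k, ∏ l, F l (k l) ∂massShell s m =
      ∫ p : EuclideanSpace ℝ (Fin s), (1 / (2 * energy m p)) •
        (F 0 (-join (energy m p) p) * F 1 (join (energy m p) p)) := by
  rw [integral_massShell, ← integral_neg_eq_self]
  refine integral_congr_ae (Filter.Eventually.of_forall fun p => ?_)
  have h1 : energy m (-p) = energy m p := by simp [energy]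
  have h2 : negShell m (-p) = -join (energy m p) p := by
    rw [negShell_eq]
    ext i
    refine Fin.cases ?_ (fun i => ?_) i
    · simp [energy]
    · simp
  simp only [h1, Fin.prod_univ_two, shellPair]
  simp [h2]

/-- The regularized sign function of the energy, integrated against products of transforms. -/
theorem integral_sign_osc_osc_neg (hm : 0 < m) {f g : 𝓢(Spacetime s, ℂ)} (h : Separated f g) :
    ∫ k, (open Classical in (if m ^ 2 < minkSq k then (if 0 < k 0 then (1 : ℂ) else -1) else 0)) *
      (osc f k * osc g (-k)) = 0 := by
  classical
  set S : Spacetime s → ℂ := fun k => if m ^ 2 < minkSq k then (if 0 < k 0 then (1 : ℂ) else -1)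
    else 0 with hS
  have hSm : Measurable S := Measurable.ite (measurableSet_lt measurable_const (by fun_prop))
    (Measurable.ite (measurableSet_lt measurable_const (by fun_prop)) measurable_const
      measurable_const) measurable_const
  have hS1 : ∀ k, ‖S k‖ ≤ 1 := by intro k; simp only [hS]; split_ifs <;> simp
  obtain ⟨C, hC0, hC⟩ := exists_norm_le_inv_wt (osc f)
  obtain ⟨D, hD0, hD⟩ := exists_norm_le_inv_wt (osc g)
  have hbd : ∀ k, ‖osc f k * osc g (-k)‖ ≤ C * D * (wt k)⁻¹ := by
    intro k
    rw [norm_mul]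
    have h1 := hD (-k)
    have h2 : (wt (-k))⁻¹ ≤ 1 := inv_le_one_of_one_le₀ (one_le_wt _)
    calc _ ≤ (C * (wt k)⁻¹) * (D * 1) := mul_le_mul (hC k)
          (h1.trans (mul_le_mul_of_nonneg_left h2 hD0)) (norm_nonneg _)
          (mul_nonneg hC0 (inv_nonneg.2 (wt_pos k).le))
      _ = _ := by ring
  have hcont : Continuous fun k => osc f k * osc g (-k) :=
    (osc f).continuous.mul ((osc g).continuous.comp continuous_neg)
  have hzero : ∀ β : ℝ, 0 < β → β < 1 →
      ∫ k, (((|minkSq k - m ^ 2| ^ β)⁻¹ : ℝ) : ℂ) * (S k * (osc f k * osc g (-k))) = 0 := by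
    intro β hβ0 hβ
    have hsin : Real.sin (Real.pi * β) ≠ 0 :=
      (Real.sin_pos_of_pos_of_lt_pi (by positivity) (by nlinarith [Real.pi_pos])).ne'
    have e : ∀ k : Spacetime s, (((|minkSq k - m ^ 2| ^ β)⁻¹ : ℝ) : ℂ) *
        (S k * (osc f k * osc g (-k))) = (2 * Complex.I * Real.sin (Real.pi * β))⁻¹ *
          (retard m β k * (osc f k * osc g (-k)) - conj (retard m β k) * (osc f k * osc g (-k))) := by
      intro k
      have h1 : retard m β k - conj (retard m β k) =
          2 * Complex.I * Real.sin (Real.pi * β) * ((((|minkSq k - m ^ 2| ^ β)⁻¹ : ℝ) : ℂ) * S k) := by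
        have he : ∀ t : ℝ, Complex.exp (Complex.I * t) =
            (Real.cos t : ℂ) + Complex.I * (Real.sin t : ℂ) := fun t => by
          rw [mul_comm, Complex.exp_mul_I]; push_cast; ring
        have hn : ∀ t : ℝ, Complex.exp (-1 * (Complex.I * t)) =
            (Real.cos t : ℂ) - Complex.I * (Real.sin t : ℂ) := fun t => by
          have := he (-t)
          rw [Real.cos_neg, Real.sin_neg] at this
          push_cast at this ⊢
          rw [neg_one_mul, ← mul_neg, this]; ring
        simp only [retard, hS]
        split_ifs
        · rw [one_mul, he]
          simp only [map_mul, map_add, Complex.conj_ofReal, Complex.conj_I]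
          ring
        · rw [hn]
          simp only [map_mul, map_sub, Complex.conj_ofReal, Complex.conj_I]
          ring
        · simp
      rw [← sub_mul, h1]
      have h2 : (Real.sin (Real.pi * β) : ℂ) ≠ 0 := by exact_mod_cast hsin
      have h3 := Complex.I_ne_zero
      field_simp
    have hb1 : Integrable fun k => retard m β k * (osc f k * osc g (-k)) :=
      integrable_retard_mul hm hβ0.le hβ hcont.measurable hbd
    have hb2 : Integrable fun k => conj (retard m β k) * (osc f k * osc g (-k)) := by
      refine hb1.mono ((Complex.continuous_conj.measurable.comp (measurable_retard m β)).mul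
        hcont.measurable).aestronglyMeasurable (Filter.Eventually.of_forall fun k => ?_)
      rw [norm_mul, norm_mul (retard m β k), RCLike.norm_conj]
    simp_rw [e]
    rw [integral_const_mul, integral_sub hb1 hb2, integral_retard_osc_osc_neg hm hβ0 hβ h,
      integral_conj_retard_osc_osc_neg hm hβ0 hβ h, sub_zero, mul_zero]
  have hlim : Filter.Tendsto (fun β : ℝ => ∫ k, (((|minkSq k - m ^ 2| ^ β)⁻¹ : ℝ) : ℂ) *
      (S k * (osc f k * osc g (-k)))) (𝓝[>] 0) (𝓝 (∫ k, S k * (osc f k * osc g (-k)))) := by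
    refine tendsto_integral_filter_of_dominated_convergence
      (fun k => C * D * ((wt k)⁻¹ + (wt k)⁻¹ * (|minkSq k - m ^ 2| ^ (1 / 2 : ℝ))⁻¹))
      (Filter.Eventually.of_forall fun β => ?_) ?_
      ((integrable_inv_wt.add (integrable_inv_wt_mul_inv_rpow hm (by norm_num)
        (by norm_num))).const_mul _) ?_
    · have := hcont.measurable
      exact Measurable.aestronglyMeasurable (by fun_prop)
    · filter_upwards [Ioo_mem_nhdsGT (show (0 : ℝ) < 1 / 2 by norm_num)] with β hβ
      filter_upwards [ae_minkSq_ne (s := s) (m ^ 2)] with k hk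
      have h0 : 0 < |minkSq k - m ^ 2| := abs_pos.2 (sub_ne_zero.2 hk)
      have h1 : (|minkSq k - m ^ 2| ^ β)⁻¹ ≤ 1 + (|minkSq k - m ^ 2| ^ (1 / 2 : ℝ))⁻¹ := by
        rcases le_or_gt 1 |minkSq k - m ^ 2| with h2 | h2
        · have h3 : (|minkSq k - m ^ 2| ^ β)⁻¹ ≤ 1 :=
            inv_le_one_of_one_le₀ (Real.one_le_rpow h2 hβ.1.le)
          have h4 : 0 ≤ (|minkSq k - m ^ 2| ^ (1 / 2 : ℝ))⁻¹ := by positivity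
          linarith
        · have h3 : (|minkSq k - m ^ 2| ^ β)⁻¹ ≤ (|minkSq k - m ^ 2| ^ (1 / 2 : ℝ))⁻¹ :=
            inv_anti₀ (Real.rpow_pos_of_pos h0 _)
              (Real.rpow_le_rpow_of_exponent_ge h0 h2.le hβ.2.le)
          linarith
      rw [norm_mul, norm_mul, Complex.norm_real, Real.norm_of_nonneg (by positivity)]
      calc _ ≤ (1 + (|minkSq k - m ^ 2| ^ (1 / 2 : ℝ))⁻¹) * (1 * (C * D * (wt k)⁻¹)) :=
            mul_le_mul h1 (mul_le_mul (hS1 k) (hbd k) (norm_nonneg _) zero_le_one)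
              (by positivity) (by positivity)
        _ = _ := by ring
    · filter_upwards [ae_minkSq_ne (s := s) (m ^ 2)] with k hk
      have h0 : 0 < |minkSq k - m ^ 2| := abs_pos.2 (sub_ne_zero.2 hk)
      have h1 : Filter.Tendsto (fun β : ℝ => (((|minkSq k - m ^ 2| ^ β)⁻¹ : ℝ) : ℂ)) (𝓝[>] 0)
          (𝓝 1) := by
        have h2 : ContinuousAt (fun β : ℝ => (((|minkSq k - m ^ 2| ^ β)⁻¹ : ℝ) : ℂ)) 0 := by
          refine Complex.continuous_ofReal.continuousAt.comp ?_
          refine ContinuousAt.inv₀ (Real.continuousAt_const_rpow h0.ne') ?_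
          simp
        have h3 := h2.tendsto
        simp only [Real.rpow_zero, inv_one, Complex.ofReal_one] at h3
        exact h3.mono_left nhdsWithin_le_nhds
      simpa using h1.mul_const (S k * (osc f k * osc g (-k)))
  refine tendsto_nhds_unique hlim (tendsto_const_nhds.congr' ?_)
  filter_upwards [Ioo_mem_nhdsGT (zero_lt_one' ℝ)] with β hβ
  exact (hzero β hβ.1 hβ.2).symm

end

/-! ### Symmetries of the truncated functions -/

section

variable {s : ℕ} {m α : ℝ}

theorem integral_massShell_swap (hm : 0 < m) (f : Fin 2 → 𝓢(Spacetime s, ℂ))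
    (h : Separated (f 0) (f 1)) :
    ∫ k, ∏ l, osc (f (Equiv.swap 0 1 l)) (k l) ∂massShell s m =
      ∫ k, ∏ l, osc (f l) (k l) ∂massShell s m := by
  rw [integral_massShell_prod (fun l => osc (f (Equiv.swap 0 1 l))),
    integral_massShell_prod fun l => osc (f l)]
  simp only [Equiv.swap_apply_left, Equiv.swap_apply_right]
  obtain ⟨C, hC0, hC⟩ := exists_norm_le_inv_wt (osc (f 0))
  obtain ⟨D, hD0, hD⟩ := exists_norm_le_inv_wt (osc (f 1))
  have hbd : ∀ k, ‖osc (f 0) k * osc (f 1) (-k)‖ ≤ C * D * (wt k)⁻¹ := by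
    intro k
    rw [norm_mul]
    have h2 : (wt (-k))⁻¹ ≤ 1 := inv_le_one_of_one_le₀ (one_le_wt _)
    calc _ ≤ (C * (wt k)⁻¹) * (D * 1) := mul_le_mul (hC k)
          ((hD (-k)).trans (mul_le_mul_of_nonneg_left h2 hD0)) (norm_nonneg _)
          (mul_nonneg hC0 (inv_nonneg.2 (wt_pos k).le))
      _ = _ := by ring
  have hcont : Continuous fun k => osc (f 0) k * osc (f 1) (-k) :=
    (osc (f 0)).continuous.mul ((osc (f 1)).continuous.comp continuous_neg)
  have hint : Integrable fun k => osc (f 0) k * osc (f 1) (-k) :=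
    (integrable_inv_wt.const_mul (C * D)).mono' hcont.aestronglyMeasurable
      (Filter.Eventually.of_forall hbd)
  set H : Spacetime s → ℂ := fun k => osc (f 0) k * osc (f 1) (-k) with hH
  have h1 := massShell_eq_of_thinShell_eq (K := fun k => H (-k)) hm hcont
    (hcont.comp continuous_neg) hbd (D := C * D) (fun k => (hbd (-k)).trans_eq (by rw [wt_neg])) ?_
  · simp only [hH, neg_neg] at h1
    rw [← h1]
    refine integral_congr_ae (Filter.Eventually.of_forall fun p => ?_)
    simp only [mul_comm]
  intro δ hδ
  classical
  have hneg : ∀ S : Set (Spacetime s), MeasurableSet S →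
      ∫ k in S, H (-k) = ∫ k in Neg.neg ⁻¹' S, H k := by
    intro S hS
    rw [← (Measure.measurePreserving_neg volume).setIntegral_preimage_emb
      (MeasurableEquiv.neg (Spacetime s)).measurableEmbedding]
    simp
  rw [hneg _ (measurableSet_thinShell m δ)]
  have key : ∀ u : ℝ, 0 < u → ∫ k in {k | u < minkSq k ∧ 0 < k 0}, H k =
      ∫ k in {k | u < minkSq k ∧ k 0 < 0}, H k := by
    intro u hu
    have h2 := integral_sign_osc_osc_neg (Real.sqrt_pos.2 hu) h
    rw [Real.sq_sqrt hu.le] at h2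
    have m1 : MeasurableSet {k : Spacetime s | u < minkSq k ∧ 0 < k 0} :=
      (measurableSet_lt measurable_const measurable_minkSq).inter
        (measurableSet_lt measurable_const (measurable_coord 0))
    have m2 : MeasurableSet {k : Spacetime s | u < minkSq k ∧ k 0 < 0} :=
      (measurableSet_lt measurable_const measurable_minkSq).inter
        (measurableSet_lt (measurable_coord 0) measurable_const)
    rw [← sub_eq_zero, ← integral_indicator m1, ← integral_indicator m2,
      ← integral_sub (hint.indicator m1) (hint.indicator m2), ← h2]
    refine integral_congr_ae (Filter.Eventually.of_forall fun k => ?_)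
    simp only [Set.indicator, Set.mem_ofPred_eq]
    by_cases hk : u < minkSq k
    · have h0 : k 0 ≠ 0 := by
        intro h0
        have : minkSq k ≤ 0 := by rw [minkSq_eq, h0]; nlinarith [sq_nonneg ‖space k‖]
        linarith
      rcases lt_or_gt_of_ne h0 with h0 | h0
      · simp [hk, h0, not_lt.2 h0.le, hH]
      · simp [hk, h0, not_lt.2 h0.le, hH]
    · simp [hk]
  have d1 : ∀ (q : Spacetime s → Prop) (_ : MeasurableSet {k | q k}),
      ∫ k in {k | m ^ 2 < minkSq k ∧ minkSq k ≤ m ^ 2 + δ ∧ q k}, H k =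
      (∫ k in {k | m ^ 2 < minkSq k ∧ q k}, H k) -
        ∫ k in {k | m ^ 2 + δ < minkSq k ∧ q k}, H k := by
    intro q hq
    have m1 : ∀ u, MeasurableSet {k : Spacetime s | u < minkSq k ∧ q k} := fun u =>
      (measurableSet_lt measurable_const measurable_minkSq).inter hq
    rw [← setIntegral_sdiff (m1 _) hint.integrableOn]
    · congr 2
      ext k
      simp only [Set.mem_ofPred_eq, Set.mem_sdiff, not_and]
      constructor
      · rintro ⟨a, b, c⟩
        exact ⟨⟨a, c⟩, fun h => absurd b (not_le.2 h)⟩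
      · rintro ⟨⟨a, c⟩, b⟩
        exact ⟨a, not_lt.1 fun h => b h c, c⟩
    · rintro k ⟨a, b⟩
      exact ⟨by linarith, b⟩
  have d2 : Neg.neg ⁻¹' thinShell s m δ =
      {k | m ^ 2 < minkSq k ∧ minkSq k ≤ m ^ 2 + δ ∧ k 0 < 0} := by
    ext k
    simp [thinShell, minkSq_neg]
  rw [d2, d1 _ (measurableSet_lt (measurable_coord 0) measurable_const), thinShell,
    d1 _ (measurableSet_lt measurable_const (measurable_coord 0)), key _ (by positivity),
    key _ (by positivity)]

/-- Locality of the truncated functions. -/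
theorem integral_truncMeasure_swap (hm : 0 < m) (hα0 : 0 < α) (hα : α ≤ 1 / 2) {n : ℕ}
    {i j : Fin n} (hij : (i : ℕ) + 1 = j) (f : Fin n → 𝓢(Spacetime s, ℂ))
    (hf : Separated (f i) (f j)) :
    ∫ k, ∏ l, osc (f (Equiv.swap i j l)) (k l) ∂truncMeasure s m α n =
      ∫ k, ∏ l, osc (f l) (k l) ∂truncMeasure s m α n := by
  rcases truncMeasure_cases s m α n with ⟨h, h'⟩ | ⟨rfl, -, h⟩
  · rw [h]
    exact integral_truncRegular_swap hm hα0 hα (fun h1 h2 => h' ⟨h1, h2⟩) hij f hf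
  · have h0 : i = 0 ∧ j = 1 := by
      constructor <;> ext <;> have := i.2 <;> have := j.2 <;> simp <;> omega
    obtain ⟨rfl, rfl⟩ := h0
    rw [h]
    simp only
    rw [integral_smul_measure, integral_smul_measure, integral_massShell_swap hm f hf]

theorem muPlus_neg (k : Spacetime s) : muPlus m α (-k) = muMinus m α k := by
  simp [muPlus, muMinus, minkSq_neg]

theorem muMinus_neg (k : Spacetime s) : muMinus m α (-k) = muPlus m α k := by
  simp [muPlus, muMinus, minkSq_neg]

theorem muMid_neg (k : Spacetime s) : muMid m α (-k) = muMid m α k := by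
  simp [muMid, minkSq_neg]

theorem IsLorentz.muPlus {L : Spacetime s ≃ₗ[ℝ] Spacetime s} (h : IsLorentz L) (k : Spacetime s) :
    muPlus m α (L k) = IndefQFT.muPlus m α k := by
  have h1 : (m ^ 2 < IndefQFT.minkSq k ∧ 0 < L k 0) ↔ (m ^ 2 < IndefQFT.minkSq k ∧ 0 < k 0) :=
    and_congr_right fun hk => h.zero_lt_iff (lt_of_le_of_lt (sq_nonneg m) hk)
  simp only [IndefQFT.muPlus, h.minkSq, h1]

theorem IsLorentz.muMinus {L : Spacetime s ≃ₗ[ℝ] Spacetime s} (h : IsLorentz L) (k : Spacetime s) :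
    muMinus m α (L k) = IndefQFT.muMinus m α k := by
  rw [← muPlus_neg, ← muPlus_neg, ← map_neg, h.muPlus]

theorem IsLorentz.muMid {L : Spacetime s ≃ₗ[ℝ] Spacetime s} (h : IsLorentz L) (k : Spacetime s) :
    muMid m α (L k) = IndefQFT.muMid m α k := by
  simp only [IndefQFT.muMid, h.minkSq]

theorem measurePreserving_deltaSum_linear {L : Spacetime s ≃ₗ[ℝ] Spacetime s}
    (hL : MeasurePreserving L volume volume) (n : ℕ) :
    MeasurePreserving (fun (k : Fin n → Spacetime s) l => L (k l)) (deltaSum s n)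
      (deltaSum s n) := by
  have hLm : Measurable L := hL.measurable
  rcases n with _ | n
  · exact ⟨by fun_prop, by simp [deltaSum]⟩
  have h1 := volume_preserving_pi (fun _ : Fin n => hL)
  refine ⟨by fun_prop, ?_⟩
  rw [deltaSum_succ, Measure.map_map (by fun_prop) (measurable_snocNeg n)]
  have h2 : ((fun (k : Fin (n + 1) → Spacetime s) l => L (k l)) ∘ snocNeg n) =
      snocNeg n ∘ fun (k : Fin n → Spacetime s) l => L (k l) := by
    funext k l
    refine Fin.lastCases ?_ (fun l => ?_) l
    · simp [map_sum]
    · simp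
  rw [h2, ← Measure.map_map (measurable_snocNeg n) h1.measurable]
  congr 1
  exact h1.map_eq

theorem measurableEmbedding_linear (L : Spacetime s ≃ₗ[ℝ] Spacetime s) (n : ℕ) :
    MeasurableEmbedding fun (k : Fin n → Spacetime s) l => L (k l) :=
  (MeasurableEquiv.piCongrRight fun _ : Fin n =>
    L.toContinuousLinearEquiv.toHomeomorph.toMeasurableEquiv).measurableEmbedding

/-- Lorentz invariance of the truncated functions. -/
theorem integral_truncMeasure_lorentz (hm : 0 < m) (hα0 : 0 < α) (hα : α ≤ 1 / 2) {n : ℕ}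
    {L : Spacetime s ≃ₗ[ℝ] Spacetime s} (hL : IsLorentz L) (F : Fin n → 𝓢(Spacetime s, ℂ)) :
    ∫ k, ∏ l, F l (L (k l)) ∂truncMeasure s m α n = ∫ k, ∏ l, F l (k l) ∂truncMeasure s m α n := by
  rcases truncMeasure_cases s m α n with ⟨h, -⟩ | ⟨rfl, -, h⟩
  · rw [h, integral_truncRegular hα0 hα, integral_truncRegular hα0 hα]
    congr 1
    refine Eq.trans ?_ ((measurePreserving_deltaSum_linear hL.measurePreserving n).integral_comp
      (measurableEmbedding_linear L n) fun k => truncDensity m α k • ∏ l, F l (k l))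
    simp only [truncDensity, hL.muPlus, hL.muMinus, hL.muMid]
  · rw [h]
    simp only
    rw [integral_smul_measure, integral_smul_measure,
      integral_massShell_prod (fun l k => F l (L k)), integral_massShell_prod fun l => ⇑(F l)]
    congr 1
    have hbd : ∀ F G : 𝓢(Spacetime s, ℂ), ∃ C, ∀ k, ‖F (-k) * G k‖ ≤ C * (wt k)⁻¹ := by
      intro F G
      obtain ⟨C, hC0, hC⟩ := exists_norm_le_inv_wt F
      obtain ⟨D, hD0, hD⟩ := exists_norm_le_inv_wt G
      refine ⟨C * D, fun k => ?_⟩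
      rw [norm_mul]
      have h2 : (wt (-k))⁻¹ ≤ 1 := inv_le_one_of_one_le₀ (one_le_wt _)
      calc _ ≤ (C * 1) * (D * (wt k)⁻¹) := mul_le_mul
            ((hC (-k)).trans (mul_le_mul_of_nonneg_left h2 hC0)) (hD k) (norm_nonneg _)
            (by positivity)
        _ = _ := by ring
    obtain ⟨C, hC⟩ := hbd (F 0) (F 1)
    obtain ⟨D, hD⟩ := hbd (transform L.symm (F 0)) (transform L.symm (F 1))
    have hc : ∀ F G : 𝓢(Spacetime s, ℂ), Continuous fun k => F (-k) * G k := fun F G =>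
      (F.continuous.comp continuous_neg).mul G.continuous
    have ht : ∀ (F : 𝓢(Spacetime s, ℂ)) k, transform L.symm F k = F (L k) := fun F k => rfl
    have := massShell_eq_of_thinShell_eq hm (hc _ _) (hc _ _) hD hC fun δ hδ => ?_
    · simpa only [ht] using this
    · have hpre : L ⁻¹' thinShell s m δ = thinShell s m δ := by
        ext k
        simp only [thinShell, Set.mem_preimage, Set.mem_ofPred_eq, hL.minkSq]
        exact and_congr_right fun hk => and_congr_right fun _ =>
          hL.zero_lt_iff (lt_of_le_of_lt (sq_nonneg m) hk)
      refine Eq.trans ?_ (hL.measurePreserving.setIntegral_preimage_emb hL.measurableEmbedding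
        (fun k => F 0 (-k) * F 1 k) _)
      rw [hpre]
      simp only [ht, map_neg]

theorem truncDensity_neg_rev {n : ℕ} (k : Fin n → Spacetime s) :
    truncDensity m α (fun l => -k (Fin.rev l)) = truncDensity m α k := by
  unfold truncDensity
  rw [← Equiv.sum_comp Fin.revPerm]
  refine Finset.sum_congr rfl fun j _ => ?_
  rw [← Equiv.prod_comp Fin.revPerm]
  refine Finset.prod_congr rfl fun l _ => ?_
  simp only [Fin.revPerm_apply, Fin.rev_rev, muPlus_neg, muMinus_neg, muMid_neg, Fin.rev_lt_rev,
    Fin.rev_inj]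
  rcases lt_trichotomy l j with h | rfl | h
  · simp [h, h.ne, not_lt.2 h.le]
  · simp
  · simp [h, h.ne', not_lt.2 h.le]

/-- Hermiticity of the truncated functions. -/
theorem integral_truncMeasure_rev (hα0 : 0 < α) (hα : α ≤ 1 / 2) {n : ℕ}
    (F : Fin n → Spacetime s → ℂ) :
    ∫ k, ∏ l, conj (F (Fin.rev l) (-k l)) ∂truncMeasure s m α n =
      conj (∫ k, ∏ l, F l (k l) ∂truncMeasure s m α n) := by
  rw [← integral_conj]
  rcases truncMeasure_cases s m α n with ⟨h, -⟩ | ⟨rfl, -, h⟩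
  · rw [h, integral_truncRegular hα0 hα, integral_truncRegular hα0 hα]
    congr 1
    have hneg : MeasurePreserving (LinearEquiv.neg ℝ (M := Spacetime s)) volume volume :=
      Measure.measurePreserving_neg volume
    rw [← (measurePreserving_deltaSum_linear hneg n).integral_comp (measurableEmbedding_linear _ n),
      ← integral_deltaSum_perm Fin.revPerm]
    refine integral_congr_ae (Filter.Eventually.of_forall fun k => ?_)
    have h1 : (fun l => (LinearEquiv.neg ℝ (M := Spacetime s)) ((k ∘ Fin.revPerm) l)) =
      fun l => -k (Fin.rev l) := rfl
    simp only [h1]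
    rw [truncDensity_neg_rev]
    simp only [map_prod]
    rw [← Equiv.prod_comp Fin.revPerm]
    simp
  · rw [h]
    simp only [map_prod]
    rw [integral_smul_measure, integral_smul_measure,
      integral_massShell_prod (fun l k => conj (F (Fin.rev l) (-k))),
      integral_massShell_prod fun l k => conj (F l k)]
    congr 2
    funext p
    have h0 : Fin.rev (0 : Fin 2) = 1 := rfl
    have h1 : Fin.rev (1 : Fin 2) = 0 := rfl
    simp only [h0, h1, neg_neg, mul_comm]

end

/-! ### Symmetries of the full functions -/

section

variable {s : ℕ} {m α : ℝ} {c : ℕ → ℝ}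

/-- The contribution of a block of labels. -/
def blockInt (m α : ℝ) (c : ℕ → ℝ) {n : ℕ} (F : Fin n → Spacetime s → ℂ) (B : Finset (Fin n)) : ℂ :=
  c B.card * ∫ k, ∏ l, F (emb B l) (k l) ∂truncMeasure s m α B.card

/-- The momentum space `n`-point function on product functions. -/
def nPoint (m α : ℝ) (c : ℕ → ℝ) {n : ℕ} (F : Fin n → Spacetime s → ℂ) : ℂ :=
  ∑ P : Finpartition (Finset.univ : Finset (Fin n)),
    (((∏ B ∈ P.parts, c B.card : ℝ)) : ℂ) * ∫ k, ∏ i, F i (k i) ∂partitionMeasure s m α P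

theorem nPoint_eq {n : ℕ} {F : Fin n → Spacetime s → ℂ} (hF : ∀ i, Measurable (F i)) :
    nPoint m α c F = ∑ P : Finpartition (Finset.univ : Finset (Fin n)),
      ∏ B ∈ P.parts, blockInt m α c F B := by
  refine Finset.sum_congr rfl fun P _ => ?_
  rw [integral_prod_partitionMeasure m α P F hF, Complex.ofReal_prod, ← Finset.prod_mul_distrib]
  rfl

theorem blockInt_eq {n r : ℕ} (F : Fin n → Spacetime s → ℂ) (e : Fin r ↪o Fin n)
    {C : Finset (Fin n)} (hC : ∀ l, e l ∈ C) (hr : C.card = r) :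
    blockInt m α c F C = c r * ∫ k, ∏ l, F (e l) (k l) ∂truncMeasure s m α r := by
  subst hr
  have : e = emb C := Finset.orderEmbOfFin_unique' rfl hC
  rw [this, blockInt]

theorem nPoint_perm {n : ℕ} (σ : Equiv.Perm (Fin n)) {F G : Fin n → Spacetime s → ℂ}
    (hF : ∀ i, Measurable (F i)) (hG : ∀ i, Measurable (G i))
    (h : ∀ B, blockInt m α c G B = blockInt m α c F (B.map σ.toEmbedding)) :
    nPoint m α c G = nPoint m α c F := by
  rw [nPoint_eq hF, nPoint_eq hG]
  simp_rw [h]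
  exact sum_finpartition_perm σ _

theorem nPoint_swap (hm : 0 < m) (hα0 : 0 < α) (hα : α ≤ 1 / 2) {n : ℕ} {i j : Fin n}
    (hij : (i : ℕ) + 1 = j) (f : Fin n → 𝓢(Spacetime s, ℂ)) (hf : Separated (f i) (f j)) :
    nPoint m α c (fun l => ⇑(osc (f (Equiv.swap i j l)))) = nPoint m α c fun l => ⇑(osc (f l)) := by
  have hlt : i < j := by rw [Fin.lt_def]; omega
  refine nPoint_perm (Equiv.swap i j) (fun l => (osc _).continuous.measurable)
    (fun l => (osc _).continuous.measurable) fun B => ?_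
  by_cases hB : i ∈ B ∧ j ∈ B
  · have hBB : B.map (Equiv.swap i j).toEmbedding = B := by
      ext l
      rw [Finset.mem_map_equiv, Equiv.symm_swap]
      rcases eq_or_ne l i with rfl | h1
      · simp [hB]
      rcases eq_or_ne l j with rfl | h2
      · simp [hB]
      rw [Equiv.swap_apply_of_ne_of_ne h1 h2]
    rw [hBB]
    have hr : ∀ x ∈ B, ∃ a, emb B a = x := fun x hx => by
      have : x ∈ Finset.univ.map (emb B).toEmbedding := by rwa [map_emb]
      obtain ⟨a, -, ha⟩ := Finset.mem_map.1 this
      exact ⟨a, ha⟩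
    obtain ⟨a, ha⟩ := hr i hB.1
    obtain ⟨b, hb⟩ := hr j hB.2
    have hab : a < b := by rw [← (emb B).lt_iff_lt, ha, hb]; exact hlt
    have hab' : (a : ℕ) + 1 = b := by
      by_contra hne
      have h1 : (a : ℕ) + 1 < b := by rw [Fin.lt_def] at hab; omega
      let d : Fin B.card := ⟨a + 1, by omega⟩
      have h2 : emb B a < emb B d := (emb B).lt_iff_lt.2 (by rw [Fin.lt_def]; simp [d])
      have h3 : emb B d < emb B b := (emb B).lt_iff_lt.2 (by rw [Fin.lt_def]; exact h1)
      rw [ha] at h2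
      rw [hb] at h3
      rw [Fin.lt_def] at h2 h3
      omega
    have key := integral_truncMeasure_swap hm hα0 hα hab' (fun l => f (emb B l))
      (by simpa [ha, hb] using hf)
    rw [blockInt, blockInt, ← key]
    congr 2
    funext k
    refine Finset.prod_congr rfl fun l _ => ?_
    rw [← ha, ← hb, ← (emb B).injective.swap_apply]
  · have hmono : StrictMono fun l => Equiv.swap i j (emb B l) := by
      intro a b hab
      have h1 : emb B a < emb B b := (emb B).lt_iff_lt.2 hab
      have ha := emb_mem B a
      have hb := emb_mem B b
      have hne : ¬ (emb B a = i ∧ emb B b = j) := fun h => hB ⟨h.1 ▸ ha, h.2 ▸ hb⟩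
      simp only [Equiv.swap_apply_def]
      simp only [Fin.lt_def, Fin.ext_iff] at h1 hne hlt ⊢
      split_ifs <;> omega
    rw [blockInt_eq (r := B.card) (C := B.map (Equiv.swap i j).toEmbedding) _
      (OrderEmbedding.ofStrictMono _ hmono)
      (fun l => Finset.mem_map_of_mem (Equiv.swap i j).toEmbedding (emb_mem B l))
      (Finset.card_map _)]
    rfl

theorem nPoint_rev (hα0 : 0 < α) (hα : α ≤ 1 / 2) {n : ℕ}
    {F : Fin n → Spacetime s → ℂ} (hF : ∀ i, Measurable (F i)) :
    nPoint m α c (fun l k => conj (F (Fin.rev l) (-k))) = conj (nPoint m α c F) := by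
  have hG : ∀ l : Fin n, Measurable fun k => conj (F (Fin.rev l) (-k)) := fun l =>
    Complex.continuous_conj.measurable.comp ((hF _).comp measurable_neg)
  rw [nPoint_eq hF, nPoint_eq hG, map_sum]
  simp_rw [map_prod]
  rw [← sum_finpartition_perm Fin.revPerm fun B => conj (blockInt m α c F B)]
  refine Finset.sum_congr rfl fun P _ => Finset.prod_congr rfl fun B _ => ?_
  have hmono : StrictMono fun l => Fin.rev (emb B (Fin.rev l)) := fun a b hab => by
    simp only [Fin.rev_lt_rev, OrderEmbedding.lt_iff_lt]
    exact hab
  rw [blockInt_eq (r := B.card) (C := B.map Fin.revPerm.toEmbedding) F (OrderEmbedding.ofStrictMono _ hmono)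
      (fun l => Finset.mem_map_of_mem (f := Fin.revPerm.toEmbedding) (emb_mem B (Fin.rev l)))
      (Finset.card_map _), map_mul, Complex.conj_ofReal, ← integral_truncMeasure_rev hα0 hα, blockInt]
  congr 2
  funext k
  refine Finset.prod_congr rfl fun l _ => ?_
  simp

theorem nPoint_lorentz (hm : 0 < m) (hα0 : 0 < α) (hα : α ≤ 1 / 2) {n : ℕ}
    {L : Spacetime s ≃ₗ[ℝ] Spacetime s} (hL : IsLorentz L) (F : Fin n → 𝓢(Spacetime s, ℂ)) :
    nPoint m α c (fun l k => F l (L k)) = nPoint m α c fun l => ⇑(F l) := by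
  rw [nPoint_eq (F := fun l k => F l (L k)) (fun l => (F l).continuous.measurable.comp hL.measurePreserving.measurable),
    nPoint_eq fun l => (F l).continuous.measurable]
  refine Finset.sum_congr rfl fun P _ => Finset.prod_congr rfl fun B _ => ?_
  rw [blockInt, blockInt, integral_truncMeasure_lorentz hm hα0 hα hL fun l => F (emb B l)]

theorem nPoint_wave {n : ℕ} (a : Spacetime s) (F : Fin n → Spacetime s → ℂ) :
    nPoint m α c (fun l k => wave k a * F l k) = nPoint m α c F := by
  refine Finset.sum_congr rfl fun P _ => ?_
  congr 1
  refine integral_congr_ae ?_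
  filter_upwards [ae_spectralTuple_partitionMeasure m α P] with k hk
  rw [Finset.prod_mul_distrib, ← wave_sum_left, hk.1, wave_zero_left, one_mul]

/-! ### Functions of lists of test functions -/

/-- The Wightman function of a list of test functions. -/
def wl (m α : ℝ) (c : ℕ → ℝ) (L : List 𝓢(Spacetime s, ℂ)) : ℂ :=
  nPoint m α c fun i : Fin L.length => ⇑(pw (L.getD i 0))

theorem wl_eq_of_length (L : List 𝓢(Spacetime s, ℂ)) {n : ℕ} (h : L.length = n) :
    wl m α c L = nPoint m α c fun i : Fin n => ⇑(pw (L.getD i 0)) := by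
  subst h; rfl

theorem wightman_prod {n : ℕ} (f : Fin n → 𝓢(Spacetime s, ℂ)) :
    wightman s m α c n (fun x => ∏ i, f i (x i)) = wl m α c (List.ofFn f) := by
  rw [wl_eq_of_length _ (List.length_ofFn), wightman, nPoint]
  refine Finset.sum_congr rfl fun P _ => ?_
  congr 1
  refine integral_congr_ae (Filter.Eventually.of_forall fun k => ?_)
  simp only
  rw [planeWaveTransform_prod]
  refine Finset.prod_congr rfl fun i _ => ?_
  simp [List.getD_eq_getElem?_getD]

theorem pw_eq_osc (f : 𝓢(Spacetime s, ℂ)) : pw f = osc ((muConst s : ℂ) • f) := by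
  rw [pw, map_smul]

theorem wl_swap (hm : 0 < m) (hα0 : 0 < α) (hα : α ≤ 1 / 2) (L₁ L₂ : List 𝓢(Spacetime s, ℂ))
    {f g : 𝓢(Spacetime s, ℂ)} (h : Separated f g) :
    wl m α c (L₁ ++ g :: f :: L₂) = wl m α c (L₁ ++ f :: g :: L₂) := by
  set n := L₁.length + (L₂.length + 2) with hn
  rw [wl_eq_of_length (n := n) _ (by simp [hn]), wl_eq_of_length (n := n) _ (by simp [hn])]
  let i : Fin n := ⟨L₁.length, by omega⟩
  let j : Fin n := ⟨L₁.length + 1, by omega⟩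
  have hi : (L₁ ++ f :: g :: L₂).getD i 0 = f := by simp [i, List.getD_eq_getElem?_getD]
  have hj : (L₁ ++ f :: g :: L₂).getD j 0 = g := by
    simp [j, List.getD_eq_getElem?_getD]
  have key := nPoint_swap (c := c) hm hα0 hα (i := i) (j := j) rfl
    (fun l => (muConst s : ℂ) • (L₁ ++ f :: g :: L₂).getD l 0) (by
      simp only [hi, hj]; exact h.smul _)
  simp_rw [← pw_eq_osc] at key
  rw [← key]
  congr 1
  funext l
  congr 2
  rcases eq_or_ne l i with rfl | h1
  · rw [Equiv.swap_apply_left, hj]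
    simp [i, List.getD_eq_getElem?_getD]
  rcases eq_or_ne l j with rfl | h2
  · rw [Equiv.swap_apply_right, hi]
    simp [j, List.getD_eq_getElem?_getD]
  rw [Equiv.swap_apply_of_ne_of_ne h1 h2]
  have h1' : (l : ℕ) ≠ L₁.length := fun h => h1 (Fin.ext h)
  have h2' : (l : ℕ) ≠ L₁.length + 1 := fun h => h2 (Fin.ext h)
  simp only [List.getD_eq_getElem?_getD, List.getElem?_append]
  split_ifs with h3
  · rfl
  · obtain ⟨r, hr⟩ : ∃ r, (l : ℕ) - L₁.length = r + 2 := ⟨(l : ℕ) - L₁.length - 2, by omega⟩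
    rw [hr]
    simp

theorem wl_reverse (hα0 : 0 < α) (hα : α ≤ 1 / 2) (L : List 𝓢(Spacetime s, ℂ)) :
    wl m α c (L.map conjFn).reverse = conj (wl m α c L) := by
  rw [wl_eq_of_length (n := L.length) _ (by simp), wl,
    ← nPoint_rev hα0 hα fun i => (pw _).continuous.measurable]
  congr 1
  funext i k
  have h1 : (L.map conjFn).reverse.getD i 0 = conjFn (L.getD (Fin.rev i) 0) := by
    have h2 : ((Fin.rev i : Fin _) : ℕ) = L.length - 1 - i := by rw [Fin.val_rev]; omega
    have h3 : L.length - 1 - i < L.length := by have := i.2; omega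
    rw [h2, List.getD_eq_getElem?_getD, List.getD_eq_getElem?_getD,
      List.getElem?_reverse (by simp), List.length_map, List.getElem?_map,
      List.getElem?_eq_getElem h3]
    rfl
  rw [h1, pw_conjFn]

theorem poincareAct_eq (g : poincareGroup s) (f : 𝓢(Spacetime s, ℂ)) :
    poincareAct g f = shift (g.1 0) (transform (AffineEquiv.linear g.1) f) := rfl

theorem pw_shift (a : Spacetime s) (f : 𝓢(Spacetime s, ℂ)) (k : Spacetime s) :
    pw (shift a f) k = wave k a * pw f k := by
  rw [pw, pw, smul_apply, smul_apply, osc_shift, smul_eq_mul, smul_eq_mul]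
  ring

theorem pw_transform {L : Spacetime s ≃ₗ[ℝ] Spacetime s} (h : IsLorentz L)
    (f : 𝓢(Spacetime s, ℂ)) (k : Spacetime s) : pw (transform L f) k = pw f (dual L k) := by
  rw [pw, pw, smul_apply, smul_apply, osc_transform h]

theorem wl_poincareAct (hm : 0 < m) (hα0 : 0 < α) (hα : α ≤ 1 / 2) (g : poincareGroup s)
    (L : List 𝓢(Spacetime s, ℂ)) : wl m α c (L.map (poincareAct g)) = wl m α c L := by
  have hL : IsLorentz (AffineEquiv.linear g.1) := isLorentz_of_mem g.2
  rw [wl_eq_of_length (n := L.length) _ (by simp), wl,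
    ← nPoint_lorentz hm hα0 hα hL.dual fun l : Fin L.length => pw (L.getD l 0)]
  refine Eq.trans ?_ (nPoint_wave (g.1 0) _)
  congr 1
  funext i k
  have h1 : (L.map (poincareAct g)).getD i 0 = poincareAct g (L.getD i 0) := by
    simp [List.getD_eq_getElem?_getD]
  rw [h1, poincareAct_eq, pw_shift, pw_transform hL]

end

/-! ### Weighted composition and multiplication operators on `L²` -/

section

variable {X Y : Type*} [MeasurableSpace X] [MeasurableSpace Y]

theorem exists_wpull {ρ : Measure X} {τ : Measure Y} {p : Y → X} (hp : Measurable p)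
    (hle : τ.map p ≤ ρ) {φ : Y → ℂ} (hφ : Measurable φ) (h1 : ∀ y, ‖φ y‖ ≤ 1) :
    ∃ T : Lp ℂ 2 ρ →L[ℂ] Lp ℂ 2 τ, ∀ f, T f =ᵐ[τ] fun y => φ y * f (p y) := by
  have hae : ∀ {P : X → Prop}, (∀ᵐ x ∂ρ, P x) → ∀ᵐ y ∂τ, P (p y) := fun h =>
    ae_of_ae_map hp.aemeasurable (ae_mono hle h)
  have hcomp : ∀ f : Lp ℂ 2 ρ, MemLp (fun y => f (p y)) 2 τ := fun f =>
    ((Lp.memLp f).mono_measure hle).comp_of_map hp.aemeasurable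
  have hmem : ∀ f : Lp ℂ 2 ρ, MemLp (fun y => φ y * f (p y)) 2 τ := fun f =>
    (hcomp f).of_le (hφ.aestronglyMeasurable.mul (hcomp f).aestronglyMeasurable)
      (Filter.Eventually.of_forall fun y => by
        rw [norm_mul]; exact mul_le_of_le_one_left (norm_nonneg _) (h1 y))
  let T : Lp ℂ 2 ρ →ₗ[ℂ] Lp ℂ 2 τ :=
    { toFun := fun f => (hmem f).toLp
      map_add' := fun f g => by
        rw [← MemLp.toLp_add]
        refine MemLp.toLp_congr _ _ ?_
        filter_upwards [hae (Lp.coeFn_add f g)] with y hy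
        simp only [hy, Pi.add_apply, mul_add]
      map_smul' := fun c f => by
        rw [RingHom.id_apply, ← MemLp.toLp_const_smul]
        refine MemLp.toLp_congr _ _ ?_
        filter_upwards [hae (Lp.coeFn_smul c f)] with y hy
        simp only [hy, Pi.smul_apply, smul_eq_mul]
        ring }
  refine ⟨T.mkContinuous 1 fun f => ?_, fun f => (hmem f).coeFn_toLp⟩
  rw [one_mul]
  change ‖(hmem f).toLp‖ ≤ _
  rw [Lp.norm_toLp, Lp.norm_def]
  refine ENNReal.toReal_mono (Lp.memLp f).eLpNorm_ne_top ?_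
  calc eLpNorm (fun y => φ y * f (p y)) 2 τ ≤ eLpNorm (fun y => f (p y)) 2 τ :=
        eLpNorm_mono fun y => by
          rw [norm_mul]; exact mul_le_of_le_one_left (norm_nonneg _) (h1 y)
    _ = eLpNorm f 2 (τ.map p) :=
        (eLpNorm_map_measure ((Lp.aestronglyMeasurable f).mono_measure hle) hp.aemeasurable).symm
    _ ≤ eLpNorm f 2 ρ := eLpNorm_mono_measure _ hle

/-- Measurable functions bounded by one. -/
structure Mult (φ : X → ℂ) : Prop where
  measurable : Measurable φ
  le_one : ∀ x, ‖φ x‖ ≤ 1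

theorem Mult.conj {φ : X → ℂ} (h : Mult φ) : Mult fun x => conj (φ x) :=
  ⟨Complex.continuous_conj.measurable.comp h.measurable, fun x => by
    rw [RCLike.norm_conj]; exact h.le_one x⟩

theorem Mult.mul {φ ψ : X → ℂ} (h : Mult φ) (h' : Mult ψ) : Mult fun x => φ x * ψ x :=
  ⟨h.measurable.mul h'.measurable, fun x => by
    rw [norm_mul]; exact mul_le_one₀ (h.le_one x) (norm_nonneg _) (h'.le_one x)⟩

theorem Mult.comp {φ : X → ℂ} (h : Mult φ) {q : Y → X} (hq : Measurable q) :
    Mult fun y => φ (q y) := ⟨h.measurable.comp hq, fun _ => h.le_one _⟩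

theorem mult_one : Mult fun _ : X => (1 : ℂ) := ⟨measurable_const, fun _ => by simp⟩

theorem mult_indicator {A : Set X} (hA : MeasurableSet A) :
    Mult (A.indicator fun _ => (1 : ℂ)) :=
  ⟨measurable_const.indicator hA, fun x => by
    by_cases h : x ∈ A <;> simp [h]⟩

variable (ρ : Measure X)

open Classical in
/-- Multiplication by a measurable function bounded by one (zero for other functions). -/
def mulOp (φ : X → ℂ) : Lp ℂ 2 ρ →L[ℂ] Lp ℂ 2 ρ :=
  if h : Mult φ then
    (exists_wpull (ρ := ρ) (τ := ρ) measurable_id (by rw [Measure.map_id]) h.measurable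
      h.le_one).choose else 0

variable {ρ}

theorem mulOp_apply {φ : X → ℂ} (h : Mult φ) (f : Lp ℂ 2 ρ) :
    mulOp ρ φ f =ᵐ[ρ] fun x => φ x * f x := by
  rw [mulOp, dif_pos h]
  exact (exists_wpull (ρ := ρ) (τ := ρ) measurable_id (by rw [Measure.map_id]) h.measurable
      h.le_one).choose_spec f

theorem mulOp_mul_apply {φ ψ : X → ℂ} (h : Mult φ) (h' : Mult ψ) (f : Lp ℂ 2 ρ) :
    mulOp ρ (fun x => φ x * ψ x) f = mulOp ρ φ (mulOp ρ ψ f) := by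
  refine Lp.ext ?_
  filter_upwards [mulOp_apply (h.mul h') f, mulOp_apply h (mulOp ρ ψ f), mulOp_apply h' f]
    with x h1 h2 h3
  rw [h1, h2, h3, mul_assoc]

theorem mulOp_one_apply (f : Lp ℂ 2 ρ) : mulOp ρ (fun _ => 1) f = f := by
  refine Lp.ext ?_
  filter_upwards [mulOp_apply mult_one f] with x h1
  rw [h1, one_mul]

theorem inner_eq_integral (f g : Lp ℂ 2 ρ) : ⟪f, g⟫_ℂ = ∫ x, conj (f x) * g x ∂ρ := by
  rw [L2.inner_def]
  simp only [RCLike.inner_apply, mul_comm]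

theorem integrable_inner (f g : Lp ℂ 2 ρ) : Integrable (fun x => conj (f x) * g x) ρ := by
  have := L2.integrable_inner (𝕜 := ℂ) f g
  simpa only [RCLike.inner_apply, mul_comm] using this

theorem inner_mulOp (f g : Lp ℂ 2 ρ) {φ : X → ℂ} (h : Mult φ) :
    ⟪f, mulOp ρ φ g⟫_ℂ = ∫ x, φ x * (conj (f x) * g x) ∂ρ := by
  rw [inner_eq_integral]
  refine integral_congr_ae ?_
  filter_upwards [mulOp_apply h g] with x h1
  rw [h1]; ring

theorem mulOp_inner (f g : Lp ℂ 2 ρ) {φ : X → ℂ} (h : Mult φ) :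
    ⟪mulOp ρ φ f, g⟫_ℂ = ⟪f, mulOp ρ (fun x => conj (φ x)) g⟫_ℂ := by
  rw [inner_mulOp _ _ h.conj, inner_eq_integral]
  refine integral_congr_ae ?_
  filter_upwards [mulOp_apply h f] with x h1
  rw [h1, map_mul]; ring

theorem norm_mulOp_of_norm_eq_one {φ : X → ℂ} (h : Mult φ) (h1 : ∀ x, ‖φ x‖ = 1) (f : Lp ℂ 2 ρ) :
    ‖mulOp ρ φ f‖ = ‖f‖ := by
  rw [Lp.norm_def, Lp.norm_def]
  congr 1
  refine eLpNorm_congr_norm_ae ?_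
  filter_upwards [mulOp_apply h f] with x hx
  rw [hx, norm_mul, h1, one_mul]

theorem norm_sq_eq_integral (f : Lp ℂ 2 ρ) : ‖f‖ ^ 2 = ∫ x, ‖f x‖ ^ 2 ∂ρ := by
  have h1 : ((‖f‖ ^ 2 : ℝ) : ℂ) = ((∫ x, ‖f x‖ ^ 2 ∂ρ : ℝ) : ℂ) := by
    have h2 := inner_self_eq_norm_sq_to_K (𝕜 := ℂ) f
    refine Eq.trans (by push_cast; exact h2.symm) ?_
    rw [inner_eq_integral, ← integral_complex_ofReal]
    refine integral_congr_ae (Filter.Eventually.of_forall fun x => ?_)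
    simp only
    rw [mul_comm, Complex.mul_conj, Complex.normSq_eq_norm_sq]
  exact_mod_cast h1

/-- Multiplication operators depend continuously on the function, for pointwise convergence. -/
theorem tendsto_mulOp {ι : Type*} {l : Filter ι} [l.IsCountablyGenerated] {φ : ι → X → ℂ}
    {ψ : X → ℂ} (h : ∀ i, Mult (φ i)) (hψ : Mult ψ)
    (hlim : ∀ᵐ x ∂ρ, Filter.Tendsto (fun i => φ i x) l (𝓝 (ψ x))) (f : Lp ℂ 2 ρ) :
    Filter.Tendsto (fun i => mulOp ρ (φ i) f) l (𝓝 (mulOp ρ ψ f)) := by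
  rw [tendsto_iff_norm_sub_tendsto_zero]
  have hsq : Filter.Tendsto (fun i => ‖mulOp ρ (φ i) f - mulOp ρ ψ f‖ ^ 2) l (𝓝 0) := by
    have e : ∀ i, ‖mulOp ρ (φ i) f - mulOp ρ ψ f‖ ^ 2 =
        ∫ x, ‖(φ i x - ψ x) * f x‖ ^ 2 ∂ρ := by
      intro i
      rw [norm_sq_eq_integral]
      refine integral_congr_ae ?_
      filter_upwards [mulOp_apply (h i) f, mulOp_apply hψ f,
        Lp.coeFn_sub (mulOp ρ (φ i) f) (mulOp ρ ψ f)] with x h1 h2 h3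
      rw [h3, Pi.sub_apply, h1, h2, sub_mul]
    simp_rw [e]
    rw [← integral_zero X ℝ (μ := ρ)]
    refine tendsto_integral_filter_of_dominated_convergence (fun x => 4 * ‖f x‖ ^ 2)
      (Filter.Eventually.of_forall fun i => ?_) (Filter.Eventually.of_forall fun i => ?_)
      ((Lp.memLp f).integrable_norm_pow (by norm_num) |>.const_mul 4) ?_
    · exact (((((h i).measurable.sub hψ.measurable).aestronglyMeasurable.mul
        (Lp.aestronglyMeasurable f)).norm).pow 2)
    · refine Filter.Eventually.of_forall fun x => ?_
      have h2 : ‖φ i x - ψ x‖ ≤ 2 := by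
        have := norm_sub_le (φ i x) (ψ x)
        have := (h i).le_one x
        have := hψ.le_one x
        linarith
      rw [Real.norm_of_nonneg (by positivity), norm_mul, mul_pow]
      have h3 : ‖φ i x - ψ x‖ ^ 2 ≤ 4 := by nlinarith [norm_nonneg (φ i x - ψ x)]
      exact mul_le_mul_of_nonneg_right h3 (by positivity)
    · filter_upwards [hlim] with x hx
      have h1 : Filter.Tendsto (fun i => ‖(φ i x - ψ x) * f x‖ ^ 2) l
          (𝓝 (‖(ψ x - ψ x) * f x‖ ^ 2)) :=
        (((hx.sub_const _).mul_const _).norm).pow 2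
      simpa using h1
  have := hsq.sqrt
  simpa [Real.sqrt_sq (norm_nonneg _)] using this

end

/-! ### A bounded self-adjoint operator as an indefinite inner product -/

section

variable {K : Type*} [NormedAddCommGroup K] [InnerProductSpace ℂ K]

/-- The projection onto a closed subspace commutes with operators that leave it and its orthogonal
complement invariant. -/
theorem starProjection_comm {S : Submodule ℂ K} [S.HasOrthogonalProjection] {B : K →L[ℂ] K}
    (h1 : ∀ x ∈ S, B x ∈ S) (h2 : ∀ x ∈ Sᗮ, B x ∈ Sᗮ) (x : K) :
    S.starProjection (B x) = B (S.starProjection x) := by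
  refine (Submodule.eq_starProjection_of_mem_of_inner_eq_zero
    (h1 _ (Submodule.starProjection_apply_mem S x)) fun w hw => ?_)
  rw [← map_sub]
  have h3 : B (x - S.starProjection x) ∈ Sᗮ := h2 _ (Submodule.sub_starProjection_mem_orthogonal x)
  exact Submodule.inner_left_of_mem_orthogonal hw h3

variable [CompleteSpace K]

/-- The square root of the absolute value and the positive and negative parts of a self-adjoint
operator. -/
theorem exists_sqrt_abs (A : K →L[ℂ] K) (hA : IsSelfAdjoint A) : ∃ J Ap Am : K →L[ℂ] K,
    IsSelfAdjoint J ∧ IsSelfAdjoint Ap ∧ Ap - Am = A ∧ Ap + Am = J * J ∧ Ap * Am = 0 ∧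
    ∀ B : K →L[ℂ] K, Commute A B → Commute J B ∧ Commute Ap B := by
  refine ⟨cfc (fun x : ℝ => Real.sqrt |x|) A, cfc (fun x : ℝ => max x 0) A,
    cfc (fun x : ℝ => max (-x) 0) A, cfc_predicate _ _, cfc_predicate _ _, ?_, ?_, ?_,
    fun B c1 => ?_⟩
  · have hid : cfc (fun x : ℝ => x) A = A := cfc_id' ℝ A
    rw [← cfc_sub (fun x : ℝ => max x 0) (fun x : ℝ => max (-x) 0) A]
    conv_rhs => rw [← hid]
    congr 1
    funext x
    rcases le_total 0 x with h | h
    · rw [max_eq_left h, max_eq_right (by linarith), sub_zero]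
    · rw [max_eq_right h, max_eq_left (by linarith)]; ring
  · rw [← cfc_add (a := A) (fun x : ℝ => max x 0) (fun x : ℝ => max (-x) 0),
      ← cfc_mul (fun x : ℝ => Real.sqrt |x|) (fun x : ℝ => Real.sqrt |x|) A]
    congr 1
    funext x
    rw [Real.mul_self_sqrt (abs_nonneg x)]
    rcases le_total 0 x with h | h
    · rw [max_eq_left h, max_eq_right (by linarith), add_zero, abs_of_nonneg h]
    · rw [max_eq_right h, max_eq_left (by linarith), abs_of_nonpos h, zero_add]
  · rw [← cfc_mul (fun x : ℝ => max x 0) (fun x : ℝ => max (-x) 0) A]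
    have : (fun x : ℝ => max x 0 * max (-x) 0) = fun _ => 0 := by
      funext x
      rcases le_total 0 x with h | h
      · rw [max_eq_right (show -x ≤ 0 by linarith), mul_zero]
      · rw [max_eq_right h, zero_mul]
    rw [this, cfc_const_zero]
  · exact ⟨hA.commute_cfc c1 _, hA.commute_cfc c1 _⟩

theorem isSelfAdjoint_inner {B : K →L[ℂ] K} (hB : IsSelfAdjoint B) (x y : K) :
    ⟪B x, y⟫_ℂ = ⟪x, B y⟫_ℂ := by
  rw [← ContinuousLinearMap.adjoint_inner_right, ContinuousLinearMap.isSelfAdjoint_iff'.1 hB]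

theorem isSelfAdjoint_of_inner {B : K →L[ℂ] K} (h : ∀ x y, ⟪B x, y⟫_ℂ = ⟪x, B y⟫_ℂ) :
    IsSelfAdjoint B :=
  ContinuousLinearMap.isSelfAdjoint_iff'.2 ((ContinuousLinearMap.eq_adjoint_iff _ _).2 h).symm

/-- Polar decomposition of a self-adjoint operator: `A = J T J` with a symmetry `T`, where `J` and
`T` commute with all operators that commute with `A`. -/
theorem exists_metric (A : K →L[ℂ] K) (hA : IsSelfAdjoint A) : ∃ J T : K →L[ℂ] K,
    IsSelfAdjoint J ∧ IsSelfAdjoint T ∧ (∀ x, T (T x) = x) ∧ (∀ x, J (T (J x)) = A x) ∧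
    (∀ x, J x = 0 ↔ A x = 0) ∧
    ∀ B : K →L[ℂ] K, (∀ x, A (B x) = B (A x)) →
      (∀ x, A (ContinuousLinearMap.adjoint B x) = ContinuousLinearMap.adjoint B (A x)) →
      (∀ x, J (B x) = B (J x)) ∧ ∀ x, T (B x) = B (T x) := by
  obtain ⟨J, Ap, Am, hJs, hAps, h1, h2, h3, hcf⟩ := exists_sqrt_abs A hA
  set S : Submodule ℂ K := (LinearMap.ker (Ap : K →ₗ[ℂ] K))ᗮ with hS
  obtain ⟨Q, hQ⟩ : ∃ Q : K →L[ℂ] K, Q = S.starProjection := ⟨_, rfl⟩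
  have hQs : ∀ x y, ⟪Q x, y⟫_ℂ = ⟪x, Q y⟫_ℂ := fun x y => by
    rw [hQ]; exact Submodule.inner_starProjection_left_eq_right S x y
  have hQQ : ∀ x, Q (Q x) = Q x := fun x => by
    rw [hQ]
    exact Submodule.starProjection_eq_self_iff.2 (Submodule.starProjection_apply_mem S x)
  obtain ⟨T, hTa⟩ : ∃ T : K →L[ℂ] K, ∀ x, T x = (2 : ℂ) • Q x - x :=
    ⟨(2 : ℂ) • Q - ContinuousLinearMap.id ℂ K, fun x => rfl⟩
  have hTi : ∀ x y, ⟪T x, y⟫_ℂ = ⟪x, T y⟫_ℂ := fun x y => by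
    rw [hTa, hTa, inner_sub_left, inner_sub_right, inner_smul_left, inner_smul_right, hQs,
      map_ofNat]
  have hTs : IsSelfAdjoint T := isSelfAdjoint_of_inner hTi
  have hTT : ∀ x, T (T x) = x := fun x => by
    rw [hTa (T x), hTa x, map_sub, map_smul, hQQ]
    simp only [two_smul]; abel
  have hQp : ∀ x, Q (Ap x) = Ap x := fun x => by
    rw [hQ]
    refine Submodule.starProjection_eq_self_iff.2 ?_
    rw [hS, Submodule.mem_orthogonal]
    intro u hu
    have hu' : Ap u = 0 := hu
    rw [← isSelfAdjoint_inner hAps, hu', inner_zero_left]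
  have hQm : ∀ x, Q (Am x) = 0 := fun x => by
    rw [hQ]
    refine (Submodule.starProjection_apply_eq_zero_iff _).2 ?_
    rw [hS, Submodule.orthogonal_orthogonal]
    exact congrArg (fun B : K →L[ℂ] K => B x) h3
  have hTJJ : ∀ x, T (J (J x)) = A x := fun x => by
    have e1 : J (J x) = Ap x + Am x := congrArg (fun B : K →L[ℂ] K => B x) h2.symm
    have e2 : A x = Ap x - Am x := congrArg (fun B : K →L[ℂ] K => B x) h1.symm
    rw [e1, e2, hTa, map_add, hQp, hQm, add_zero, two_smul]
    abel
  have hcomm : ∀ B : K →L[ℂ] K, (∀ x, A (B x) = B (A x)) →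
      (∀ x, A (ContinuousLinearMap.adjoint B x) = ContinuousLinearMap.adjoint B (A x)) →
      (∀ x, J (B x) = B (J x)) ∧ ∀ x, T (B x) = B (T x) := by
    intro B hB hB'
    have c1 : Commute A B := ContinuousLinearMap.ext hB
    have c2 : Commute A (star B) := ContinuousLinearMap.ext hB'
    refine ⟨fun x => congrArg (fun B : K →L[ℂ] K => B x) (hcf B c1).1.eq, fun x => ?_⟩
    have hpB : ∀ x, Ap (B x) = B (Ap x) := fun x =>
      congrArg (fun B : K →L[ℂ] K => B x) (hcf B c1).2.eq
    have hpB' : ∀ x, Ap (ContinuousLinearMap.adjoint B x) = ContinuousLinearMap.adjoint B (Ap x) :=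
      fun x => congrArg (fun B : K →L[ℂ] K => B x) (hcf _ c2).2.eq
    rw [hTa, hTa, map_sub, map_smul, hQ]
    congr 2
    refine starProjection_comm (fun x hx => ?_) (fun x hx => ?_) x
    · rw [hS, Submodule.mem_orthogonal] at hx ⊢
      intro u hu
      rw [← ContinuousLinearMap.adjoint_inner_left]
      refine hx _ ?_
      have hu' : Ap u = 0 := hu
      change Ap _ = 0
      rw [hpB', hu', map_zero]
    · rw [hS, Submodule.orthogonal_orthogonal] at hx ⊢
      have hx' : Ap x = 0 := hx
      change Ap _ = 0
      rw [hpB, hx', map_zero]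
  have hTA : ∀ x, A (T x) = T (A x) := by
    intro x
    have e : ∀ x, A x = T (J (J x)) := fun x => (hTJJ x).symm
    refine ext_inner_left ℂ fun y => ?_
    rw [← isSelfAdjoint_inner hA, e y, hTi, isSelfAdjoint_inner hJs, isSelfAdjoint_inner hJs, hTT,
      e x, hTT]
  have hJT := (hcomm T hTA (by rw [ContinuousLinearMap.isSelfAdjoint_iff'.1 hTs]; exact hTA)).1
  refine ⟨J, T, hJs, hTs, hTT, fun x => by rw [hJT, hTJJ], fun x => ⟨fun h => ?_, fun h => ?_⟩, hcomm⟩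
  · rw [← hTJJ, h, map_zero, map_zero]
  · have hJJ : J (J x) = T (A x) := by rw [← hTJJ, hTT]
    have : ⟪J x, J x⟫_ℂ = 0 := by
      rw [isSelfAdjoint_inner hJs, hJJ, h, map_zero, inner_zero_right]
    exact inner_self_eq_zero.1 this

end

/-! ### Generators of unitary groups are self-adjoint -/

section

variable {H : Type*} [NormedAddCommGroup H] [InnerProductSpace ℂ H] {s : ℕ}
  {V : Spacetime s → H ≃ₗᵢ[ℂ] H}

theorem mem_generator_domain {a : Spacetime s} {Ψ : H} :
    Ψ ∈ (generator V a).domain ↔ DifferentiableAt ℝ (fun t : ℝ => V (t • a) Ψ) 0 := Iff.rfl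

theorem generator_apply {a : Spacetime s} (Ψ : (generator V a).domain) :
    generator V a Ψ = (-Complex.I) • deriv (fun t : ℝ => V (t • a) (Ψ : H)) 0 := rfl

theorem hasDerivAt_of_mem_generator {a : Spacetime s} (Ψ : (generator V a).domain) :
    HasDerivAt (fun t : ℝ => V (t • a) (Ψ : H)) (Complex.I • generator V a Ψ) 0 := by
  rw [generator_apply, smul_smul]
  have : Complex.I * -Complex.I = 1 := by rw [mul_neg, Complex.I_mul_I, neg_neg]
  rw [this, one_smul]
  exact (mem_generator_domain.1 Ψ.2).hasDerivAt

theorem mem_generator_of_hasDerivAt {a : Spacetime s} {Ψ Φ : H}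
    (h : HasDerivAt (fun t : ℝ => V (t • a) Ψ) (Complex.I • Φ) 0) :
    ∃ h : Ψ ∈ (generator V a).domain, generator V a ⟨Ψ, h⟩ = Φ := by
  refine ⟨mem_generator_domain.2 h.differentiableAt, ?_⟩
  rw [generator_apply]
  simp only
  rw [h.deriv, smul_smul, neg_mul, Complex.I_mul_I, neg_neg, one_smul]

/-- Strongly continuous unitary representations of the translations. -/
structure IsTranslationGroup (V : Spacetime s → H ≃ₗᵢ[ℂ] H) : Prop where
  map_add : ∀ (a b : Spacetime s) (Ψ : H), V (a + b) Ψ = V a (V b Ψ)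
  continuous : ∀ Ψ : H, Continuous fun a => V a Ψ

namespace IsTranslationGroup

theorem zero_apply (hV : IsTranslationGroup V) (Ψ : H) : V 0 Ψ = Ψ := by
  refine (V 0).injective ?_
  rw [← hV.map_add, add_zero]

theorem neg_apply (hV : IsTranslationGroup V) (a : Spacetime s) (Ψ : H) : V (-a) (V a Ψ) = Ψ := by
  rw [← hV.map_add, neg_add_cancel, hV.zero_apply]

theorem inner_left (hV : IsTranslationGroup V) (a : Spacetime s) (Φ Ψ : H) :
    ⟪V a Φ, Ψ⟫_ℂ = ⟪Φ, V (-a) Ψ⟫_ℂ := by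
  rw [← (V (-a)).inner_map_map (V a Φ), hV.neg_apply]

theorem continuous_smul (hV : IsTranslationGroup V) (a : Spacetime s) (Ψ : H) :
    Continuous fun t : ℝ => V (t • a) Ψ :=
  (hV.continuous Ψ).comp (continuous_id.smul continuous_const)

theorem hasDerivAt (hV : IsTranslationGroup V) {a : Spacetime s} (Ψ : (generator V a).domain)
    (t : ℝ) : HasDerivAt (fun t : ℝ => V (t • a) (Ψ : H))
      (V (t • a) (Complex.I • generator V a Ψ)) t := by
  have h1 := (hasDerivAt_of_mem_generator Ψ)
  have h2 : HasDerivAt (fun r : ℝ => V ((r - t) • a) (Ψ : H)) (Complex.I • generator V a Ψ) t := by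
    have h3 : HasDerivAt (fun r : ℝ => r - t) 1 t := (hasDerivAt_id t).sub_const t
    have h4 := HasDerivAt.scomp (h := fun r : ℝ => r - t) t
      (by rw [sub_self]; exact h1) h3
    simpa [Function.comp_def] using h4
  have h5 := (((V (t • a)).toContinuousLinearEquiv : H →L[ℂ] H).restrictScalars
    ℝ).hasFDerivAt.comp_hasDerivAt t h2
  refine h5.congr_of_eventuallyEq (Filter.Eventually.of_forall fun r => ?_)
  change V (r • a) (Ψ : H) = V (t • a) (V ((r - t) • a) (Ψ : H))
  rw [← hV.map_add, ← add_smul, add_sub_cancel]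

theorem generator_symm (hV : IsTranslationGroup V) {a : Spacetime s}
    (Φ Ψ : (generator V a).domain) :
    ⟪generator V a Φ, (Ψ : H)⟫_ℂ = ⟪(Φ : H), generator V a Ψ⟫_ℂ := by
  have h1 := (hasDerivAt_of_mem_generator Φ).inner ℂ (hasDerivAt_of_mem_generator Ψ)
  have h2 : (fun t : ℝ => ⟪V (t • a) (Φ : H), V (t • a) (Ψ : H)⟫_ℂ) = fun _ => ⟪(Φ : H), (Ψ : H)⟫_ℂ := by
    funext t; exact (V (t • a)).inner_map_map _ _
  rw [h2] at h1
  have h3 := h1.unique (hasDerivAt_const _ _)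
  rw [zero_smul, hV.zero_apply, hV.zero_apply, inner_smul_left, inner_smul_right,
    Complex.conj_I] at h3
  have h4 : Complex.I * (⟪(Φ : H), generator V a Ψ⟫_ℂ - ⟪generator V a Φ, (Ψ : H)⟫_ℂ) = 0 := by
    rw [← h3]; ring
  rcases mul_eq_zero.1 h4 with h | h
  · exact absurd h Complex.I_ne_zero
  · exact (sub_eq_zero.1 h).symm

variable [CompleteSpace H]

theorem hasDerivAt_integral (hV : IsTranslationGroup V) (a : Spacetime s) (Ψ : H) (ε : ℝ) :
    HasDerivAt (fun t : ℝ => V (t • a) (∫ r in (0 : ℝ)..ε, V (r • a) Ψ))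
      (V (ε • a) Ψ - Ψ) 0 := by
  have hc := hV.continuous_smul a Ψ
  have h1 : ∀ t : ℝ, V (t • a) (∫ r in (0 : ℝ)..ε, V (r • a) Ψ) =
      (∫ r in (0 : ℝ)..(t + ε), V (r • a) Ψ) - ∫ r in (0 : ℝ)..t, V (r • a) Ψ := by
    intro t
    have h2 := ((V (t • a)).toContinuousLinearEquiv : H →L[ℂ] H).intervalIntegral_comp_comm
      (hc.intervalIntegrable 0 ε) (μ := volume)
    change _ = V (t • a) (∫ r in (0 : ℝ)..ε, V (r • a) Ψ) at h2
    rw [← h2, intervalIntegral.integral_interval_sub_left (hc.intervalIntegrable _ _)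
      (hc.intervalIntegrable _ _)]
    have h3 := intervalIntegral.integral_comp_add_left (a := (0 : ℝ)) (b := ε)
      (fun r : ℝ => V (r • a) Ψ) t
    rw [add_zero] at h3
    rw [← h3]
    refine intervalIntegral.integral_congr fun r _ => ?_
    change V (t • a) (V (r • a) Ψ) = V ((t + r) • a) Ψ
    rw [← hV.map_add, ← add_smul]
  have hF : ∀ u : ℝ, HasDerivAt (fun u : ℝ => ∫ r in (0 : ℝ)..u, V (r • a) Ψ) (V (u • a) Ψ) u :=
    fun u => intervalIntegral.integral_hasDerivAt_right (hc.intervalIntegrable _ _)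
      (hc.stronglyMeasurableAtFilter _ _) hc.continuousAt
  have h4 : HasDerivAt (fun t : ℝ => ∫ r in (0 : ℝ)..(t + ε), V (r • a) Ψ) (V (ε • a) Ψ) 0 := by
    have h5 : HasDerivAt (fun t : ℝ => t + ε) 1 0 := (hasDerivAt_id 0).add_const ε
    have h6 := HasDerivAt.scomp (h := fun t : ℝ => t + ε) 0 (by rw [zero_add]; exact hF ε) h5
    simpa [Function.comp_def] using h6
  have h7 := h4.sub (hF 0)
  rw [zero_smul, hV.zero_apply] at h7
  exact h7.congr_of_eventuallyEq (Filter.Eventually.of_forall h1)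

theorem dense_domain (hV : IsTranslationGroup V) (a : Spacetime s) :
    Dense ((generator V a).domain : Set H) := by
  intro Ψ
  have hc := hV.continuous_smul a Ψ
  have h1 : HasDerivAt (fun u : ℝ => ∫ r in (0 : ℝ)..u, V (r • a) Ψ) (V ((0 : ℝ) • a) Ψ) 0 :=
    intervalIntegral.integral_hasDerivAt_right (hc.intervalIntegrable _ _)
      (hc.stronglyMeasurableAtFilter _ _) hc.continuousAt
  rw [zero_smul, hV.zero_apply] at h1
  have h2 := h1.tendsto_slope_zero_right
  refine mem_closure_of_tendsto h2 (Filter.Eventually.of_forall fun ε => ?_)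
  have h3 : (∫ r in (0 : ℝ)..(0 + ε), V (r • a) Ψ) - ∫ r in (0 : ℝ)..0, V (r • a) Ψ =
      ∫ r in (0 : ℝ)..ε, V (r • a) Ψ := by simp
  rw [h3]
  have h4 : (∫ r in (0 : ℝ)..ε, V (r • a) Ψ) ∈ (generator V a).domain :=
    mem_generator_domain.2 (hV.hasDerivAt_integral a Ψ ε).differentiableAt
  have h5 : ε⁻¹ • (∫ r in (0 : ℝ)..ε, V (r • a) Ψ) =
      ((ε⁻¹ : ℝ) : ℂ) • ∫ r in (0 : ℝ)..ε, V (r • a) Ψ := (Complex.coe_smul _ _).symm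
  rw [h5]
  exact (generator V a).domain.smul_mem _ h4

theorem mem_domain_of_inner (hV : IsTranslationGroup V) {a : Spacetime s} {Φ χ : H}
    (h : ∀ Ψ : (generator V a).domain, ⟪Φ, generator V a Ψ⟫_ℂ = ⟪χ, (Ψ : H)⟫_ℂ) :
    ∃ h : Φ ∈ (generator V a).domain, generator V a ⟨Φ, h⟩ = χ := by
  have hcχ := hV.continuous_smul a χ
  have key : ∀ t : ℝ, V (t • a) Φ = Φ + Complex.I • ∫ r in (0 : ℝ)..t, V (r • a) χ := by
    intro t
    rw [← sub_eq_zero]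
    refine (hV.dense_domain a).eq_zero_of_inner_left ℂ fun Ψ hΨ => ?_
    set Ψ' : (generator V a).domain := ⟨Ψ, hΨ⟩
    have hF : ∀ u : ℝ, HasDerivAt (fun u : ℝ => ∫ r in (0 : ℝ)..u, V (r • a) χ) (V (u • a) χ) u :=
      fun u => intervalIntegral.integral_hasDerivAt_right (hcχ.intervalIntegrable _ _)
        (hcχ.stronglyMeasurableAtFilter _ _) hcχ.continuousAt
    have hd : ∀ u : ℝ, HasDerivAt (fun u : ℝ => ⟪V (u • a) Φ - (Φ + Complex.I •
        ∫ r in (0 : ℝ)..u, V (r • a) χ), Ψ⟫_ℂ) 0 u := by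
      intro u
      have hu : HasDerivAt (fun u : ℝ => V ((-u) • a) Ψ)
          (-V ((-u) • a) (Complex.I • generator V a Ψ')) u := by
        have h1 := hV.hasDerivAt Ψ' (-u)
        have h2 := HasDerivAt.scomp (h := fun u : ℝ => -u) u h1 (hasDerivAt_neg u)
        simpa [Function.comp_def] using h2
      have hu1 : HasDerivAt (fun u : ℝ => ⟪V (u • a) Φ, Ψ⟫_ℂ)
          (⟪Φ, -V ((-u) • a) (Complex.I • generator V a Ψ')⟫_ℂ) u := by
        have h3 := (hasDerivAt_const u Φ).inner ℂ hu
        simp only [inner_zero_left, add_zero] at h3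
        refine h3.congr_of_eventuallyEq (Filter.Eventually.of_forall fun r => ?_)
        simp only [hV.inner_left, neg_smul]
      have hdom : ∃ h : V ((-u) • a) Ψ ∈ (generator V a).domain,
          generator V a ⟨_, h⟩ = V ((-u) • a) (generator V a Ψ') := by
        refine mem_generator_of_hasDerivAt ?_
        have h4 := (((V ((-u) • a)).toContinuousLinearEquiv : H →L[ℂ] H).restrictScalars
          ℝ).hasFDerivAt.comp_hasDerivAt (0 : ℝ) (hasDerivAt_of_mem_generator Ψ')
        have h5 : V ((-u) • a) (Complex.I • generator V a Ψ') =
          Complex.I • V ((-u) • a) (generator V a Ψ') := map_smul _ _ _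
        rw [← h5]
        refine h4.congr_of_eventuallyEq (Filter.Eventually.of_forall fun r => ?_)
        change V (r • a) (V ((-u) • a) Ψ) = V ((-u) • a) (V (r • a) Ψ)
        rw [← hV.map_add, ← hV.map_add, add_comm]
      obtain ⟨hm, hg⟩ := hdom
      have hu2 := (((hasDerivAt_const u Φ).add ((hF u).const_smul Complex.I)).inner ℂ
        (hasDerivAt_const u Ψ))
      have hu3 := hu1.sub hu2
      have h6 : ⟪Φ, -V ((-u) • a) (Complex.I • generator V a Ψ')⟫_ℂ -
          (⟪Φ + Complex.I • ∫ r in (0 : ℝ)..u, V (r • a) χ, (0 : H)⟫_ℂ +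
            ⟪0 + Complex.I • V (u • a) χ, Ψ⟫_ℂ) = 0 := by
        have h7 : ⟪Φ, V ((-u) • a) (generator V a Ψ')⟫_ℂ = ⟪V (u • a) χ, Ψ⟫_ℂ := by
          rw [← hg, h ⟨_, hm⟩, hV.inner_left, ← neg_smul]
        rw [inner_zero_right, zero_add, zero_add, inner_neg_right, map_smul, inner_smul_right,
          inner_smul_left, h7, Complex.conj_I]
        ring
      have h8 := hu3.congr_deriv h6
      refine h8.congr_of_eventuallyEq (Filter.Eventually.of_forall fun r => ?_)
      simp only [Pi.sub_apply, Pi.add_apply, Pi.smul_apply, inner_sub_left]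
    have h9 := is_const_of_deriv_eq_zero (fun u => (hd u).differentiableAt) (fun u => (hd u).deriv) t 0
    rw [h9]
    simp [hV.zero_apply]
  refine mem_generator_of_hasDerivAt ?_
  have hF : HasDerivAt (fun u : ℝ => ∫ r in (0 : ℝ)..u, V (r • a) χ) (V ((0 : ℝ) • a) χ) 0 :=
    intervalIntegral.integral_hasDerivAt_right (hcχ.intervalIntegrable _ _)
      (hcχ.stronglyMeasurableAtFilter _ _) hcχ.continuousAt
  rw [zero_smul, hV.zero_apply] at hF
  exact ((hF.const_smul Complex.I).const_add Φ).congr_of_eventuallyEq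
    (Filter.Eventually.of_forall key)

theorem isSelfAdjoint_generator (hV : IsTranslationGroup V) (a : Spacetime s) :
    IsSelfAdjoint (generator V a) := by
  have hd := hV.dense_domain a
  rw [LinearPMap.isSelfAdjoint_def]
  refine le_antisymm (show (generator V a).adjoint.domain ≤ (generator V a).domain ∧
    ∀ ⦃x : (generator V a).adjoint.domain⦄ ⦃y : (generator V a).domain⦄, (x : H) = y →
      (generator V a).adjoint x = generator V a y from ⟨fun Φ hΦ => ?_, ?_⟩)
    (LinearPMap.IsFormalAdjoint.le_adjoint hd ?_)
  · have h1 := LinearPMap.adjoint_isFormalAdjoint (T := generator V a) hd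
    exact (hV.mem_domain_of_inner (χ := (generator V a).adjoint ⟨Φ, hΦ⟩)
      fun Ψ => (h1 ⟨Φ, hΦ⟩ Ψ).symm).1
  · rintro ⟨Φ, hΦ⟩ ⟨Φ', hΦ'⟩ rfl
    have h1 := LinearPMap.adjoint_isFormalAdjoint (T := generator V a) hd
    obtain ⟨h2, h3⟩ := hV.mem_domain_of_inner (χ := (generator V a).adjoint ⟨Φ, hΦ⟩)
      fun Ψ => (h1 ⟨Φ, hΦ⟩ Ψ).symm
    exact h3.symm
  · exact fun Φ Ψ => hV.generator_symm Φ Ψ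

end IsTranslationGroup

end

/-! ### Measures on tuples of momenta of arbitrary length -/

section sigma

variable {ι γ : Type*} {β : ι → Type*} [∀ a, MeasurableSpace (β a)] [MeasurableSpace γ]

theorem measurable_of_sigma {f : (Σ a, β a) → γ} (h : ∀ a, Measurable fun b => f ⟨a, b⟩) :
    Measurable f := fun _ hS => MeasurableSpace.measurableSet_iInf.2 fun a => h a hS

theorem measurable_sigma_mk (a : ι) : Measurable (Sigma.mk a : β a → Σ a, β a) :=
  fun _ hS => MeasurableSpace.measurableSet_iInf.1 hS a

end sigma

section

variable (s : ℕ)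

/-- Tuples of momenta. -/
abbrev Tuple : Type := Σ n : ℕ, (Fin n → Spacetime s)

/-- Labels of the terms in all functions `W_{j+l}`. -/
abbrev TermLabel : Type := Σ jl : ℕ × ℕ, Finpartition (Finset.univ : Finset (Fin (jl.1 + jl.2)))

/-- Pairs of tuples of momenta, for each term. -/
abbrev PairTuple : Type := Σ q : TermLabel, (Fin (q.1.1 + q.1.2) → Spacetime s)

end

section

variable {s : ℕ}

/-- The momenta of the left factor, in reversed order and with reversed sign. -/
def leftPart {j l : ℕ} (k : Fin (j + l) → Spacetime s) : Fin j → Spacetime s :=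
  fun i => -k (Fin.castAdd l (Fin.rev i))

/-- The momenta of the right factor. -/
def rightPart {j l : ℕ} (k : Fin (j + l) → Spacetime s) : Fin l → Spacetime s :=
  fun i => k (Fin.natAdd j i)

@[fun_prop] theorem measurable_leftPart {j l : ℕ} :
    Measurable (leftPart : (Fin (j + l) → Spacetime s) → Fin j → Spacetime s) := by
  unfold leftPart; fun_prop

@[fun_prop] theorem measurable_rightPart {j l : ℕ} :
    Measurable (rightPart : (Fin (j + l) → Spacetime s) → Fin l → Spacetime s) := by
  unfold rightPart; fun_prop

theorem invWt_split {j l : ℕ} (k : Fin (j + l) → Spacetime s) :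
    invWt k = invWt (leftPart k) * invWt (rightPart k) := by
  simp only [invWt, leftPart, rightPart, wt_neg]
  rw [Fin.prod_univ_add]
  congr 1
  exact (Equiv.prod_comp Fin.revPerm fun i : Fin j => (wt (k (Fin.castAdd l i)))⁻¹).symm

/-- The total momentum. -/
def totalMom (x : Tuple s) : Spacetime s := ∑ i, x.2 i

@[fun_prop] theorem measurable_totalMom : Measurable (totalMom : Tuple s → Spacetime s) :=
  by
  refine measurable_of_sigma fun n => ?_
  change Measurable fun b : Fin n → Spacetime s => ∑ i, b i
  exact Finset.measurable_sum _ fun i _ => measurable_pi_apply i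

/-- The left tuple of a pair. -/
def leftTuple (y : PairTuple s) : Tuple s := ⟨y.1.1.1, leftPart y.2⟩

/-- The right tuple of a pair. -/
def rightTuple (y : PairTuple s) : Tuple s := ⟨y.1.1.2, rightPart y.2⟩

@[fun_prop] theorem measurable_leftTuple : Measurable (leftTuple : PairTuple s → Tuple s) :=
  by
  refine measurable_of_sigma fun q => ?_
  exact (measurable_sigma_mk (β := fun n : ℕ => Fin n → Spacetime s) q.1.1).comp
    (measurable_leftPart (j := q.1.1) (l := q.1.2))

@[fun_prop] theorem measurable_rightTuple : Measurable (rightTuple : PairTuple s → Tuple s) :=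
  by
  refine measurable_of_sigma fun q => ?_
  exact (measurable_sigma_mk (β := fun n : ℕ => Fin n → Spacetime s) q.1.2).comp
    (measurable_rightPart (j := q.1.1) (l := q.1.2))

theorem totalMom_leftTuple (q : TermLabel) (k : Fin (q.1.1 + q.1.2) → Spacetime s)
    (h : ∑ i, k i = 0) : totalMom (leftTuple ⟨q, k⟩) = totalMom (rightTuple ⟨q, k⟩) := by
  rw [Fin.sum_univ_add] at h
  change ∑ i : Fin q.1.1, -k (Fin.castAdd q.1.2 (Fin.rev i)) =
    ∑ i : Fin q.1.2, k (Fin.natAdd q.1.1 i)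
  rw [Finset.sum_neg_distrib]
  refine neg_eq_of_add_eq_zero_right (Eq.trans ?_ h)
  congr 1
  exact Equiv.sum_comp Fin.revPerm fun i : Fin q.1.1 => k (Fin.castAdd q.1.2 i)

theorem totalMom_rightTuple_mem (q : TermLabel) (k : Fin (q.1.1 + q.1.2) → Spacetime s)
    (h : SpectralTuple k) : totalMom (rightTuple ⟨q, k⟩) ∈ forwardCone s := by
  have h1 := h.2 (Finset.univ.map (Fin.natAddEmb q.1.1)) (by
    intro a b hab ha
    simp only [Finset.coe_map, Finset.coe_univ, Set.image_univ, Set.mem_range,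
      Fin.natAddEmb_apply] at ha ⊢
    obtain ⟨i, rfl⟩ := ha
    have h2 : q.1.1 ≤ (b : ℕ) := by
      rw [Fin.le_def, Fin.val_natAdd] at hab; omega
    exact ⟨⟨b - q.1.1, by omega⟩, Fin.ext (by simp; omega)⟩)
  rw [Finset.sum_map] at h1
  exact h1

variable (m α : ℝ) (c : ℕ → ℝ)

/-- The product of the constants of a partition. -/
def coef {n : ℕ} (P : Finpartition (Finset.univ : Finset (Fin n))) : ℝ := ∏ B ∈ P.parts, c B.card

variable (s) in
/-- The measure of a partition with an integrable weight. -/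
def weighted {n : ℕ} (P : Finpartition (Finset.univ : Finset (Fin n))) :
    Measure (Fin n → Spacetime s) :=
  (partitionMeasure s m α P).withDensity fun k => ENNReal.ofReal (invWt k)

theorem isFiniteMeasure_weighted {m α : ℝ} (hm : 0 < m) (hα0 : 0 < α) (hα : α ≤ 1 / 2) {n : ℕ}
    (P : Finpartition (Finset.univ : Finset (Fin n))) : IsFiniteMeasure (weighted s m α P) :=
  isFiniteMeasure_withDensity_ofReal (integrable_invWt_partitionMeasure hm hα0 hα P).2

theorem integral_weighted {n : ℕ} (P : Finpartition (Finset.univ : Finset (Fin n)))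
    (F : (Fin n → Spacetime s) → ℂ) :
    ∫ k, F k ∂weighted s m α P = ∫ k, (invWt k : ℂ) * F k ∂partitionMeasure s m α P := by
  rw [weighted, integral_withDensity_eq_integral_toReal_smul (by fun_prop)
    (Filter.Eventually.of_forall fun _ => ENNReal.ofReal_lt_top)]
  refine integral_congr_ae (Filter.Eventually.of_forall fun k => ?_)
  simp only
  rw [ENNReal.toReal_ofReal (invWt_pos k).le, Complex.real_smul]

variable (s) in
/-- The size of the `n`-point function. -/
def sizeBound (n : ℕ) : ℝ :=
  ∑ P : Finpartition (Finset.univ : Finset (Fin n)), (1 + |coef c P|) * (weighted s m α P).real Set.univ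

theorem sizeBound_nonneg (n : ℕ) : 0 ≤ sizeBound s m α c n :=
  Finset.sum_nonneg fun P _ => mul_nonneg (by positivity) measureReal_nonneg

variable (s) in
/-- The normalization of tuples of length `n`. -/
def scale (n : ℕ) : ℝ := 2 ^ n * (1 + ∑ i ∈ Finset.range (2 * n + 1), sizeBound s m α c i)

theorem one_le_sum_sizeBound (n : ℕ) :
    1 ≤ 1 + ∑ i ∈ Finset.range (2 * n + 1), sizeBound s m α c i :=
  le_add_of_nonneg_right (Finset.sum_nonneg fun i _ => sizeBound_nonneg m α c i)

theorem scale_pos (n : ℕ) : 0 < scale s m α c n :=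
  mul_pos (by positivity) (zero_lt_one.trans_le (one_le_sum_sizeBound m α c n))

theorem sizeBound_le (j l : ℕ) :
    sizeBound s m α c (j + l) ≤ (1 / 2) ^ j * (1 / 2) ^ l * (scale s m α c j * scale s m α c l) := by
  have e : (1 / 2 : ℝ) ^ j * (1 / 2) ^ l * (scale s m α c j * scale s m α c l) =
      (1 + ∑ i ∈ Finset.range (2 * j + 1), sizeBound s m α c i) *
        (1 + ∑ i ∈ Finset.range (2 * l + 1), sizeBound s m α c i) := by
    have h1 : ∀ n : ℕ, (1 / 2 : ℝ) ^ n * 2 ^ n = 1 := fun n => by rw [← mul_pow]; norm_num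
    simp only [scale]
    linear_combination (((1 + ∑ i ∈ Finset.range (2 * j + 1), sizeBound s m α c i) *
        (1 + ∑ i ∈ Finset.range (2 * l + 1), sizeBound s m α c i))) * ((1 / 2 : ℝ) ^ l * 2 ^ l) * h1 j +
        (((1 + ∑ i ∈ Finset.range (2 * j + 1), sizeBound s m α c i) *
        (1 + ∑ i ∈ Finset.range (2 * l + 1), sizeBound s m α c i))) * h1 l
  have h2 : ∀ n, j + l ≤ 2 * n → sizeBound s m α c (j + l) ≤
      1 + ∑ i ∈ Finset.range (2 * n + 1), sizeBound s m α c i := fun n hn =>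
    (Finset.single_le_sum (fun i _ => sizeBound_nonneg m α c i)
      (Finset.mem_range.2 (by omega))).trans (le_add_of_nonneg_left zero_le_one)
  have hj := one_le_sum_sizeBound (s := s) m α c j
  have hl := one_le_sum_sizeBound (s := s) m α c l
  rw [e]
  rcases le_total j l with h | h
  · exact (h2 l (by omega)).trans (le_mul_of_one_le_left (by linarith) hj)
  · exact (h2 j (by omega)).trans (le_mul_of_one_le_right (by linarith) hl)

variable (s) in
/-- The measure of a term. -/
def termMeasure (q : TermLabel) : Measure (PairTuple s) :=
  ENNReal.ofReal ((1 + |coef c q.2|) / (scale s m α c q.1.1 * scale s m α c q.1.2)) •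
    (weighted s m α q.2).map (Sigma.mk q)

variable (s) in
/-- The measure on pairs of tuples of momenta. -/
def pairMeasure : Measure (PairTuple s) := Measure.sum (termMeasure s m α c)

variable (s) in
/-- The measure on tuples of momenta. -/
def tupleMeasure : Measure (Tuple s) :=
  (pairMeasure s m α c).map leftTuple + (pairMeasure s m α c).map rightTuple

theorem isFiniteMeasure_pairMeasure {m α : ℝ} (hm : 0 < m) (hα0 : 0 < α) (hα : α ≤ 1 / 2) :
    IsFiniteMeasure (pairMeasure s m α c) := by
  refine ⟨?_⟩
  rw [pairMeasure, Measure.sum_apply _ MeasurableSet.univ, ENNReal.tsum_sigma']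
  have h1 : ∀ jl : ℕ × ℕ, ∑' P : Finpartition (Finset.univ : Finset (Fin (jl.1 + jl.2))),
      termMeasure s m α c ⟨jl, P⟩ Set.univ ≤ ENNReal.ofReal ((1 / 2) ^ jl.1 * (1 / 2) ^ jl.2) := by
    intro jl
    have hs := mul_pos (scale_pos (s := s) m α c jl.1) (scale_pos (s := s) m α c jl.2)
    have h2 : ∀ P : Finpartition (Finset.univ : Finset (Fin (jl.1 + jl.2))),
        termMeasure s m α c ⟨jl, P⟩ Set.univ = ENNReal.ofReal
          ((1 + |coef c P|) * (weighted s m α P).real Set.univ /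
            (scale s m α c jl.1 * scale s m α c jl.2)) := by
      intro P
      have := isFiniteMeasure_weighted (s := s) hm hα0 hα P
      rw [termMeasure, Measure.smul_apply, Measure.map_apply (measurable_sigma_mk _)
        MeasurableSet.univ, Set.preimage_univ, smul_eq_mul, ← ofReal_measureReal,
        ← ENNReal.ofReal_mul (by positivity)]
      congr 1
      ring
    rw [tsum_fintype]
    simp_rw [h2]
    rw [← ENNReal.ofReal_sum_of_nonneg fun P _ => div_nonneg (mul_nonneg (by positivity)
      measureReal_nonneg) hs.le, ← Finset.sum_div]
    refine ENNReal.ofReal_le_ofReal ?_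
    rw [div_le_iff₀ hs]
    exact sizeBound_le m α c jl.1 jl.2
  refine (ENNReal.tsum_le_tsum h1).trans_lt ?_
  have h3 : Summable fun jl : ℕ × ℕ => (1 / 2 : ℝ) ^ jl.1 * (1 / 2) ^ jl.2 :=
    summable_geometric_two.mul_of_nonneg summable_geometric_two (fun _ => by positivity)
      fun _ => by positivity
  exact h3.tsum_ofReal_lt_top

theorem isFiniteMeasure_tupleMeasure {m α : ℝ} (hm : 0 < m) (hα0 : 0 < α) (hα : α ≤ 1 / 2) :
    IsFiniteMeasure (tupleMeasure s m α c) := by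
  have := isFiniteMeasure_pairMeasure (s := s) c hm hα0 hα
  unfold tupleMeasure
  infer_instance

theorem map_leftTuple_le : (pairMeasure s m α c).map leftTuple ≤ tupleMeasure s m α c :=
  Measure.le_add_right le_rfl

theorem map_rightTuple_le : (pairMeasure s m α c).map rightTuple ≤ tupleMeasure s m α c :=
  Measure.le_add_left le_rfl

theorem ae_pairMeasure {p : PairTuple s → Prop} (hp : MeasurableSet {y | p y})
    (h : ∀ q, ∀ᵐ k ∂partitionMeasure s m α q.2, p ⟨q, k⟩) : ∀ᵐ y ∂pairMeasure s m α c, p y := by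
  rw [pairMeasure, Measure.ae_sum_iff' hp]
  intro q
  refine Measure.ae_smul_measure ?_ _
  rw [ae_map_iff (measurable_sigma_mk _).aemeasurable hp]
  exact (withDensity_absolutelyContinuous _ _).ae_le (h q)

theorem ae_totalMom_eq :
    ∀ᵐ y ∂pairMeasure s m α c, totalMom (leftTuple y) = totalMom (rightTuple y) := by
  refine ae_pairMeasure m α c (measurableSet_eq_fun (by fun_prop) (by fun_prop)) fun q => ?_
  filter_upwards [ae_spectralTuple_partitionMeasure m α q.2] with k hk
  exact totalMom_leftTuple q k hk.1

theorem ae_totalMom_rightTuple_mem :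
    ∀ᵐ y ∂pairMeasure s m α c, totalMom (rightTuple y) ∈ forwardCone s := by
  refine ae_pairMeasure m α c ((measurable_totalMom.comp measurable_rightTuple)
    isClosed_forwardCone.measurableSet) fun q => ?_
  filter_upwards [ae_spectralTuple_partitionMeasure m α q.2] with k hk
  exact totalMom_rightTuple_mem q k hk

theorem ae_totalMom_mem : ∀ᵐ x ∂tupleMeasure s m α c, totalMom x ∈ forwardCone s := by
  have hms : MeasurableSet {x : Tuple s | totalMom x ∈ forwardCone s} :=
    measurable_totalMom isClosed_forwardCone.measurableSet
  have h2 := ae_totalMom_rightTuple_mem (s := s) m α c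
  rw [tupleMeasure, ae_add_measure_iff]
  refine ⟨(ae_map_iff (by fun_prop) hms).2 ?_, (ae_map_iff (by fun_prop) hms).2 h2⟩
  filter_upwards [h2, ae_totalMom_eq m α c] with y hy hy'
  rwa [hy']

/-- The coefficient of a term relative to its measure. -/
def termCoef (y : PairTuple s) : ℂ := (coef c y.1.2 / (1 + |coef c y.1.2|) : ℝ)

theorem mult_termCoef : Mult (termCoef c : PairTuple s → ℂ) := by
  refine ⟨measurable_of_sigma fun q => ?_, fun y => ?_⟩
  · exact (measurable_const : Measurable fun _ : Fin (q.1.1 + q.1.2) → Spacetime s =>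
      ((coef c q.2 / (1 + |coef c q.2|) : ℝ) : ℂ))
  rw [termCoef, Complex.norm_real, Real.norm_eq_abs, abs_div,
    abs_of_pos (by positivity : 0 < 1 + |coef c y.1.2|), div_le_one (by positivity)]
  linarith

theorem exists_gramOp : ∃ A : Lp ℂ 2 (tupleMeasure s m α c) →L[ℂ] Lp ℂ 2 (tupleMeasure s m α c),
    ∀ F G, ⟪F, A G⟫_ℂ = ∫ y, conj (F (leftTuple y)) * (termCoef c y * G (rightTuple y))
      ∂pairMeasure s m α c := by
  obtain ⟨S, hS⟩ := exists_wpull measurable_leftTuple (map_leftTuple_le (s := s) m α c)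
    (mult_one (X := PairTuple s)).measurable mult_one.le_one
  obtain ⟨R, hR⟩ := exists_wpull measurable_rightTuple (map_rightTuple_le (s := s) m α c)
    (mult_termCoef c).measurable (mult_termCoef c).le_one
  refine ⟨(ContinuousLinearMap.adjoint S).comp R, fun F G => ?_⟩
  rw [ContinuousLinearMap.comp_apply, ContinuousLinearMap.adjoint_inner_right, inner_eq_integral]
  refine integral_congr_ae ?_
  filter_upwards [hS F, hR G] with y h1 h2
  rw [h1, h2, one_mul]

variable (s) in
/-- The operator of the indefinite inner product. -/
def gramOp : Lp ℂ 2 (tupleMeasure s m α c) →L[ℂ] Lp ℂ 2 (tupleMeasure s m α c) :=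
  (exists_gramOp m α c).choose

theorem inner_gramOp (F G : Lp ℂ 2 (tupleMeasure s m α c)) :
    ⟪F, gramOp s m α c G⟫_ℂ = ∫ y, conj (F (leftTuple y)) * (termCoef c y * G (rightTuple y))
      ∂pairMeasure s m α c := (exists_gramOp m α c).choose_spec F G

theorem gramOp_mulOp {φ : Spacetime s → ℂ} (hφ : Mult φ) (G : Lp ℂ 2 (tupleMeasure s m α c)) :
    gramOp s m α c (mulOp _ (fun x => φ (totalMom x)) G) =
      mulOp _ (fun x => φ (totalMom x)) (gramOp s m α c G) := by
  have hK : Mult fun x : Tuple s => φ (totalMom x) := hφ.comp measurable_totalMom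
  refine ext_inner_left ℂ fun F => ?_
  have h1 := mulOp_inner F (gramOp s m α c G) hK.conj
  simp only [Complex.conj_conj] at h1
  rw [← h1, inner_gramOp, inner_gramOp]
  refine integral_congr_ae ?_
  have hr := ae_of_ae_map measurable_rightTuple.aemeasurable
    (ae_mono (map_rightTuple_le m α c) (mulOp_apply hK G))
  have hl := ae_of_ae_map measurable_leftTuple.aemeasurable
    (ae_mono (map_leftTuple_le m α c) (mulOp_apply hK.conj F))
  filter_upwards [hr, hl, ae_totalMom_eq m α c] with y h2 h3 h4
  rw [h2, h3, h4, map_mul, Complex.conj_conj]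
  ring

end

/-! ### Functions of `n` momenta as vectors -/

section

variable {s : ℕ}

/-- Measurable functions of `n` momenta that decay like the weight. -/
def Tame {n : ℕ} (F : (Fin n → Spacetime s) → ℂ) : Prop :=
  Measurable F ∧ ∃ C, ∀ k, ‖F k‖ ≤ C * invWt k

theorem Tame.add {n : ℕ} {F G : (Fin n → Spacetime s) → ℂ} (hF : Tame F) (hG : Tame G) :
    Tame (F + G) := by
  obtain ⟨h1, C, hC⟩ := hF
  obtain ⟨h2, D, hD⟩ := hG
  refine ⟨h1.add h2, C + D, fun k => (norm_add_le _ _).trans ?_⟩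
  rw [add_mul]
  exact add_le_add (hC k) (hD k)

theorem Tame.smul {n : ℕ} {F : (Fin n → Spacetime s) → ℂ} (hF : Tame F) (a : ℂ) :
    Tame (a • F) := by
  obtain ⟨h1, C, hC⟩ := hF
  refine ⟨h1.const_smul a, ‖a‖ * C, fun k => ?_⟩
  rw [Pi.smul_apply, norm_smul, mul_assoc]
  exact mul_le_mul_of_nonneg_left (hC k) (norm_nonneg a)

theorem tame_prod {n : ℕ} (F : Fin n → 𝓢(Spacetime s, ℂ)) :
    Tame fun k : Fin n → Spacetime s => ∏ i, F i (k i) := by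
  choose C hC0 hC using fun i => exists_norm_le_inv_wt (F i)
  refine ⟨Finset.measurable_prod _ fun i _ =>
    (F i).continuous.measurable.comp (measurable_pi_apply i), ∏ i, C i, fun k => ?_⟩
  rw [norm_prod, invWt, ← Finset.prod_mul_distrib]
  exact Finset.prod_le_prod (fun _ _ => norm_nonneg _) fun i _ => hC i (k i)

/-- A seminorm that bounds a test function by the weight. -/
def decaySeminorm (s n : ℕ) : Seminorm ℂ (TestFn s n) :=
  (2 ^ (2 * (s + 2) * n) : NNReal) •
    (Finset.Iic ((2 * (s + 2) * n, 0) : ℕ × ℕ)).sup fun m => SchwartzMap.seminorm ℂ m.1 m.2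

theorem norm_le_decaySeminorm {n : ℕ} (f : TestFn s n) (k : Fin n → Spacetime s) :
    ‖f k‖ ≤ decaySeminorm s n f * invWt k := by
  have h1 := SchwartzMap.one_add_le_sup_seminorm_apply (𝕜 := ℂ) (m := (2 * (s + 2) * n, 0))
    (k := 2 * (s + 2) * n) (n := 0) le_rfl le_rfl f k
  rw [norm_iteratedFDeriv_zero] at h1
  have h2 : ((1 + ‖k‖) ^ (2 * (s + 2) * n))⁻¹ ≤ invWt k := by
    rw [invWt, pow_mul, ← inv_pow]
    calc ((1 + ‖k‖) ^ (2 * (s + 2)))⁻¹ ^ n = ∏ _i : Fin n, ((1 + ‖k‖) ^ (2 * (s + 2)))⁻¹ := by simp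
      _ ≤ _ := Finset.prod_le_prod (fun _ _ => by positivity) fun i _ =>
        inv_anti₀ (wt_pos _) (wt_le_pow k i)
  have h3 : 0 < (1 + ‖k‖) ^ (2 * (s + 2) * n) := by positivity
  have h4 : ‖f k‖ ≤ decaySeminorm s n f * ((1 + ‖k‖) ^ (2 * (s + 2) * n))⁻¹ := by
    rw [← div_eq_mul_inv, le_div_iff₀ h3, mul_comm]
    exact h1
  exact h4.trans (mul_le_mul_of_nonneg_left h2 (apply_nonneg _ _))

theorem continuous_decaySeminorm (n : ℕ) : Continuous (decaySeminorm s n) := by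
  have h : Continuous ⇑((Finset.Iic ((2 * (s + 2) * n, 0) : ℕ × ℕ)).sup
      (fun m => SchwartzMap.seminorm ℂ m.1 m.2) : Seminorm ℂ (TestFn s n)) :=
    Seminorm.continuous_finsetSup fun m _ =>
      (schwartz_withSeminorms ℂ (Fin n → Spacetime s) ℂ).continuous_seminorm m
  exact h.const_smul _

theorem tame_testFn {n : ℕ} (f : TestFn s n) : Tame ⇑f :=
  ⟨f.continuous.measurable, _, norm_le_decaySeminorm f⟩

variable (m α : ℝ) (c : ℕ → ℝ)

open Classical in
/-- The function on tuples that represents a function of `n` momenta. -/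
def vecFn (n : ℕ) (F : (Fin n → Spacetime s) → ℂ) (x : Tuple s) : ℂ :=
  if h : x.1 = n then
    ((scale s m α c n * (invWt x.2)⁻¹ : ℝ) : ℂ) * F fun i => x.2 (Fin.cast h.symm i)
  else 0

theorem vecFn_mk {n : ℕ} (F : (Fin n → Spacetime s) → ℂ) (k : Fin n → Spacetime s) :
    vecFn m α c n F ⟨n, k⟩ = ((scale s m α c n * (invWt k)⁻¹ : ℝ) : ℂ) * F k := by
  rw [vecFn, dif_pos rfl]; rfl

theorem vecFn_of_ne {n j : ℕ} (h : j ≠ n) (F : (Fin n → Spacetime s) → ℂ)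
    (k : Fin j → Spacetime s) : vecFn m α c n F ⟨j, k⟩ = 0 := by
  rw [vecFn, dif_neg h]

theorem measurable_vecFn {n : ℕ} {F : (Fin n → Spacetime s) → ℂ} (hF : Measurable F) :
    Measurable (vecFn m α c n F) := by
  refine measurable_of_sigma fun j => ?_
  by_cases h : j = n
  · subst h
    simp_rw [vecFn_mk]
    exact (Complex.measurable_ofReal.comp (by fun_prop)).mul hF
  · simp_rw [vecFn_of_ne m α c h]
    exact measurable_const

theorem norm_vecFn_le {n : ℕ} {F : (Fin n → Spacetime s) → ℂ} {C : ℝ}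
    (hF : ∀ k, ‖F k‖ ≤ C * invWt k) (hC : 0 ≤ C) (x : Tuple s) :
    ‖vecFn m α c n F x‖ ≤ scale s m α c n * C := by
  obtain ⟨j, k⟩ := x
  have h0 := scale_pos (s := s) m α c n
  by_cases h : j = n
  · subst h
    have h1 := invWt_pos k
    rw [vecFn_mk, norm_mul, Complex.norm_real, Real.norm_of_nonneg (by positivity), mul_assoc]
    refine mul_le_mul_of_nonneg_left ?_ h0.le
    rw [inv_mul_le_iff₀ h1, mul_comm]
    exact hF k
  · rw [vecFn_of_ne m α c h, norm_zero]
    positivity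

theorem vecFn_add {n : ℕ} (F G : (Fin n → Spacetime s) → ℂ) :
    vecFn m α c n (F + G) = vecFn m α c n F + vecFn m α c n G := by
  funext x
  obtain ⟨j, k⟩ := x
  rw [Pi.add_apply]
  by_cases h : j = n
  · subst h
    simp only [vecFn_mk, Pi.add_apply, mul_add]
  · simp only [vecFn_of_ne m α c h, add_zero]

theorem vecFn_smul {n : ℕ} (a : ℂ) (F : (Fin n → Spacetime s) → ℂ) :
    vecFn m α c n (a • F) = a • vecFn m α c n F := by
  funext x
  obtain ⟨j, k⟩ := x
  rw [Pi.smul_apply]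
  by_cases h : j = n
  · subst h
    simp only [vecFn_mk, Pi.smul_apply, smul_eq_mul]
    ring
  · simp only [vecFn_of_ne m α c h, smul_zero]

theorem memLp_vecFn [IsFiniteMeasure (tupleMeasure s m α c)] {n : ℕ}
    {F : (Fin n → Spacetime s) → ℂ} (hF : Tame F) :
    MemLp (vecFn m α c n F) 2 (tupleMeasure s m α c) := by
  obtain ⟨h1, C, hC⟩ := hF
  refine MemLp.of_bound (measurable_vecFn m α c h1).aestronglyMeasurable
    (scale s m α c n * max C 0) (Filter.Eventually.of_forall fun x =>
      norm_vecFn_le m α c (fun k => (hC k).trans ?_) (le_max_right _ _) x)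
  exact mul_le_mul_of_nonneg_right (le_max_left _ _) (invWt_pos k).le

open Classical in
/-- The vector of a function of `n` momenta. -/
def vec (n : ℕ) (F : (Fin n → Spacetime s) → ℂ) : Lp ℂ 2 (tupleMeasure s m α c) :=
  if h : MemLp (vecFn m α c n F) 2 (tupleMeasure s m α c) then h.toLp else 0

variable [IsFiniteMeasure (tupleMeasure s m α c)] {n : ℕ}

theorem vec_ae {F : (Fin n → Spacetime s) → ℂ} (hF : Tame F) :
    vec m α c n F =ᵐ[tupleMeasure s m α c] vecFn m α c n F := by
  rw [vec, dif_pos (memLp_vecFn m α c hF)]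
  exact MemLp.coeFn_toLp _

theorem vec_eq_of_ae {F : (Fin n → Spacetime s) → ℂ} (hF : Tame F)
    {G : Lp ℂ 2 (tupleMeasure s m α c)} (h : G =ᵐ[tupleMeasure s m α c] vecFn m α c n F) :
    vec m α c n F = G := Lp.ext ((vec_ae m α c hF).trans h.symm)

theorem vec_add {F G : (Fin n → Spacetime s) → ℂ} (hF : Tame F) (hG : Tame G) :
    vec m α c n (F + G) = vec m α c n F + vec m α c n G := by
  refine vec_eq_of_ae m α c (hF.add hG) ?_
  rw [vecFn_add]
  exact (Lp.coeFn_add _ _).trans ((vec_ae m α c hF).add (vec_ae m α c hG))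

theorem vec_smul {F : (Fin n → Spacetime s) → ℂ} (hF : Tame F) (a : ℂ) :
    vec m α c n (a • F) = a • vec m α c n F := by
  refine vec_eq_of_ae m α c (hF.smul a) ?_
  rw [vecFn_smul]
  exact (Lp.coeFn_smul _ _).trans ((vec_ae m α c hF).const_smul a)

theorem norm_vec_le {F : (Fin n → Spacetime s) → ℂ} {C : ℝ} (hm : Measurable F)
    (hF : ∀ k, ‖F k‖ ≤ C * invWt k) (hC : 0 ≤ C) :
    ‖vec m α c n F‖ ≤
      (tupleMeasure s m α c).real Set.univ ^ ((2 : ENNReal).toReal⁻¹) * (scale s m α c n * C) := by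
  refine Lp.norm_le_of_ae_bound (mul_nonneg (scale_pos m α c n).le hC) ?_
  filter_upwards [vec_ae m α c ⟨hm, C, hF⟩] with x hx
  rw [hx]
  exact norm_vecFn_le m α c hF hC x

theorem mulOp_vec {φ : Spacetime s → ℂ} (hφ : Mult φ) {F : (Fin n → Spacetime s) → ℂ}
    (hF : Tame F) : mulOp _ (fun x => φ (totalMom x)) (vec m α c n F) =
      vec m α c n (fun k => φ (∑ i, k i) * F k) := by
  have hK : Mult fun x : Tuple s => φ (totalMom x) := hφ.comp measurable_totalMom
  have hT : Tame fun k => φ (∑ i, k i) * F k := by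
    obtain ⟨h1, C, hC⟩ := hF
    refine ⟨(hφ.measurable.comp (Finset.measurable_sum _ fun i _ => measurable_pi_apply i)).mul h1,
      C, fun k => ?_⟩
    rw [norm_mul]
    exact (mul_le_of_le_one_left (norm_nonneg _) (hφ.le_one _)).trans (hC k)
  refine (vec_eq_of_ae m α c hT ?_).symm
  filter_upwards [mulOp_apply hK (vec m α c n F), vec_ae m α c hF] with x h1 h2
  rw [h1, h2]
  obtain ⟨j, k⟩ := x
  by_cases h : j = n
  · subst h
    rw [vecFn_mk, vecFn_mk, mul_left_comm]
    rfl
  · rw [vecFn_of_ne m α c h, vecFn_of_ne m α c h, mul_zero]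

theorem inner_vec_gramOp_vec {m α : ℝ} (hm : 0 < m) (hα0 : 0 < α) (hα : α ≤ 1 / 2) (c : ℕ → ℝ)
    {j l : ℕ} {F : (Fin j → Spacetime s) → ℂ} {G : (Fin l → Spacetime s) → ℂ} (hF : Tame F)
    (hG : Tame G) [IsFiniteMeasure (tupleMeasure s m α c)] :
    ⟪vec m α c j F, gramOp s m α c (vec m α c l G)⟫_ℂ =
      ∑ P : Finpartition (Finset.univ : Finset (Fin (j + l))), (coef c P : ℂ) *
        ∫ k, conj (F (leftPart k)) * G (rightPart k) ∂partitionMeasure s m α P := by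
  have hfin := isFiniteMeasure_pairMeasure (s := s) c hm hα0 hα
  obtain ⟨B, hB⟩ : ∃ B : PairTuple s → ℂ, B = fun y => conj (vecFn m α c j F (leftTuple y)) *
    (termCoef c y * vecFn m α c l G (rightTuple y)) := ⟨_, rfl⟩
  have hBm : Measurable B := by
    rw [hB]
    exact (Complex.continuous_conj.measurable.comp
      ((measurable_vecFn m α c hF.1).comp measurable_leftTuple)).mul
      ((mult_termCoef c).measurable.mul ((measurable_vecFn m α c hG.1).comp measurable_rightTuple))
  have hBi : Integrable B (pairMeasure s m α c) := by
    obtain ⟨-, C, hC⟩ := hF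
    obtain ⟨-, D, hD⟩ := hG
    have hC' : ∀ k, ‖F k‖ ≤ max C 0 * invWt k := fun k =>
      (hC k).trans (mul_le_mul_of_nonneg_right (le_max_left _ _) (invWt_pos k).le)
    have hD' : ∀ k, ‖G k‖ ≤ max D 0 * invWt k := fun k =>
      (hD k).trans (mul_le_mul_of_nonneg_right (le_max_left _ _) (invWt_pos k).le)
    refine Integrable.of_bound hBm.aestronglyMeasurable
      ((scale s m α c j * max C 0) * (1 * (scale s m α c l * max D 0)))
      (Filter.Eventually.of_forall fun y => ?_)
    rw [hB]
    simp only
    have h0 := mul_nonneg (scale_pos (s := s) m α c j).le (le_max_right C 0)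
    rw [norm_mul, norm_mul, RCLike.norm_conj]
    exact mul_le_mul (norm_vecFn_le m α c hC' (le_max_right _ _) _)
      (mul_le_mul ((mult_termCoef c).le_one y) (norm_vecFn_le m α c hD' (le_max_right _ _) _)
        (norm_nonneg _) zero_le_one) (by positivity) h0
  have h1 : ⟪vec m α c j F, gramOp s m α c (vec m α c l G)⟫_ℂ = ∫ y, B y ∂pairMeasure s m α c := by
    rw [inner_gramOp]
    refine integral_congr_ae ?_
    filter_upwards [ae_of_ae_map measurable_leftTuple.aemeasurable
      (ae_mono (map_leftTuple_le m α c) (vec_ae m α c hF)),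
      ae_of_ae_map measurable_rightTuple.aemeasurable
      (ae_mono (map_rightTuple_le m α c) (vec_ae m α c hG))] with y e1 e2
    rw [e1, e2, hB]
  rw [h1, pairMeasure, integral_sum_measure hBi]
  have hterm : ∀ q : TermLabel, ∫ y, B y ∂termMeasure s m α c q =
      (((1 + |coef c q.2|) / (scale s m α c q.1.1 * scale s m α c q.1.2) : ℝ) : ℂ) *
        ∫ k, (invWt k : ℂ) * B ⟨q, k⟩ ∂partitionMeasure s m α q.2 := by
    intro q
    have h0 := mul_pos (scale_pos (s := s) m α c q.1.1) (scale_pos (s := s) m α c q.1.2)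
    rw [termMeasure, integral_smul_measure, integral_map (measurable_sigma_mk _).aemeasurable
      hBm.aestronglyMeasurable, integral_weighted, ENNReal.toReal_ofReal (by positivity),
      Complex.real_smul]
  simp_rw [hterm]
  rw [← (sigma_mk_injective (β := fun jl : ℕ × ℕ =>
    Finpartition (Finset.univ : Finset (Fin (jl.1 + jl.2)))) (i := (j, l))).tsum_eq, tsum_fintype]
  · refine Finset.sum_congr rfl fun P _ => ?_
    have hj := scale_pos (s := s) m α c j
    have hl := scale_pos (s := s) m α c l
    rw [← integral_const_mul, ← integral_const_mul]
    refine integral_congr_ae (Filter.Eventually.of_forall fun k => ?_)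
    have e1 : vecFn m α c j F (leftTuple ⟨⟨(j, l), P⟩, k⟩) = _ := vecFn_mk m α c F (leftPart k)
    have e2 : vecFn m α c l G (rightTuple ⟨⟨(j, l), P⟩, k⟩) = _ := vecFn_mk m α c G (rightPart k)
    have h5 := invWt_pos (leftPart k)
    have h6 := invWt_pos (rightPart k)
    have h7 : 0 < 1 + |coef c P| := by positivity
    simp only [hB]
    rw [e1, e2, invWt_split k, termCoef, map_mul, Complex.conj_ofReal]
    have h8 : ((1 + |coef c P|) / (scale s m α c j * scale s m α c l)) *
        ((invWt (leftPart k) * invWt (rightPart k)) * ((scale s m α c j * (invWt (leftPart k))⁻¹) *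
        ((coef c P / (1 + |coef c P|)) * (scale s m α c l * (invWt (rightPart k))⁻¹)))) =
        coef c P := by field_simp
    have h9 := congrArg (fun r : ℝ => (r : ℂ)) h8
    push_cast at h9 ⊢
    linear_combination (conj (F (leftPart k)) * G (rightPart k)) * h9
  · intro q hq
    by_contra hne
    refine hq ?_
    have hB0 : ∀ k, B ⟨q, k⟩ = 0 := by
      intro k
      obtain ⟨⟨j', l'⟩, P⟩ := q
      by_cases h1 : j' = j
      · by_cases h2 : l' = l
        · subst h1; subst h2
          exact absurd ⟨P, rfl⟩ hne
        · have e2 : vecFn m α c l G (rightTuple ⟨⟨(j', l'), P⟩, k⟩) = 0 :=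
            vecFn_of_ne m α c h2 G (rightPart k)
          rw [hB]
          simp only [e2, mul_zero]
      · have e1 : vecFn m α c j F (leftTuple ⟨⟨(j', l'), P⟩, k⟩) = 0 :=
            vecFn_of_ne m α c h1 F (leftPart k)
        rw [hB]
        simp only [e1, map_zero, zero_mul]
    simp only [hB0, mul_zero, integral_zero]

end

/-! ### Temperedness and Hilbert seminorms -/

section

variable {s : ℕ} {m α : ℝ}

theorem integrable_planeWaveTransform (hm : 0 < m) (hα0 : 0 < α) (hα : α ≤ 1 / 2) {n : ℕ}
    (P : Finpartition (Finset.univ : Finset (Fin n))) (f : TestFn s n) :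
    Integrable (planeWaveTransform f) (partitionMeasure s m α P) := by
  have := hasTemperateGrowth_partitionMeasure (s := s) hm hα0 hα P
  rw [← pwn_coe]
  exact (pwn n f).integrable

theorem exists_wightman_clm (hm : 0 < m) (hα0 : 0 < α) (hα : α ≤ 1 / 2) (c : ℕ → ℝ) (n : ℕ) :
    ∃ w : TestFn s n →L[ℂ] ℂ, ∀ f : TestFn s n, wightman s m α c n f = w f := by
  have hT := fun P => hasTemperateGrowth_partitionMeasure (s := s) hm hα0 hα (n := n) P
  refine ⟨∑ P : Finpartition (Finset.univ : Finset (Fin n)), (coef c P : ℂ) •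
    (SchwartzMap.integralCLM ℂ (partitionMeasure s m α P)).comp (pwn n), fun f => ?_⟩
  rw [sum_apply, wightman]
  refine Finset.sum_congr rfl fun P _ => ?_
  rw [smul_apply, ContinuousLinearMap.comp_apply,
    SchwartzMap.integralCLM_apply, pwn_coe, smul_eq_mul]
  rfl

/-- Reversal of the order and the signs of the momenta. -/
def revNeg {n : ℕ} (k : Fin n → Spacetime s) : Fin n → Spacetime s := fun i => -k (Fin.rev i)

@[fun_prop] theorem measurable_revNeg {n : ℕ} :
    Measurable (revNeg : (Fin n → Spacetime s) → Fin n → Spacetime s) := by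
  unfold revNeg; fun_prop

theorem invWt_revNeg {n : ℕ} (k : Fin n → Spacetime s) : invWt (revNeg k) = invWt k := by
  simp only [invWt, revNeg, wt_neg]
  exact Equiv.prod_comp Fin.revPerm fun i : Fin n => (wt (k i))⁻¹

theorem revNeg_leftPart {j l : ℕ} (k : Fin (j + l) → Spacetime s) :
    revNeg (leftPart k) = fun i => k (Fin.castAdd l i) := by
  funext i
  simp [revNeg, leftPart]

theorem Tame.comp_revNeg {n : ℕ} {F : (Fin n → Spacetime s) → ℂ} (hF : Tame F) :
    Tame fun k => F (revNeg k) := by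
  obtain ⟨h1, C, hC⟩ := hF
  exact ⟨h1.comp measurable_revNeg, C, fun k => by rw [← invWt_revNeg k]; exact hC _⟩

theorem Tame.conj {n : ℕ} {F : (Fin n → Spacetime s) → ℂ} (hF : Tame F) :
    Tame fun k => conj (F k) := by
  obtain ⟨h1, C, hC⟩ := hF
  exact ⟨Complex.continuous_conj.measurable.comp h1, C, fun k => by
    rw [RCLike.norm_conj]; exact hC _⟩

variable (m α) (c : ℕ → ℝ) [IsFiniteMeasure (tupleMeasure s m α c)] {n : ℕ}

theorem norm_vec_congr {F G : (Fin n → Spacetime s) → ℂ} (hF : Tame F) (hG : Tame G)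
    (h : ∀ k, ‖F k‖ = ‖G k‖) : ‖vec m α c n F‖ = ‖vec m α c n G‖ := by
  rw [Lp.norm_def, Lp.norm_def]
  congr 1
  refine eLpNorm_congr_norm_ae ?_
  filter_upwards [vec_ae m α c hF, vec_ae m α c hG] with x h1 h2
  rw [h1, h2]
  obtain ⟨j, k⟩ := x
  by_cases hj : j = n
  · subst hj
    rw [vecFn_mk, vecFn_mk, norm_mul, norm_mul, h]
  · rw [vecFn_of_ne m α c hj, vecFn_of_ne m α c hj]

theorem wightman_tensor {m α : ℝ} (hm : 0 < m) (hα0 : 0 < α) (hα : α ≤ 1 / 2) (c : ℕ → ℝ)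
    [IsFiniteMeasure (tupleMeasure s m α c)] {j l : ℕ} (f : TestFn s j) (g : TestFn s l) :
    wightman s m α c (j + l) (tensor f g) =
      ⟪vec m α c j fun k => conj (pwn j f (revNeg k)), gramOp s m α c (vec m α c l (pwn l g))⟫_ℂ := by
  rw [inner_vec_gramOp_vec hm hα0 hα c (tame_testFn _).comp_revNeg.conj (tame_testFn _), wightman]
  refine Finset.sum_congr rfl fun P _ => ?_
  congr 1
  refine integral_congr_ae (Filter.Eventually.of_forall fun k => ?_)
  simp only
  rw [planeWaveTransform_tensor, Complex.conj_conj, revNeg_leftPart, pwn_coe, pwn_coe]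
  rfl

/-- A test function and its reversal as a vector. -/
def pairVec (n : ℕ) : TestFn s n →ₗ[ℂ]
    WithLp 2 (Lp ℂ 2 (tupleMeasure s m α c) × Lp ℂ 2 (tupleMeasure s m α c)) where
  toFun f := WithLp.toLp 2 (vec m α c n (pwn n f), vec m α c n fun k => pwn n f (revNeg k))
  map_add' f g := by
    have h1 := vec_add m α c (tame_testFn (pwn n f)) (tame_testFn (pwn n g))
    have h2 := vec_add m α c (tame_testFn (pwn n f)).comp_revNeg
      (tame_testFn (pwn n g)).comp_revNeg
    rw [← WithLp.toLp_add, Prod.mk_add_mk, ← h1, ← h2, map_add]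
    rfl
  map_smul' a f := by
    have h1 := vec_smul m α c (tame_testFn (pwn n f)) a
    have h2 := vec_smul m α c (tame_testFn (pwn n f)).comp_revNeg a
    rw [RingHom.id_apply, ← WithLp.toLp_smul, Prod.smul_mk, ← h1, ← h2, map_smul]
    rfl

theorem norm_pairVec_sq (f : TestFn s n) : ‖pairVec m α c n f‖ ^ 2 =
    ‖vec m α c n (pwn n f)‖ ^ 2 + ‖vec m α c n fun k => pwn n f (revNeg k)‖ ^ 2 :=
  WithLp.prod_norm_sq_eq_of_L2 _

theorem norm_pairVec_translate (a : Spacetime s) (f : TestFn s n) :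
    ‖pairVec m α c n (translate a f)‖ = ‖pairVec m α c n f‖ := by
  rw [← sq_eq_sq₀ (norm_nonneg _) (norm_nonneg _), norm_pairVec_sq, norm_pairVec_sq]
  have h : ∀ k, ‖pwn n (translate a f) k‖ = ‖pwn n f k‖ := fun k => by
    rw [pwn_coe, pwn_coe, planeWaveTransform_translate, norm_mul, norm_wave, one_mul]
  rw [norm_vec_congr m α c (tame_testFn _) (tame_testFn (pwn n f)) h,
    norm_vec_congr m α c (tame_testFn _).comp_revNeg (tame_testFn (pwn n f)).comp_revNeg
      fun k => h (revNeg k)]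

theorem exists_norm_vec_le (n : ℕ) : ∃ C, 0 ≤ C ∧ ∀ F : (Fin n → Spacetime s) → ℂ, Measurable F →
    ∀ D, 0 ≤ D → (∀ k, ‖F k‖ ≤ D * invWt k) → ‖vec m α c n F‖ ≤ C * D :=
  ⟨_, mul_nonneg (Real.rpow_nonneg measureReal_nonneg _) (scale_pos m α c n).le,
    fun _ hF _ hD h => (norm_vec_le m α c hF h hD).trans (le_of_eq (mul_assoc _ _ _).symm)⟩

theorem exists_hilbertSeminorms {m α : ℝ} (hm : 0 < m) (hα0 : 0 < α) (hα : α ≤ 1 / 2)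
    (c : ℕ → ℝ) : ∃ p : (n : ℕ) → Seminorm ℂ (TestFn s n),
      HilbertStructureCondition (wightman s m α c) p ∧
      ∀ (n : ℕ) (a : Spacetime s) (f : TestFn s n), p n (translate a f) = p n f := by
  have := isFiniteMeasure_tupleMeasure (s := s) c hm hα0 hα
  obtain ⟨A, hA⟩ : ∃ A : NNReal, A = ‖gramOp s m α c‖₊ := ⟨_, rfl⟩
  obtain ⟨p, hp⟩ : ∃ p : (n : ℕ) → Seminorm ℂ (TestFn s n), ∀ n f,
      p n f = Real.sqrt A * ‖pairVec m α c n f‖ :=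
    ⟨fun n => (NNReal.sqrt A) • (normSeminorm ℂ _).comp (pairVec m α c n), fun n f => by
      rw [Real.sqrt, Real.toNNReal_coe]; rfl⟩
  refine ⟨p, ⟨fun n => ⟨?_, ?_⟩, fun j l f g => ?_⟩, fun n a f => ?_⟩
  · obtain ⟨C, hC0, hC⟩ := exists_norm_vec_le (s := s) m α c n
    have hcont : Continuous ⇑((decaySeminorm s n).comp (pwn (s := s) n).toLinearMap) :=
      show Continuous fun f : TestFn s n => decaySeminorm s n (pwn n f) from
        (continuous_decaySeminorm n).comp (pwn n).continuous
    have hle : ∀ f, p n f ≤ Real.sqrt A * (2 * C) * decaySeminorm s n (pwn n f) := by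
      intro f
      rw [hp, mul_assoc]
      refine mul_le_mul_of_nonneg_left ?_ (Real.sqrt_nonneg _)
      have h0 : 0 ≤ decaySeminorm s n (pwn n f) := apply_nonneg _ _
      have h1 := hC _ (pwn n f).continuous.measurable _ h0 (norm_le_decaySeminorm _)
      have h2 := hC (fun k => pwn n f (revNeg k))
        ((pwn n f).continuous.measurable.comp measurable_revNeg) _ h0 fun k => by
          rw [← invWt_revNeg k]; exact norm_le_decaySeminorm _ _
      have h3 := norm_pairVec_sq m α c f
      nlinarith [norm_nonneg (pairVec m α c n f), norm_nonneg (vec m α c n (pwn n f)),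
        norm_nonneg (vec m α c n fun k => pwn n f (revNeg k)), mul_nonneg hC0 h0]
    refine Seminorm.continuous_of_le (q := (NNReal.sqrt A * (2 * C.toNNReal)) •
      (decaySeminorm s n).comp (pwn (s := s) n).toLinearMap) (hcont.const_smul _) fun f => (hle f).trans (le_of_eq ?_)
    change _ = ((NNReal.sqrt A * (2 * C.toNNReal) : NNReal) : ℝ) * decaySeminorm s n (pwn n f)
    rw [NNReal.coe_mul, NNReal.coe_mul, Real.coe_toNNReal _ hC0, Real.coe_sqrt]
    rfl
  · refine ⟨LinearMap.mk₂'ₛₗ _ _ (fun f g => (A : ℂ) * ⟪pairVec m α c n f, pairVec m α c n g⟫_ℂ)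
      ?_ ?_ ?_ ?_, fun f => ?_⟩
    · intro f g h
      rw [map_add, inner_add_left, mul_add]
    · intro a f g
      rw [map_smul, inner_smul_left, smul_eq_mul]
      ring
    · intro f g h
      rw [map_add, inner_add_right, mul_add]
    · intro a f g
      rw [map_smul, inner_smul_right, smul_eq_mul, RingHom.id_apply]
      ring
    · rw [LinearMap.mk₂'ₛₗ_apply, inner_self_eq_norm_sq_to_K, hp, mul_pow,
        Real.sq_sqrt A.coe_nonneg]
      push_cast
      rfl
  · have e : ‖vec m α c j fun k => conj (pwn j f (revNeg k))‖ =
        ‖vec m α c j fun k => pwn j f (revNeg k)‖ :=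
      norm_vec_congr m α c (tame_testFn _).comp_revNeg.conj (tame_testFn _).comp_revNeg
        fun k => RCLike.norm_conj _
    have h1 := norm_pairVec_sq m α c f
    have h2 := norm_pairVec_sq m α c g
    have h3 : ‖vec m α c j fun k => pwn j f (revNeg k)‖ ≤ ‖pairVec m α c j f‖ := by
      rw [← sq_le_sq₀ (norm_nonneg _) (norm_nonneg _), h1]
      exact le_add_of_nonneg_left (sq_nonneg _)
    have h4 : ‖vec m α c l (pwn l g)‖ ≤ ‖pairVec m α c l g‖ := by
      rw [← sq_le_sq₀ (norm_nonneg _) (norm_nonneg _), h2]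
      exact le_add_of_nonneg_right (sq_nonneg _)
    rw [wightman_tensor hm hα0 hα, hp, hp]
    refine (norm_inner_le_norm _ _).trans ?_
    rw [e]
    have h5 : ‖gramOp s m α c (vec m α c l (pwn l g))‖ ≤ A * ‖pairVec m α c l g‖ := by
      rw [hA]
      exact ((gramOp s m α c).le_opNorm _).trans (mul_le_mul_of_nonneg_left h4 (norm_nonneg _))
    calc _ ≤ ‖pairVec m α c j f‖ * (A * ‖pairVec m α c l g‖) :=
          mul_le_mul h3 h5 (norm_nonneg _) (norm_nonneg _)
      _ = Real.sqrt A * Real.sqrt A * (‖pairVec m α c j f‖ * ‖pairVec m α c l g‖) := by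
          rw [Real.mul_self_sqrt A.coe_nonneg]; ring
      _ = _ := by ring
  · rw [hp, hp, norm_pairVec_translate]

end

/-! ### Products of test functions are total -/

section

variable {E : Type*} [NormedAddCommGroup E] {n : ℕ}

theorem boxes_isTopologicalBasis : TopologicalSpace.IsTopologicalBasis
    {B : Set (Fin n → E) | ∃ U : Fin n → Set E, (∀ i, IsOpen (U i) ∧ Bornology.IsBounded (U i)) ∧
      B = Set.univ.pi U} := by
  refine TopologicalSpace.isTopologicalBasis_of_isOpen_of_nhds ?_ ?_
  · rintro B ⟨U, hU, rfl⟩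
    exact isOpen_set_pi Set.finite_univ fun i _ => (hU i).1
  · intro a u ha hu
    obtain ⟨ε, hε, h⟩ := Metric.isOpen_iff.1 hu a ha
    refine ⟨Metric.ball a ε, ⟨fun i => Metric.ball (a i) ε, fun i =>
      ⟨Metric.isOpen_ball, Metric.isBounded_ball⟩, ball_pi a hε⟩, Metric.mem_ball_self hε, h⟩

theorem boxes_isPiSystem : IsPiSystem
    {B : Set (Fin n → E) | ∃ U : Fin n → Set E, (∀ i, IsOpen (U i) ∧ Bornology.IsBounded (U i)) ∧
      B = Set.univ.pi U} := by
  rintro B ⟨U, hU, rfl⟩ B' ⟨U', hU', rfl⟩ -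
  exact ⟨fun i => U i ∩ U' i, fun i => ⟨(hU i).1.inter (hU' i).1, (hU i).2.subset
    Set.inter_subset_left⟩, Set.pi_inter_distrib.symm⟩

variable [NormedSpace ℝ E] [FiniteDimensional ℝ E]

/-- The indicator of a bounded open set is a limit of smooth functions with compact support. -/
theorem exists_smooth_tendsto_indicator {U : Set E} (hU : IsOpen U) (hb : Bornology.IsBounded U) :
    ∃ F : ℕ → E → ℝ, (∀ n, ContDiff ℝ ((⊤ : ℕ∞) : WithTop ℕ∞) (F n)) ∧
      (∀ n, HasCompactSupport (F n)) ∧ (∀ n x, |F n x| ≤ 1) ∧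
      ∀ x, Filter.Tendsto (fun n => F n x) Filter.atTop (𝓝 (U.indicator (fun _ => (1 : ℝ)) x)) := by
  obtain ⟨f, hf, hd, hr⟩ := hU.exists_contDiff_support_eq (n := ⊤)
  have h01 : ∀ x, 0 ≤ f x ∧ f x ≤ 1 := fun x => hr ⟨x, rfl⟩
  have hz : ∀ x, x ∉ U → f x = 0 := fun x hx => by
    rw [← hf] at hx
    exact Function.notMem_support.1 hx
  refine ⟨fun n x => 1 - (1 - f x) ^ (n + 1), fun n => ?_, fun n => ?_, fun n x => ?_, fun x => ?_⟩
  · exact contDiff_const.sub ((contDiff_const.sub hd).pow _)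
  · refine HasCompactSupport.of_support_subset_isCompact hb.isCompact_closure fun x hx => ?_
    by_contra h
    refine hx ?_
    simp only
    rw [hz x fun h' => h (subset_closure h'), sub_zero, one_pow, sub_self]
  · have h1 := h01 x
    have h2 : (1 - f x) ^ (n + 1) ≤ 1 := pow_le_one₀ (by linarith) (by linarith)
    have h3 : 0 ≤ (1 - f x) ^ (n + 1) := pow_nonneg (by linarith) _
    rw [abs_le]
    constructor <;> linarith
  · by_cases hx : x ∈ U
    · have h1 := h01 x
      have h2 : f x ≠ 0 := by
        rw [← hf] at hx
        exact hx
      have h3 : 0 < f x := lt_of_le_of_ne h1.1 (Ne.symm h2)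
      have h4 := (tendsto_pow_atTop_nhds_zero_of_lt_one (r := 1 - f x) (by linarith)
        (by linarith)).comp (Filter.tendsto_add_atTop_nat 1)
      have h5 := h4.const_sub 1
      rw [sub_zero] at h5
      rw [Set.indicator_of_mem hx]
      exact h5
    · simp [Set.indicator_of_notMem hx, hz x hx]

variable [MeasurableSpace E] [BorelSpace E]

/-- An integrable function that is orthogonal to products of smooth functions with compact support
vanishes. -/
theorem ae_eq_zero_of_integral_prod {ρ : Measure (Fin n → E)} {h : (Fin n → E) → ℂ}
    (hi : Integrable h ρ)
    (h0 : ∀ F : Fin n → E → ℝ, (∀ i, ContDiff ℝ ((⊤ : ℕ∞) : WithTop ℕ∞) (F i)) →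
      (∀ i, HasCompactSupport (F i)) → ∫ k, ((∏ i, F i (k i) : ℝ) : ℂ) * h k ∂ρ = 0) :
    h =ᵐ[ρ] 0 := by
  have hbox : ∀ U : Fin n → Set E, (∀ i, IsOpen (U i) ∧ Bornology.IsBounded (U i)) →
      ∫ k in Set.univ.pi U, h k ∂ρ = 0 := by
    intro U hU
    choose F hF1 hF2 hF3 hF4 using fun i => exists_smooth_tendsto_indicator (hU i).1 (hU i).2
    have hms : MeasurableSet (Set.univ.pi U) :=
      MeasurableSet.univ_pi fun i => (hU i).1.measurableSet
    have hlim : Filter.Tendsto (fun j => ∫ k, ((∏ i, F i j (k i) : ℝ) : ℂ) * h k ∂ρ) Filter.atTop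
        (𝓝 (∫ k, (Set.univ.pi U).indicator h k ∂ρ)) := by
      refine tendsto_integral_of_dominated_convergence (fun k => ‖h k‖) (fun j => ?_) hi.norm
        (fun j => Filter.Eventually.of_forall fun k => ?_) (Filter.Eventually.of_forall fun k => ?_)
      · refine AEStronglyMeasurable.mul (Continuous.aestronglyMeasurable ?_) hi.1
        exact Complex.continuous_ofReal.comp (continuous_finsetProd _ fun i _ =>
          (hF1 i j).continuous.comp (continuous_apply i))
      · rw [norm_mul, Complex.norm_real, Real.norm_eq_abs, Finset.abs_prod]
        exact mul_le_of_le_one_left (norm_nonneg _)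
          (Finset.prod_le_one (fun _ _ => abs_nonneg _) fun i _ => hF3 i j (k i))
      · have h1 : Filter.Tendsto (fun j => ∏ i, F i j (k i)) Filter.atTop
            (𝓝 (∏ i, (U i).indicator (fun _ => (1 : ℝ)) (k i))) :=
          tendsto_finsetProd _ fun i _ => hF4 i (k i)
        have h2 := ((Complex.continuous_ofReal.tendsto _).comp h1).mul_const (h k)
        have h3 : (Set.univ.pi U).indicator h k =
            ((∏ i, (U i).indicator (fun _ => (1 : ℝ)) (k i) : ℝ) : ℂ) * h k := by
          by_cases hk : k ∈ Set.univ.pi U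
          · rw [Set.indicator_of_mem hk, Finset.prod_eq_one fun i _ =>
              Set.indicator_of_mem (hk i trivial) _, Complex.ofReal_one, one_mul]
          · rw [Set.indicator_of_notMem hk]
            obtain ⟨i, hi⟩ : ∃ i, k i ∉ U i := by
              by_contra hne
              push Not at hne
              exact hk fun i _ => hne i
            rw [Finset.prod_eq_zero (Finset.mem_univ i) (Set.indicator_of_notMem hi _),
              Complex.ofReal_zero, zero_mul]
        rw [h3]
        exact h2
    have h1 : (fun j => ∫ k, ((∏ i, F i j (k i) : ℝ) : ℂ) * h k ∂ρ) = fun _ => 0 := by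
      funext j
      exact h0 (fun i => F i j) (fun i => hF1 i j) fun i => hF2 i j
    rw [h1] at hlim
    rw [← integral_indicator hms]
    exact tendsto_nhds_unique hlim tendsto_const_nhds
  have huniv : ∫ k, h k ∂ρ = 0 := by
    have h1 := tendsto_setIntegral_of_monotone (μ := ρ) (f := h)
      (s := fun R : ℕ => Set.univ.pi fun _ : Fin n => Metric.ball (0 : E) R)
      (fun R => MeasurableSet.univ_pi fun _ => Metric.isOpen_ball.measurableSet)
      (fun R R' hR => Set.pi_mono fun _ _ => Metric.ball_subset_ball (by exact_mod_cast hR))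
      hi.integrableOn
    have h2 : (⋃ R : ℕ, Set.univ.pi fun _ : Fin n => Metric.ball (0 : E) R) = Set.univ := by
      refine Set.eq_univ_of_forall fun k => Set.mem_iUnion.2 ?_
      obtain ⟨R, hR⟩ := exists_nat_gt ‖k‖
      exact ⟨R, fun i _ => by
        rw [mem_ball_zero_iff]; exact (norm_le_pi_norm k i).trans_lt hR⟩
    rw [h2, Measure.restrict_univ] at h1
    have h3 : (fun R : ℕ => ∫ k in Set.univ.pi fun _ : Fin n => Metric.ball (0 : E) R, h k ∂ρ) =
        fun _ => 0 := by
      funext R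
      exact hbox _ fun _ => ⟨Metric.isOpen_ball, Metric.isBounded_ball⟩
    rw [h3] at h1
    exact tendsto_nhds_unique h1 tendsto_const_nhds
  have hall : ∀ S, MeasurableSet S → ∫ k in S, h k ∂ρ = 0 := by
    refine MeasurableSpace.induction_on_inter (C := fun S _ => ∫ k in S, h k ∂ρ = 0)
      ((BorelSpace.measurable_eq (α := Fin n → E)).trans
        boxes_isTopologicalBasis.borel_eq_generateFrom) boxes_isPiSystem ?_ ?_ ?_ ?_
    · simp
    · rintro S ⟨U, hU, rfl⟩
      exact hbox U hU
    · intro S hS h1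
      rw [setIntegral_compl hS hi, huniv, h1, sub_zero]
    · intro f hd hm h1
      rw [integral_iUnion hm hd hi.integrableOn]
      simp [h1]
  refine hi.ae_eq_zero_of_forall_setIntegral_eq_zero fun S hS _ => hall S hS

end

section

variable {s : ℕ} {m α : ℝ} (c : ℕ → ℝ)

theorem measurableEmbedding_sigma_mk {ι : Type*} {β : ι → Type*} [∀ a, MeasurableSpace (β a)]
    (a : ι) : MeasurableEmbedding (Sigma.mk a : β a → Σ a, β a) := by
  refine ⟨sigma_mk_injective, measurable_sigma_mk a, fun {S} hS => ?_⟩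
  refine MeasurableSpace.measurableSet_iInf.2 fun b => ?_
  change MeasurableSet (Sigma.mk b ⁻¹' (Sigma.mk a '' S))
  by_cases h : b = a
  · subst h
    rw [Set.preimage_image_eq _ sigma_mk_injective]
    exact hS
  · convert MeasurableSet.empty
    refine Set.eq_empty_of_forall_notMem fun x hx => ?_
    obtain ⟨y, -, hy⟩ := hx
    exact h (congrArg Sigma.fst hy).symm

variable (m α) in
/-- The vector of a list of test functions. -/
def listVec (L : List 𝓢(Spacetime s, ℂ)) : Lp ℂ 2 (tupleMeasure s m α c) :=
  vec m α c L.length fun k => ∏ i : Fin L.length, pw (L.getD i 0) (k i)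

theorem tame_list (L : List 𝓢(Spacetime s, ℂ)) :
    Tame fun k : Fin L.length → Spacetime s => ∏ i : Fin L.length, pw (L.getD i 0) (k i) :=
  tame_prod fun i : Fin L.length => pw (L.getD i 0)

theorem listVec_eq_of_length (L : List 𝓢(Spacetime s, ℂ)) {n : ℕ} (h : L.length = n) :
    listVec m α c L = vec m α c n fun k => ∏ i : Fin n, pw (L.getD i 0) (k i) := by
  subst h; rfl

theorem getD_reverse_conjFn (L : List 𝓢(Spacetime s, ℂ)) (i : Fin L.length) :
    (L.map conjFn).reverse.getD i 0 = conjFn (L.getD (Fin.rev i) 0) := by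
  have h2 : ((Fin.rev i : Fin _) : ℕ) = L.length - 1 - i := by rw [Fin.val_rev]; omega
  have h3 : L.length - 1 - i < L.length := by have := i.2; omega
  rw [h2, List.getD_eq_getElem?_getD, List.getD_eq_getElem?_getD,
    List.getElem?_reverse (by simp), List.length_map, List.getElem?_map,
    List.getElem?_eq_getElem h3]
  rfl

theorem inner_listVec (hm : 0 < m) (hα0 : 0 < α) (hα : α ≤ 1 / 2)
    (L L' : List 𝓢(Spacetime s, ℂ)) :
    ⟪listVec m α c L, gramOp s m α c (listVec m α c L')⟫_ℂ =
      wl m α c ((L.map conjFn).reverse ++ L') := by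
  have := isFiniteMeasure_tupleMeasure (s := s) c hm hα0 hα
  rw [listVec, listVec, inner_vec_gramOp_vec hm hα0 hα c (tame_list L) (tame_list L'),
    wl_eq_of_length (n := L.length + L'.length) _ (by simp), nPoint]
  refine Finset.sum_congr rfl fun P _ => ?_
  rw [coef]
  congr 1
  refine integral_congr_ae (Filter.Eventually.of_forall fun k => ?_)
  simp only
  rw [Fin.prod_univ_add, map_prod]
  congr 1
  · rw [← Equiv.prod_comp Fin.revPerm]
    refine Finset.prod_congr rfl fun i _ => ?_
    have h1 : ((L.map conjFn).reverse ++ L').getD (Fin.castAdd L'.length i : ℕ) 0 =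
        conjFn (L.getD (Fin.rev i) 0) := by
      rw [← getD_reverse_conjFn, Fin.val_castAdd, List.getD_append _ _ _ _ (by simp)]
    rw [h1, pw_conjFn, Fin.revPerm_apply, leftPart, Fin.rev_rev]
  · refine Finset.prod_congr rfl fun i _ => ?_
    have h1 : ((L.map conjFn).reverse ++ L').getD (Fin.natAdd L.length i : ℕ) 0 =
        L'.getD i 0 := by
      rw [Fin.val_natAdd, List.getD_append_right _ _ _ _ (by simp)]
      simp
    rw [h1]
    rfl

theorem eq_zero_of_inner_listVec [IsFiniteMeasure (tupleMeasure s m α c)]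
    {G : Lp ℂ 2 (tupleMeasure s m α c)} (h : ∀ L, ⟪listVec m α c L, G⟫_ℂ = 0) : G = 0 := by
  refine Lp.eq_zero_iff_ae_eq_zero.2 ?_
  have hGi : Integrable G (tupleMeasure s m α c) := (Lp.memLp G).integrable (by norm_num)
  have hsec : ∀ n : ℕ, ∀ᵐ x ∂(tupleMeasure s m α c).restrict (Set.range (Sigma.mk n)), G x = 0 := by
    intro n
    have hemb := measurableEmbedding_sigma_mk (β := fun n : ℕ => Fin n → Spacetime s) n
    rw [← hemb.map_comap, hemb.ae_map_iff]
    obtain ⟨ρ, hρ⟩ : ∃ ρ, ρ = (tupleMeasure s m α c).comap (Sigma.mk n) := ⟨_, rfl⟩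
    rw [← hρ]
    have hint : ∀ H : Tuple s → ℂ, ∫ k, H ⟨n, k⟩ ∂ρ =
        ∫ x in Set.range (Sigma.mk n), H x ∂tupleMeasure s m α c := by
      intro H
      rw [← hemb.map_comap, hemb.integral_map, hρ]
    have hGρ : Integrable (fun k => G ⟨n, k⟩) ρ := by
      have h1 := hGi.integrableOn (s := Set.range (Sigma.mk n))
      rw [IntegrableOn, ← hemb.map_comap, hemb.integrable_map_iff, ← hρ] at h1
      exact h1
    have hprod : ∀ F : Fin n → 𝓢(Spacetime s, ℂ),
        ∫ k, conj (((invWt k)⁻¹ : ℝ) * ∏ i, F i (k i)) * G ⟨n, k⟩ ∂ρ = 0 := by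
      intro F
      choose f hf using fun i => pw_surjective (F i)
      have hsc : ((scale s m α c n : ℝ) : ℂ) ≠ 0 := by exact_mod_cast (scale_pos m α c n).ne'
      have hT := tame_prod F
      have h1 := h (List.ofFn f)
      have h2 : listVec m α c (List.ofFn f) = vec m α c n fun k => ∏ i, F i (k i) := by
        rw [listVec_eq_of_length c _ (List.length_ofFn (f := f))]
        congr 1
        funext k
        refine Finset.prod_congr rfl fun i _ => ?_
        rw [← hf]
        simp [List.getD_eq_getElem?_getD]
      rw [h2, inner_eq_integral] at h1
      have h3 : ∫ x, conj (vecFn m α c n (fun k => ∏ i, F i (k i)) x) * G x ∂tupleMeasure s m α c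
          = 0 := by
        rw [← h1]
        refine integral_congr_ae ?_
        filter_upwards [vec_ae m α c hT] with x hx
        rw [hx]
      rw [← setIntegral_eq_integral_of_forall_compl_eq_zero (s := Set.range (Sigma.mk n)),
        ← hint] at h3
      · simp only [vecFn_mk] at h3
        have h4 : ∀ k, conj (((scale s m α c n * (invWt k)⁻¹ : ℝ) : ℂ) * ∏ i, F i (k i)) *
            G ⟨n, k⟩ = (scale s m α c n : ℂ) *
              (conj (((invWt k)⁻¹ : ℝ) * ∏ i, F i (k i)) * G ⟨n, k⟩) := by
          intro k
          simp only [Complex.ofReal_mul, map_mul, Complex.conj_ofReal]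
          ring
        simp_rw [h4] at h3
        rw [integral_const_mul] at h3
        exact (mul_eq_zero.1 h3).resolve_left hsc
      · rintro ⟨j, k⟩ hx
        have hj : j ≠ n := by
          rintro rfl
          exact hx ⟨k, rfl⟩
        rw [vecFn_of_ne m α c hj, map_zero, zero_mul]
    have hR : ∀ R : ℕ, ∀ᵐ k ∂ρ, (∀ i, k i ∈ Metric.ball (0 : Spacetime s) R) → G ⟨n, k⟩ = 0 := by
      intro R
      obtain ⟨χ, hχ, hχd, hχr⟩ :=
        (Metric.isOpen_ball (x := (0 : Spacetime s)) (ε := R)).exists_contDiff_support_eq (n := ⊤)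
      have hχc : HasCompactSupport χ :=
        HasCompactSupport.of_support_subset_isCompact (isCompact_closedBall 0 (R : ℝ)) (by
          rw [hχ]; exact Metric.ball_subset_closedBall)
      obtain ⟨C, hC⟩ : ∃ C, ∀ k, |χ k * wt k| ≤ C := by
        have hc : Continuous fun k => χ k * wt k := hχd.continuous.mul continuous_wt
        obtain ⟨C, hC⟩ := hc.bounded_above_of_compact_support (hχc.mul_right (f' := wt))
        exact ⟨C, hC⟩
      have hw : ∀ k : Fin n → Spacetime s, (∏ i, χ (k i)) * (invWt k)⁻¹ =
          ∏ i, (χ (k i) * wt (k i)) := by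
        intro k
        rw [invWt, Finset.prod_mul_distrib, ← Finset.prod_inv_distrib]
        simp
      have hi : Integrable (fun k => (((∏ i, χ (k i)) * (invWt k)⁻¹ : ℝ) : ℂ) * G ⟨n, k⟩) ρ := by
        refine hGρ.bdd_mul (c := C ^ n) ?_ (Filter.Eventually.of_forall fun k => ?_)
        · refine (Complex.measurable_ofReal.comp (Measurable.mul ?_ (by fun_prop))).aestronglyMeasurable
          exact Finset.measurable_prod _ fun i _ =>
            hχd.continuous.measurable.comp (measurable_pi_apply i)
        · rw [Complex.norm_real, Real.norm_eq_abs, hw, Finset.abs_prod]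
          calc ∏ i, |χ (k i) * wt (k i)| ≤ ∏ _i : Fin n, C :=
                Finset.prod_le_prod (fun _ _ => abs_nonneg _) fun i _ => hC (k i)
            _ = C ^ n := by simp
      have hz := ae_eq_zero_of_integral_prod hi fun F hF hFc => by
        have hs : ∀ i, HasCompactSupport fun x => ((F i x * χ x : ℝ) : ℂ) := fun i =>
          ((hFc i).mul_right (f' := χ)).comp_left (g := fun r : ℝ => (r : ℂ)) (by simp)
        have hd : ∀ i, ContDiff ℝ ((⊤ : ℕ∞) : WithTop ℕ∞) fun x => ((F i x * χ x : ℝ) : ℂ) :=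
          fun i => Complex.ofRealCLM.contDiff.comp ((hF i).mul hχd)
        have h1 := hprod fun i => (hs i).toSchwartzMap (hd i)
        rw [← h1]
        refine integral_congr_ae (Filter.Eventually.of_forall fun k => ?_)
        simp only [HasCompactSupport.toSchwartzMap_toFun, ← Complex.ofReal_prod,
          ← Complex.ofReal_mul, Complex.conj_ofReal, Finset.prod_mul_distrib]
        rw [← mul_assoc, ← Complex.ofReal_mul]
        congr 2
        ring
      filter_upwards [hz] with k hk hkR
      have h1 : (((∏ i, χ (k i)) * (invWt k)⁻¹ : ℝ) : ℂ) ≠ 0 := by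
        refine Complex.ofReal_ne_zero.2 (mul_ne_zero (Finset.prod_ne_zero_iff.2 fun i _ => ?_)
          (inv_ne_zero (invWt_pos k).ne'))
        have := hkR i
        rw [← hχ] at this
        exact this
      exact (mul_eq_zero.1 hk).resolve_left h1
    filter_upwards [ae_all_iff.2 hR] with k hk
    obtain ⟨R, hR⟩ := exists_nat_gt ‖k‖
    exact hk R fun i => by rw [mem_ball_zero_iff]; exact (norm_le_pi_norm k i).trans_lt hR
  have hU : (⋃ n : ℕ, Set.range (Sigma.mk (β := fun n : ℕ => Fin n → Spacetime s) n)) = Set.univ :=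
    Set.eq_univ_of_forall fun x => by
      obtain ⟨n, k⟩ := x
      exact Set.mem_iUnion.2 ⟨n, k, rfl⟩
  have h1 := (ae_restrict_iUnion_iff (μ := tupleMeasure s m α c)
    (fun n : ℕ => Set.range (Sigma.mk (β := fun n : ℕ => Fin n → Spacetime s) n)) fun x => G x = 0).2 hsec
  rw [hU, Measure.restrict_univ] at h1
  exact h1

theorem dense_span_listVec [IsFiniteMeasure (tupleMeasure s m α c)] :
    (Submodule.span ℂ (Set.range (listVec (s := s) m α c))).topologicalClosure = ⊤ := by
  rw [Submodule.topologicalClosure_eq_top_iff, Submodule.eq_bot_iff]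
  intro G hG
  refine eq_zero_of_inner_listVec c fun L => ?_
  exact (Submodule.mem_orthogonal _ _).1 hG _ (Submodule.subset_span ⟨L, rfl⟩)

theorem map_reverse_conjFn (L : List 𝓢(Spacetime s, ℂ)) :
    (((L.map conjFn).reverse).map conjFn).reverse = L := by
  have h : ∀ f : 𝓢(Spacetime s, ℂ), conjFn (conjFn f) = f := fun f => by
    ext x; simp [conjFn]
  simp [Function.comp_def, h]

theorem isSelfAdjoint_gramOp (hm : 0 < m) (hα0 : 0 < α) (hα : α ≤ 1 / 2) :
    IsSelfAdjoint (gramOp s m α c) := by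
  have := isFiniteMeasure_tupleMeasure (s := s) c hm hα0 hα
  have hd : Dense (Submodule.span ℂ (Set.range (listVec (s := s) m α c)) :
      Set (Lp ℂ 2 (tupleMeasure s m α c))) :=
    Submodule.dense_iff_topologicalClosure_eq_top.2 (dense_span_listVec c)
  obtain ⟨A, hA⟩ : ∃ A, A = gramOp s m α c := ⟨_, rfl⟩
  have h1 : ∀ L L' : List 𝓢(Spacetime s, ℂ), ⟪A (listVec m α c L), listVec m α c L'⟫_ℂ =
      ⟪listVec m α c L, A (listVec m α c L')⟫_ℂ := by
    intro L L'
    rw [hA, ← inner_conj_symm, inner_listVec c hm hα0 hα, inner_listVec c hm hα0 hα,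
      ← wl_reverse hα0 hα, List.map_append, List.reverse_append, map_reverse_conjFn]
  rw [← hA]
  refine ContinuousLinearMap.isSelfAdjoint_iff'.2 (ContinuousLinearMap.ext_on hd ?_)
  rintro _ ⟨L', rfl⟩
  refine ext_inner_left ℂ fun F => ?_
  have h2 : (innerSL ℂ (ContinuousLinearMap.adjoint A (listVec m α c L') - A (listVec m α c L'))) = 0 := by
    refine ContinuousLinearMap.ext_on hd ?_
    rintro _ ⟨L, rfl⟩
    rw [innerSL_apply_apply, inner_sub_left, ContinuousLinearMap.adjoint_inner_left, h1, sub_self]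
    rfl
  have h3 : ⟪ContinuousLinearMap.adjoint A (listVec m α c L') - A (listVec m α c L'), F⟫_ℂ = 0 := by
    rw [← innerSL_apply_apply, h2]; rfl
  rw [← sub_eq_zero, ← inner_sub_right, ← inner_conj_symm, h3, map_zero]

end

/-! ### Functions of the momentum as multiplication operators -/

section

variable {X : Type*} [MeasurableSpace X] {ρ : Measure X}

theorem mulOp_union {A B : Set X} (hA : MeasurableSet A) (hB : MeasurableSet B)
    (h : Disjoint A B) (f : Lp ℂ 2 ρ) :
    mulOp ρ ((A ∪ B).indicator fun _ => (1 : ℂ)) f =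
      mulOp ρ (A.indicator fun _ => (1 : ℂ)) f + mulOp ρ (B.indicator fun _ => (1 : ℂ)) f := by
  refine Lp.ext ?_
  filter_upwards [mulOp_apply (mult_indicator (hA.union hB)) f, mulOp_apply (mult_indicator hA) f,
    mulOp_apply (mult_indicator hB) f, Lp.coeFn_add (mulOp ρ (A.indicator fun _ => (1 : ℂ)) f)
      (mulOp ρ (B.indicator fun _ => (1 : ℂ)) f)] with x h1 h2 h3 h4
  rw [h4, Pi.add_apply, h1, h2, h3, Set.indicator_union_of_disjoint h, add_mul]

theorem mulOp_empty (f : Lp ℂ 2 ρ) : mulOp ρ ((∅ : Set X).indicator fun _ => (1 : ℂ)) f = 0 := by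
  refine Lp.eq_zero_iff_ae_eq_zero.2 ?_
  filter_upwards [mulOp_apply (mult_indicator (MeasurableSet.empty (α := X))) f] with x h1
  rw [h1]; simp

theorem mulOp_biUnion {A : ℕ → Set X} (hA : ∀ i, MeasurableSet (A i))
    (hd : Pairwise (Function.onFun Disjoint A)) (f : Lp ℂ 2 ρ) (F : Finset ℕ) :
    mulOp ρ ((⋃ i ∈ F, A i).indicator fun _ => (1 : ℂ)) f =
      ∑ i ∈ F, mulOp ρ ((A i).indicator fun _ => (1 : ℂ)) f := by
  induction F using Finset.induction_on with
  | empty =>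
    rw [show (⋃ i ∈ (∅ : Finset ℕ), A i) = ∅ by simp, mulOp_empty, Finset.sum_empty]
  | insert a F ha ih =>
    rw [Finset.sum_insert ha, Finset.set_biUnion_insert, mulOp_union (hA a)
      (Finset.measurableSet_biUnion F fun i _ => hA i) ?_, ih]
    refine Set.disjoint_iUnion₂_right.2 fun i hi => hd ?_
    rintro rfl
    exact ha hi

theorem hasSum_mulOp_indicator {A : ℕ → Set X} (hA : ∀ i, MeasurableSet (A i))
    (hd : Pairwise (Function.onFun Disjoint A)) (f : Lp ℂ 2 ρ) :
    HasSum (fun i => mulOp ρ ((A i).indicator fun _ => (1 : ℂ)) f)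
      (mulOp ρ ((⋃ i, A i).indicator fun _ => (1 : ℂ)) f) := by
  have h := tendsto_mulOp (ρ := ρ) (l := Filter.atTop)
    (φ := fun F : Finset ℕ => (⋃ i ∈ F, A i).indicator fun _ => (1 : ℂ))
    (fun F => mult_indicator (Finset.measurableSet_biUnion F fun i _ => hA i))
    (mult_indicator (MeasurableSet.iUnion hA)) (Filter.Eventually.of_forall fun x =>
      (tendsto_indicator_biUnion_finset A (fun _ => (1 : ℂ)) x).mono_right (pure_le_nhds _)) f
  simp_rw [mulOp_biUnion hA hd] at h
  exact h

variable {s : ℕ} {p : X → Spacetime s}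

theorem mult_wave (a : Spacetime s) : Mult fun k : Spacetime s => wave k a :=
  ⟨(continuous_wave_left a).measurable, fun k => (norm_wave k a).le⟩

theorem wave_smul (k a : Spacetime s) (t : ℝ) :
    wave k (t • a) = Complex.exp (Complex.I * ((t * ⟪k, a⟫_ℝ : ℝ) : ℂ)) := by
  rw [wave, inner_smul_right]

theorem tendsto_wave_slope (k a : Spacetime s) :
    Filter.Tendsto (fun t : ℝ => (t : ℂ)⁻¹ * (wave k (t • a) - 1)) (𝓝[≠] 0)
      (𝓝 (Complex.I * (⟪k, a⟫_ℝ : ℂ))) := by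
  have h1 : HasDerivAt (fun t : ℝ => Complex.I * ((t * ⟪k, a⟫_ℝ : ℝ) : ℂ))
      (Complex.I * (⟪k, a⟫_ℝ : ℂ)) 0 := by
    have := ((hasDerivAt_id (0 : ℝ)).mul_const ⟪k, a⟫_ℝ).ofReal_comp.const_mul Complex.I
    simpa using this
  have h2 := h1.cexp
  rw [hasDerivAt_iff_tendsto_slope_zero] at h2
  simp only [zero_mul, Complex.ofReal_zero, mul_zero, Complex.exp_zero, one_mul, zero_add] at h2
  refine h2.congr fun t => ?_
  rw [wave_smul, Complex.real_smul, Complex.ofReal_inv]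

theorem norm_wave_slope_le (k a : Spacetime s) {t : ℝ} (ht : t ≠ 0) :
    ‖(t : ℂ)⁻¹ * (wave k (t • a) - 1)‖ ≤ |⟪k, a⟫_ℝ| := by
  rw [norm_mul, norm_inv, Complex.norm_real, wave_smul, inv_mul_le_iff₀ (norm_pos_iff.2 ht)]
  refine Real.norm_exp_I_mul_ofReal_sub_one_le.trans ?_
  rw [norm_mul]
  rfl


theorem slope_mulOp_wave (hp : Measurable p) (a : Spacetime s) (f : Lp ℂ 2 ρ) (t : ℝ) :
    (t⁻¹ • (mulOp ρ (fun x => wave (p x) ((0 + t) • a)) f -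
      mulOp ρ (fun x => wave (p x) ((0 : ℝ) • a)) f) : Lp ℂ 2 ρ) =ᵐ[ρ]
      fun x => (t : ℂ)⁻¹ * (wave (p x) (t • a) - 1) * f x := by
  rw [zero_add]
  filter_upwards [mulOp_apply ((mult_wave (t • a)).comp hp) f,
    mulOp_apply ((mult_wave ((0 : ℝ) • a)).comp hp) f,
    Lp.coeFn_sub (mulOp ρ (fun x => wave (p x) (t • a)) f)
      (mulOp ρ (fun x => wave (p x) ((0 : ℝ) • a)) f),
    Lp.coeFn_smul t⁻¹ (mulOp ρ (fun x => wave (p x) (t • a)) f -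
      mulOp ρ (fun x => wave (p x) ((0 : ℝ) • a)) f)] with x h1 h2 h3 h4
  rw [h4, Pi.smul_apply, h3, Pi.sub_apply, h1, h2, zero_smul, wave_zero_right, Complex.real_smul,
    Complex.ofReal_inv]
  ring

theorem ae_eq_of_hasDerivAt_wave (hp : Measurable p) {a : Spacetime s} {f g : Lp ℂ 2 ρ}
    (h : HasDerivAt (fun t : ℝ => mulOp ρ (fun x => wave (p x) (t • a)) f) g 0) :
    g =ᵐ[ρ] fun x => Complex.I * (⟪p x, a⟫_ℝ : ℂ) * f x := by
  rw [hasDerivAt_iff_tendsto_slope_zero] at h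
  obtain ⟨ns, hns, hlim⟩ := (tendstoInMeasure_of_tendsto_Lp h).exists_seq_tendsto_ae'
  filter_upwards [hlim, ae_all_iff.2 fun i => slope_mulOp_wave hp a f (ns i)] with x h1 h2
  refine tendsto_nhds_unique h1 ?_
  simp_rw [h2]
  exact ((tendsto_wave_slope (p x) a).comp hns).mul_const (f x)

theorem hasDerivAt_wave (hp : Measurable p) {a : Spacetime s} {f g : Lp ℂ 2 ρ}
    (h : g =ᵐ[ρ] fun x => Complex.I * (⟪p x, a⟫_ℝ : ℂ) * f x) :
    HasDerivAt (fun t : ℝ => mulOp ρ (fun x => wave (p x) (t • a)) f) g 0 := by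
  rw [hasDerivAt_iff_tendsto_slope_zero, tendsto_iff_norm_sub_tendsto_zero]
  have hsq : Filter.Tendsto (fun t : ℝ => ‖t⁻¹ • (mulOp ρ (fun x => wave (p x) ((0 + t) • a)) f -
      mulOp ρ (fun x => wave (p x) ((0 : ℝ) • a)) f) - g‖ ^ 2) (𝓝[≠] 0) (𝓝 0) := by
    have e : ∀ t : ℝ, ‖t⁻¹ • (mulOp ρ (fun x => wave (p x) ((0 + t) • a)) f -
        mulOp ρ (fun x => wave (p x) ((0 : ℝ) • a)) f) - g‖ ^ 2 =
        ∫ x, ‖((t : ℂ)⁻¹ * (wave (p x) (t • a) - 1) - Complex.I * (⟪p x, a⟫_ℝ : ℂ)) * f x‖ ^ 2 ∂ρ := by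
      intro t
      rw [norm_sq_eq_integral]
      refine integral_congr_ae ?_
      filter_upwards [slope_mulOp_wave hp a f t, h, Lp.coeFn_sub (t⁻¹ •
        (mulOp ρ (fun x => wave (p x) ((0 + t) • a)) f -
        mulOp ρ (fun x => wave (p x) ((0 : ℝ) • a)) f)) g] with x h1 h2 h3
      rw [h3, Pi.sub_apply, h1, h2, sub_mul]
    simp_rw [e]
    rw [show 𝓝 (0 : ℝ) = 𝓝 (∫ _ : X, (0 : ℝ) ∂ρ) by rw [integral_zero]]
    refine tendsto_integral_filter_of_dominated_convergence (fun x => 4 * ‖g x‖ ^ 2)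
      (Filter.Eventually.of_forall fun t => ?_) ?_
      ((Lp.memLp g).integrable_norm_pow (by norm_num) |>.const_mul 4) ?_
    · have hm : Measurable fun x => (t : ℂ)⁻¹ * (wave (p x) (t • a) - 1) -
          Complex.I * (⟪p x, a⟫_ℝ : ℂ) := by
        have hc : Continuous fun k : Spacetime s => (t : ℂ)⁻¹ * (wave k (t • a) - 1) -
            Complex.I * (⟪k, a⟫_ℝ : ℂ) := by fun_prop
        exact hc.measurable.comp hp
      exact ((hm.aestronglyMeasurable.mul (Lp.aestronglyMeasurable f)).norm).pow 2
    · filter_upwards [self_mem_nhdsWithin] with t ht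
      filter_upwards [h] with x hx
      have h1 := norm_wave_slope_le (p x) a ht
      have h2 : ‖Complex.I * (⟪p x, a⟫_ℝ : ℂ)‖ = |⟪p x, a⟫_ℝ| := by
        rw [norm_mul, Complex.norm_I, one_mul, Complex.norm_real, Real.norm_eq_abs]
      have h3 := (norm_sub_le ((t : ℂ)⁻¹ * (wave (p x) (t • a) - 1))
        (Complex.I * (⟪p x, a⟫_ℝ : ℂ))).trans (add_le_add h1 h2.le)
      rw [Real.norm_of_nonneg (by positivity), hx, norm_mul, norm_mul _ (f x), h2, mul_pow, mul_pow,
        ← mul_assoc]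
      refine mul_le_mul_of_nonneg_right ?_ (by positivity)
      nlinarith [norm_nonneg ((t : ℂ)⁻¹ * (wave (p x) (t • a) - 1) -
        Complex.I * (⟪p x, a⟫_ℝ : ℂ)), abs_nonneg ⟪p x, a⟫_ℝ]
    · refine Filter.Eventually.of_forall fun x => ?_
      have h1 := ((((tendsto_wave_slope (p x) a).sub_const
        (Complex.I * (⟪p x, a⟫_ℝ : ℂ))).mul_const (f x)).norm).pow 2
      simpa using h1
  have := hsq.sqrt
  simpa [Real.sqrt_sq (norm_nonneg _)] using this

theorem exists_hasDerivAt_wave_iff (hp : Measurable p) {a : Spacetime s} {f : Lp ℂ 2 ρ} :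
    (∃ g, HasDerivAt (fun t : ℝ => mulOp ρ (fun x => wave (p x) (t • a)) f) g 0) ↔
      Integrable (fun x => ⟪p x, a⟫_ℝ ^ 2 * ‖f x‖ ^ 2) ρ := by
  have hm : Measurable fun x => Complex.I * (⟪p x, a⟫_ℝ : ℂ) := by
    have hc : Continuous fun k : Spacetime s => Complex.I * (⟪k, a⟫_ℝ : ℂ) := by fun_prop
    exact hc.measurable.comp hp
  have hn : ∀ x, ‖Complex.I * (⟪p x, a⟫_ℝ : ℂ) * f x‖ ^ 2 = ⟪p x, a⟫_ℝ ^ 2 * ‖f x‖ ^ 2 := fun x => by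
    rw [norm_mul, norm_mul, Complex.norm_I, one_mul, Complex.norm_real, mul_pow, Real.norm_eq_abs,
      sq_abs]
  have hs : AEStronglyMeasurable (fun x => Complex.I * (⟪p x, a⟫_ℝ : ℂ) * f x) ρ :=
    hm.aestronglyMeasurable.mul (Lp.aestronglyMeasurable f)
  constructor
  · rintro ⟨g, hg⟩
    have h1 := ae_eq_of_hasDerivAt_wave hp hg
    refine ((Lp.memLp g).integrable_norm_pow (by norm_num)).congr ?_
    filter_upwards [h1] with x hx
    rw [hx]
    exact hn x
  · intro h
    have h1 : MemLp (fun x => Complex.I * (⟪p x, a⟫_ℝ : ℂ) * f x) 2 ρ := by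
      rw [memLp_two_iff_integrable_sq_norm hs]
      exact h.congr (Filter.Eventually.of_forall fun x => (hn x).symm)
    exact ⟨h1.toLp, hasDerivAt_wave hp h1.coeFn_toLp⟩

end

/-! ### Translations and spectral measure on an invariant subspace -/

section

variable {K : Type*} [NormedAddCommGroup K] [InnerProductSpace ℂ K] (S : Submodule ℂ K)
  [S.HasOrthogonalProjection]

/-- The compression of an operator to a closed subspace. -/
def compress (B : K →L[ℂ] K) : S →L[ℂ] S := S.orthogonalProjectionOnto.comp (B.comp S.subtypeL)

variable {S}

theorem compress_apply (B : K →L[ℂ] K) (x : S) : compress S B x = S.orthogonalProjectionOnto (B x) := rfl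

theorem coe_compress {B : K →L[ℂ] K} (h : ∀ x ∈ S, B x ∈ S) (x : S) : (compress S B x : K) = B x := by
  rw [compress_apply]
  exact Submodule.starProjection_eq_self_iff.2 (h x x.2)

end

section

variable {X : Type*} [MeasurableSpace X] {ρ : Measure X} {s : ℕ} {p : X → Spacetime s}
  {S : Submodule ℂ (Lp ℂ 2 ρ)}

variable (p S) in
/-- The subspace is invariant under multiplication by functions of the momentum. -/
def MomentumInvariant : Prop :=
  Measurable p ∧ ∀ φ, Mult φ → ∀ x ∈ S, mulOp ρ (fun x => φ (p x)) x ∈ S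

variable [S.HasOrthogonalProjection]

variable (p S) in
/-- Multiplication by a function of the momentum. -/
def momOp (φ : Spacetime s → ℂ) : S →L[ℂ] S := compress S (mulOp ρ fun x => φ (p x))

namespace MomentumInvariant

theorem coe_momOp (hS : MomentumInvariant p S) {φ : Spacetime s → ℂ} (hφ : Mult φ) (Ψ : S) :
    (momOp p S φ Ψ : Lp ℂ 2 ρ) = mulOp ρ (fun x => φ (p x)) (Ψ : Lp ℂ 2 ρ) :=
  coe_compress (hS.2 φ hφ) Ψ

theorem momOp_mul (hS : MomentumInvariant p S) {φ ψ : Spacetime s → ℂ} (hφ : Mult φ) (hψ : Mult ψ)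
    (Ψ : S) : momOp p S (fun k => φ k * ψ k) Ψ = momOp p S φ (momOp p S ψ Ψ) := by
  refine Subtype.ext ?_
  rw [hS.coe_momOp (hφ.mul hψ), hS.coe_momOp hφ, hS.coe_momOp hψ,
    mulOp_mul_apply (hφ.comp hS.1) (hψ.comp hS.1)]

theorem momOp_one (hS : MomentumInvariant p S) (Ψ : S) : momOp p S (fun _ => 1) Ψ = Ψ := by
  refine Subtype.ext ?_
  rw [hS.coe_momOp mult_one, mulOp_one_apply]

theorem momOp_inner (hS : MomentumInvariant p S) {φ : Spacetime s → ℂ} (hφ : Mult φ) (Φ Ψ : S) :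
    ⟪momOp p S φ Φ, Ψ⟫_ℂ = ⟪Φ, momOp p S (fun k => conj (φ k)) Ψ⟫_ℂ := by
  rw [Submodule.coe_inner, Submodule.coe_inner, hS.coe_momOp hφ, hS.coe_momOp hφ.conj,
    mulOp_inner _ _ (hφ.comp hS.1)]

theorem momOp_wave_neg (hS : MomentumInvariant p S) (a : Spacetime s) (Ψ : S) :
    momOp p S (fun k => wave k (-a)) (momOp p S (fun k => wave k a) Ψ) = Ψ := by
  rw [← hS.momOp_mul (mult_wave _) (mult_wave _)]
  have : (fun k : Spacetime s => wave k (-a) * wave k a) = fun _ => 1 := by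
    funext k
    rw [← wave_add_right, neg_add_cancel, wave_zero_right]
  rw [this, hS.momOp_one]

/-- The translations. -/
def translations (hS : MomentumInvariant p S) (a : Spacetime s) : S ≃ₗᵢ[ℂ] S where
  toLinearEquiv := LinearEquiv.ofLinearMap (momOp p S fun k => wave k a).toLinearMap
    (momOp p S fun k => wave k (-a)).toLinearMap
    (LinearMap.ext fun Ψ => by
      have := hS.momOp_wave_neg (-a) Ψ
      rwa [neg_neg] at this)
    (LinearMap.ext fun Ψ => hS.momOp_wave_neg a Ψ)
  norm_map' Ψ := by
    change ‖momOp p S (fun k => wave k a) Ψ‖ = ‖Ψ‖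
    change ‖(momOp p S (fun k => wave k a) Ψ : Lp ℂ 2 ρ)‖ = ‖(Ψ : Lp ℂ 2 ρ)‖
    rw [hS.coe_momOp (mult_wave a), norm_mulOp_of_norm_eq_one
      ((mult_wave a).comp hS.1) fun x => norm_wave _ _]

theorem translations_apply (hS : MomentumInvariant p S) (a : Spacetime s) (Ψ : S) :
    hS.translations a Ψ = momOp p S (fun k => wave k a) Ψ := rfl

theorem coe_translations (hS : MomentumInvariant p S) (a : Spacetime s) (Ψ : S) :
    (hS.translations a Ψ : Lp ℂ 2 ρ) = mulOp ρ (fun x => wave (p x) a) (Ψ : Lp ℂ 2 ρ) :=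
  hS.coe_momOp (mult_wave a) Ψ

theorem isTranslationGroup (hS : MomentumInvariant p S) : IsTranslationGroup hS.translations := by
  refine ⟨fun a b Ψ => ?_, fun Ψ => ?_⟩
  · rw [translations_apply, translations_apply, translations_apply,
      ← hS.momOp_mul (mult_wave _) (mult_wave _)]
    congr 2
    funext k
    rw [wave_add_right]
  · refine continuous_iff_continuousAt.2 fun a => ?_
    have h := tendsto_mulOp (ρ := ρ) (l := 𝓝 a) (φ := fun a x => wave (p x) a)
      (fun a => (mult_wave a).comp hS.1) ((mult_wave a).comp hS.1)
      (Filter.Eventually.of_forall fun x => (continuous_wave_right (p x)).tendsto a)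
      (Ψ : Lp ℂ 2 ρ)
    exact (S.orthogonalProjectionOnto.continuous.tendsto _).comp h

theorem exists_hasDerivAt_iff (hS : MomentumInvariant p S) (a : Spacetime s) (Ψ : S) :
    DifferentiableAt ℝ (fun t : ℝ => hS.translations (t • a) Ψ) 0 ↔
      Integrable (fun x => ⟪p x, a⟫_ℝ ^ 2 * ‖(Ψ : Lp ℂ 2 ρ) x‖ ^ 2) ρ := by
  rw [← exists_hasDerivAt_wave_iff hS.1]
  constructor
  · intro h
    have h1 := ((S.subtypeL).restrictScalars ℝ).hasFDerivAt.comp_hasDerivAt (0 : ℝ) h.hasDerivAt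
    refine ⟨_, h1.congr_of_eventuallyEq (Filter.Eventually.of_forall fun t => ?_)⟩
    exact (hS.coe_translations (t • a) Ψ).symm
  · rintro ⟨g, hg⟩
    have h1 := ((S.orthogonalProjectionOnto).restrictScalars ℝ).hasFDerivAt.comp_hasDerivAt (0 : ℝ) hg
    exact h1.differentiableAt

theorem inner_generator (hS : MomentumInvariant p S) (a : Spacetime s)
    (Ψ : (generator hS.translations a).domain) :
    ⟪(Ψ : S), generator hS.translations a Ψ⟫_ℂ =
      ((∫ x, ⟪p x, a⟫_ℝ * ‖((Ψ : S) : Lp ℂ 2 ρ) x‖ ^ 2 ∂ρ : ℝ) : ℂ) := by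
  have h := hasDerivAt_of_mem_generator Ψ
  have h1 := ((S.subtypeL).restrictScalars ℝ).hasFDerivAt.comp_hasDerivAt (0 : ℝ) h
  have h2 := ae_eq_of_hasDerivAt_wave hS.1 (h1.congr_of_eventuallyEq
    (Filter.Eventually.of_forall fun t => (hS.coe_translations (t • a) (Ψ : S)).symm))
  have h3 : Complex.I * ⟪(Ψ : S), generator hS.translations a Ψ⟫_ℂ =
      ⟪((Ψ : S) : Lp ℂ 2 ρ), S.subtypeL (Complex.I • generator hS.translations a Ψ)⟫_ℂ :=
    (inner_smul_right (Ψ : S) (generator hS.translations a Ψ) Complex.I).symm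
  have h4 : ⟪((Ψ : S) : Lp ℂ 2 ρ), S.subtypeL (Complex.I • generator hS.translations a Ψ)⟫_ℂ =
      Complex.I * ((∫ x, ⟪p x, a⟫_ℝ * ‖((Ψ : S) : Lp ℂ 2 ρ) x‖ ^ 2 ∂ρ : ℝ) : ℂ) := by
    rw [inner_eq_integral, ← integral_complex_ofReal, ← integral_const_mul]
    refine integral_congr_ae ?_
    filter_upwards [h2] with x hx
    refine (congrArg (conj (((Ψ : S) : Lp ℂ 2 ρ) x) * ·) hx).trans ?_
    have e : conj (((Ψ : S) : Lp ℂ 2 ρ) x) * (((Ψ : S) : Lp ℂ 2 ρ) x) =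
        ((‖((Ψ : S) : Lp ℂ 2 ρ) x‖ ^ 2 : ℝ) : ℂ) := by
      rw [mul_comm, Complex.mul_conj, Complex.normSq_eq_norm_sq]
    rw [Complex.ofReal_mul, ← e]
    ring
  rw [h4] at h3
  exact mul_left_cancel₀ Complex.I_ne_zero h3

variable [CompleteSpace S]

theorem isStarProjection_momOp (hS : MomentumInvariant p S) {A : Set (Spacetime s)}
    (hA : MeasurableSet A) : IsStarProjection (momOp p S (A.indicator fun _ => (1 : ℂ))) := by
  have hm := mult_indicator hA
  refine ⟨ContinuousLinearMap.ext fun Ψ => ?_, isSelfAdjoint_of_inner fun Φ Ψ => ?_⟩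
  · rw [mul_apply_eq_comp, ← hS.momOp_mul hm hm]
    congr 2
    funext k
    by_cases h : k ∈ A <;> simp [h]
  · rw [hS.momOp_inner hm]
    congr 3
    funext k
    by_cases h : k ∈ A <;> simp [h]

open Classical in
/-- The spectral measure of the momentum. -/
def spectralMeasure (hS : MomentumInvariant p S) : ProjectionValuedMeasure S (Spacetime s) where
  proj A := if MeasurableSet A then momOp p S (A.indicator fun _ => (1 : ℂ)) else 0
  isStarProjection A hA := by
    rw [if_pos hA]; exact hS.isStarProjection_momOp hA
  proj_univ := by
    rw [if_pos MeasurableSet.univ, Set.indicator_univ]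
    exact ContinuousLinearMap.ext fun Ψ => hS.momOp_one Ψ
  proj_inter A B hA hB := by
    rw [if_pos hA, if_pos hB, if_pos (hA.inter hB)]
    refine ContinuousLinearMap.ext fun Ψ => ?_
    rw [mul_apply_eq_comp, ← hS.momOp_mul (mult_indicator hA) (mult_indicator hB)]
    congr 2
    funext k
    by_cases h : k ∈ A <;> by_cases h' : k ∈ B <;> simp [h, h']
  hasSum_iUnion A hA hd Ψ := by
    simp_rw [if_pos (hA _)]
    rw [if_pos (MeasurableSet.iUnion hA)]
    have h := hasSum_mulOp_indicator (ρ := ρ) (A := fun i => p ⁻¹' A i) (fun i => hS.1 (hA i))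
      (fun i j hij => (hd hij).preimage p) (Ψ : Lp ℂ 2 ρ)
    rw [← Set.preimage_iUnion] at h
    exact h.mapL S.orthogonalProjectionOnto

theorem spectralMeasure_apply (hS : MomentumInvariant p S) {A : Set (Spacetime s)}
    (hA : MeasurableSet A) :
    hS.spectralMeasure.proj A = momOp p S (A.indicator fun _ => (1 : ℂ)) := if_pos hA

theorem scalar_spectralMeasure (hS : MomentumInvariant p S) (Ψ : S) :
    hS.spectralMeasure.scalar Ψ =
      (ρ.withDensity fun x => ENNReal.ofReal (‖(Ψ : Lp ℂ 2 ρ) x‖ ^ 2)).map p := by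
  have hi : Integrable (fun x => ‖(Ψ : Lp ℂ 2 ρ) x‖ ^ 2) ρ :=
    (Lp.memLp (Ψ : Lp ℂ 2 ρ)).integrable_norm_pow (by norm_num)
  refine Measure.ext fun A hA => ?_
  rw [ProjectionValuedMeasure.scalar, Measure.ofMeasurable_apply _ hA, hS.spectralMeasure_apply hA,
    Measure.map_apply hS.1 hA, withDensity_apply _ (hS.1 hA),
    ← ofReal_integral_eq_lintegral_ofReal hi.integrableOn
      (Filter.Eventually.of_forall fun x => sq_nonneg _)]
  change ENNReal.ofReal (‖(momOp p S (A.indicator fun _ => (1 : ℂ)) Ψ : Lp ℂ 2 ρ)‖ ^ 2) = _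
  rw [hS.coe_momOp (mult_indicator hA), norm_sq_eq_integral, ← integral_indicator (hS.1 hA)]
  congr 1
  refine integral_congr_ae ?_
  filter_upwards [mulOp_apply ((mult_indicator hA).comp hS.1) (Ψ : Lp ℂ 2 ρ)] with x hx
  rw [hx]
  by_cases h : p x ∈ A
  · rw [Set.indicator_of_mem h, Set.indicator_of_mem (show x ∈ p ⁻¹' A from h), one_mul]
  · rw [Set.indicator_of_notMem h, Set.indicator_of_notMem (show x ∉ p ⁻¹' A from h), zero_mul]
    simp

theorem isJointSpectralMeasure (hS : MomentumInvariant p S) :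
    IsJointSpectralMeasure (energyMomentum hS.translations) hS.spectralMeasure := by
  have hin : ∀ (k : Spacetime s) i, ⟪k, EuclideanSpace.single i (1 : ℝ)⟫_ℝ = k i := fun k i => by
    rw [EuclideanSpace.inner_single_right]
    simp
  have hmeas : ∀ Ψ : S, AEMeasurable (fun x => ENNReal.ofReal (‖(Ψ : Lp ℂ 2 ρ) x‖ ^ 2)) ρ :=
    fun Ψ => ((Lp.aestronglyMeasurable (Ψ : Lp ℂ 2 ρ)).norm.pow 2).aemeasurable.ennreal_ofReal
  have hlt : ∀ Ψ : S, ∀ᵐ x ∂ρ, ENNReal.ofReal (‖(Ψ : Lp ℂ 2 ρ) x‖ ^ 2) < ⊤ :=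
    fun Ψ => Filter.Eventually.of_forall fun x => ENNReal.ofReal_lt_top
  refine ⟨fun i Ψ => ?_, fun i Ψ => ?_⟩
  · refine (hS.exists_hasDerivAt_iff (EuclideanSpace.single i 1) Ψ).trans ?_
    rw [scalar_spectralMeasure,
      integrable_map_measure (by fun_prop) hS.1.aemeasurable,
      integrable_withDensity_iff_integrable_smul₀' (hmeas Ψ) (hlt Ψ)]
    refine integrable_congr (Filter.Eventually.of_forall fun x => ?_)
    simp only [Function.comp_apply]
    rw [ENNReal.toReal_ofReal (sq_nonneg _), hin, smul_eq_mul, mul_comm]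
  · refine (hS.inner_generator _ Ψ).trans ?_
    rw [scalar_spectralMeasure, integral_map hS.1.aemeasurable (by fun_prop),
      integral_withDensity_eq_integral_toReal_smul₀ (hmeas Ψ) (hlt Ψ)]
    congr 1
    refine integral_congr_ae (Filter.Eventually.of_forall fun x => ?_)
    simp only
    rw [ENNReal.toReal_ofReal (sq_nonneg _), hin, smul_eq_mul, mul_comm]

theorem support_spectralMeasure (hS : MomentumInvariant p S) {C : Set (Spacetime s)}
    (hC : IsClosed C) (h : ∀ᵐ x ∂ρ, p x ∈ C) : hS.spectralMeasure.support ⊆ C := by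
  intro k hk
  by_contra hkC
  refine hk Cᶜ hC.isOpen_compl hkC ?_
  rw [hS.spectralMeasure_apply hC.measurableSet.compl]
  refine ContinuousLinearMap.ext fun Ψ => Subtype.ext ?_
  rw [hS.coe_momOp (mult_indicator hC.measurableSet.compl)]
  refine Lp.eq_zero_iff_ae_eq_zero.2 ?_
  filter_upwards [mulOp_apply ((mult_indicator hC.measurableSet.compl).comp hS.1) (Ψ : Lp ℂ 2 ρ), h]
    with x h1 h2
  rw [h1, Set.indicator_of_notMem (show p x ∉ Cᶜ from not_not_intro h2), zero_mul]
  rfl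

end MomentumInvariant

theorem integral_integral_wave_mul_osc [SFinite ρ] (hp : Measurable p)
    (hV : ∀ᵐ x ∂ρ, p x ∈ forwardCone s) {G : X → ℂ} (hG : Integrable G ρ) {h : 𝓢(Spacetime s, ℂ)}
    (hh : Disjoint (tsupport h) (backwardCone s)) :
    ∫ a, (∫ x, wave (p x) a * G x ∂ρ) * osc h a = 0 := by
  simp_rw [← integral_mul_const]
  rw [integral_integral_swap]
  · have h1 : ∀ᵐ x ∂ρ, ∫ a, wave (p x) a * G x * osc h a = 0 := by
      filter_upwards [hV] with x hx
      have h2 : h (-p x) = 0 := by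
        refine image_eq_zero_of_notMem_tsupport fun h3 => Set.disjoint_left.1 hh h3 ?_
        rw [← neg_mem_forwardCone_iff, neg_neg]
        exact hx
      have h4 : ∀ a, wave (p x) a * G x * osc h a = G x * (wave (p x) a * osc h a) := fun a => by
        ring
      simp_rw [h4]
      rw [integral_const_mul, integral_wave_mul_osc, h2, mul_zero, mul_zero]
    rw [integral_congr_ae h1, integral_zero]
  · have h1 := ((osc h).integrable (μ := volume)).mul_prod hG
    have h2 := h1.bdd_mul (c := 1) (f := fun y : Spacetime s × X => wave (p y.2) y.1)
      ((continuous_wave.measurable.comp ((hp.comp measurable_snd).prodMk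
        measurable_fst)).aestronglyMeasurable)
      (Filter.Eventually.of_forall fun y => (norm_wave _ _).le)
    refine h2.congr (Filter.Eventually.of_forall fun y => ?_)
    simp only [Function.uncurry]
    ring

end

/-! ### Reconstruction of the field from its Gram matrix -/

section

variable {s : ℕ}

theorem poincareAct_apply (g : poincareGroup s) (f : 𝓢(Spacetime s, ℂ)) (x : Spacetime s) :
    poincareAct g f x = f (g.1.symm x) := by
  change f ((AffineEquiv.linear g.1).symm (x - g.1 0)) = _
  congr 1
  rw [AffineEquiv.eq_symm_apply]
  have h := g.1.map_vadd 0 ((AffineEquiv.linear g.1).symm (x - g.1 0))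
  rw [vadd_eq_add, add_zero, LinearEquiv.apply_symm_apply, vadd_eq_add, sub_add_cancel] at h
  exact h

theorem poincareAct_mul (g h : poincareGroup s) (f : 𝓢(Spacetime s, ℂ)) :
    poincareAct (g * h) f = poincareAct g (poincareAct h f) := by
  ext x
  rw [poincareAct_apply, poincareAct_apply, poincareAct_apply]
  rfl

theorem poincareAct_one (f : 𝓢(Spacetime s, ℂ)) : poincareAct 1 f = f := by
  ext x
  rw [poincareAct_apply]
  rfl

theorem conjFn_poincareAct (g : poincareGroup s) (f : 𝓢(Spacetime s, ℂ)) :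
    conjFn (poincareAct g f) = poincareAct g (conjFn f) := by
  ext x
  rw [poincareAct_apply]
  change conj (poincareAct g f x) = conj (f _)
  rw [poincareAct_apply]

theorem conjFn_conjFn (f : 𝓢(Spacetime s, ℂ)) : conjFn (conjFn f) = f := by
  ext x; simp [conjFn]

theorem map_poincareAct_inv (g : poincareGroup s) (L : List 𝓢(Spacetime s, ℂ)) :
    (L.map (poincareAct g⁻¹)).map (poincareAct g) = L := by
  rw [List.map_map]
  refine (List.map_congr_left fun f _ => ?_).trans (List.map_id L)
  rw [Function.comp_apply, ← poincareAct_mul, mul_inv_cancel, poincareAct_one]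
  rfl

theorem wl_poincareAct_inv {m α : ℝ} (c : ℕ → ℝ) (hm : 0 < m) (hα0 : 0 < α) (hα : α ≤ 1 / 2)
    (g : poincareGroup s) (L L' : List 𝓢(Spacetime s, ℂ)) :
    wl m α c ((L.map conjFn).reverse ++ L'.map (poincareAct g)) =
      wl m α c (((L.map (poincareAct g⁻¹)).map conjFn).reverse ++ L') := by
  rw [← wl_poincareAct hm hα0 hα g (((L.map (poincareAct g⁻¹)).map conjFn).reverse ++ L'),
    List.map_append, List.map_reverse]
  have h : ((L.map (poincareAct g⁻¹)).map conjFn).map (poincareAct g) = L.map conjFn := by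
    conv_rhs => rw [← map_poincareAct_inv g L]
    simp only [List.map_map]
    refine List.map_congr_left fun f _ => ?_
    simp only [Function.comp_apply, conjFn_poincareAct]
  rw [h]

variable {H : Type*} [NormedAddCommGroup H] [InnerProductSpace ℂ H]

/-- Vectors labelled by lists of test functions that realize a given functional as their Gram
matrix in an indefinite inner product. -/
structure Realizes (T : H →L[ℂ] H) (v : List 𝓢(Spacetime s, ℂ) → H)
    (w : List 𝓢(Spacetime s, ℂ) → ℂ) : Prop where
  symm : ∀ Φ Ψ, ⟪T Φ, Ψ⟫_ℂ = ⟪Φ, T Ψ⟫_ℂ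
  sq : ∀ Φ, T (T Φ) = Φ
  dense : Dense (Submodule.span ℂ (Set.range v) : Set H)
  gram : ∀ L L', ⟪v L, T (v L')⟫_ℂ = w ((L.map conjFn).reverse ++ L')
  cons_add : ∀ f g L, v ((f + g) :: L) = v (f :: L) + v (g :: L)
  cons_smul : ∀ (a : ℂ) f L, v ((a • f) :: L) = a • v (f :: L)
  cons_continuous : ∀ L, Continuous fun f => v (f :: L)

namespace Realizes

variable {T : H →L[ℂ] H} {v : List 𝓢(Spacetime s, ℂ) → H} {w : List 𝓢(Spacetime s, ℂ) → ℂ}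

theorem eq_zero (h : Realizes T v w) {Φ : H} (h0 : ∀ L, ⟪v L, T Φ⟫_ℂ = 0) : Φ = 0 := by
  have h1 : innerSL ℂ (T Φ) = 0 := by
    refine ContinuousLinearMap.ext_on h.dense ?_
    rintro _ ⟨L, rfl⟩
    rw [innerSL_apply_apply, ← inner_conj_symm, h0, map_zero]
    rfl
  have h2 : ⟪T Φ, T Φ⟫_ℂ = 0 := by
    rw [← innerSL_apply_apply, h1]; rfl
  rw [← h.sq Φ, inner_self_eq_zero.1 h2, map_zero]

theorem eq_of_gram (h : Realizes T v w) {L₁ L₂ : List 𝓢(Spacetime s, ℂ)}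
    (h0 : ∀ L : List 𝓢(Spacetime s, ℂ),
      w ((L.map conjFn).reverse ++ L₁) = w ((L.map conjFn).reverse ++ L₂)) :
    v L₁ = v L₂ := by
  rw [← sub_eq_zero]
  refine h.eq_zero fun L => ?_
  rw [map_sub, inner_sub_right, h.gram, h.gram, h0, sub_self]

variable (v) in
/-- The vectors as elements of their span. -/
def elem (L : List 𝓢(Spacetime s, ℂ)) : Submodule.span ℂ (Set.range v) :=
  ⟨v L, Submodule.subset_span ⟨L, rfl⟩⟩

theorem span_elem : Submodule.span ℂ (Set.range (elem v)) = ⊤ := by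
  refine Submodule.map_injective_of_injective
    (Submodule.span ℂ (Set.range v)).injective_subtype ?_
  rw [Submodule.map_span, Submodule.map_top, Submodule.range_subtype, ← Set.range_comp]
  rfl

theorem elem_induction {P : Submodule.span ℂ (Set.range v) → Prop} (h : ∀ L, P (elem v L))
    (hadd : ∀ Φ Ψ, P Φ → P Ψ → P (Φ + Ψ)) (hsmul : ∀ (a : ℂ) Φ, P Φ → P (a • Φ))
    (Φ : Submodule.span ℂ (Set.range v)) : P Φ := by
  have hΦ : Φ ∈ Submodule.span ℂ (Set.range (elem v)) := by rw [span_elem]; trivial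
  refine Submodule.span_induction (p := fun Φ _ => P Φ) ?_ ?_ (fun Φ Ψ _ _ => hadd Φ Ψ)
    (fun a Φ _ => hsmul a Φ) hΦ
  · rintro _ ⟨L, rfl⟩
    exact h L
  · have := hsmul 0 _ (h [])
    rwa [zero_smul] at this

theorem exists_op (h : Realizes T v w) (a a' : List 𝓢(Spacetime s, ℂ) → List 𝓢(Spacetime s, ℂ))
    (haa : ∀ L L', w ((L.map conjFn).reverse ++ a L') = w (((a' L).map conjFn).reverse ++ L')) :
    ∃ R : Module.End ℂ (Submodule.span ℂ (Set.range v)), ∀ L, R (elem v L) = elem v (a L) := by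
  obtain ⟨P, hP⟩ : ∃ P, P = Finsupp.linearCombination ℂ (elem v) := ⟨_, rfl⟩
  obtain ⟨Q, hQ⟩ : ∃ Q, Q = Finsupp.linearCombination ℂ fun L => elem v (a L) := ⟨_, rfl⟩
  have hPr : LinearMap.range P = ⊤ := by
    rw [hP, Finsupp.range_linearCombination, span_elem]
  obtain ⟨g, hg⟩ := P.exists_rightInverse_of_surjective hPr
  have hker : ∀ x, P x = 0 → Q x = 0 := by
    intro x hx
    refine Subtype.ext (h.eq_zero fun L => ?_)
    have h1 : ∀ y, ⟪v L, T (Q y : H)⟫_ℂ = ⟪v (a' L), T (P y : H)⟫_ℂ := by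
      intro y
      induction y using Finsupp.induction_linear with
      | zero => simp
      | add y z hy hz =>
        rw [map_add, map_add, Submodule.coe_add, Submodule.coe_add, map_add, map_add,
          inner_add_right, inner_add_right, hy, hz]
      | single L' b =>
        rw [hP, hQ, Finsupp.linearCombination_single, Finsupp.linearCombination_single,
          Submodule.coe_smul, Submodule.coe_smul, map_smul, map_smul, inner_smul_right,
          inner_smul_right]
        change b * ⟪v L, T (v (a L'))⟫_ℂ = b * ⟪v (a' L), T (v L')⟫_ℂ
        rw [h.gram, h.gram, haa]
    rw [h1, hx]
    simp
  refine ⟨Q.comp g, fun L => ?_⟩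
  have e1 : P (Finsupp.single L 1) = elem v L := by
    rw [hP, Finsupp.linearCombination_single, one_smul]
  have e2 : Q (Finsupp.single L 1) = elem v (a L) := by
    rw [hQ, Finsupp.linearCombination_single, one_smul]
  have e3 : P (g (elem v L)) = elem v L := LinearMap.congr_fun hg (elem v L)
  rw [LinearMap.comp_apply, ← e2, ← sub_eq_zero, ← map_sub]
  refine hker _ ?_
  rw [map_sub, e3, e1, sub_self]

theorem inner_ext {A B : Module.End ℂ (Submodule.span ℂ (Set.range v))}
    (hAB : ∀ L L', ⟪(elem v L : H), T (A (elem v L'))⟫_ℂ = ⟪(B (elem v L) : H), T (elem v L')⟫_ℂ)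
    (Φ Ψ : Submodule.span ℂ (Set.range v)) : ⟪(Φ : H), T (A Ψ)⟫_ℂ = ⟪(B Φ : H), T Ψ⟫_ℂ := by
  induction Φ using elem_induction with
  | h L =>
    induction Ψ using elem_induction with
    | h L' => exact hAB L L'
    | hadd Φ Ψ h1 h2 =>
      rw [map_add, Submodule.coe_add, Submodule.coe_add, map_add, map_add, inner_add_right,
        inner_add_right, h1, h2]
    | hsmul a Φ h1 =>
      rw [map_smul, Submodule.coe_smul, Submodule.coe_smul, map_smul, map_smul, inner_smul_right,
        inner_smul_right, h1]
  | hadd Φ Ψ h1 h2 =>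
    rw [map_add, Submodule.coe_add, Submodule.coe_add, inner_add_left, inner_add_left, h1, h2]
  | hsmul a Φ h1 =>
    rw [map_smul, Submodule.coe_smul, Submodule.coe_smul, inner_smul_left, inner_smul_left, h1]

variable [CompleteSpace H]

theorem exists_qft {m α : ℝ} {c : ℕ → ℝ} (hm : 0 < m) (hα0 : 0 < α) (hα : α ≤ 1 / 2)
    (h : Realizes T v (wl m α c)) {V : Spacetime s → H ≃ₗᵢ[ℂ] H} (hV : IsTranslationGroup V)
    (hVv : ∀ a L, V a (v L) = v (L.map (poincareAct (transl a))))
    (hspec : ∀ (Φ Ψ : H) (h : 𝓢(Spacetime s, ℂ)), Disjoint (tsupport h) (backwardCone s) →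
      ∫ a, ⟪Φ, T (V a Ψ)⟫_ℂ * osc h a = 0) :
    ∃ Q : IndefiniteMetricQFT H s (wightman s m α c), Q.T = T ∧ IsUnitaryTranslations Q V := by
  have hφ : ∀ f : 𝓢(Spacetime s, ℂ), ∃ R : Module.End ℂ (Submodule.span ℂ (Set.range v)),
      ∀ L, R (elem v L) = elem v (f :: L) := fun f =>
    h.exists_op (fun L => f :: L) (fun L => conjFn f :: L) fun L L' => by
      simp [conjFn_conjFn]
  have hU : ∀ g : poincareGroup s, ∃ R : Module.End ℂ (Submodule.span ℂ (Set.range v)),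
      ∀ L, R (elem v L) = elem v (L.map (poincareAct g)) := fun g =>
    h.exists_op (fun L => L.map (poincareAct g)) (fun L => L.map (poincareAct g⁻¹))
      (wl_poincareAct_inv c hm hα0 hα g)
  choose φ hφ using hφ
  choose U hU using hU
  have hUmul : ∀ g g' Ψ, U (g * g') Ψ = U g (U g' Ψ) := by
    intro g g' Ψ
    induction Ψ using elem_induction with
    | h L =>
      rw [hU, hU, hU, List.map_map]
      congr 2
      funext f
      exact poincareAct_mul g g' f
    | hadd Φ Ψ h1 h2 => rw [map_add, map_add, map_add, h1, h2]
    | hsmul a Φ h1 => rw [map_smul, map_smul, map_smul, h1]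
  have hUone : ∀ Ψ, U 1 Ψ = Ψ := by
    intro Ψ
    induction Ψ using elem_induction with
    | h L =>
      rw [hU]
      congr 1
      refine (List.map_congr_left fun f _ => ?_).trans (List.map_id L)
      rw [poincareAct_one]
      rfl
    | hadd Φ Ψ h1 h2 => rw [map_add, h1, h2]
    | hsmul a Φ h1 => rw [map_smul, h1]
  have hUV : ∀ a (Ψ : Submodule.span ℂ (Set.range v)), V a (Ψ : H) = (U (transl a) Ψ : H) := by
    intro a Ψ
    induction Ψ using elem_induction with
    | h L =>
      rw [hU]
      exact hVv a L
    | hadd Φ Ψ h1 h2 => rw [map_add, Submodule.coe_add, map_add, h1, h2, Submodule.coe_add]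
    | hsmul a Φ h1 => rw [map_smul, Submodule.coe_smul, map_smul, h1, Submodule.coe_smul]
  have hfold : ∀ L : List 𝓢(Spacetime s, ℂ),
      L.foldr (fun f Ψ => φ f Ψ) (elem v []) = elem v L := by
    intro L
    induction L with
    | nil => rfl
    | cons f L ih => rw [List.foldr_cons, ih, hφ]
  let Q : IndefiniteMetricQFT H s (wightman s m α c) :=
    { T := T
      T_selfAdjoint := isSelfAdjoint_of_inner h.symm
      T_sq := ContinuousLinearMap.ext h.sq
      D := Submodule.span ℂ (Set.range v)
      dense_D := h.dense
      Ω := elem v []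
      φ :=
        { toFun := φ
          map_add' := fun f g => by
            refine LinearMap.ext fun Ψ => ?_
            induction Ψ using elem_induction with
            | h L =>
              rw [LinearMap.add_apply, hφ, hφ, hφ]
              exact Subtype.ext (h.cons_add f g L)
            | hadd Φ Ψ h1 h2 => rw [map_add, map_add, h1, h2]
            | hsmul a Φ h1 => rw [map_smul, map_smul, h1]
          map_smul' := fun b f => by
            refine LinearMap.ext fun Ψ => ?_
            induction Ψ using elem_induction with
            | h L =>
              rw [LinearMap.smul_apply, hφ, hφ]
              exact Subtype.ext (h.cons_smul b f L)
            | hadd Φ Ψ h1 h2 => rw [map_add, map_add, h1, h2]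
            | hsmul a Φ h1 => rw [map_smul, map_smul, h1] }
      φ_continuous := fun Ψ => by
        change Continuous fun f => (φ f Ψ : H)
        induction Ψ using elem_induction with
        | h L =>
          simp_rw [hφ]
          exact h.cons_continuous L
        | hadd Φ Ψ h1 h2 =>
          simp_rw [map_add, Submodule.coe_add]
          exact h1.add h2
        | hsmul a Φ h1 =>
          simp_rw [map_smul, Submodule.coe_smul]
          exact h1.const_smul a
      cyclic := by
        change Submodule.span ℂ (Set.range fun L : List 𝓢(Spacetime s, ℂ) =>
          L.foldr (fun f Ψ => φ f Ψ) (elem v [])) = ⊤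
        simp_rw [hfold]
        exact span_elem
      φ_symm := fun f Φ Ψ => by
        refine inner_ext (A := φ f) (B := φ (conjFn f)) (fun L L' => ?_) Φ Ψ
        rw [hφ, hφ]
        refine (h.gram L (f :: L')).trans (Eq.trans ?_ (h.gram (conjFn f :: L) L').symm)
        simp [conjFn_conjFn]
      locality := fun f g hfg Ψ => by
        change φ f (φ g Ψ) = φ g (φ f Ψ)
        induction Ψ using elem_induction with
        | h L =>
          rw [hφ, hφ, hφ, hφ]
          refine Subtype.ext (h.eq_of_gram fun L' => ?_)
          exact (wl_swap hm hα0 hα _ _ fun x y hx hy =>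
            hfg x (subset_closure hx) y (subset_closure hy)).symm
        | hadd Φ Ψ h1 h2 => rw [map_add, map_add, map_add, map_add, h1, h2]
        | hsmul a Φ h1 => rw [map_smul, map_smul, map_smul, map_smul, h1]
      vev := fun n f => by
        refine (wightman_prod f).trans ?_
        change _ = ⟪v [], T ((List.ofFn f).foldr (fun f Ψ => φ f Ψ) (elem v []) :
          Submodule.span ℂ (Set.range v))⟫_ℂ
        rw [hfold]
        exact (h.gram [] (List.ofFn f)).symm
      U :=
        { toFun := U
          map_one' := LinearMap.ext hUone
          map_mul' := fun g g' => LinearMap.ext (hUmul g g') }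
      U_unitary := fun g Φ Ψ => by
        change ⟪(U g Φ : H), T (U g Ψ)⟫_ℂ = ⟪(Φ : H), T Ψ⟫_ℂ
        have h1 := inner_ext (T := T) (A := U g) (B := U g⁻¹) (fun L L' => by
          rw [hU, hU]
          exact (h.gram L (L'.map (poincareAct g))).trans
            ((wl_poincareAct_inv c hm hα0 hα g L L').trans
              (h.gram (L.map (poincareAct g⁻¹)) L').symm)) (U g Φ) Ψ
        rw [h1, ← hUmul, inv_mul_cancel, hUone]
      U_vacuum := fun g => hU g []
      covariance := fun g f Ψ => by
        change U g (φ f (U g⁻¹ Ψ)) = φ (poincareAct g f) Ψ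
        induction Ψ using elem_induction with
        | h L => rw [hU, hφ, hU, hφ, List.map_cons, map_poincareAct_inv]
        | hadd Φ Ψ h1 h2 => rw [map_add, map_add, map_add, map_add, h1, h2]
        | hsmul a Φ h1 => rw [map_smul, map_smul, map_smul, map_smul, h1]
      spectral := fun Φ Ψ f hf => by
        refine Eq.trans ?_ (hspec Φ Ψ f hf)
        refine integral_congr_ae (Filter.Eventually.of_forall fun a => ?_)
        change ⟪(Φ : H), T (U (transl a) Ψ)⟫_ℂ * _ = _
        rw [← hUV]
        change _ = ⟪(Φ : H), T (V a (Ψ : H))⟫_ℂ * osc f a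
        rw [osc_apply]
        simp only [wave_comm a]
        rfl }
  exact ⟨Q, rfl, hV.map_add, hV.continuous, hUV⟩

end Realizes

end

/-! ### The Hilbert space of the field -/

section

variable {s : ℕ}

theorem pw_poincareAct_transl (a : Spacetime s) (f : 𝓢(Spacetime s, ℂ)) (k : Spacetime s) :
    pw (poincareAct (transl a) f) k = wave k a * pw f k := by
  rw [← pw_shift]
  congr 2
  ext x
  rw [poincareAct_apply, shift_apply]
  congr 1
  change -a +ᵥ x = x - a
  rw [vadd_eq_add, neg_add_eq_sub]

/-- A continuous seminorm that bounds the transform of a test function by the weight. -/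
theorem exists_seminorm_pw (s : ℕ) : ∃ q : Seminorm ℂ 𝓢(Spacetime s, ℂ), Continuous q ∧
    ∀ f k, ‖pw f k‖ ≤ q f * (wt k)⁻¹ := by
  let q₀ : Seminorm ℂ 𝓢(Spacetime s, ℂ) := (2 ^ (2 * (s + 2)) : NNReal) •
    (Finset.Iic ((2 * (s + 2), 0) : ℕ × ℕ)).sup fun m => SchwartzMap.seminorm ℂ m.1 m.2
  have hq : Continuous q₀ := by
    have h : Continuous ⇑((Finset.Iic ((2 * (s + 2), 0) : ℕ × ℕ)).sup
        (fun m => SchwartzMap.seminorm ℂ m.1 m.2) : Seminorm ℂ 𝓢(Spacetime s, ℂ)) :=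
      Seminorm.continuous_finsetSup fun m _ =>
        (schwartz_withSeminorms ℂ (Spacetime s) ℂ).continuous_seminorm m
    exact h.const_smul _
  refine ⟨q₀.comp ((muConst s : ℂ) • (osc : 𝓢(Spacetime s, ℂ) →L[ℂ] 𝓢(Spacetime s, ℂ))).toLinearMap,
    hq.comp ((muConst s : ℂ) • (osc : 𝓢(Spacetime s, ℂ) →L[ℂ] 𝓢(Spacetime s, ℂ))).continuous,
    fun f k => ?_⟩
  have h1 := SchwartzMap.one_add_le_sup_seminorm_apply (𝕜 := ℂ) (m := (2 * (s + 2), 0))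
    (k := 2 * (s + 2)) (n := 0) le_rfl le_rfl (pw f) k
  rw [norm_iteratedFDeriv_zero] at h1
  have h2 : wt k ≤ (1 + ‖k‖) ^ (2 * (s + 2)) := by
    rw [wt, pow_mul]
    exact pow_le_pow_left₀ (by positivity) (by nlinarith [norm_nonneg k]) _
  rw [← div_eq_mul_inv, le_div_iff₀ (wt_pos k), mul_comm]
  exact (mul_le_mul_of_nonneg_right h2 (norm_nonneg _)).trans h1

variable {m α : ℝ} (c : ℕ → ℝ)

theorem listVec_cons (f : 𝓢(Spacetime s, ℂ)) (L : List 𝓢(Spacetime s, ℂ)) :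
    listVec m α c (f :: L) = vec m α c (L.length + 1) fun k =>
      pw f (k 0) * ∏ i : Fin L.length, pw (L.getD i 0) (k i.succ) := by
  rw [listVec]
  change vec m α c (L.length + 1) _ = _
  congr 1
  funext k
  exact Fin.prod_univ_succ _

theorem tame_cons (f : 𝓢(Spacetime s, ℂ)) (L : List 𝓢(Spacetime s, ℂ)) :
    Tame fun k : Fin (L.length + 1) → Spacetime s =>
      pw f (k 0) * ∏ i : Fin L.length, pw (L.getD i 0) (k i.succ) := by
  have h := tame_list (f :: L)
  refine (congrArg Tame (funext fun k => ?_)).mp h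
  exact Fin.prod_univ_succ _

variable [IsFiniteMeasure (tupleMeasure s m α c)]

theorem listVec_cons_add (f g : 𝓢(Spacetime s, ℂ)) (L : List 𝓢(Spacetime s, ℂ)) :
    listVec m α c ((f + g) :: L) = listVec m α c (f :: L) + listVec m α c (g :: L) := by
  rw [listVec_cons, listVec_cons, listVec_cons, ← vec_add m α c (tame_cons f L) (tame_cons g L)]
  congr 1
  funext k
  rw [pw_add, Pi.add_apply, ← add_mul]
  rfl

theorem listVec_cons_smul (a : ℂ) (f : 𝓢(Spacetime s, ℂ)) (L : List 𝓢(Spacetime s, ℂ)) :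
    listVec m α c ((a • f) :: L) = a • listVec m α c (f :: L) := by
  rw [listVec_cons, listVec_cons, ← vec_smul m α c (tame_cons f L)]
  congr 1
  funext k
  rw [pw_smul, Pi.smul_apply, smul_eq_mul, ← mul_assoc]
  rfl

theorem continuous_listVec_cons (L : List 𝓢(Spacetime s, ℂ)) :
    Continuous fun f => listVec m α c (f :: L) := by
  obtain ⟨q, hq, hqf⟩ := exists_seminorm_pw s
  obtain ⟨B, hB⟩ := (tame_list L).2
  obtain ⟨C, hC, hCv⟩ := exists_norm_vec_le (s := s) m α c (L.length + 1)
  let R : 𝓢(Spacetime s, ℂ) →ₗ[ℂ] Lp ℂ 2 (tupleMeasure s m α c) :=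
    { toFun := fun f => listVec m α c (f :: L)
      map_add' := fun f g => listVec_cons_add c f g L
      map_smul' := fun a f => listVec_cons_smul c a f L }
  have hR : ∀ f, ‖R f‖ ≤ C * (q f * max B 0) := by
    intro f
    change ‖listVec m α c (f :: L)‖ ≤ _
    rw [listVec_cons]
    refine hCv _ (tame_cons f L).1 _ (mul_nonneg (apply_nonneg _ _) (le_max_right _ _)) fun k => ?_
    have h1 : invWt k = (wt (k 0))⁻¹ * invWt fun i : Fin L.length => k i.succ :=
      Fin.prod_univ_succ _
    have h2 := hB fun i => k i.succ
    have h3 : 0 < invWt fun i : Fin L.length => k i.succ := invWt_pos _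
    rw [norm_mul, h1, mul_mul_mul_comm]
    refine mul_le_mul (hqf f (k 0)) (h2.trans ?_) (norm_nonneg _)
      (mul_nonneg (apply_nonneg _ _) (inv_pos.2 (wt_pos _)).le)
    exact mul_le_mul_of_nonneg_right (le_max_left _ _) h3.le
  have h0 : ContinuousAt R 0 := by
    rw [ContinuousAt, map_zero]
    refine squeeze_zero_norm hR ?_
    have h4 : Continuous fun f => C * (q f * max B 0) := by fun_prop
    have h5 := h4.tendsto 0
    rwa [map_zero, zero_mul, mul_zero] at h5
  exact continuous_of_continuousAt_zero R h0

theorem mulOp_listVec (a : Spacetime s) (L : List 𝓢(Spacetime s, ℂ)) :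
    mulOp _ (fun x => wave (totalMom x) a) (listVec m α c L) =
      listVec m α c (L.map (poincareAct (transl a))) := by
  rw [listVec_eq_of_length (n := L.length) c (L.map (poincareAct (transl a))) (by simp), listVec,
    mulOp_vec m α c (mult_wave a) (tame_list L)]
  congr 1
  funext k
  rw [wave_sum_left, ← Finset.prod_mul_distrib]
  refine Finset.prod_congr rfl fun i _ => ?_
  rw [← pw_poincareAct_transl]
  congr 2
  simp

end

section

variable {K : Type*} [NormedAddCommGroup K] [InnerProductSpace ℂ K]

theorem mem_orthogonal_ker_of_comm {A B B' : K →L[ℂ] K} (h : ∀ x, A (B' x) = B' (A x))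
    (hB : ∀ x y, ⟪B' x, y⟫_ℂ = ⟪x, B y⟫_ℂ) {x : K} (hx : x ∈ (LinearMap.ker A.toLinearMap)ᗮ) :
    B x ∈ (LinearMap.ker A.toLinearMap)ᗮ := by
  rw [Submodule.mem_orthogonal] at hx ⊢
  intro u hu
  rw [← hB]
  refine hx _ ?_
  have hu' : A u = 0 := hu
  change A (B' u) = 0
  rw [h, hu', map_zero]

end

section

variable {s : ℕ} {m α : ℝ}

theorem exists_indefiniteMetricQFT (hm : 0 < m) (hα0 : 0 < α) (hα : α ≤ 1 / 2) (c : ℕ → ℝ) :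
    ∃ (H : Type) (_ : NormedAddCommGroup H) (_ : InnerProductSpace ℂ H) (_ : CompleteSpace H)
      (Q : IndefiniteMetricQFT H s (wightman s m α c)) (V : Spacetime s → H ≃ₗᵢ[ℂ] H),
      IsUnitaryTranslations Q V ∧
      (∀ (a : Spacetime s) (Ψ : H), Q.T (V a Ψ) = V a (Q.T Ψ)) ∧
      (∀ i, IsSelfAdjoint (energyMomentum V i)) ∧
      ∃ E : ProjectionValuedMeasure H (Spacetime s),
        IsJointSpectralMeasure (energyMomentum V) E ∧ E.support ⊆ forwardCone s := by
  have := isFiniteMeasure_tupleMeasure (s := s) c hm hα0 hα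
  have hA := isSelfAdjoint_gramOp (s := s) c hm hα0 hα
  obtain ⟨J, T, hJ, hT, hTT, hJTJ, hJ0, hcomm⟩ := exists_metric (gramOp s m α c) hA
  set A := gramOp s m α c with hAdef
  set S : Submodule ℂ (Lp ℂ 2 (tupleMeasure s m α c)) := (LinearMap.ker A.toLinearMap)ᗮ with hSdef
  have hadj : ∀ φ : Spacetime s → ℂ, Mult φ → ContinuousLinearMap.adjoint
      (mulOp (tupleMeasure s m α c) fun x => φ (totalMom x)) =
        mulOp _ fun x => conj (φ (totalMom x)) := fun φ hφ =>
    ((ContinuousLinearMap.eq_adjoint_iff _ _).2 fun x y => by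
      have h := mulOp_inner x y (hφ.comp measurable_totalMom).conj
      simpa only [Complex.conj_conj] using h).symm
  have hmom : ∀ φ : Spacetime s → ℂ, Mult φ →
      (∀ x, J (mulOp _ (fun x => φ (totalMom x)) x) = mulOp _ (fun x => φ (totalMom x)) (J x)) ∧
      ∀ x, T (mulOp _ (fun x => φ (totalMom x)) x) = mulOp _ (fun x => φ (totalMom x)) (T x) := by
    intro φ hφ
    refine hcomm _ (gramOp_mulOp m α c hφ) fun x => ?_
    rw [hadj φ hφ]
    exact gramOp_mulOp m α c hφ.conj x
  have hTA : ∀ x, A (T x) = T (A x) := fun x =>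
    ((hcomm A (fun _ => rfl)
      (by rw [ContinuousLinearMap.isSelfAdjoint_iff'.1 hA]; exact fun _ => rfl)).2 x).symm
  have hTS : ∀ x ∈ S, T x ∈ S := fun x hx =>
    mem_orthogonal_ker_of_comm hTA (isSelfAdjoint_inner hT) hx
  have hJS : ∀ x, J x ∈ S := fun x => by
    rw [hSdef, Submodule.mem_orthogonal]
    intro u hu
    rw [← isSelfAdjoint_inner hJ, (hJ0 u).2 hu, inner_zero_left]
  have hS : MomentumInvariant totalMom S := by
    refine ⟨measurable_totalMom, fun φ hφ x hx => ?_⟩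
    refine mem_orthogonal_ker_of_comm (gramOp_mulOp m α c hφ.conj) (fun x y => ?_) hx
    have h := mulOp_inner x y (hφ.comp measurable_totalMom).conj
    simpa only [Complex.conj_conj] using h
  obtain ⟨T', hT'⟩ : ∃ T' : S →L[ℂ] S, ∀ x, (T' x : Lp ℂ 2 (tupleMeasure s m α c)) = T x :=
    ⟨compress S T, coe_compress hTS⟩
  have hR : Realizes T' (fun L => (⟨J (listVec m α c L), hJS _⟩ : S)) (wl m α c) :=
    { symm := fun Φ Ψ => by
        rw [Submodule.coe_inner, Submodule.coe_inner, hT', hT', isSelfAdjoint_inner hT]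
      sq := fun Φ => Subtype.ext (by rw [hT', hT', hTT])
      dense := by
        rw [Submodule.dense_iff_topologicalClosure_eq_top, Submodule.topologicalClosure_eq_top_iff,
          Submodule.eq_bot_iff]
        intro y hy
        have h1 : J y = 0 := eq_zero_of_inner_listVec c fun L => by
          rw [← isSelfAdjoint_inner hJ]
          exact (Submodule.mem_orthogonal _ _).1 hy _ (Submodule.subset_span ⟨L, rfl⟩)
        have h2 : (y : Lp ℂ 2 (tupleMeasure s m α c)) ∈ LinearMap.ker A.toLinearMap := (hJ0 _).1 h1
        exact Subtype.ext (inner_self_eq_zero.1 ((Submodule.mem_orthogonal _ _).1 y.2 _ h2))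
      gram := fun L L' => by
        rw [Submodule.coe_inner, hT', isSelfAdjoint_inner hJ, hJTJ]
        exact inner_listVec c hm hα0 hα L L'
      cons_add := fun f g L => Subtype.ext
        ((congrArg J (listVec_cons_add c f g L)).trans (map_add _ _ _))
      cons_smul := fun a f L => Subtype.ext
        ((congrArg J (listVec_cons_smul c a f L)).trans (map_smul _ _ _))
      cons_continuous := fun L =>
        (J.continuous.comp (continuous_listVec_cons c L)).subtype_mk _ }
  obtain ⟨Q, hQ, hV⟩ := hR.exists_qft hm hα0 hα hS.isTranslationGroup
    (fun a L => Subtype.ext (by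
      rw [hS.coe_translations, ← (hmom _ (mult_wave a)).1, mulOp_listVec]))
    (fun Φ Ψ h hh => by
      refine Eq.trans (integral_congr_ae (Filter.Eventually.of_forall fun a => ?_))
        (integral_integral_wave_mul_osc measurable_totalMom (ae_totalMom_mem m α c)
          (integrable_inner (T (Φ : Lp ℂ 2 (tupleMeasure s m α c))) Ψ) hh)
      simp only
      rw [Submodule.coe_inner, hT', ← isSelfAdjoint_inner hT, hS.coe_translations,
        inner_mulOp _ _ ((mult_wave a).comp measurable_totalMom)])
  refine ⟨S, inferInstance, inferInstance, inferInstance, Q, hS.translations, hV, fun a Ψ => ?_,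
    fun i => hS.isTranslationGroup.isSelfAdjoint_generator _, hS.spectralMeasure,
    hS.isJointSpectralMeasure,
    hS.support_spectralMeasure isClosed_forwardCone (ae_totalMom_mem m α c)⟩
  refine Subtype.ext ?_
  rw [hQ, hT', hS.coe_translations, hS.coe_translations, hT', (hmom _ (mult_wave a)).2]

end

end IndefQFT

end

open IndefQFT in
theorem theorem4p3 (s : ℕ) (m α : ℝ) (hm : 0 < m) (hα0 : 0 < α) (hα : α ≤ 1 / 2)
    (ν : Measure ℝ) [IsProbabilityMeasure ν] (hν : InfinitelyDivisible ν)
    (hmom : ∀ n : ℕ, Integrable (fun t : ℝ => t ^ n) ν) :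
    -- the Wightman functions are well defined tempered distributions
    (∀ n : ℕ,
      (∀ (P : Finpartition (Finset.univ : Finset (Fin n))) (f : TestFn s n),
        Integrable (planeWaveTransform f) (partitionMeasure s m α P)) ∧
      ∃ w : TestFn s n →L[ℂ] ℂ, ∀ f : TestFn s n, wightman s m α (cumulant ν) n f = w f) ∧
    -- the Hilbert seminorms can be chosen translation invariant
    (∃ p : (n : ℕ) → Seminorm ℂ (TestFn s n),
      HilbertStructureCondition (wightman s m α (cumulant ν)) p ∧
      ∀ (n : ℕ) (a : Spacetime s) (f : TestFn s n), p n (translate a f) = p n f) ∧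
    -- there is a Hilbert space structure with unitary translations
    ∃ (H : Type) (_ : NormedAddCommGroup H) (_ : InnerProductSpace ℂ H) (_ : CompleteSpace H)
      (Q : IndefiniteMetricQFT H s (wightman s m α (cumulant ν)))
      (V : Spacetime s → H ≃ₗᵢ[ℂ] H),
      IsUnitaryTranslations Q V ∧
      (∀ (a : Spacetime s) (Ψ : H), Q.T (V a Ψ) = V a (Q.T Ψ)) ∧
      -- the generator is a self-adjoint vector operator with spectrum in the forward cone
      (∀ i, IsSelfAdjoint (energyMomentum V i)) ∧
      ∃ E : ProjectionValuedMeasure H (Spacetime s),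
        IsJointSpectralMeasure (energyMomentum V) E ∧ E.support ⊆ forwardCone s :=
  ⟨fun n => ⟨fun P f => integrable_planeWaveTransform hm hα0 hα P f,
      exists_wightman_clm hm hα0 hα (cumulant ν) n⟩,
    exists_hilbertSeminorms hm hα0 hα (cumulant ν),
    exists_indefiniteMetricQFT hm hα0 hα (cumulant ν)⟩
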